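/- **Conventions.** A classical randomized algorithm is a program, with fair coin tosses, of a fixed machine model whose running time counts bit operations up to a polynomial (polynomially equivalent to probabilistic Turing machines); all running times are worst-case. A complex number $z$ is described with $k$ bits of precision by integers $a,b$ with $|z-(a+ib)/2^k|\le 2^{-k}$. A family of states $\varphi_i$ of $n_i$ qudits (indexed by instances $i$ that are encoded as data) is *computationally tractable* (CT) if (1) there is a randomized algorithm which, given $i,k$, samples in time $\mathrm{poly}(n_i,k)$ from a distribution that is $2^{-k}$-close in $\ell_1$ to $x\mapsto|\langle x|\varphi_i\rangle|^2$, and (2) there is an algorithm which, given $i$, a basis label $x$ and $k$, computes $\langle x|\varphi_i\rangle$ with $k$ bits of precision in time $\mathrm{poly}(n_i,k)$. A vector is $t$-sparse if at most $t$ entries are nonzero; a probability distribution $\mathcal P$ is $\varepsilon$-approximately $t$-sparse if $\|\mathcal P-v\|_1\le\varepsilon$ for some $t$-sparse complex vector $v$. **Theorem.** There is an absolute constant $K$ such that the following holds. (1) *Tensor product operations.* Consider a family of systems $\mathcal H_i=\mathbb C^{d_{i,1}}\otimes\cdots\otimes\mathbb C^{d_{i,n_i}}$ of qudits of possibly different dimensions,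 all bounded by a constant $D$ (for qubits, all $d_{i,j}=2$), with normalized input states $|\psi_i^{\rm in}\rangle$ and unitaries $U_{1,i}$ such that the family $U_{1,i}|\psi_i^{\rm in}\rangle$ is CT. Then there are a randomized algorithm $A$, a sampling algorithm $B$ and a constant $a$ such that the following holds for every instance $i$ (with $n=n_i$), every tensor product unitary $U_2=u_1\otimes\cdots\otimes u_n$, every subset $S$ of the qudits, and all $t\in\mathbb N$, $0<\varepsilon\le 1/6$, $0<\delta<1$. Let $\mathcal P$ be the distribution of the outcomes when the qudits in $S$ of the state $U_2U_{1,i}|\psi_i^{\rm in}\rangle$ are measured in the computational basis, and suppose that $\mathcal P$ is $\varepsilon$-approximately $t$-sparse. Given $i$, $S$, the dimensions, the entries of the $u_j$ with $a(n+t+\lfloor1/\varepsilon\rfloor+1)$ bits of precision, and $t$, $\lfloor 1/\varepsilon\rfloor$, $\lceil\log_2(1/\delta)\rceil$, the algorithm $A$ outputs, within time $\mathrm{poly}(n,t,1/\varepsilon,\log\frac1\delta)$, a probability distribution $\mathcal P'$ as a list of all its nonzero probabilities (as fractions). It always has at most $Kt/\varepsilon$ nonzero probabilities, and $\|\mathcal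 P'-\mathcal P\|_1\le K\varepsilon$ with probability at least $1-\delta$. Furthermore $B$, given the list output by $A$, samples exactly from $\mathcal P'$ in time $\mathrm{poly}(n,t,1/\varepsilon)$. The polynomials depend on the family only. (2) *IQP circuits.* There are algorithms $A$, $B$ and a constant $a$ with the same property for all IQP circuits: for all $n,r$, every $x\in\{0,1\}^n$, all gates $\exp(i\theta_gT_g)$, $g=1,\dots,r$, with $\theta_g\in\mathbb R$ and $T_g$ a tensor product of operators $I$ and $X$, and every set $S$ of qubits, let $\mathcal P$ be the distribution of the outcomes when the qubits in $S$ are measured after the circuit has been applied to $|x\rangle$, and suppose that $\mathcal P$ is $\varepsilon$-approximately $t$-sparse with $\varepsilon,\delta$ as above. Given $x$, $S$, the $T_g$, the phases $e^{i\theta_g}$ with $a(n+r+t+\lfloor1/\varepsilon\rfloor+1)$ bits of precision, and $t$, $\lfloor 1/\varepsilon\rfloor$, $\lceil\log_2(1/\delta)\rceil$, the algorithm $A$ outputs $\mathcal P'$ as in (1) within time $\mathrm{poly}(n,r,t,1/\varepsilon,\log\frac1\delta)$, and $B$ samples from $\mathcal P'$ in time $\mathrm{poly}(n,t,1/\varepsilon)$.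 -/

import Mathlib

open scoped Matrix

noncomputable section

namespace SparseSim

/-! ### Classical randomized algorithms with a logarithmic-cost step count

Programs of a small WHILE language act on trees whose leaves are natural numbers.  They have a
fair coin and binary arithmetic.  Every elementary instruction is charged at least the number of
bits of the data on which it acts (and the square of it for multiplication and division), so that
the running times agree up to a polynomial with those of probabilistic Turing machines. -/

/-- The data of a program: binary trees with natural numbers at the leaves. -/
inductive Data : Type
  | nat (a : ℕ) : Data
  | pair (v w : Data) : Data

namespace Data

/-- The number of bits (up to a constant factor) needed to write down a piece of data. -/
def size : Data → ℕ
  | nat a => Nat.size a + 1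
  | pair v w => size v + size w + 1

/-- The left subtree (`0` for a leaf). -/
def fst : Data → Data
  | nat _ => nat 0
  | pair v _ => v

/-- The right subtree (`0` for a leaf). -/
def snd : Data → Data
  | nat _ => nat 0
  | pair _ w => w

/-- The number stored at a leaf (`0` for an inner node). -/
def toNat : Data → ℕ
  | nat a => a
  | pair _ _ => 0

/-- Whether the data is the leaf `0`. -/
def isZero : Data → Bool
  | nat a => a == 0
  | pair _ _ => false

/-- Whether the data is a leaf, as a number `1` or `0`. -/
def leafBit : Data → ℕ
  | nat _ => 1
  | pair _ _ => 0

/-- Lists, with `0` as the empty list and `pair` as the list constructor. -/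
def list : List Data → Data
  | [] => nat 0
  | v :: l => pair v (list l)

/-- Integers, as a sign bit and an absolute value. -/
def int (z : ℤ) : Data := pair (nat (if z < 0 then 1 else 0)) (nat z.natAbs)

/-- Gaussian integers. -/
def gauss (z : ℤ × ℤ) : Data := pair (int z.1) (int z.2)

/-- Booleans. -/
def bool (b : Bool) : Data := nat b.toNat

end Data

/-- Programs.  A program maps a piece of data to a piece of data. -/
inductive Code : Type
  /-- do nothing -/
  | id : Code
  /-- replace the data by a fixed numeral -/
  | const (a : ℕ) : Code
  /-- left subtree -/
  | fst : Code
  /-- right subtree -/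
  | snd : Code
  /-- is the data a leaf? -/
  | isLeaf : Code
  /-- arithmetic on the two numbers in the left and in the right subtree;
  subtraction is truncated at `0`, division rounds down -/
  | add : Code
  | sub : Code
  | mul : Code
  | div : Code
  /-- toss a fair coin, with result `0` or `1` -/
  | coin : Code
  /-- run `f` and then `g` on the same data and form the pair of the results -/
  | both (f g : Code) : Code
  /-- run `f`, then run `g` on the result -/
  | seq (f g : Code) : Code
  /-- run the test `b`; run `f` if the result of the test is not `0`, otherwise run `g` -/
  | ite (b f g : Code) : Code
  /-- while the left subtree is not `0`, run `f` -/
  | loop (f : Code) : Code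

/-- The random result of an execution: the final data and the number of steps, or `none` when a
loop has been cut off. -/
abbrev Result : Type := PMF (Option (Data × ℕ))

/-- Take `t` steps and return `v`. -/
def done (t : ℕ) (v : Data) : Result := PMF.pure (some (v, t))

/-- Sequential execution with fresh coins; the numbers of steps are added. -/
def Result.andThen (r : Result) (f : Data → Result) : Result :=
  r.bind fun o =>
    match o with
    | none => PMF.pure none
    | some (v, t) => (f v).map (Option.map fun q => (q.1, t + q.2))

/-- The while loop, cut off when it has not come to an end after the given number of rounds. -/
def runLoop (body : Data → Result) : ℕ → Data → Result
  | 0, v => if v.fst.isZero then done v.size v else PMF.pure none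
  | k + 1, v =>
      if v.fst.isZero then done v.size v
      else (done v.size v).andThen fun v => (body v).andThen (runLoop body k)

/-- Execution of a program, with every loop cut off after `N` rounds. -/
def Code.exec (N : ℕ) : Code → Data → Result
  | .id, v => done v.size v
  | .const a, v => done (v.size + Nat.size a) (.nat a)
  | .fst, v => done v.size v.fst
  | .snd, v => done v.size v.snd
  | .isLeaf, v => done v.size (.nat v.leafBit)
  | .add, v => done v.size (.nat (v.fst.toNat + v.snd.toNat))
  | .sub, v => done v.size (.nat (v.fst.toNat - v.snd.toNat))
  | .mul, v => done (v.size ^ 2) (.nat (v.fst.toNat * v.snd.toNat))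
  | .div, v => done (v.size ^ 2) (.nat (v.fst.toNat / v.snd.toNat))
  | .coin, v => (PMF.uniformOfFintype Bool).bind fun b => done v.size (.bool b)
  | .both f g, v =>
      (Code.exec N f v).andThen fun a => (Code.exec N g v).andThen fun b =>
        done v.size (.pair a b)
  | .seq f g, v => (Code.exec N f v).andThen (Code.exec N g)
  | .ite b f g, v =>
      (Code.exec N b v).andThen fun a =>
        if a.isZero then Code.exec N g v else Code.exec N f v
  | .loop f, v => runLoop (Code.exec N f) N v

/-- On input `v` the program halts after at most `T` steps, whatever the coin tosses, and its
output has the distribution `μ`.  Every round of a loop takes at least one step, so an execution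
with at most `T` steps is not affected by a cut-off after `T` rounds. -/
def Code.Outputs (A : Code) (v : Data) (T : ℕ) (μ : PMF Data) : Prop :=
  (∀ o ∈ (A.exec T v).support, ∃ w t, o = some (w, t) ∧ t ≤ T) ∧
    (A.exec T v).map (Option.map Prod.fst) = μ.map some

/-! ### Systems of qudits -/

/-- The labels `x = (x_1, ..., x_n)` of the computational basis of `ℂ^{d_1} ⊗ ... ⊗ ℂ^{d_n}`. -/
abbrev Basis {n : ℕ} (d : Fin n → ℕ) : Type := ∀ j, Fin (d j)

/-- The outcomes of a measurement of the qudits in `S` in the computational basis. -/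
abbrev Outcome {n : ℕ} (d : Fin n → ℕ) (S : Finset (Fin n)) : Type := ∀ j : S, Fin (d j)

/-- The tensor product operator `u_1 ⊗ ... ⊗ u_n`, as a matrix in the computational basis. -/
def tensor {n : ℕ} {d : Fin n → ℕ} (u : ∀ j, Matrix (Fin (d j)) (Fin (d j)) ℂ) :
    Matrix (Basis d) (Basis d) ℂ :=
  Matrix.of fun x y => ∏ j, u j (x j) (y j)

/-- The probability of the outcome `y` when the qudits in `S` of the state `ψ` are measured. -/
def outcomeProb {n : ℕ} {d : Fin n → ℕ} (S : Finset (Fin n)) (ψ : Basis d → ℂ)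
    (y : Outcome d S) : ℝ :=
  ∑ x : Basis d, if (fun j : S => x j) = y then ‖ψ x‖ ^ 2 else 0

/-- `p` is `ε`-approximately `t`-sparse: it is `ε`-close in `ℓ¹` to a vector with at most `t`
nonzero entries. -/
def ApproxSparse {X : Type*} [Fintype X] (ε : ℝ) (t : ℕ) (p : X → ℝ) : Prop :=
  ∃ v : X → ℂ, (Function.support v).ncard ≤ t ∧ ∑ x, ‖(p x : ℂ) - v x‖ ≤ ε

/-- Basis labels as lists of digits. -/
def encBasis {n : ℕ} {d : Fin n → ℕ} (x : Basis d) : Data :=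
  .list (List.ofFn fun j => .nat (x j))

/-- Outcomes as lists of digits, in increasing order of the measured qudits. -/
def encOutcome {n : ℕ} {d : Fin n → ℕ} {S : Finset (Fin n)} (y : Outcome d S) : Data :=
  .list ((List.finRange n).filterMap fun j =>
    if h : j ∈ S then some (.nat (y ⟨j, h⟩)) else none)

/-- `a + b i`, divided by `2 ^ k`, approximates the complex number `z` with error at most
`2 ^ (-k)`; that is, `(a, b)` describes `z` with `k` bits of precision. -/
def Approx (k : ℕ) (z : ℂ) (w : ℤ × ℤ) : Prop :=
  ‖z - ((w.1 : ℂ) + (w.2 : ℂ) * Complex.I) / 2 ^ k‖ ≤ (2 ^ k)⁻¹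

/-! ### Computationally tractable states -/

/-- A family of states `φ i` of `n i` qudits, whose members are named to programs by `enc i`, is
computationally tractable: in time polynomial in `n i` one can sample from the distribution
`|⟨x|φ i⟩|²`, and compute `⟨x|φ i⟩` for a given `x`.  Since a program handles finitely many bits,
both are up to an error `2 ^ (-k)`, in time polynomial in `n i` and `k`, for every given `k`. -/
def IsCT {ι : Type*} (enc : ι → Data) {n : ι → ℕ} (d : ∀ i, Fin (n i) → ℕ)
    (φ : ∀ i, Basis (d i) → ℂ) : Prop :=
  (∃ (A : Code) (C c : ℕ), ∀ (i : ι) (k : ℕ), ∃ μ : PMF (Basis (d i)),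
      A.Outputs (.pair (enc i) (.nat k)) (C * (n i + k + 1) ^ c) (μ.map encBasis) ∧
      ∑ x, |(μ x).toReal - ‖φ i x‖ ^ 2| ≤ (2 ^ k)⁻¹) ∧
  (∃ (A : Code) (C c : ℕ), ∀ (i : ι) (x : Basis (d i)) (k : ℕ), ∃ w : ℤ × ℤ,
      A.Outputs (.pair (enc i) (.pair (encBasis x) (.nat k))) (C * (n i + k + 1) ^ c)
        (PMF.pure (.gauss w)) ∧
      Approx k (φ i x) w)

/-! ### Simulation by sparse distributions -/

/-- `v` lists all nonzero probabilities of `P'`: it is a list of triples `(y, a, b)`, one for every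
outcome `y` with `P' y ≠ 0`, where `P' y = a / b`. -/
def Lists {n : ℕ} {d : Fin n → ℕ} {S : Finset (Fin n)} (v : Data)
    (P' : PMF (Outcome d S)) : Prop :=
  ∃ L : List (Outcome d S × ℕ × ℕ),
    v = .list (L.map fun q => .pair (encOutcome q.1) (.pair (.nat q.2.1) (.nat q.2.2))) ∧
    (L.map Prod.fst).Nodup ∧
    (∀ y, y ∈ L.map Prod.fst ↔ P' y ≠ 0) ∧
    ∀ q ∈ L, 0 < q.2.2 ∧ (P' q.1).toReal = (q.2.1 : ℝ) / q.2.2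

/-- On the given input, `A` halts within `T` steps and always outputs, as a list of its nonzero
probabilities, a probability distribution `P'` with at most `s` nonzero probabilities; with
probability at least `1 - δ` it is `η`-close to `P` in `ℓ¹`.  Each such `P'` is sampled by `B`
from its list within `T'` steps. -/
def SimulatesSparse {n : ℕ} {d : Fin n → ℕ} {S : Finset (Fin n)} (A B : Code) (input : Data)
    (T T' : ℕ) (s η δ : ℝ) (P : Outcome d S → ℝ) : Prop :=
  ∃ ν : PMF Data, A.Outputs input T ν ∧
    (∀ v ∈ ν.support, ∃ P' : PMF (Outcome d S),
      Lists v P' ∧ (P'.support.ncard : ℝ) ≤ s ∧ B.Outputs v T' (P'.map encOutcome)) ∧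
    ENNReal.ofReal (1 - δ) ≤ ν.toOuterMeasure
      {v | ∃ P' : PMF (Outcome d S), Lists v P' ∧ ∑ y, |(P' y).toReal - P y| ≤ η}

/-- The accuracy `ε` as an integer. -/
def accuracy (ε : ℝ) : ℕ := ⌊1 / ε⌋₊

/-- The failure probability `δ` as an integer. -/
def confidence (δ : ℝ) : ℕ := ⌈Real.logb 2 (1 / δ)⌉₊

/-- The numbers `t`, `ε`, `δ` as they are handed to a program. -/
def encParams (t : ℕ) (ε δ : ℝ) : Data :=
  .list [.nat t, .nat (accuracy ε), .nat (confidence δ)]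

/-- A tensor product operator, given by the rounded entries of its factors, and a set of measured
qudits, as they are handed to a program: for every qudit its dimension, whether it is measured,
and the rows of its matrix. -/
def encProduct {n : ℕ} {d : Fin n → ℕ} (S : Finset (Fin n))
    (w : ∀ j, Fin (d j) → Fin (d j) → ℤ × ℤ) : Data :=
  .list (List.ofFn fun j => .list [.nat (d j), .bool (decide (j ∈ S)),
    .list (List.ofFn fun a => .list (List.ofFn fun b => .gauss (w j a b)))])

/-! ### IQP circuits -/

/-- The dimensions of a system of `n` qubits. -/
abbrev qubits (n : ℕ) : Fin n → ℕ := fun _ => 2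

/-- The computational basis state `|x⟩`. -/
def ket {n : ℕ} {d : Fin n → ℕ} (x : Basis d) : Basis d → ℂ := Pi.single x 1

/-- The operator `T_1 ⊗ ... ⊗ T_n` with `T_j = X` where `m j` is true and `T_j = I` elsewhere. -/
def pauliX {n : ℕ} (m : Fin n → Bool) : Matrix (Basis (qubits n)) (Basis (qubits n)) ℂ :=
  tensor (d := qubits n) fun j => if m j then !![0, 1; 1, 0] else 1

/-- The IQP circuit on `n` qubits with the gates `exp(i θ_g T_g)`. -/
def iqp {n r : ℕ} (θ : Fin r → ℝ) (m : Fin r → Fin n → Bool) :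
    Matrix (Basis (qubits n)) (Basis (qubits n)) ℂ :=
  (List.ofFn fun g => NormedSpace.exp ((Complex.I * (θ g : ℂ)) • pauliX (m g))).prod

/-- An IQP circuit with its input `x`, given by rounded values of the phases `exp(i θ_g)`, and a
set of measured qubits, as they are handed to a program. -/
def encIQP {n r : ℕ} (x : Basis (qubits n)) (m : Fin r → Fin n → Bool) (w : Fin r → ℤ × ℤ)
    (S : Finset (Fin n)) : Data :=
  .list [encBasis x,
    .list (List.ofFn fun g => .pair (.gauss (w g)) (.list (List.ofFn fun j => .bool (m g j)))),
    .list (List.ofFn fun j => .bool (decide (j ∈ S)))]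

end SparseSim

end

open SparseSim

noncomputable section

namespace SparseSim

/-! ### Executions that are not affected by cut-offs -/

/-! Let φ be the tractable state and ψ = (u_1 ⊗ ... ⊗ u_n) φ. The probability `prefixProb ψ Y` that
certain measured qudits of ψ show prescribed digits is a quadratic form in φ whose operator is a
tensor product: a rank one projection, made of a row of u_k, at every prescribed position and the
identity elsewhere. It is therefore the sum over pairs of labels of K(x,z) · conj K(z,x), where K =
`kernelAmp` is φ(x) times conjugated row entries at z and Kronecker deltas at the other positions.
Since the rows are unit vectors, |K(x,z)|² is a probability distribution on pairs that is easy to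
sample: draw x from |φ|², keep its free digits and redraw the prescribed ones from the squared
entries of their rows.

The quotient of the two amplitudes G = K(x,z) and H = K(z,x) would be an unbounded estimator. The
score |G+H|²/(2(|G|²+|H|²)) is symmetric and lies in [0,1]; exchanging x and z shows that its mean
is exactly (1+`prefixProb`)/2 (`sum_pairProb_mul_cscore`). An exponential moment bound
(`deviation_le`) then gives every such probability up to an inverse polynomial from polynomially
many samples. Rounding is harmless: weighted with |G|², the score is Lipschitz in the amplitudes
(`cscore_perturb`), and the accumulated loss is only exponential in n, hence covered by polynomially
many bits (`mean_close`). A common factor of both amplitudes cancels, so integer data suffice.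

Significant outcomes are found by a tree search that fixes the measured digits one qudit at a time
and keeps the prefixes whose estimate exceeds a threshold. Prefixes of one level are disjoint
events, so there are few significant ones, and every prefix of a significant outcome is significant
itself (`fails_level`, `fails_search`). If the outcome distribution is close to a t-sparse one, the
outcomes that are missed carry total weight O(ε), and normalizing the estimates changes little
(`sum_abs_normalize_le`). The normalized weights are rounded to fractions with a power of two as
common denominator, which makes exact sampling with coins possible (`weightPMF_close`,
`resample_roundWeights`).

An IQP circuit is H D H with H the Hadamard transformation of all qubits and D diagonal (`iqp_eq`).
The state D H|x⟩ has amplitudes of equal modulus and computable phases, so the same search applies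
with uniformly random labels and the Hadamard matrices as the product operation.

All of this is carried out for actual programs. `PT` and `RPT` are the polynomial time functions and
randomized functions on encoded data; they are closed under composition because the running time
bounds the size of the output (`Run.size_le`). Loops reduce to the fold rule `RPT.pfold`, which asks
for an invariant that bounds the intermediate data. `RTime` converts bounds in the input size into
bounds in n, t, 1/ε and log(1/δ). -/

theorem pmf_bind_congr {α β : Type*} (p : PMF α) {f g : α → PMF β}
    (h : ∀ a ∈ p.support, f a = g a) : p.bind f = p.bind g := by
  ext b
  rw [PMF.bind_apply, PMF.bind_apply]
  refine tsum_congr fun a => ?_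
  by_cases ha : p a = 0
  · simp [ha]
  · rw [h a ha]

theorem pmf_map_congr {α β : Type*} (p : PMF α) {f g : α → β}
    (h : ∀ a ∈ p.support, f a = g a) : p.map f = p.map g :=
  pmf_bind_congr p fun a ha => by simp [h a ha]

theorem Data.one_le_size (v : Data) : 1 ≤ v.size := by
  cases v <;> simp [Data.size]

/-- A result that has no cut-off, takes at most `T` steps and has the distribution `μ`. -/
def Good (r : Result) (T : ℕ) (μ : PMF Data) : Prop :=
  (∀ o ∈ r.support, ∃ w t, o = some (w, t) ∧ t ≤ T) ∧
    r.map (Option.map Prod.fst) = μ.map some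

theorem Good.exists_mem {r : Result} {T : ℕ} {μ : PMF Data} (h : Good r T μ) {w : Data}
    (hw : w ∈ μ.support) : ∃ t, some (w, t) ∈ r.support ∧ t ≤ T := by
  have h1 : some w ∈ (r.map (Option.map Prod.fst)).support := by
    rw [h.2, PMF.mem_support_map_iff]; exact ⟨w, hw, rfl⟩
  rw [PMF.mem_support_map_iff] at h1
  obtain ⟨o, ho, h2⟩ := h1
  obtain ⟨w', t, rfl, ht⟩ := h.1 o ho
  simp at h2
  exact ⟨t, h2 ▸ ho, ht⟩

theorem Good.mem_of_mem {r : Result} {T : ℕ} {μ : PMF Data} (h : Good r T μ) {w : Data} {t : ℕ}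
    (hw : some (w, t) ∈ r.support) : w ∈ μ.support := by
  have h1 : some w ∈ (r.map (Option.map Prod.fst)).support := by
    rw [PMF.mem_support_map_iff]; exact ⟨_, hw, rfl⟩
  rw [h.2, PMF.mem_support_map_iff] at h1
  obtain ⟨o, ho, h2⟩ := h1
  simp at h2
  exact h2 ▸ ho

theorem Good.mono {r : Result} {T T' : ℕ} {μ : PMF Data} (h : Good r T μ) (hT : T ≤ T') :
    Good r T' μ :=
  ⟨fun o ho => by
    obtain ⟨w, t, h1, h2⟩ := h.1 o ho
    exact ⟨w, t, h1, h2.trans hT⟩, h.2⟩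

theorem good_done (t : ℕ) (v : Data) : Good (done t v) t (PMF.pure v) := by
  refine ⟨?_, ?_⟩
  · intro o ho
    simp [done] at ho
    exact ⟨v, t, ho, le_rfl⟩
  · simp [done, PMF.pure_map]

theorem Good.andThen {r : Result} {T₁ T₂ : ℕ} {μ : PMF Data} {f : Data → Result}
    {κ : Data → PMF Data} (hr : Good r T₁ μ) (hf : ∀ w ∈ μ.support, Good (f w) T₂ (κ w)) :
    Good (r.andThen f) (T₁ + T₂) (μ.bind κ) := by
  refine ⟨?_, ?_⟩
  · intro o ho
    unfold Result.andThen at ho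
    rw [PMF.mem_support_bind_iff] at ho
    obtain ⟨o', ho', h⟩ := ho
    obtain ⟨w, t, rfl, ht⟩ := hr.1 o' ho'
    simp only [PMF.mem_support_map_iff] at h
    obtain ⟨o'', h1, h2⟩ := h
    obtain ⟨w', t', rfl, ht'⟩ := (hf w (hr.mem_of_mem ho')).1 o'' h1
    exact ⟨w', t + t', by simpa using h2.symm, by omega⟩
  · let g : Option Data → PMF (Option Data) := fun o => match o with
      | none => PMF.pure none
      | some v => (κ v).map some
    have h1 : (r.andThen f).map (Option.map Prod.fst) =
        (r.map (Option.map Prod.fst)).bind g := by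
      unfold Result.andThen
      rw [PMF.map_bind, PMF.bind_map]
      refine pmf_bind_congr _ fun o ho => ?_
      obtain ⟨w, t, rfl, ht⟩ := hr.1 o ho
      simp only [Function.comp, Option.map, g]
      rw [← (hf w (hr.mem_of_mem ho)).2, PMF.map_comp]
      congr 1
      ext o
      cases o <;> rfl
    rw [h1, hr.2, PMF.bind_map, PMF.map_bind]
    rfl

/-- On input `v` the program `A` halts after at most `T` steps and its output has the
distribution `μ`, for all cut-offs that are not below `T`. -/
def Run (A : Code) (v : Data) (T : ℕ) (μ : PMF Data) : Prop :=
  ∀ N, T ≤ N → Good (A.exec N v) T μ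

theorem Run.outputs {A : Code} {v : Data} {T : ℕ} {μ : PMF Data} (h : Run A v T μ) :
    A.Outputs v T μ := h T le_rfl

theorem Run.mono {A : Code} {v : Data} {T T' : ℕ} {μ : PMF Data} (h : Run A v T μ)
    (hT : T ≤ T') : Run A v T' μ := fun N hN => (h N (hT.trans hN)).mono hT

theorem none_mem_andThen {r : Result} {f : Data → Result} (h : none ∉ (r.andThen f).support) :
    none ∉ r.support ∧ ∀ v t, some (v, t) ∈ r.support → none ∉ (f v).support := by
  unfold Result.andThen at h
  rw [PMF.mem_support_bind_iff] at h
  push Not at h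
  refine ⟨fun h0 => ?_, fun v t hv h0 => ?_⟩
  · exact h none h0 (by simp)
  · refine h _ hv ?_
    rw [PMF.mem_support_map_iff]
    exact ⟨none, h0, rfl⟩

theorem andThen_congr {r r' : Result} {f f' : Data → Result} (h : none ∉ (r.andThen f).support)
    (hr : none ∉ r.support → r' = r) (hf : ∀ v, none ∉ (f v).support → f' v = f v) :
    r'.andThen f' = r.andThen f := by
  obtain ⟨h1, h2⟩ := none_mem_andThen h
  rw [hr h1]
  unfold Result.andThen
  refine pmf_bind_congr _ fun o ho => ?_
  match o with
  | none => rfl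
  | some (v, t) => simp only [hf v (h2 v t ho)]

theorem runLoop_cutoff {b b' : Data → Result} (hb : ∀ v, none ∉ (b v).support → b' v = b v) :
    ∀ (k k' : ℕ) (v : Data), k ≤ k' → none ∉ (runLoop b k v).support →
      runLoop b' k' v = runLoop b k v := by
  intro k
  induction k with
  | zero =>
    intro k' v _ h
    by_cases hv : v.fst.isZero
    · cases k' <;> simp [runLoop, hv]
    · simp [runLoop, hv] at h
  | succ k ih =>
    intro k' v hk h
    obtain ⟨k', rfl⟩ : ∃ j, k' = j + 1 := ⟨k' - 1, by omega⟩
    by_cases hv : v.fst.isZero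
    · simp [runLoop, hv]
    · simp only [runLoop, hv, Bool.false_eq_true, if_false] at h ⊢
      refine andThen_congr h (fun _ => rfl) fun v hv => ?_
      exact andThen_congr hv (hb v) fun v hv => ih k' v (by omega) hv

/-- If no branch was cut off, every loop ended within its rounds, and a larger limit changes
nothing. Composed programs need one limit that serves all parts; this is what makes `Outputs`, with
its limit fixed at T, equivalent to `Run`. -/
theorem exec_cutoff (A : Code) {N N' : ℕ} (hN : N ≤ N') :
    ∀ v, none ∉ (A.exec N v).support → A.exec N' v = A.exec N v := by
  induction A with
  | both f g hf hg =>
    intro v h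
    simp only [Code.exec] at h ⊢
    refine andThen_congr h (hf v) fun a ha => ?_
    exact andThen_congr ha (hg v) fun _ _ => rfl
  | seq f g hf hg =>
    intro v h
    simp only [Code.exec] at h ⊢
    exact andThen_congr h (hf v) fun a ha => hg a ha
  | ite b f g hb hf hg =>
    intro v h
    simp only [Code.exec] at h ⊢
    refine andThen_congr h (hb v) fun a ha => ?_
    by_cases h0 : a.isZero
    · simp only [h0, if_true] at ha ⊢
      exact hg v ha
    · simp only [h0, Bool.false_eq_true, if_false] at ha ⊢
      exact hf v ha
  | loop f hf =>
    intro v h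
    exact runLoop_cutoff hf N N' v hN h
  | _ => intro v _; rfl

theorem run_of_outputs {A : Code} {v : Data} {T : ℕ} {μ : PMF Data} (h : A.Outputs v T μ) :
    Run A v T μ := by
  intro N hN
  rw [exec_cutoff A hN v]
  · exact h
  · intro h0
    obtain ⟨w, t, h1, _⟩ := h.1 _ h0
    simp at h1

theorem mem_andThen {r : Result} {f : Data → Result} {w : Data} {t : ℕ}
    (h : some (w, t) ∈ (r.andThen f).support) :
    ∃ v t₁ t₂, some (v, t₁) ∈ r.support ∧ some (w, t₂) ∈ (f v).support ∧ t = t₁ + t₂ := by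
  unfold Result.andThen at h
  rw [PMF.mem_support_bind_iff] at h
  obtain ⟨o, ho, h⟩ := h
  match o with
  | none => simp at h
  | some (v, t₁) =>
    simp only [PMF.mem_support_map_iff] at h
    obtain ⟨o', h1, h2⟩ := h
    match o' with
    | none => simp at h2
    | some (w', t₂) =>
      simp at h2
      exact ⟨v, t₁, t₂, ho, by rw [← h2.1]; exact h1, h2.2.symm⟩

theorem mem_done {t t' : ℕ} {v w : Data} (h : some (w, t') ∈ (done t v).support) :
    w = v ∧ t' = t := by
  simpa [done] using h

/-- The output fits into the time, and so does the input. -/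
def SizeBound (v : Data) (r : Result) : Prop :=
  ∀ w t, some (w, t) ∈ r.support → w.size ≤ v.size + 2 * t ∧ v.size ≤ t

theorem sizeBound_done {v w : Data} {t : ℕ} (h : w.size ≤ v.size + 2 * t) (h' : v.size ≤ t) :
    SizeBound v (done t w) := by
  intro w' t' hw
  obtain ⟨rfl, rfl⟩ := mem_done hw
  exact ⟨h, h'⟩

theorem SizeBound.andThen {v : Data} {r : Result} {f : Data → Result} (hr : SizeBound v r)
    (hf : ∀ w, SizeBound w (f w)) : SizeBound v (r.andThen f) := by
  intro w t h
  obtain ⟨u, t₁, t₂, h1, h2, rfl⟩ := mem_andThen h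
  have := hr _ _ h1
  have := hf _ _ _ h2
  omega

theorem nat_size_add_le (a b : ℕ) : Nat.size (a + b) ≤ Nat.size a + Nat.size b + 1 := by
  rw [Nat.size_le]
  have h1 := Nat.lt_size_self a
  have h2 := Nat.lt_size_self b
  have h3 : 2 ^ a.size ≤ 2 ^ (a.size + b.size) := Nat.pow_le_pow_right (by norm_num) (by omega)
  have h4 : 2 ^ b.size ≤ 2 ^ (a.size + b.size) := Nat.pow_le_pow_right (by norm_num) (by omega)
  rw [pow_succ]
  omega

theorem nat_size_mul_le (a b : ℕ) : Nat.size (a * b) ≤ Nat.size a + Nat.size b := by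
  rw [Nat.size_le, pow_add]
  exact Nat.mul_lt_mul'' (Nat.lt_size_self a) (Nat.lt_size_self b)

theorem toNat_size_le (v : Data) : Nat.size v.toNat + 1 ≤ v.size := by
  cases v with
  | nat a => simp [Data.toNat, Data.size]
  | pair v w => simp [Data.toNat, Data.size]; 

theorem fst_size_le (v : Data) : v.fst.size ≤ v.size := by
  cases v with
  | nat a => simp [Data.fst, Data.size]
  | pair v w => simp [Data.fst, Data.size]; omega

theorem snd_size_le (v : Data) : v.snd.size ≤ v.size := by
  cases v with
  | nat a => simp [Data.snd, Data.size]
  | pair v w => simp [Data.snd, Data.size]; omega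

theorem sizeBound_runLoop {b : Data → Result} (hb : ∀ v, SizeBound v (b v)) :
    ∀ (k : ℕ) (v : Data), SizeBound v (runLoop b k v) := by
  intro k
  induction k with
  | zero =>
    intro v
    by_cases hv : v.fst.isZero
    · simp only [runLoop, hv, if_true]
      exact sizeBound_done (by omega) le_rfl
    · intro w t h
      simp [runLoop, hv] at h
  | succ k ih =>
    intro v
    by_cases hv : v.fst.isZero
    · simp only [runLoop, hv, if_true]
      exact sizeBound_done (by omega) le_rfl
    · simp only [runLoop, hv, Bool.false_eq_true, if_false]
      exact (sizeBound_done (by omega) le_rfl).andThen fun v => (hb v).andThen ih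

/-- Every instruction is charged at least for its input, and none enlarges data by more than this
charge allows; the factor 2 leaves room for the extra node of a pair. Running times thus control all
intermediate sizes, and no separate analysis of output lengths is needed. -/
theorem sizeBound_exec (A : Code) (N : ℕ) : ∀ v, SizeBound v (A.exec N v) := by
  induction A with
  | both f g hf hg =>
    intro v w t h
    simp only [Code.exec] at h
    obtain ⟨a, t₁, t₂, h1, h2, rfl⟩ := mem_andThen h
    obtain ⟨b, t₃, t₄, h3, h4, rfl⟩ := mem_andThen h2
    obtain ⟨rfl, rfl⟩ := mem_done h4
    have := hf v _ _ h1
    have := hg v _ _ h3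
    have := v.one_le_size
    simp only [Data.size]
    omega
  | seq f g hf hg =>
    intro v
    exact (hf v).andThen hg
  | ite b f g hb hf hg =>
    intro v w t h
    simp only [Code.exec] at h
    obtain ⟨a, t₁, t₂, h1, h2, rfl⟩ := mem_andThen h
    by_cases h0 : a.isZero
    · simp only [h0, if_true] at h2
      have := hg v _ _ h2
      omega
    · simp only [h0, Bool.false_eq_true, if_false] at h2
      have := hf v _ _ h2
      omega
  | loop f hf =>
    intro v
    exact sizeBound_runLoop hf N v
  | id => intro v; exact sizeBound_done (by omega) le_rfl
  | const a =>
    intro v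
    refine sizeBound_done ?_ (by omega)
    have := v.one_le_size
    simp [Data.size]; omega
  | fst => intro v; exact sizeBound_done (by have := fst_size_le v; omega) le_rfl
  | snd => intro v; exact sizeBound_done (by have := snd_size_le v; omega) le_rfl
  | isLeaf =>
    intro v
    refine sizeBound_done ?_ le_rfl
    have := v.one_le_size
    cases v <;> simp [Data.leafBit, Data.size] <;> omega
  | add =>
    intro v
    refine sizeBound_done ?_ le_rfl
    have := nat_size_add_le v.fst.toNat v.snd.toNat
    have := toNat_size_le v.fst
    have := toNat_size_le v.snd
    have := fst_size_le v
    have := snd_size_le v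
    simp [Data.size]; omega
  | sub =>
    intro v
    refine sizeBound_done ?_ le_rfl
    have : Nat.size (v.fst.toNat - v.snd.toNat) ≤ Nat.size v.fst.toNat :=
      Nat.size_le_size (Nat.sub_le _ _)
    have := toNat_size_le v.fst
    have := fst_size_le v
    simp [Data.size]; omega
  | mul =>
    intro v
    have h0 := v.one_le_size
    have h1 : v.size ≤ v.size ^ 2 := by nlinarith
    refine sizeBound_done ?_ h1
    have := nat_size_mul_le v.fst.toNat v.snd.toNat
    have := toNat_size_le v.fst
    have := toNat_size_le v.snd
    have := fst_size_le v
    have := snd_size_le v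
    simp only [Data.size]; omega
  | div =>
    intro v
    have h0 := v.one_le_size
    have h1 : v.size ≤ v.size ^ 2 := by nlinarith
    refine sizeBound_done ?_ h1
    have : Nat.size (v.fst.toNat / v.snd.toNat) ≤ Nat.size v.fst.toNat :=
      Nat.size_le_size (Nat.div_le_self _ _)
    have := toNat_size_le v.fst
    have := fst_size_le v
    simp only [Data.size]; omega
  | coin =>
    intro v w t h
    simp only [Code.exec, PMF.mem_support_bind_iff] at h
    obtain ⟨b, _, h⟩ := h
    obtain ⟨rfl, rfl⟩ := mem_done h
    have := v.one_le_size
    cases b <;> simp [Data.bool, Data.size] <;> omega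

theorem Run.size_le {A : Code} {v w : Data} {T : ℕ} {μ : PMF Data} (h : Run A v T μ)
    (hw : w ∈ μ.support) : w.size ≤ v.size + 2 * T := by
  obtain ⟨t, h1, h2⟩ := (h T le_rfl).exists_mem hw
  have := sizeBound_exec A T v _ _ h1
  omega

/-- Any program pays for reading its input. This later turns the time bound of a tractable family
into a bound on the length of the names of its instances. -/
theorem Run.input_le {A : Code} {v : Data} {T : ℕ} {μ : PMF Data} (h : Run A v T μ) :
    v.size ≤ T := by
  obtain ⟨w, hw⟩ := μ.support_nonempty
  obtain ⟨t, h1, h2⟩ := (h T le_rfl).exists_mem hw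
  have := sizeBound_exec A T v _ _ h1
  omega

/-! ### Rules for executions -/

theorem Run.congr {A : Code} {v v' : Data} {T T' : ℕ} {μ μ' : PMF Data} (h : Run A v T μ)
    (hv : v = v') (hT : T ≤ T') (hμ : μ = μ') : Run A v' T' μ' := by
  subst hv hμ
  exact h.mono hT

theorem run_id (v : Data) : Run .id v v.size (PMF.pure v) := fun _ _ => good_done _ _

theorem run_const (a : ℕ) (v : Data) :
    Run (.const a) v (v.size + Nat.size a) (PMF.pure (.nat a)) := fun _ _ => good_done _ _

theorem run_fst (v : Data) : Run .fst v v.size (PMF.pure v.fst) := fun _ _ => good_done _ _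

theorem run_snd (v : Data) : Run .snd v v.size (PMF.pure v.snd) := fun _ _ => good_done _ _

theorem run_add (v : Data) :
    Run .add v v.size (PMF.pure (.nat (v.fst.toNat + v.snd.toNat))) := fun _ _ => good_done _ _

theorem run_sub (v : Data) :
    Run .sub v v.size (PMF.pure (.nat (v.fst.toNat - v.snd.toNat))) := fun _ _ => good_done _ _

theorem run_mul (v : Data) :
    Run .mul v (v.size ^ 2) (PMF.pure (.nat (v.fst.toNat * v.snd.toNat))) :=
  fun _ _ => good_done _ _

theorem run_div (v : Data) :
    Run .div v (v.size ^ 2) (PMF.pure (.nat (v.fst.toNat / v.snd.toNat))) :=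
  fun _ _ => good_done _ _

theorem run_coin (v : Data) :
    Run .coin v v.size ((PMF.uniformOfFintype Bool).map Data.bool) := by
  intro N _
  refine ⟨?_, ?_⟩
  · intro o ho
    simp only [Code.exec, PMF.mem_support_bind_iff] at ho
    obtain ⟨b, _, h⟩ := ho
    simp [done] at h
    exact ⟨_, _, h, le_rfl⟩
  · simp only [Code.exec, done, PMF.map_bind, PMF.pure_map, PMF.map_comp, Option.map]
    rfl

theorem Run.seq {f g : Code} {v : Data} {T₁ T₂ : ℕ} {μ : PMF Data} {κ : Data → PMF Data}
    (hf : Run f v T₁ μ) (hg : ∀ w ∈ μ.support, Run g w T₂ (κ w)) :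
    Run (.seq f g) v (T₁ + T₂) (μ.bind κ) := fun N hN =>
  (hf N (by omega)).andThen fun w hw => hg w hw N (by omega)

theorem Run.both {f g : Code} {v : Data} {T₁ T₂ : ℕ} {μ ν : PMF Data}
    (hf : Run f v T₁ μ) (hg : Run g v T₂ ν) :
    Run (.both f g) v (T₁ + (T₂ + v.size))
      (μ.bind fun a => ν.bind fun b => PMF.pure (.pair a b)) := fun N hN =>
  (hf N (by omega)).andThen fun _ _ => (hg N (by omega)).andThen fun _ _ => good_done _ _

theorem Run.ite {b f g : Code} {v w : Data} {T₁ T₂ : ℕ} {μ : PMF Data}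
    (hb : Run b v T₁ (PMF.pure w)) (hf : w.isZero = false → Run f v T₂ μ)
    (hg : w.isZero = true → Run g v T₂ μ) : Run (.ite b f g) v (T₁ + T₂) μ := fun N hN => by
  have := (hb N (by omega)).andThen
    (f := fun a => if a.isZero then Code.exec N g v else Code.exec N f v)
    (T₂ := T₂) (κ := fun _ => μ) ?_
  · simpa [Code.exec] using this
  · intro w' hw'
    simp at hw'
    subst hw'
    cases h : w'.isZero
    · simpa using hf h N (by omega)
    · simpa using hg h N (by omega)

/-- The same as `Run`, for a loop. -/
def LoopRun (f : Code) (v : Data) (T : ℕ) (μ : PMF Data) : Prop :=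
  ∀ N k, T ≤ N → T ≤ k → Good (runLoop (f.exec N) k v) T μ

theorem LoopRun.run {f : Code} {v : Data} {T : ℕ} {μ : PMF Data} (h : LoopRun f v T μ) :
    Run (.loop f) v T μ := fun N hN => h N N hN hN

theorem LoopRun.mono {f : Code} {v : Data} {T T' : ℕ} {μ : PMF Data} (h : LoopRun f v T μ)
    (hT : T ≤ T') : LoopRun f v T' μ :=
  fun N k hN hk => (h N k (hT.trans hN) (hT.trans hk)).mono hT

theorem loopRun_stop {f : Code} {v : Data} (h : v.fst.isZero = true) :
    LoopRun f v v.size (PMF.pure v) := by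
  intro N k _ _
  cases k <;> simp [runLoop, h] <;> exact good_done _ _

/-- The charge `v.size` for the test is at least 1, so using up one round never leaves fewer rounds
than the remaining time bound. -/
theorem LoopRun.step {f : Code} {v : Data} {T₁ T₂ : ℕ} {μ : PMF Data} {κ : Data → PMF Data}
    (h : v.fst.isZero = false) (hf : Run f v T₁ μ)
    (hl : ∀ w ∈ μ.support, LoopRun f w T₂ (κ w)) :
    LoopRun f v (v.size + (T₁ + T₂)) (μ.bind κ) := by
  intro N k hN hk
  have := v.one_le_size
  obtain ⟨k, rfl⟩ : ∃ j, k = j + 1 := ⟨k - 1, by omega⟩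
  simp only [runLoop, h, Bool.false_eq_true, if_false]
  have h1 := (good_done v.size v).andThen
    (f := fun v => ((f.exec N) v).andThen (runLoop (f.exec N) k)) (T₂ := T₁ + T₂)
    (κ := fun _ => μ.bind κ) ?_
  · simpa using h1
  · intro w hw
    simp at hw
    subst hw
    exact (hf N (by omega)).andThen fun w hw => hl w hw N k (by omega) (by omega)

end SparseSim

end

/-! ### Uniqueness of output distributions; typed data and polynomial time -/

noncomputable section

namespace SparseSim

theorem Good.unique {r : Result} {T T' : ℕ} {μ μ' : PMF Data} (h : Good r T μ)
    (h' : Good r T' μ') : μ = μ' := by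
  have h1 : μ.map some = μ'.map some := h.2.symm.trans h'.2
  ext w
  have h2 := congrFun (congrArg DFunLike.coe h1) (some w)
  rw [PMF.map_apply, PMF.map_apply] at h2
  rw [tsum_eq_single w (by simp +contextual [eq_comm]),
    tsum_eq_single w (by simp +contextual [eq_comm])] at h2
  simpa using h2

theorem Run.unique {A : Code} {v : Data} {T T' : ℕ} {μ μ' : PMF Data} (h : Run A v T μ)
    (h' : Run A v T' μ') : μ = μ' :=
  (h _ (le_max_left T T')).unique (h' _ (le_max_right T T'))

open Classical in
/-- A family of distributions that depends only on the encodings factors through the encoding. -/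
theorem exists_kernel {β : Type*} (e : β → Data) (s : Set β) (κ : β → PMF Data)
    (h : ∀ b ∈ s, ∀ b' ∈ s, e b = e b' → κ b = κ b') :
    ∃ κ' : Data → PMF Data, ∀ b ∈ s, κ' (e b) = κ b := by
  refine ⟨fun w => if h : ∃ b ∈ s, e b = w then κ h.choose else PMF.pure w, fun b hb => ?_⟩
  have h1 : ∃ b' ∈ s, e b' = e b := ⟨b, hb, rfl⟩
  simp only [h1, dif_pos]
  exact h _ h1.choose_spec.1 _ hb h1.choose_spec.2

/-- The second program sees only `e b`, and `e` need not be injective. The output distribution of a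
program is determined by its input (`Run.unique`), so κ factors through `e` on the support
automatically. -/
theorem Run.seq_map {β : Type*} {f g : Code} {v : Data} {T₁ T₂ : ℕ} {μ : PMF β} {e : β → Data}
    {κ : β → PMF Data} (hf : Run f v T₁ (μ.map e))
    (hg : ∀ b ∈ μ.support, Run g (e b) T₂ (κ b)) :
    Run (.seq f g) v (T₁ + T₂) (μ.bind κ) := by
  obtain ⟨κ', hκ⟩ := exists_kernel e μ.support κ fun b hb b' hb' h =>
    (hg b hb).unique (h ▸ hg b' hb')
  have h1 : Run (.seq f g) v (T₁ + T₂) ((μ.map e).bind κ') := by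
    refine hf.seq fun w hw => ?_
    rw [PMF.mem_support_map_iff] at hw
    obtain ⟨b, hb, rfl⟩ := hw
    rw [hκ b hb]
    exact hg b hb
  rw [PMF.bind_map] at h1
  rwa [pmf_bind_congr μ (fun b hb => (hκ b hb).symm)]

theorem Run.seq_pure {f g : Code} {v w : Data} {T₁ T₂ : ℕ} {μ : PMF Data}
    (hf : Run f v T₁ (PMF.pure w)) (hg : Run g w T₂ μ) : Run (.seq f g) v (T₁ + T₂) μ := by
  have := hf.seq (κ := fun _ => μ) (g := g) (T₂ := T₂) (by
    intro w' hw
    simp at hw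
    subst hw
    exact hg)
  simpa using this

theorem Run.pure_both {β : Type*} {f g : Code} {v w : Data} {T₁ T₂ : ℕ} {μ : PMF β}
    {e : β → Data} (hf : Run f v T₁ (PMF.pure w)) (hg : Run g v T₂ (μ.map e)) :
    Run (.both f g) v (T₁ + (T₂ + v.size)) (μ.map fun b => .pair w (e b)) := by
  have := hf.both hg
  rw [PMF.pure_bind, PMF.bind_map] at this
  exact this

theorem Run.both_pure {f g : Code} {v w u : Data} {T₁ T₂ : ℕ}
    (hf : Run f v T₁ (PMF.pure w)) (hg : Run g v T₂ (PMF.pure u)) :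
    Run (.both f g) v (T₁ + (T₂ + v.size)) (PMF.pure (.pair w u)) := by
  have := hf.both hg
  simpa using this

theorem LoopRun.step_map {β : Type*} {f : Code} {v : Data} {T₁ T₂ : ℕ} {μ : PMF β}
    {e : β → Data} {κ : β → PMF Data} (h : v.fst.isZero = false) (hf : Run f v T₁ (μ.map e))
    (hl : ∀ b ∈ μ.support, LoopRun f (e b) T₂ (κ b)) :
    LoopRun f v (v.size + (T₁ + T₂)) (μ.bind κ) := by
  obtain ⟨κ', hκ⟩ := exists_kernel e μ.support κ fun b hb b' hb' h =>
    (hl b hb).run.unique (h ▸ (hl b' hb').run)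
  have h1 : LoopRun f v (v.size + (T₁ + T₂)) ((μ.map e).bind κ') := by
    refine LoopRun.step h hf fun w hw => ?_
    rw [PMF.mem_support_map_iff] at hw
    obtain ⟨b, hb, rfl⟩ := hw
    rw [hκ b hb]
    exact hl b hb
  rw [PMF.bind_map] at h1
  rwa [pmf_bind_congr μ (fun b hb => (hκ b hb).symm)]

/-! ### Typed data -/

/-- A representation of the elements of a type as data. -/
class Enc (α : Type*) where
  /-- the encoding -/
  enc : α → Data

open Enc

instance : Enc ℕ := ⟨Data.nat⟩
instance : Enc Bool := ⟨Data.bool⟩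
instance : Enc Unit := ⟨fun _ => .nat 0⟩
instance : Enc ℤ := ⟨Data.int⟩
instance {α β : Type*} [Enc α] [Enc β] : Enc (α × β) := ⟨fun p => .pair (enc p.1) (enc p.2)⟩
instance {α : Type*} [Enc α] : Enc (List α) := ⟨fun l => .list (l.map enc)⟩
instance {α : Type*} [Enc α] {P : α → Prop} : Enc {a // P a} := ⟨fun a => enc a.1⟩

/-- The number of bits of an encoding. -/
def esize {α : Type*} [Enc α] (a : α) : ℕ := (enc a).size

section PT

variable {α β γ δ : Type*} [Enc α] [Enc β] [Enc γ] [Enc δ]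

theorem one_le_esize (a : α) : 1 ≤ esize a := Data.one_le_size _

@[simp] theorem esize_pair (a : α) (b : β) : esize (a, b) = esize a + esize b + 1 := rfl
@[simp] theorem esize_nil : esize ([] : List α) = 1 := by simp [esize, enc, Data.list, Data.size]
@[simp] theorem esize_cons (a : α) (l : List α) : esize (a :: l) = esize a + esize l + 1 := rfl
theorem esize_nat (n : ℕ) : esize n = Nat.size n + 1 := rfl

theorem length_lt_esize (l : List α) : l.length < esize l := by
  induction l with
  | nil => simp
  | cons a l ih => simp; omega

theorem esize_mem_le {l : List α} {a : α} (h : a ∈ l) : esize a ≤ esize l := by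
  induction l with
  | nil => simp at h
  | cons b l ih =>
    rcases List.mem_cons.1 h with rfl | h
    · simp; omega
    · have := ih h
      simp; omega

theorem esize_list_le {l : List α} {B : ℕ} (h : ∀ a ∈ l, esize a ≤ B) :
    esize l ≤ l.length * (B + 1) + 1 := by
  induction l with
  | nil => simp
  | cons b l ih =>
    have h1 := ih fun a ha => h a (by simp [ha])
    have h2 := h b (by simp)
    simp only [esize_cons, List.length_cons]
    nlinarith

/-- Polynomially bounded in the size of the encoding. -/
def PB (g : α → ℕ) : Prop := ∃ C c : ℕ, ∀ a, g a ≤ C * esize a ^ c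

theorem PB.mono {g h : α → ℕ} (hh : PB h) (H : ∀ a, g a ≤ h a) : PB g := by
  obtain ⟨C, c, hC⟩ := hh
  exact ⟨C, c, fun a => (H a).trans (hC a)⟩

theorem PB.const (k : ℕ) : PB (fun _ : α => k) := ⟨k, 0, fun a => by simp⟩

theorem PB.esize : PB (fun a : α => esize a) := ⟨1, 1, fun a => by simp⟩

theorem PB.add {g h : α → ℕ} (hg : PB g) (hh : PB h) : PB (fun a => g a + h a) := by
  obtain ⟨C, c, hC⟩ := hg
  obtain ⟨D, d, hD⟩ := hh
  refine ⟨C + D, c + d, fun a => ?_⟩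
  have h1 : SparseSim.esize a ^ c ≤ SparseSim.esize a ^ (c + d) :=
    Nat.pow_le_pow_right (one_le_esize a) (by omega)
  have h2 : SparseSim.esize a ^ d ≤ SparseSim.esize a ^ (c + d) :=
    Nat.pow_le_pow_right (one_le_esize a) (by omega)
  have := hC a
  have := hD a
  nlinarith

theorem PB.mul {g h : α → ℕ} (hg : PB g) (hh : PB h) : PB (fun a => g a * h a) := by
  obtain ⟨C, c, hC⟩ := hg
  obtain ⟨D, d, hD⟩ := hh
  refine ⟨C * D, c + d, fun a => ?_⟩
  calc g a * h a ≤ (C * SparseSim.esize a ^ c) * (D * SparseSim.esize a ^ d) :=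
        Nat.mul_le_mul (hC a) (hD a)
    _ = _ := by ring

theorem PB.pow {g : α → ℕ} (hg : PB g) (k : ℕ) : PB (fun a => g a ^ k) := by
  induction k with
  | zero => simpa using PB.const 1
  | succ k ih => simpa [pow_succ] using ih.mul hg

/-- A randomized function that is computed in polynomial time. -/
def RPT (f : α → PMF β) : Prop :=
  ∃ (A : Code) (g : α → ℕ), PB g ∧ ∀ a, Run A (enc a) (g a) ((f a).map enc)

/-- A function that is computed in polynomial time. -/
@[fun_prop] def PT (f : α → β) : Prop :=
  ∃ (A : Code) (g : α → ℕ), PB g ∧ ∀ a, Run A (enc a) (g a) (PMF.pure (enc (f a)))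

theorem PT.rpt {f : α → β} (h : PT f) : RPT (fun a => PMF.pure (f a)) := by
  obtain ⟨A, g, hg, h⟩ := h
  exact ⟨A, g, hg, fun a => by rw [PMF.pure_map]; exact h a⟩

theorem RPT.pt {f : α → β} (h : RPT (fun a => PMF.pure (f a))) : PT f := by
  obtain ⟨A, g, hg, h⟩ := h
  exact ⟨A, g, hg, fun a => by rw [← PMF.pure_map]; exact h a⟩

/-- Polynomial time forces polynomial output size through `Run.size_le`. This makes polynomial
bounds composable. -/
theorem RPT.esize_le {f : α → PMF β} (h : RPT f) :
    ∃ B : α → ℕ, PB B ∧ ∀ a, ∀ b ∈ (f a).support, esize b ≤ B a := by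
  obtain ⟨A, g, hg, h⟩ := h
  refine ⟨fun a => esize a + 2 * g a, PB.esize.add ((PB.const 2).mul hg), fun a b hb => ?_⟩
  refine (h a).size_le ?_
  rw [PMF.mem_support_map_iff]
  exact ⟨b, hb, rfl⟩

theorem PT.esize_le {f : α → β} (h : PT f) : PB (fun a => esize (f a)) := by
  obtain ⟨B, hB, h⟩ := h.rpt.esize_le
  exact hB.mono fun a => h a _ (by simp)

theorem PB.comp {g : β → ℕ} (hg : PB g) {f : α → β} (hf : PT f) : PB (fun a => g (f a)) := by
  obtain ⟨C, c, hC⟩ := hg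
  exact ((PB.const C).mul (hf.esize_le.pow c)).mono fun a => hC _

/-- A function whose value has the same encoding as the argument. -/
theorem PT.of_enc_eq {f : α → β} (h : ∀ a, enc (f a) = enc a) : PT f :=
  ⟨.id, fun a => esize a, PB.esize, fun a => by rw [h]; exact run_id _⟩

@[fun_prop] theorem PT.id : PT (fun a : α => a) := PT.of_enc_eq fun _ => rfl

theorem RPT.comp {f : β → PMF γ} (hf : RPT f) {g : α → β} (hg : PT g) :
    RPT (fun a => f (g a)) := by
  obtain ⟨A, p, hp, hA⟩ := hg
  obtain ⟨B, q, hq, hB⟩ := hf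
  refine ⟨.seq A B, fun a => p a + q (g a), hp.add (hq.comp ⟨A, p, hp, hA⟩), fun a => ?_⟩
  exact (hA a).seq_pure (hB (g a))

@[fun_prop] theorem PT.comp {f : β → γ} (hf : PT f) {g : α → β} (hg : PT g) :
    PT (fun a => f (g a)) := (hf.rpt.comp hg).pt

theorem RPT.pair_right {f : α → β} (hf : PT f) {g : α → PMF γ} (hg : RPT g) :
    RPT (fun a => (g a).map fun c => (f a, c)) := by
  obtain ⟨A, p, hp, hA⟩ := hf
  obtain ⟨B, q, hq, hB⟩ := hg
  refine ⟨.both A B, fun a => p a + (q a + esize a), hp.add (hq.add PB.esize), fun a => ?_⟩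
  rw [PMF.map_comp]
  exact (hA a).pure_both (hB a)

@[fun_prop] theorem PT.prodMk {f : α → β} (hf : PT f) {g : α → γ} (hg : PT g) :
    PT (fun a => (f a, g a)) := by
  refine RPT.pt ?_
  have := RPT.pair_right hf hg.rpt
  simpa only [PMF.pure_map] using this

theorem exists_const_code (v : Data) :
    ∃ (A : Code) (k : ℕ), ∀ w : Data, Run A w (k * w.size) (PMF.pure v) := by
  induction v with
  | nat a =>
    refine ⟨.const a, 1 + Nat.size a, fun w => (run_const a w).mono ?_⟩
    have := w.one_le_size
    nlinarith
  | pair v w hv hw =>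
    obtain ⟨A, k, hA⟩ := hv
    obtain ⟨B, l, hB⟩ := hw
    exact ⟨.both A B, k + (l + 1), fun u => ((hA u).both_pure (hB u)).mono (by
      rw [add_mul, add_mul, one_mul])⟩

@[fun_prop] theorem PT.const (b : β) : PT (fun _ : α => b) := by
  obtain ⟨A, k, hA⟩ := exists_const_code (enc b)
  exact ⟨A, fun a => k * esize a, (PB.const k).mul PB.esize, fun a => hA _⟩

@[fun_prop] theorem PT.fst {f : α → β × γ} (hf : PT f) : PT (fun a => (f a).1) :=
  PT.comp (f := Prod.fst) ⟨.fst, _, PB.esize, fun _ => run_fst _⟩ hf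

@[fun_prop] theorem PT.snd {f : α → β × γ} (hf : PT f) : PT (fun a => (f a).2) :=
  PT.comp (f := Prod.snd) ⟨.snd, _, PB.esize, fun _ => run_snd _⟩ hf

@[fun_prop] theorem PT.natAdd {f g : α → ℕ} (hf : PT f) (hg : PT g) :
    PT (fun a => f a + g a) :=
  PT.comp (f := fun p : ℕ × ℕ => p.1 + p.2) ⟨.add, _, PB.esize, fun _ => run_add _⟩
    (hf.prodMk hg)

@[fun_prop] theorem PT.natSub {f g : α → ℕ} (hf : PT f) (hg : PT g) :
    PT (fun a => f a - g a) :=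
  PT.comp (f := fun p : ℕ × ℕ => p.1 - p.2) ⟨.sub, _, PB.esize, fun _ => run_sub _⟩
    (hf.prodMk hg)

@[fun_prop] theorem PT.natMul {f g : α → ℕ} (hf : PT f) (hg : PT g) :
    PT (fun a => f a * g a) :=
  PT.comp (f := fun p : ℕ × ℕ => p.1 * p.2) ⟨.mul, _, PB.esize.pow 2, fun _ => run_mul _⟩
    (hf.prodMk hg)

@[fun_prop] theorem PT.natDiv {f g : α → ℕ} (hf : PT f) (hg : PT g) :
    PT (fun a => f a / g a) :=
  PT.comp (f := fun p : ℕ × ℕ => p.1 / p.2) ⟨.div, _, PB.esize.pow 2, fun _ => run_div _⟩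
    (hf.prodMk hg)

theorem RPT.coin : RPT (fun _ : α => PMF.uniformOfFintype Bool) :=
  ⟨.coin, _, PB.esize, fun _ => run_coin _⟩

/-- The second stage may rely on its argument being a possible result of the first. This matters
when that stage is efficient only on meaningful data, such as lists that are digits of a basis
label. -/
theorem RPT.bind_of_mem {f : α → PMF β} (hf : RPT f) {g : α → β → PMF γ}
    (hg : RPT (fun p : {p : α × β // p.2 ∈ (f p.1).support} => g p.1.1 p.1.2)) :
    RPT (fun a => (f a).bind (g a)) := by
  obtain ⟨bd, hbd, hle⟩ := hf.esize_le
  obtain ⟨A, p, hp, hA⟩ := RPT.pair_right PT.id hf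
  obtain ⟨B, q, ⟨C, c, hC⟩, hB⟩ := hg
  refine ⟨.seq A B, fun a => p a + C * (esize a + bd a + 1) ^ c,
    hp.add ((PB.const C).mul (((PB.esize.add hbd).add (PB.const 1)).pow c)), fun a => ?_⟩
  have h1 := (hA a)
  rw [PMF.map_comp] at h1
  rw [PMF.map_bind]
  refine h1.seq_map fun b hb => ?_
  refine (hB ⟨(a, b), hb⟩).mono ((hC _).trans ?_)
  gcongr
  have := hle a b hb
  change esize (a, b) ≤ _
  simp; omega

theorem PT.subtype_val {P : α → Prop} : PT (fun a : {a // P a} => a.1) :=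
  PT.of_enc_eq fun _ => rfl

theorem RPT.bind {f : α → PMF β} (hf : RPT f) {g : α → β → PMF γ}
    (hg : RPT (fun p : α × β => g p.1 p.2)) : RPT (fun a => (f a).bind (g a)) :=
  hf.bind_of_mem (hg.comp PT.subtype_val)

theorem RPT.map {f : α → PMF β} (hf : RPT f) {g : α → β → γ}
    (hg : PT (fun p : α × β => g p.1 p.2)) : RPT (fun a => (f a).map (g a)) :=
  hf.bind hg.rpt

theorem RPT.cond {b : α → Bool} (hb : PT b) {f g : α → PMF β} (hf : RPT f) (hg : RPT g) :
    RPT (fun a => if b a = true then f a else g a) := by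
  obtain ⟨A, p, hp, hA⟩ := hb
  obtain ⟨B, q, hq, hB⟩ := hf
  obtain ⟨C, r, hr, hC⟩ := hg
  refine ⟨.ite A B C, fun a => p a + (q a + r a), hp.add (hq.add hr), fun a => ?_⟩
  refine (hA a).ite (fun h => ?_) (fun h => ?_)
  · cases h' : b a
    · simp [h', enc, Data.bool, Data.isZero] at h
    · simpa [h'] using (hB a).mono (Nat.le_add_right (q a) (r a))
  · cases h' : b a
    · simpa [h'] using (hC a).mono (Nat.le_add_left (r a) (q a))
    · simp [h', enc, Data.bool, Data.isZero] at h

@[fun_prop] theorem PT.ite {P : α → Prop} [DecidablePred P] (hP : PT (fun a => decide (P a)))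
    {f g : α → β} (hf : PT f) (hg : PT g) : PT (fun a => if P a then f a else g a) := by
  refine RPT.pt ?_
  have := RPT.cond hP hf.rpt hg.rpt
  refine (congrArg RPT ?_).mp this
  funext a
  by_cases h : P a <;> simp [h]

theorem RPT.ite {P : α → Prop} [DecidablePred P] (hP : PT (fun a => decide (P a)))
    {f g : α → PMF β} (hf : RPT f) (hg : RPT g) : RPT (fun a => if P a then f a else g a) := by
  have := RPT.cond hP hf hg
  simpa using this

/-- Test whether a number is not zero. -/
theorem PT.ne_zero {f : α → ℕ} (hf : PT f) : PT (fun a => decide (f a ≠ 0)) := by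
  obtain ⟨A, p, hp, hA⟩ := hf
  refine ⟨.ite A (.const 1) (.const 0), fun a => p a + (esize a + 1), hp.add
    (PB.esize.add (PB.const 1)), fun a => ?_⟩
  refine (hA a).ite (fun h => ?_) (fun h => ?_)
  · have : f a ≠ 0 := by simpa [enc, Data.isZero] using h
    simpa [this, enc, Data.bool, esize] using run_const 1 (enc a)
  · have : f a = 0 := by simpa [enc, Data.isZero] using h
    simpa [this, enc, Data.bool] using (run_const 0 (enc a)).mono (by simp [esize])

@[fun_prop] theorem PT.decide_le {f g : α → ℕ} (hf : PT f) (hg : PT g) :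
    PT (fun a => decide (f a ≤ g a)) := by
  -- With truncated subtraction, f ≤ g is the same as g + 1 - f ≠ 0.
  have := PT.ne_zero ((hg.natAdd (PT.const 1)).natSub hf)
  refine (congrArg PT ?_).mp this
  funext a
  congr 1
  simp only [ne_eq, eq_iff_iff]
  omega

@[fun_prop] theorem PT.decide_lt {f g : α → ℕ} (hf : PT f) (hg : PT g) :
    PT (fun a => decide (f a < g a)) := PT.decide_le (hf.natAdd (PT.const 1)) hg

@[fun_prop] theorem PT.decide_bool {f : α → Bool} (hf : PT f) :
    PT (fun a => decide (f a = true)) := by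
  simpa using hf

@[fun_prop] theorem PT.not {f : α → Bool} (hf : PT f) : PT (fun a => !(f a)) := by
  have := PT.ite (P := fun a => f a = true) (by fun_prop) (PT.const (α := α) false)
    (PT.const (α := α) true)
  refine (congrArg PT ?_).mp this
  funext a
  cases f a <;> rfl

@[fun_prop] theorem PT.and {f g : α → Bool} (hf : PT f) (hg : PT g) :
    PT (fun a => f a && g a) := by
  have := PT.ite (P := fun a => f a = true) (by fun_prop) hg (PT.const (α := α) false)
  refine (congrArg PT ?_).mp this
  funext a
  cases f a <;> simp

@[fun_prop] theorem PT.decide_eq {f g : α → ℕ} (hf : PT f) (hg : PT g) :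
    PT (fun a => decide (f a = g a)) := by
  have := PT.and (PT.decide_le hf hg) (PT.decide_le hg hf)
  refine (congrArg PT ?_).mp this
  funext a
  rw [← Bool.decide_and]
  congr 1
  simp only [eq_iff_iff]
  omega

@[fun_prop] theorem PT.decide_not {P : α → Prop} [DecidablePred P]
    (hP : PT (fun a => decide (P a))) : PT (fun a => decide (¬ P a)) := by
  have := PT.not hP
  simpa using this

@[fun_prop] theorem PT.cons {f : α → β} (hf : PT f) {l : α → List β} (hl : PT l) :
    PT (fun a => f a :: l a) :=
  PT.comp (f := fun p : β × List β => p.1 :: p.2) (PT.of_enc_eq fun _ => rfl) (hf.prodMk hl)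

@[fun_prop] theorem PT.tail {l : α → List β} (hl : PT l) : PT (fun a => (l a).tail) :=
  PT.comp (f := fun p : List β => p.tail) ⟨.snd, _, PB.esize, fun a => by
    refine (run_snd _).congr rfl le_rfl ?_
    cases a <;> rfl⟩ hl

@[fun_prop] theorem PT.isEmpty {l : α → List β} (hl : PT l) : PT (fun a => (l a).isEmpty) :=
  PT.comp (f := fun p : List β => p.isEmpty) ⟨.ite .id (.const 0) (.const 1),
    fun a => esize a + (esize a + 1), PB.esize.add (PB.esize.add (PB.const 1)), fun a => by
    refine (run_id _).ite (fun h => ?_) (fun h => ?_)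
    · cases a with
      | nil => simp [enc, Data.list, Data.isZero] at h
      | cons b l => exact (run_const 0 _).mono (by simp [esize])
    · cases a with
      | nil => exact (run_const 1 _).mono (by simp [esize])
      | cons b l => simp [enc, Data.list, Data.isZero] at h⟩ hl

@[fun_prop] theorem PT.headD {l : α → List β} (hl : PT l) {f : α → β} (hf : PT f) :
    PT (fun a => (l a).headD (f a)) := by
  refine PT.comp (f := fun p : List β × β => p.1.headD p.2) ⟨.ite .fst (.seq .fst .fst) .snd,
    fun a => esize a + (esize a + esize a), PB.esize.add (PB.esize.add PB.esize), ?_⟩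
    (hl.prodMk hf)
  rintro ⟨l, b⟩
  refine (run_fst _).ite (fun h => ?_) (fun h => ?_)
  · cases l with
    | nil => simp [enc, Data.list, Data.isZero, Data.fst] at h
    | cons b' l =>
      refine ((run_fst _).seq_pure (run_fst _)).mono ?_
      gcongr
      · rfl
      · exact fst_size_le _
  · cases l with
    | nil => exact (run_snd _).mono (by simp [esize])
    | cons b' l => simp [enc, Data.list, Data.isZero, Data.fst] at h

end PT

end SparseSim

end

/-! ### Folds, maps and list operations in polynomial time -/

noncomputable section

namespace SparseSim

open Enc

theorem pmf_map_id' {α : Type*} (p : PMF α) : p.map (fun a => a) = p := PMF.map_id p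

/-- Left fold with a randomized step. -/
def pfold {β γ : Type*} (F : β → γ → PMF γ) : List β → γ → PMF γ
  | [], c => PMF.pure c
  | b :: l, c => (F b c).bind (pfold F l)

/-- Apply a randomized function to all members of a list, with independent coins. -/
def mapP {β γ : Type*} (f : β → PMF γ) : List β → PMF (List γ)
  | [] => PMF.pure []
  | b :: l => (f b).bind fun c => (mapP f l).map fun r => c :: r

theorem pfold_pure {β γ : Type*} (F : β → γ → γ) (l : List β) (c : γ) :
    pfold (fun b c => PMF.pure (F b c)) l c = PMF.pure (l.foldl (fun c b => F b c) c) := by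
  induction l generalizing c with
  | nil => rfl
  | cons b l ih => simp [pfold, ih]

theorem mapP_pure {β γ : Type*} (f : β → γ) (l : List β) :
    mapP (fun b => PMF.pure (f b)) l = PMF.pure (l.map f) := by
  induction l with
  | nil => rfl
  | cons b l ih => simp [mapP, ih, PMF.pure_map]

theorem pfold_cons_eq_mapP {β γ : Type*} (f : β → PMF γ) (l : List β) (acc : List γ) :
    pfold (fun b acc => (f b).map fun c => c :: acc) l acc =
      (mapP f l).map fun r => r.reverse ++ acc := by
  induction l generalizing acc with
  | nil => simp [pfold, mapP, PMF.pure_map]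
  | cons b l ih =>
    simp only [pfold, mapP, PMF.bind_map, PMF.map_bind, PMF.map_comp]
    congr 1
    funext c
    simp only [Function.comp, ih]
    congr 1
    funext r
    simp

theorem mem_support_mapP {β γ : Type*} {f : β → PMF γ} {l : List β} {r : List γ} :
    r ∈ (mapP f l).support ↔ List.Forall₂ (fun b c => c ∈ (f b).support) l r := by
  induction l generalizing r with
  | nil => simp [mapP]
  | cons b l ih =>
    simp only [mapP, PMF.mem_support_bind_iff, PMF.mem_support_map_iff, ih,
      List.forall₂_cons_left_iff]
    constructor
    · rintro ⟨c, hc, r', hr, rfl⟩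
      exact ⟨c, r', hc, hr, rfl⟩
    · rintro ⟨c, r', hc, hr, rfl⟩
      exact ⟨c, hc, r', hr, rfl⟩

section PT

variable {α β γ δ : Type*} [Enc α] [Enc β] [Enc γ] [Enc δ]

/-- Iterating a polynomial time step can make the accumulator grow exponentially. The invariant
excludes this: with all accumulators below a polynomial bound, each round has a uniform polynomial
cost and the number of rounds is the length of the list. -/
theorem RPT.pfold {F : α → β → γ → PMF γ} {l : α → List β} {init : α → γ}
    (hF : RPT (fun p : α × β × γ => F p.1 p.2.1 p.2.2)) (hl : PT l) (hi : PT init)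
    {B : α → ℕ} (hB : PB B) (Inv : α → ℕ → γ → Prop) (h0 : ∀ a, Inv a 0 (init a))
    (hstep : ∀ a i c (h : i < (l a).length), Inv a i c →
      ∀ c' ∈ (F a (l a)[i] c).support, Inv a (i + 1) c')
    (hsz : ∀ a i c, i ≤ (l a).length → Inv a i c → esize c ≤ B a) :
    RPT (fun a => pfold (F a) (l a) (init a)) := by
  -- The loop body runs only while the remaining list is nonempty, so no default element of β is
  -- needed.
  have hhead : PT (fun st : {st : List β × α × γ // st.1 ≠ []} => st.1.1.head st.2) := by
    refine ⟨.seq .fst .fst, fun a => esize a + esize a, PB.esize.add PB.esize, ?_⟩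
    rintro ⟨⟨l, a, c⟩, h⟩
    obtain ⟨b, l, rfl⟩ := List.exists_cons_of_ne_nil h
    exact ((run_fst _).seq_pure (run_fst _)).mono (Nat.add_le_add le_rfl (fst_size_le _))
  have hv := PT.subtype_val (α := List β × α × γ) (P := fun st => st.1 ≠ [])
  have hbody : RPT (fun st : {st : List β × α × γ // st.1 ≠ []} =>
      (F st.1.2.1 (st.1.1.head st.2) st.1.2.2).map fun c' => (st.1.1.tail, st.1.2.1, c')) := by
    refine RPT.map (hF.comp ((PT.fst (PT.snd hv)).prodMk (hhead.prodMk (PT.snd (PT.snd hv)))))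
      (g := fun (st : {st : List β × α × γ // st.1 ≠ []}) c' => (st.1.1.tail, st.1.2.1, c')) ?_
    have := hv.comp (PT.fst (PT.id (α := {st : List β × α × γ // st.1 ≠ []} × γ)))
    fun_prop
  obtain ⟨A, g, ⟨C, k, hC⟩, hA⟩ := hbody
  obtain ⟨A₀, p, hp, hA₀⟩ := hl.prodMk ((PT.id (α := α)).prodMk hi)
  let S : α → ℕ := fun a => esize (l a) + esize a + B a + 2
  have hS : PB S := ((hl.esize_le.add PB.esize).add hB).add (PB.const 2)
  have key : ∀ a (l' : List β) i c, i + l'.length = (l a).length → l' = (l a).drop i →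
      Inv a i c → LoopRun A (enc (l', a, c)) ((l'.length + 1) * (S a + C * S a ^ k))
        ((SparseSim.pfold (F a) l' c).map fun c' => enc (([] : List β), a, c')) := by
    intro a l'
    induction l' with
    | nil =>
      intro i c hi _ hc
      simp only [SparseSim.pfold, PMF.pure_map]
      refine (loopRun_stop rfl).mono ?_
      have := hsz a i c (by simp at hi; omega) hc
      have h1 : esize (([] : List β), a, c) ≤ S a := by
        have := one_le_esize (l a)
        simp [S]; omega
      simp only [List.length_nil, zero_add, one_mul]
      exact h1.trans (Nat.le_add_right _ _)
    | cons b l' ih =>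
      intro i c hi hd hc
      have hlt : i < (l a).length := by simp at hi; omega
      have hb : (l a)[i] = b ∧ l' = (l a).drop (i + 1) := by
        rw [List.drop_eq_getElem_cons hlt, List.cons_eq_cons] at hd
        exact ⟨hd.1.symm, hd.2⟩
      have hle : esize ((b :: l'), a, c) ≤ S a := by
        have h1 := hsz a i c hlt.le hc
        have h2 : esize (b :: l') ≤ esize (l a) := by
          rw [hd]
          have : ∀ (m : List β) j, esize (m.drop j) ≤ esize m := by
            intro m
            induction m with
            | nil => simp
            | cons x m ih =>
              intro j
              cases j with
              | zero => simp
              | succ j => have := ih j; simp; omega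
          exact this _ _
        rw [esize_pair, esize_pair]
        simp only [S]; omega
      have h1 := hA ⟨(b :: l', a, c), by simp⟩
      rw [PMF.map_comp] at h1
      simp only [SparseSim.pfold, PMF.map_bind]
      refine (LoopRun.step_map (T₂ := (l'.length + 1) * (S a + C * S a ^ k)) rfl h1 ?_).mono ?_
      · intro c' hc'
        exact ih (i + 1) c' (by simp at hi; omega) hb.2
          (hstep a i c hlt hc c' (by rw [hb.1]; exact hc'))
      · have h2 : g ⟨(b :: l', a, c), by simp⟩ ≤ C * S a ^ k :=
          (hC _).trans (by gcongr; exact hle)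
        have h3 : (enc (b :: l', a, c)).size ≤ S a := hle
        simp only [List.length_cons]
        calc _ ≤ S a + (C * S a ^ k + (l'.length + 1) * (S a + C * S a ^ k)) :=
              Nat.add_le_add h3 (Nat.add_le_add h2 le_rfl)
          _ = _ := by ring
  have hloop : RPT (fun a => (SparseSim.pfold (F a) (l a) (init a)).map fun c' =>
      (([] : List β), a, c')) := by
    refine ⟨.seq A₀ (.loop A), fun a => p a + (esize (l a) + 1) * (S a + C * S a ^ k),
      hp.add ((hl.esize_le.add (PB.const 1)).mul (hS.add ((PB.const C).mul (hS.pow k)))),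
      fun a => ?_⟩
    refine (hA₀ a).seq_pure ?_
    have h1 := (key a (l a) 0 (init a) (by simp) (by simp) (h0 a)).run
    rw [PMF.map_comp]
    refine h1.mono ?_
    gcongr
    exact (length_lt_esize _).le
  have := hloop.map (g := fun _ st => st.2.2) (by fun_prop)
  simpa [PMF.map_comp, Function.comp_def, pmf_map_id'] using this

theorem PT.foldl_inv {F : α → γ → β → γ} {l : α → List β} {init : α → γ}
    (hF : PT (fun p : α × β × γ => F p.1 p.2.2 p.2.1)) (hl : PT l) (hi : PT init)
    {B : α → ℕ} (hB : PB B) (Inv : α → ℕ → γ → Prop) (h0 : ∀ a, Inv a 0 (init a))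
    (hstep : ∀ a i c (h : i < (l a).length), Inv a i c → Inv a (i + 1) (F a c (l a)[i]))
    (hsz : ∀ a i c, i ≤ (l a).length → Inv a i c → esize c ≤ B a) :
    PT (fun a => (l a).foldl (F a) (init a)) := by
  refine RPT.pt ?_
  have := RPT.pfold (F := fun a b c => PMF.pure (F a c b)) hF.rpt hl hi hB Inv h0
    (by intro a i c h hc c' hc'; simp at hc'; subst hc'; exact hstep a i c h hc) hsz
  simpa only [pfold_pure] using this

/-- The most frequent case of the fold rule: a step that enlarges the accumulator by a bounded
amount gives linear growth in the number of rounds. -/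
theorem PT.foldl_add {F : α → γ → β → γ} {l : α → List β} {init : α → γ}
    (hF : PT (fun p : α × β × γ => F p.1 p.2.2 p.2.1)) (hl : PT l) (hi : PT init)
    {g : α → ℕ} (hg : PB g) (h : ∀ a, ∀ b ∈ l a, ∀ c, esize (F a c b) ≤ esize c + g a) :
    PT (fun a => (l a).foldl (F a) (init a)) := by
  refine PT.foldl_inv hF hl hi (B := fun a => esize (init a) + esize (l a) * g a)
    (hi.esize_le.add (hl.esize_le.mul hg)) (fun a i c => esize c ≤ esize (init a) + i * g a)
    (by simp) ?_ ?_
  · intro a i c hi hc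
    have := h a _ (List.getElem_mem hi) c
    rw [add_mul]; omega
  · intro a i c hi hc
    refine hc.trans ?_
    gcongr
    exact hi.trans (length_lt_esize _).le

@[fun_prop] theorem PT.reverse {l : α → List β} (hl : PT l) : PT (fun a => (l a).reverse) := by
  have : PT (fun a => (l a).foldl (fun c b => b :: c) []) :=
    PT.foldl_add (F := fun _ c b => b :: c) (by fun_prop) hl (PT.const [])
      (hl.esize_le.add (PB.const 1)) (by
        intro a b hb c
        have := esize_mem_le hb
        simp; omega)
  simpa using this

/-- Independent evaluations are a fold that pushes the results onto an accumulator, followed by a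
reversal (`pfold_cons_eq_mapP`). -/
theorem RPT.mapP {f : α → β → PMF γ} (hf : RPT (fun p : α × β => f p.1 p.2)) {l : α → List β}
    (hl : PT l) : RPT (fun a => mapP (f a) (l a)) := by
  obtain ⟨B, ⟨C, k, hC⟩, hB⟩ := hf.esize_le
  let g : α → ℕ := fun a => C * (esize a + esize (l a) + 1) ^ k + 1
  have hg : PB g := ((PB.const C).mul (((PB.esize.add hl.esize_le).add (PB.const 1)).pow k)).add
    (PB.const 1)
  have h1 : RPT (fun a => SparseSim.pfold (fun b acc => (f a b).map fun c => c :: acc) (l a) []) := by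
    refine RPT.pfold (F := fun a b acc => (f a b).map fun c => c :: acc)
      (B := fun a => 1 + esize (l a) * g a) ?_ hl (PT.const [])
      ((PB.const 1).add (hl.esize_le.mul hg)) (fun a i c => esize c ≤ 1 + i * g a) (by simp) ?_ ?_
    · exact RPT.map (hf.comp (g := fun p : α × β × List γ => (p.1, p.2.1)) (by fun_prop))
        (g := fun p c => c :: p.2.2) (by fun_prop)
    · intro a i c hi hc c' hc'
      rw [PMF.mem_support_map_iff] at hc'
      obtain ⟨b, hb, rfl⟩ := hc'
      have h2 : esize b ≤ C * (esize a + esize (l a) + 1) ^ k := by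
        refine ((hB (a, (l a)[i]) b hb).trans (hC _)).trans ?_
        gcongr
        have := esize_mem_le (List.getElem_mem hi)
        rw [esize_pair]; omega
      rw [esize_cons, add_mul]
      simp only [g] at hc ⊢
      omega
    · intro a i c hi hc
      refine hc.trans ?_
      gcongr
      exact hi.trans (length_lt_esize _).le
  simp only [pfold_cons_eq_mapP] at h1
  have := h1.map (g := fun _ r => r.reverse) (by fun_prop)
  simpa [PMF.map_comp, Function.comp_def, pmf_map_id', PMF.map_id] using this

@[fun_prop] theorem PT.map {f : α → β → γ} {l : α → List β}
    (hf : PT (fun p : α × β => f p.1 p.2)) (hl : PT l) : PT (fun a => (l a).map (f a)) := by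
  refine RPT.pt ?_
  simpa only [mapP_pure] using RPT.mapP (f := fun a b => PMF.pure (f a b)) hf.rpt hl

theorem esize_append (l m : List α) : esize (l ++ m) + 1 = esize l + esize m := by
  induction l with
  | nil => simp; omega
  | cons a l ih => simp; omega

@[fun_prop] theorem PT.append {l m : α → List β} (hl : PT l) (hm : PT m) :
    PT (fun a => l a ++ m a) := by
  have : PT (fun a => (l a).reverse.foldl (fun c b => b :: c) (m a)) :=
    PT.foldl_add (F := fun _ c b => b :: c) (by fun_prop) (by fun_prop) hm
      (hl.esize_le.add (PB.const 1)) (by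
        intro a b hb c
        have := esize_mem_le (List.mem_reverse.1 hb)
        simp; omega)
  simpa using this

@[fun_prop] theorem PT.flatten {l : α → List (List β)} (hl : PT l) :
    PT (fun a => (l a).flatten) := by
  have : PT (fun a => (l a).foldl (fun c b => c ++ b) []) :=
    PT.foldl_add (F := fun _ c b => c ++ b) (by fun_prop) (by fun_prop) (PT.const [])
      hl.esize_le (by
        intro a b hb c
        have := esize_mem_le hb
        have := esize_append c b
        omega)
  refine (congrArg PT ?_).mp this
  funext a
  have h1 : ∀ (l : List (List β)) c, l.foldl (fun c b => c ++ b) c = c ++ l.flatten := by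
    intro l
    induction l with
    | nil => simp
    | cons b l ih => intro c; simp [ih]
  simp [h1]

@[fun_prop] theorem PT.flatMap {f : α → β → List γ} {l : α → List β}
    (hf : PT (fun p : α × β => f p.1 p.2)) (hl : PT l) :
    PT (fun a => (l a).flatMap (f a)) := by
  simp only [List.flatMap_def]
  fun_prop

@[fun_prop] theorem PT.filter {f : α → β → Bool} {l : α → List β}
    (hf : PT (fun p : α × β => f p.1 p.2)) (hl : PT l) :
    PT (fun a => (l a).filter (f a)) := by
  have : PT (fun a => (l a).flatMap fun b => if f a b = true then [b] else []) := by fun_prop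
  refine (congrArg PT ?_).mp this
  funext a
  induction l a with
  | nil => rfl
  | cons b l ih => by_cases h : f a b = true <;> simp [h, ih]

@[fun_prop] theorem PT.sum {l : α → List ℕ} (hl : PT l) : PT (fun a => (l a).sum) := by
  have : PT (fun a => (l a).foldl (fun c b => c + b) 0) :=
    PT.foldl_add (F := fun _ c b => c + b) (by fun_prop) (by fun_prop) (PT.const 0)
      (hl.esize_le.add (PB.const 1)) (by
        intro a b hb c
        have := esize_mem_le hb
        have := nat_size_add_le c b
        simp only [esize_nat] at *
        omega)
  simpa [List.sum_eq_foldl] using this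

@[fun_prop] theorem PT.length {l : α → List β} (hl : PT l) : PT (fun a => (l a).length) := by
  have : PT (fun a => ((l a).map fun _ => 1).sum) := by fun_prop
  simpa using this

@[fun_prop] theorem PT.two_pow_length {l : α → List β} (hl : PT l) :
    PT (fun a => 2 ^ (l a).length) := by
  have : PT (fun a => (l a).foldl (fun c _ => 2 * c) 1) :=
    PT.foldl_add (F := fun _ c _ => 2 * c) (by fun_prop) (by fun_prop) (PT.const 1)
      (PB.const 2) (by
        intro a b hb c
        have := nat_size_mul_le 2 c
        simp only [esize_nat] at *
        have : Nat.size 2 = 2 := by decide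
        omega)
  refine (congrArg PT ?_).mp this
  funext a
  have : ∀ (l : List β) (c : ℕ), l.foldl (fun c _ => 2 * c) c = 2 ^ l.length * c := by
    intro l
    induction l with
    | nil => simp
    | cons b l ih => intro c; simp [ih, pow_succ]; ring
  simp [this]

@[fun_prop] theorem PT.boolToNat {f : α → Bool} (hf : PT f) : PT (fun a => (f a).toNat) :=
  PT.comp (f := Bool.toNat) (PT.of_enc_eq fun _ => rfl) hf

@[fun_prop] theorem PT.all {f : α → β → Bool} {l : α → List β}
    (hf : PT (fun p : α × β => f p.1 p.2)) (hl : PT l) : PT (fun a => (l a).all (f a)) := by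
  have : PT (fun a => ((l a).filter fun b => !(f a b)).isEmpty) := by fun_prop
  refine (congrArg PT ?_).mp this
  funext a
  induction l a with
  | nil => rfl
  | cons b l ih => cases h : f a b <;> simp_all

/-- The number with given binary digits, the most significant one first. -/
def ofBits (l : List Bool) : ℕ := l.foldl (fun c b => 2 * c + b.toNat) 0

@[fun_prop] theorem PT.ofBits {l : α → List Bool} (hl : PT l) : PT (fun a => ofBits (l a)) :=
  PT.foldl_add (F := fun _ c (b : Bool) => 2 * c + b.toNat) (by fun_prop) (by fun_prop) (PT.const 0)
      (PB.const 4) (by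
        intro a b hb c
        have h1 := nat_size_mul_le 2 c
        have h2 := nat_size_add_le (2 * c) b.toNat
        have h3 : Nat.size 2 = 2 := by decide
        have h4 : Nat.size b.toNat ≤ 1 := by cases b <;> simp
        simp only [esize_nat] at *
        omega)

@[fun_prop] theorem PT.zip [Inhabited γ] {l : α → List β} {m : α → List γ} (hl : PT l)
    (hm : PT m) : PT (fun a => (l a).zip (m a)) := by
  -- The guard stops the pairing at the end of the second list; the default element is never used.
  let F : List γ × List (β × γ) → β → List γ × List (β × γ) := fun c b =>
    if c.1.isEmpty = true then c else (c.1.tail, (b, c.1.headD default) :: c.2)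
  have h1 : PT (fun a => (l a).foldl F (m a, [])) := by
    refine PT.foldl_add (F := fun _ => F) (by unfold F; fun_prop) hl (by fun_prop)
      (hl.esize_le.add (PB.const 2)) ?_
    rintro a b hb ⟨_ | ⟨x, c⟩, d⟩
    · simp [F]
    · have := esize_mem_le hb
      simp [F]
      omega
  have h2 : ∀ (l : List β) (m : List γ) acc, ((l.foldl F (m, acc)).2).reverse =
      acc.reverse ++ l.zip m := by
    intro l
    induction l with
    | nil => simp
    | cons b l ih =>
      intro m acc
      cases m with
      | nil =>
        have := ih [] acc
        simp [F] at this ⊢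
        exact this
      | cons x m =>
        have := ih m ((b, x) :: acc)
        simp [F] at this ⊢
        exact this
  have h3 : PT (fun a => ((l a).foldl F (m a, [])).2.reverse) := by fun_prop
  simpa [h2] using h3

@[fun_prop] theorem PT.zipIdx {l : α → List β} (hl : PT l) : PT (fun a => (l a).zipIdx) := by
  have h1 : PT (fun a => (l a).foldl (fun c b => (c.1 + 1, (b, c.1) :: c.2))
      ((0 : ℕ), ([] : List (β × ℕ)))) := by
    refine PT.foldl_inv (F := fun _ c b => (c.1 + 1, (b, c.1) :: c.2)) (by fun_prop) hl
      (by fun_prop) (B := fun a => (esize (l a) + 1) + esize (l a) * (2 * esize (l a) + 3) + 2)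
      (((hl.esize_le.add (PB.const 1)).add (hl.esize_le.mul
      (((PB.const 2).mul hl.esize_le).add (PB.const 3)))).add (PB.const 2))
      (fun a i c => c.1 = i ∧ esize c.2 ≤ 1 + i * (2 * esize (l a) + 3)) (by simp) ?_ ?_
    · rintro a i ⟨n, c⟩ hi ⟨rfl, hc⟩
      refine ⟨rfl, ?_⟩
      have h1 := esize_mem_le (List.getElem_mem hi)
      have h2 := length_lt_esize (l a)
      have h3 : Nat.size n ≤ n := Nat.size_le.2 (Nat.lt_two_pow_self)
      simp only [esize_cons, esize_pair, esize_nat] at *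
      rw [add_mul]
      omega
    · rintro a i ⟨n, c⟩ hi ⟨rfl, hc⟩
      have h3 : Nat.size n ≤ n := Nat.size_le.2 (Nat.lt_two_pow_self)
      have h2 := length_lt_esize (l a)
      simp only [esize_pair, esize_nat] at *
      have : n * (2 * esize (l a) + 3) ≤ esize (l a) * (2 * esize (l a) + 3) := by
        gcongr; omega
      omega
  have h2 : ∀ (l : List β) n acc, (l.foldl (fun c b => (c.1 + 1, (b, c.1) :: c.2))
      ((n : ℕ), (acc : List (β × ℕ)))).2.reverse = acc.reverse ++ l.zipIdx n := by
    intro l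
    induction l with
    | nil => simp
    | cons b l ih => intro n acc; simp [ih]
  have h3 : PT (fun a => ((l a).foldl (fun c b => (c.1 + 1, (b, c.1) :: c.2))
      ((0 : ℕ), ([] : List (β × ℕ)))).2.reverse) := by fun_prop
  simpa [h2] using h3

/-- The number of binary digits, in unary. -/
theorem PT.sizeList : PT (fun n : ℕ => List.replicate (Nat.size n) ()) := by
  -- Each round halves the number, so the rounds count its binary digits. Plain counting down would
  -- be exponential in the input size.
  have hbody : PT (fun p : ℕ × List Unit => (p.1 / 2, () :: p.2)) := by fun_prop
  obtain ⟨A, g, ⟨C, k, hC⟩, hA⟩ := hbody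
  have hun : ∀ j : ℕ, esize (List.replicate j ()) = 2 * j + 1 := by
    intro j
    induction j with
    | zero => simp
    | succ j ih =>
      rw [List.replicate_succ, esize_cons, ih]
      simp [esize, enc, Data.size]; omega
  have key : ∀ s n j : ℕ, Nat.size n + j ≤ s → LoopRun A (enc (n, List.replicate j ()))
      ((Nat.size n + 1) * ((3 * s + 9) + C * (3 * s + 9) ^ k))
      (PMF.pure (enc ((0 : ℕ), List.replicate (Nat.size n + j) ()))) := by
    intro s n
    induction n using Nat.strong_induction_on with
    | _ n ih =>
      intro j hn
      have h5 : esize (n, List.replicate j ()) ≤ 3 * s + 9 := by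
        rw [esize_pair, esize_nat, hun]; omega
      rcases Nat.eq_zero_or_pos n with rfl | hpos
      · have := (loopRun_stop (f := A) (v := enc ((0 : ℕ), List.replicate j ())) rfl).mono
          (T' := (Nat.size 0 + 1) * ((3 * s + 9) + C * (3 * s + 9) ^ k)) (by
            simp only [Nat.size_zero, zero_add, one_mul]
            exact h5.trans (Nat.le_add_right _ _))
        simpa using this
      · have hs : Nat.size (n / 2) + 1 = Nat.size n := by
          have h4 : 0 < Nat.size n := Nat.size_pos.2 hpos
          refine le_antisymm ?_ ?_
          · have h2 : n / 2 < 2 ^ (Nat.size n - 1) := by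
              have h3 := Nat.lt_size_self n
              obtain ⟨m, hm⟩ : ∃ m, Nat.size n = m + 1 := ⟨Nat.size n - 1, by omega⟩
              rw [hm] at h3 ⊢
              rw [pow_succ] at h3
              simp; omega
            have := Nat.size_le.2 h2
            omega
          · rw [Nat.size_le, pow_succ]
            have := Nat.lt_size_self (n / 2)
            omega
        have h1 := ih (n / 2) (Nat.div_lt_self hpos (by norm_num)) (j + 1) (by omega)
        rw [hs, show Nat.size (n / 2) + (j + 1) = Nat.size n + j by omega] at h1
        have h3 : (enc (n, List.replicate j ())).fst.isZero = false := by
          simp [enc, Data.fst, Data.isZero]; omega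
        have h4 := LoopRun.step h3 (hA (n, List.replicate j ())) (κ := fun _ =>
          PMF.pure (enc ((0 : ℕ), List.replicate (Nat.size n + j) ()))) (by
            intro w hw
            simp only [PMF.mem_support_pure_iff] at hw
            subst hw
            exact h1)
        rw [PMF.pure_bind] at h4
        refine h4.mono ?_
        have h6 : g (n, List.replicate j ()) ≤ C * (3 * s + 9) ^ k :=
          (hC _).trans (by gcongr)
        calc _ ≤ (3 * s + 9) + (C * (3 * s + 9) ^ k +
              Nat.size n * ((3 * s + 9) + C * (3 * s + 9) ^ k)) :=
              Nat.add_le_add h5 (Nat.add_le_add h6 le_rfl)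
          _ = _ := by ring
  obtain ⟨A₀, p, hp, hA₀⟩ := (PT.id (α := ℕ)).prodMk (PT.const (α := ℕ) ([] : List Unit))
  have h1 : PT (fun n : ℕ => ((0 : ℕ), List.replicate (Nat.size n) ())) := by
    refine ⟨.seq A₀ (.loop A), fun n => p n + esize n * ((3 * esize n + 9) +
      C * (3 * esize n + 9) ^ k), hp.add (PB.esize.mul ?_), fun n => ?_⟩
    · have h2 : PB (fun n : ℕ => 3 * esize n + 9) := ((PB.const 3).mul PB.esize).add (PB.const 9)
      exact h2.add ((PB.const C).mul (h2.pow k))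
    · have h2 := (key (esize n) n 0 (by rw [esize_nat]; omega)).run
      exact (hA₀ n).seq_pure h2
  exact h1.snd

end PT

end SparseSim

end

noncomputable section

namespace SparseSim

open Enc

section PT

variable {α β γ δ : Type*} [Enc α] [Enc β] [Enc γ] [Enc δ]

/-! ### Integers and Gaussian integers -/

@[fun_prop] theorem PT.intToNat {f : α → ℤ} (hf : PT f) : PT (fun a => (f a).toNat) := by
  -- Applied to sign bit and absolute value, this gives |z| for sign bit 0 and 0 for sign bit 1.
  have h1 : PT (fun p : ℕ × ℕ => p.2 - p.1 * p.2) := by fun_prop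
  refine PT.comp (f := Int.toNat) ?_ hf
  obtain ⟨A, g, hg, hA⟩ := h1
  obtain ⟨C, k, hC⟩ := hg
  refine ⟨A, fun z => C * esize z ^ k, ⟨C, k, fun z => le_rfl⟩, fun z => ?_⟩
  have h2 := hA (if z < 0 then 1 else 0, z.natAbs)
  refine (h2.mono (hC _)).congr rfl le_rfl ?_
  congr 2
  by_cases hz : z < 0 <;> simp [hz] <;> omega

@[fun_prop] theorem PT.intSubNat {f g : α → ℕ} (hf : PT f) (hg : PT g) :
    PT (fun a => (f a : ℤ) - (g a : ℤ)) := by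
  -- One of the two truncated differences vanishes, so their sum is the absolute value.
  have h1 : PT (fun a => ((if f a < g a then 1 else 0 : ℕ), (f a - g a) + (g a - f a))) := by
    fun_prop
  obtain ⟨A, p, hp, hA⟩ := h1
  refine ⟨A, p, hp, fun a => (hA a).congr rfl le_rfl ?_⟩
  congr 1
  simp only [enc, Data.int]
  congr 2
  · by_cases h : f a < g a
    · simp [h]
    · simp [h]
  · omega

@[fun_prop] theorem PT.intNeg {f : α → ℤ} (hf : PT f) : PT (fun a => -f a) := by
  have h1 : PT (fun z : ℤ => (if z < 0 then 1 else 0 : ℕ)) :=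
    ⟨.fst, _, PB.esize, fun _ => run_fst _⟩
  have h2 : PT (fun z : ℤ => z.natAbs) := ⟨.snd, _, PB.esize, fun _ => run_snd _⟩
  have h3 : PT (fun z : ℤ => ((z.natAbs - z.toNat : ℕ) : ℤ) - (z.toNat : ℤ)) := by fun_prop
  refine PT.comp (f := fun z => -z) ?_ hf
  refine (congrArg PT ?_).mp h3
  funext z
  omega

@[fun_prop] theorem PT.intAdd {f g : α → ℤ} (hf : PT f) (hg : PT g) :
    PT (fun a => f a + g a) := by
  have h1 : PT (fun a => (((f a).toNat + (g a).toNat : ℕ) : ℤ) -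
    (((-f a).toNat + (-g a).toNat : ℕ) : ℤ)) := by fun_prop
  refine (congrArg PT ?_).mp h1
  funext a
  omega

@[fun_prop] theorem PT.intMul {f g : α → ℤ} (hf : PT f) (hg : PT g) :
    PT (fun a => f a * g a) := by
  -- Both factors are split into positive and negative parts, so that only natural numbers are
  -- multiplied.
  have h1 : PT (fun a => (((f a).toNat * (g a).toNat + (-f a).toNat * (-g a).toNat : ℕ) : ℤ) -
    (((f a).toNat * (-g a).toNat + (-f a).toNat * (g a).toNat : ℕ) : ℤ)) := by fun_prop
  refine (congrArg PT ?_).mp h1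
  funext a
  have hx : f a = (f a).toNat - (-f a).toNat := by omega
  have hy : g a = (g a).toNat - (-g a).toNat := by omega
  conv_rhs => rw [hx, hy]
  push_cast
  ring

/-- Multiplication of Gaussian integers. -/
def gmul (z w : ℤ × ℤ) : ℤ × ℤ := (z.1 * w.1 + -(z.2 * w.2), z.1 * w.2 + z.2 * w.1)

/-- Conjugation of Gaussian integers. -/
def gconj (z : ℤ × ℤ) : ℤ × ℤ := (z.1, -z.2)

/-- The absolute square of a Gaussian integer. -/
def gsq (z : ℤ × ℤ) : ℕ := (z.1 * z.1 + z.2 * z.2).toNat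

@[fun_prop] theorem PT.gmul {f g : α → ℤ × ℤ} (hf : PT f) (hg : PT g) :
    PT (fun a => gmul (f a) (g a)) := by unfold SparseSim.gmul; fun_prop

@[fun_prop] theorem PT.gadd {f g : α → ℤ × ℤ} (hf : PT f) (hg : PT g) :
    PT (fun a => f a + g a) := by
  have : PT (fun a => ((f a).1 + (g a).1, (f a).2 + (g a).2)) := by fun_prop
  exact this

@[fun_prop] theorem PT.gconj {f : α → ℤ × ℤ} (hf : PT f) :
    PT (fun a => gconj (f a)) := by unfold SparseSim.gconj; fun_prop

@[fun_prop] theorem PT.gsq {f : α → ℤ × ℤ} (hf : PT f) :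
    PT (fun a => gsq (f a)) := by unfold SparseSim.gsq; fun_prop

theorem gsq_cast (z : ℤ × ℤ) : (gsq z : ℤ) = z.1 * z.1 + z.2 * z.2 := by
  unfold gsq
  exact Int.toNat_of_nonneg (by nlinarith [mul_self_nonneg z.1, mul_self_nonneg z.2])

theorem gsq_gmul (z w : ℤ × ℤ) : gsq (gmul z w) = gsq z * gsq w := by
  zify
  rw [gsq_cast, gsq_cast, gsq_cast]
  simp only [gmul]
  ring

theorem esize_int (z : ℤ) : esize z ≤ Nat.size z.natAbs + 4 := by
  simp only [esize, enc, Data.int, Data.size]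
  have : Nat.size (if z < 0 then 1 else 0) ≤ 1 := by split_ifs <;> simp
  omega

theorem natAbs_le_esize (z : ℤ) : Nat.size z.natAbs ≤ esize z := by
  simp only [esize, enc, Data.int, Data.size]
  omega

theorem natAbs_le_gsq (z : ℤ × ℤ) : z.1.natAbs ≤ gsq z ∧ z.2.natAbs ≤ gsq z := by
  have h := gsq_cast z
  constructor
  · zify
    rw [h]
    nlinarith [Int.le_self_sq |z.1|, sq_abs z.1, mul_self_nonneg z.2]
  · zify
    rw [h]
    nlinarith [Int.le_self_sq |z.2|, sq_abs z.2, mul_self_nonneg z.1]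

theorem esize_gauss_le (z : ℤ × ℤ) : esize z ≤ 2 * Nat.size (gsq z) + 9 := by
  have h := natAbs_le_gsq z
  have h1 := esize_int z.1
  have h2 := esize_int z.2
  have h3 := Nat.size_le_size h.1
  have h4 := Nat.size_le_size h.2
  have : esize z = esize z.1 + esize z.2 + 1 := rfl
  omega

theorem size_gsq_le (z : ℤ × ℤ) : Nat.size (gsq z) ≤ 2 * esize z + 1 := by
  have h : gsq z = z.1.natAbs * z.1.natAbs + z.2.natAbs * z.2.natAbs := by
    zify
    rw [gsq_cast, abs_mul_abs_self, abs_mul_abs_self]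
  rw [h]
  have h1 := natAbs_le_esize z.1
  have h2 := natAbs_le_esize z.2
  have h3 := nat_size_mul_le z.1.natAbs z.1.natAbs
  have h4 := nat_size_mul_le z.2.natAbs z.2.natAbs
  have h5 := nat_size_add_le (z.1.natAbs * z.1.natAbs) (z.2.natAbs * z.2.natAbs)
  have : esize z = esize z.1 + esize z.2 + 1 := rfl
  omega

/-- The product of a list of Gaussian integers. -/
def gprod (l : List (ℤ × ℤ)) : ℤ × ℤ := l.foldl gmul (1, 0)

-- The absolute square is multiplicative, so its bit length grows additively along the product; it
-- controls the size of the partial products.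
@[fun_prop] theorem PT.gprod {l : α → List (ℤ × ℤ)} (hl : PT l) :
    PT (fun a => gprod (l a)) := by
  refine PT.foldl_inv (F := fun _ => SparseSim.gmul) (by fun_prop) hl (PT.const _)
    (B := fun a => 2 * (1 + esize (l a) * (2 * esize (l a) + 1)) + 9)
    (((PB.const 2).mul ((PB.const 1).add (hl.esize_le.mul (((PB.const 2).mul
      hl.esize_le).add (PB.const 1))))).add (PB.const 9))
    (fun a i c => Nat.size (SparseSim.gsq c) ≤ 1 + i * (2 * esize (l a) + 1)) ?_ ?_ ?_
  · intro a
    simp [SparseSim.gsq]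
  · intro a i c hi hc
    rw [gsq_gmul]
    have h1 := nat_size_mul_le (SparseSim.gsq c) (SparseSim.gsq (l a)[i])
    have h2 := size_gsq_le (l a)[i]
    have h3 := esize_mem_le (List.getElem_mem hi)
    rw [add_mul]
    omega
  · intro a i c hi hc
    refine (esize_gauss_le c).trans ?_
    have : i * (2 * esize (l a) + 1) ≤ esize (l a) * (2 * esize (l a) + 1) := by
      gcongr
      exact hi.trans (length_lt_esize _).le
    omega

/-- The sum of a list of Gaussian integers. -/
def gsum (l : List (ℤ × ℤ)) : ℤ × ℤ := l.foldl (fun c z => c + z) (0, 0)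

theorem esize_int_add (z w : ℤ) : esize (z + w) ≤ Nat.size z.natAbs + esize w + 5 := by
  have h1 := esize_int (z + w)
  have h2 := Nat.size_le_size (Int.natAbs_add_le z w)
  have h3 := nat_size_add_le z.natAbs w.natAbs
  have h4 := natAbs_le_esize w
  omega

@[fun_prop] theorem PT.gsum {l : α → List (ℤ × ℤ)} (hl : PT l) :
    PT (fun a => gsum (l a)) := by
  refine PT.foldl_add (F := fun _ c z => c + z) (by fun_prop) hl (PT.const _)
    (g := fun a => 10 + esize (l a)) ((PB.const 10).add hl.esize_le) ?_
  intro a b hb c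
  have h1 := esize_int_add c.1 b.1
  have h2 := esize_int_add c.2 b.2
  have h3 := natAbs_le_esize c.1
  have h4 := natAbs_le_esize c.2
  have h5 := esize_mem_le hb
  have h6 : esize (c + b) = esize (c.1 + b.1) + esize (c.2 + b.2) + 1 := rfl
  have h7 : esize c = esize c.1 + esize c.2 + 1 := rfl
  have h8 : esize b = esize b.1 + esize b.2 + 1 := rfl
  omega

/-! ### Random numbers and random choices -/

/-- Independent fair coins, one for every member of a list. -/
def coins {β : Type*} (l : List β) : PMF (List Bool) :=
  mapP (fun _ => PMF.uniformOfFintype Bool) l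

/-- A uniformly distributed number with as many digits as the list has members. -/
def rand {β : Type*} (l : List β) : PMF ℕ := (coins l).map ofBits

theorem RPT.rand {l : α → List β} (hl : PT l) : RPT (fun a => rand (l a)) :=
  (RPT.mapP RPT.coin hl).map (g := fun _ => SparseSim.ofBits) (by fun_prop)

/-- The member of a weighted list that is hit by the number `r`. -/
def pick {β : Type*} (dflt : β) : List (β × ℕ) → ℕ → β
  | [], _ => dflt
  | (b, w) :: l, r => if r < w then b else pick dflt l (r - w)

@[fun_prop] theorem PT.pick {d : α → β} {l : α → List (β × ℕ)} {r : α → ℕ} (hd : PT d)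
    (hl : PT l) (hr : PT r) : PT (fun a => pick (d a) (l a) (r a)) := by
  let F : ℕ × Bool × β → β × ℕ → ℕ × Bool × β := fun c b =>
    if c.2.1 = true then c else if c.1 < b.2 then (c.1, true, b.1) else (c.1 - b.2, c.2)
  have h0 : ∀ b : Bool, esize b ≤ 2 := by
    intro b
    cases b <;> simp [esize, enc, Data.bool, Data.size]
  have h1 : PT (fun a => (l a).foldl F (r a, false, d a)) := by
    refine PT.foldl_inv (F := fun _ => F) (by unfold F; fun_prop) hl (by fun_prop)
      (B := fun a => esize (r a) + (2 + (esize (d a) + esize (l a)) + 1) + 1)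
      ((hr.esize_le.add (((PB.const 2).add (hd.esize_le.add hl.esize_le)).add (PB.const 1))).add
        (PB.const 1))
      (fun a i c => esize c.1 ≤ esize (r a) ∧ esize c.2.2 ≤ esize (d a) + esize (l a)) ?_ ?_ ?_
    · intro a
      simp
    · rintro a i ⟨n, b, x⟩ hi ⟨h2, h3⟩
      simp only [F]
      have h4 := esize_mem_le (List.getElem_mem hi)
      have h5 : esize (l a)[i] = esize (l a)[i].1 + esize (l a)[i].2 + 1 := rfl
      split_ifs
      · exact ⟨h2, h3⟩
      · exact ⟨h2, by dsimp only; omega⟩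
      · refine ⟨?_, h3⟩
        refine le_trans ?_ h2
        have := Nat.size_le_size (Nat.sub_le n (l a)[i].2)
        simp only [esize_nat]
        omega
    · rintro a i ⟨n, b, x⟩ hi ⟨h2, h3⟩
      have := h0 b
      simp only [esize_pair] at *
      omega
  have h2 : ∀ (l : List (β × ℕ)) d r, (l.foldl F (r, false, d)).2.2 = SparseSim.pick d l r := by
    intro l d r
    have h3 : ∀ (l : List (β × ℕ)) c, c.2.1 = true → l.foldl F c = c := by
      intro l
      induction l with
      | nil => simp
      | cons b l ih =>
        intro c hc
        have : F c b = c := by simp only [F]; rw [if_pos hc]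
        rw [List.foldl_cons, this, ih c hc]
    induction l generalizing r with
    | nil => rfl
    | cons b l ih =>
      obtain ⟨b, w⟩ := b
      rw [List.foldl_cons, SparseSim.pick]
      by_cases hr : r < w
      · simp only [F, Bool.false_eq_true, if_false, hr, if_true]
        rw [h3 _ _ rfl]
      · simp only [F, Bool.false_eq_true, if_false, hr]
        exact ih _
  simpa [h2] using PT.snd (PT.snd h1)

/-- Rescale weights such that they sum up to `2 ^ M.length`. -/
def dyadic {β μ : Type*} (M : List μ) (l : List (β × ℕ)) : List (β × ℕ) :=
  let W := (l.map Prod.snd).sum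
  let l' := l.map fun p => (p.1, 2 ^ M.length * p.2 / W)
  -- Rounding down loses a remainder, which is given to the first member so that the total is exact.
  -- If all weights vanish, the divisions give 0 and the first member receives everything.
  let R := 2 ^ M.length - (l'.map Prod.snd).sum
  l'.zipIdx.map fun q => if q.2 = 0 then (q.1.1, q.1.2 + R) else q.1

@[fun_prop] theorem PT.dyadic {M : α → List γ} {l : α → List (β × ℕ)} (hM : PT M) (hl : PT l) :
    PT (fun a => dyadic (M a) (l a)) := by
  unfold SparseSim.dyadic
  fun_prop

/-- The first members of a list, as many as `M` has. -/
def cut {β μ : Type*} (M : List μ) (l : List β) : List β :=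
  (l.zip (M.map fun _ => ())).map Prod.fst

@[fun_prop] theorem PT.cut {M : α → List γ} {l : α → List β} (hM : PT M) (hl : PT l) :
    PT (fun a => cut (M a) (l a)) := by
  unfold SparseSim.cut
  fun_prop

theorem cut_eq_take {β μ : Type*} (M : List μ) (l : List β) : cut M l = l.take M.length := by
  unfold cut
  induction l generalizing M with
  | nil => simp
  | cons b l ih =>
    cases M with
    | nil => simp
    | cons x M =>
      have := ih M
      simp only [List.map_const'] at this
      simpa using this

end PT

end SparseSim

end

/-! ### The estimation and search algorithm -/

noncomputable section

namespace SparseSim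

open Enc

/-- The list of the digits of a basis label. -/
def digits {n : ℕ} {d : Fin n → ℕ} (x : Basis d) : List ℕ := List.ofFn fun k => (x k : ℕ)

theorem digits_injective {n : ℕ} {d : Fin n → ℕ} : Function.Injective (digits (d := d)) := by
  intro x y h
  funext k
  have := List.ofFn_injective h
  exact Fin.ext (congrFun this k)

theorem encBasis_eq {n : ℕ} {d : Fin n → ℕ} (x : Basis d) : encBasis x = enc (digits x) := by
  simp only [encBasis, digits, enc, List.map_ofFn]
  rfl

/-- Whether a list is the list of the digits of a basis label. -/
def isLabel (dims l : List ℕ) : Bool :=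
  decide (l.length = dims.length) && (l.zip dims).all fun p => decide (p.1 < p.2)

theorem isLabel_iff {n : ℕ} {d : Fin n → ℕ} (l : List ℕ) :
    isLabel (List.ofFn d) l = true ↔ ∃ x : Basis d, digits x = l := by
  simp only [isLabel, List.length_ofFn, Bool.and_eq_true, decide_eq_true_eq, List.all_eq_true]
  constructor
  · rintro ⟨h1, h2⟩
    have h3 : ∀ k : Fin n, l[(k : ℕ)]'(by rw [h1]; exact k.2) < d k := by
      intro k
      have := h2 ((l.zip (List.ofFn d))[(k : ℕ)]'(by simp [h1])) (List.getElem_mem _)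
      simpa using this
    refine ⟨fun k => ⟨_, h3 k⟩, ?_⟩
    refine List.ext_getElem (by simp [digits, h1]) ?_
    intro i hi hi'
    simp [digits]
  · rintro ⟨x, rfl⟩
    refine ⟨by simp [digits], ?_⟩
    intro p hp
    obtain ⟨i, hi, rfl⟩ := List.mem_iff_getElem.1 hp
    simp [digits]

instance {J : Type*} [Enc J] {n : J → ℕ} {d : ∀ j, Fin (n j) → ℕ} : Enc (Σ j, Basis (d j)) :=
  ⟨fun p => .pair (enc p.1) (enc (digits p.2))⟩

/-- A family of systems of qudits, whose dimensions can be computed, with random basis labels that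
can be sampled and with Gaussian integers, indexed by basis labels, that can be evaluated. -/
structure Source (J : Type*) [Enc J] where
  /-- the number of qudits -/
  n : J → ℕ
  /-- the dimensions -/
  d : ∀ j, Fin (n j) → ℕ
  /-- the distribution of the basis labels -/
  μ : ∀ j, PMF (Basis (d j))
  /-- the values at the basis labels -/
  val : ∀ j, Basis (d j) → ℤ × ℤ
  dims_pt : PT fun j => List.ofFn (d j)
  sample_rpt : RPT fun j => (μ j).map digits
  val_pt : PT fun p : (Σ j, Basis (d j)) => val p.1 p.2

/-- An operator on one qudit of which one row is relevant for the measurement: whether the qudit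
is measured with a fixed outcome, that outcome, and the corresponding row. -/
abbrev Entry : Type := Bool × ℕ × List (ℤ × ℤ)

/-- The dimension of a qudit, whether it is measured, and the matrix of its operator. -/
abbrev Factor : Type := ℕ × Bool × List (List (ℤ × ℤ)) × Unit

/-- The random choice of an index, according to the squares of the entries of a row. -/
def draw {μ : Type*} (M : List μ) (row : List (ℤ × ℤ)) : PMF ℕ :=
  (rand M).map fun r => pick 0 (dyadic M (row.zipIdx.map fun p => (p.2, gsq p.1))) r

/-- The digit `x` of a qudit without a fixed outcome, and a random digit otherwise. -/
def drawDigit {μ : Type*} (M : List μ) (x : ℕ) (e : Entry) : PMF ℕ :=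
  if e.1 = true then draw M e.2.2 else PMF.pure x

/-- Independent random digits. -/
def redraw {μ : Type*} (M : List μ) (xs : List ℕ) (Y : List Entry) : PMF (List ℕ) :=
  mapP (fun p : ℕ × Entry => drawDigit M p.1 p.2) (xs.zip Y)

/-- The member of a list with a given index. -/
def look (row : List (ℤ × ℤ)) (x : ℕ) : ℤ × ℤ :=
  gsum (row.zipIdx.map fun p => if p.2 = x then p.1 else (0, 0))

/-- The product of the relevant entries of the operators. -/
def ampl (xs : List ℕ) (Y : List Entry) : ℤ × ℤ :=
  gprod ((xs.zip Y).map fun p => if p.2.1 = true then look p.2.2.2 p.1 else (1, 0))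

/-- The rounded score of a pair of basis labels. -/
def score {μ : Type*} (M : List μ) (α β u v : ℤ × ℤ) : ℕ :=
  -- This is `cscore` of α · conj v and β · conj u in units of 2 ^ (-`M.length`), rounded down. A
  -- scale common to both products cancels, so the integer amplitudes need no normalization.
  2 ^ M.length * gsq (gmul α (gconj v) + gmul β (gconj u)) /
    (2 * (gsq (gmul α (gconj v)) + gsq (gmul β (gconj u))))

/-- The options for one more qudit. -/
def options (p : Factor) : List Entry :=
  if p.2.1 = true then p.2.2.1.zipIdx.map fun q => (true, q.2, q.1) else [(false, 0, [])]

/-- The fixed outcomes. -/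
def outcomeOf (Y : List Entry) : List ℕ := (Y.filter fun e => e.1).map fun e => e.2.1

/-- All measured qudits have the outcome `0`. -/
def zeroOutcome (l : List Factor) : List ℕ := (l.filter fun p => p.2.1).map fun _ => 0

/-- The final list of outcomes with their probabilities. -/
def report {μ : Type*} (M : List μ) (l : List Factor) (nodes : List (List Entry × ℕ)) :
    List (List ℕ × ℕ × ℕ) :=
  -- An unlucky run may discard every node. A fixed outcome is reported then, so that the output is
  -- always a probability distribution.
  let ws := if nodes.isEmpty = true then [(zeroOutcome l, 1)]
    else nodes.map fun nd => (outcomeOf nd.1, nd.2)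
  ((dyadic M ws).filter fun q => decide (¬ q.2 = 0)).map fun q => (q.1, q.2, 2 ^ M.length)

namespace Source

variable {J : Type*} [Enc J] (s : Source J)

open Classical in
/-- The value at a basis label that is given as a list. -/
def valL (j : J) (l : List ℕ) : ℤ × ℤ :=
  if h : ∃ x : Basis (s.d j), digits x = l then s.val j h.choose else (0, 0)

theorem valL_digits (j : J) (x : Basis (s.d j)) : s.valL j (digits x) = s.val j x := by
  have h : ∃ y : Basis (s.d j), digits y = digits x := ⟨x, rfl⟩
  rw [valL, dif_pos h]
  exact congrArg _ (digits_injective h.choose_spec)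

/-- The label behind the list never has to be computed: a pair of an index and a label is encoded by
the index and the digits, and these are at hand. -/
theorem valL_pt {α : Type*} [Enc α] {f : α → J} {l : α → List ℕ} (hf : PT f) (hl : PT l)
    (h : ∀ a, ∃ x : Basis (s.d (f a)), digits x = l a) : PT fun a => s.valL (f a) (l a) := by
  choose x hx using h
  have h1 : PT (fun a => (⟨f a, x a⟩ : Σ j, Basis (s.d j))) := by
    obtain ⟨A, g, hg, hA⟩ := hf.prodMk hl
    refine ⟨A, g, hg, fun a => (hA a).congr rfl le_rfl ?_⟩
    simp only [enc, hx]
  have h2 := s.val_pt.comp h1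
  refine (congrArg PT ?_).mp h2
  funext a
  rw [← hx, valL_digits]

/-- One random score. -/
def sample {μ : Type*} (j : J) (M : List μ) (Y : List Entry) : PMF ℕ :=
  ((s.μ j).map digits).bind fun xs => (redraw M xs Y).map fun z =>
    -- The source can evaluate labels only, so the program needs a fallback. For rows of the right
    -- lengths the redrawn list is always a label.
    let z' := if isLabel (List.ofFn (s.d j)) z = true then z else xs
    score M (s.valL j xs) (s.valL j z') (ampl xs Y) (ampl z' Y)

/-- The estimate of a probability, as a multiple of `(N.length * 2 ^ M.length)⁻¹`. -/
def estimate {μ : Type*} (j : J) (M N : List μ) (Y : List Entry) : PMF ℕ :=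
  -- The ideal mean of a score is (1 + P) / 2, whence the doubling and the subtraction. Truncation
  -- at 0 can only help, as P is nonnegative.
  (mapP (fun _ => s.sample j M Y) N).map fun l => 2 * l.sum - N.length * 2 ^ M.length

/-- The extensions of the nodes by one more qudit. -/
def candidates (p : Factor) (nodes : List (List Entry × ℕ)) : List (List Entry) :=
  nodes.flatMap fun nd => (options p).map fun e => nd.1 ++ [e]

/-- The estimated probability of a prefix. -/
def nodeEstimate {μ : Type*} (j : J) (M N : List μ) (Y : List Entry) : PMF (List Entry × ℕ) :=
  -- The remaining qudits receive trivial entries. There may be too many of them; pairing with the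
  -- digits ignores the surplus.
  (s.estimate j M N (Y ++ (List.ofFn (s.d j)).map fun _ => (false, 0, []))).map fun c => (Y, c)

/-- The significant members of a list of nodes. -/
def prune {μ : Type*} (M N L : List μ) (thr : ℕ) (l : List (List Entry × ℕ)) :
    List (List Entry × ℕ) :=
  -- The condition says that the estimate is at least 1 / thr. The cut guarantees the running time
  -- and the sparsity in all cases; nothing is lost when the estimates are accurate.
  cut L (l.filter fun nd => decide (N.length * 2 ^ M.length ≤ nd.2 * thr))

/-- One level of the search tree. -/
def level {μ : Type*} (j : J) (M N L : List μ) (thr : ℕ) (p : Factor)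
    (nodes : List (List Entry × ℕ)) : PMF (List (List Entry × ℕ)) :=
  (mapP (s.nodeEstimate j M N) (candidates p nodes)).map (prune M N L thr)

/-- The search for the significant outcomes. -/
def search {μ : Type*} (j : J) (M N L : List μ) (thr : ℕ) (l : List Factor) :
    PMF (List (List Entry × ℕ)) :=
  -- The root has probability 1 in the units of the estimates.
  pfold (s.level j M N L thr) l [([], N.length * 2 ^ M.length)]

/-- The algorithm. -/
def simulate {μ : Type*} (j : J) (M N L : List μ) (thr : ℕ) (l : List Factor) :
    PMF (List (List ℕ × ℕ × ℕ)) :=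
  (s.search j M N L thr l).map (report M l)

end Source

/-- Sampling from a list of probabilities. -/
def resample (l : List (List ℕ × ℕ × ℕ)) : PMF (List ℕ) :=
  -- The denominator is a power of two, and the binary length of 2 ^ k is k + 1; dropping one member
  -- leaves exactly k coins.
  (rand (List.replicate (Nat.size (l.headD ([], 0, 0)).2.2) ()).tail).map fun r =>
    pick [] (l.map fun q => (q.1, q.2.1)) r

section PT

variable {α β γ δ : Type*} [Enc α] [Enc β] [Enc γ] [Enc δ]

@[fun_prop] theorem PT.isLabel {d l : α → List ℕ} (hd : PT d) (hl : PT l) :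
    PT fun a => isLabel (d a) (l a) := by
  unfold SparseSim.isLabel; fun_prop

theorem RPT.draw {M : α → List β} {row : α → List (ℤ × ℤ)} (hM : PT M) (hr : PT row) :
    RPT fun a => draw (M a) (row a) :=
  by
  have h : PT fun p : α × ℕ => SparseSim.pick 0 (SparseSim.dyadic (M p.1)
      ((row p.1).zipIdx.map fun q => (q.2, SparseSim.gsq q.1))) p.2 := by fun_prop
  unfold SparseSim.draw
  exact RPT.map (RPT.rand hM) h

theorem RPT.redraw {M : α → List β} {xs : α → List ℕ} {Y : α → List Entry} (hM : PT M)
    (hx : PT xs) (hY : PT Y) : RPT fun a => redraw (M a) (xs a) (Y a) := by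
  refine RPT.mapP (f := fun a (p : ℕ × Entry) => drawDigit (M a) p.1 p.2) ?_
    (l := fun a => (xs a).zip (Y a)) (by fun_prop)
  refine RPT.ite (P := fun p : α × ℕ × Entry => p.2.2.1 = true) (by fun_prop)
    (RPT.draw (by fun_prop) (by fun_prop)) (PT.rpt (by fun_prop))

@[fun_prop] theorem PT.look {l : α → List (ℤ × ℤ)} {x : α → ℕ} (hl : PT l) (hx : PT x) :
    PT fun a => look (l a) (x a) := by
  unfold SparseSim.look; fun_prop

@[fun_prop] theorem PT.ampl {xs : α → List ℕ} {Y : α → List Entry} (hx : PT xs) (hY : PT Y) :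
    PT fun a => ampl (xs a) (Y a) := by
  unfold SparseSim.ampl; fun_prop

@[fun_prop] theorem PT.score {M : α → List β} {x y u v : α → ℤ × ℤ} (hM : PT M) (hx : PT x)
    (hy : PT y) (hu : PT u) (hv : PT v) : PT fun a => score (M a) (x a) (y a) (u a) (v a) := by
  unfold SparseSim.score; fun_prop

@[fun_prop] theorem PT.options {p : α → Factor} (hp : PT p) : PT fun a => options (p a) := by
  unfold SparseSim.options; fun_prop

@[fun_prop] theorem PT.outcomeOf {Y : α → List Entry} (hY : PT Y) :
    PT fun a => outcomeOf (Y a) := by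
  unfold SparseSim.outcomeOf; fun_prop

@[fun_prop] theorem PT.zeroOutcome {l : α → List Factor} (hl : PT l) :
    PT fun a => zeroOutcome (l a) := by
  unfold SparseSim.zeroOutcome; fun_prop

@[fun_prop] theorem PT.report {M : α → List β} {l : α → List Factor}
    {nodes : α → List (List Entry × ℕ)} (hM : PT M) (hl : PT l) (hn : PT nodes) :
    PT fun a => report (M a) (l a) (nodes a) := by
  unfold SparseSim.report; fun_prop

@[fun_prop] theorem PT.candidates {p : α → Factor} {nodes : α → List (List Entry × ℕ)}
    (hp : PT p) (hn : PT nodes) : PT fun a => Source.candidates (p a) (nodes a) := by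
  unfold Source.candidates; fun_prop

@[fun_prop] theorem PT.prune {M N L : α → List β} {thr : α → ℕ}
    {l : α → List (List Entry × ℕ)} (hM : PT M) (hN : PT N) (hL : PT L) (ht : PT thr)
    (hl : PT l) : PT fun a => Source.prune (M a) (N a) (L a) (thr a) (l a) := by
  unfold Source.prune; fun_prop

theorem RPT.resample : RPT resample := by
  have h1 : PT fun p : List (List ℕ × ℕ × ℕ) × ℕ =>
      SparseSim.pick [] (p.1.map fun q => (q.1, q.2.1)) p.2 := by fun_prop
  have h2 : PT fun l : List (List ℕ × ℕ × ℕ) => (l.headD ([], 0, 0)).2.2 := by fun_prop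
  have h3 := PT.tail (PT.sizeList.comp h2)
  exact RPT.map (RPT.rand h3) h1

end PT

namespace Source

variable {J : Type*} [Enc J] (s : Source J)
variable {α β : Type*} [Enc α] [Enc β]

theorem dims_pt' {f : α → J} (hf : PT f) : PT fun a => List.ofFn (s.d (f a)) :=
  s.dims_pt.comp hf

theorem sample_rpt' {f : α → J} {M : α → List β} {Y : α → List Entry} (hf : PT f) (hM : PT M)
    (hY : PT Y) : RPT fun a => s.sample (f a) (M a) (Y a) := by
  refine (s.sample_rpt.comp hf).bind_of_mem (g := fun a xs => (redraw (M a) xs (Y a)).map fun z =>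
    let z' := if isLabel (List.ofFn (s.d (f a))) z = true then z else xs
    score (M a) (s.valL (f a) xs) (s.valL (f a) z') (ampl xs (Y a)) (ampl z' (Y a))) ?_
  have hv := PT.subtype_val (α := α × List ℕ)
    (P := fun p => p.2 ∈ ((s.μ (f p.1)).map digits).support)
  refine RPT.map (RPT.redraw (by fun_prop) (by fun_prop) (by fun_prop))
    (g := fun (p : {p : α × List ℕ // p.2 ∈ ((s.μ (f p.1)).map digits).support}) z =>
    let z' := if isLabel (List.ofFn (s.d (f p.1.1))) z = true then z else p.1.2
    score (M p.1.1) (s.valL (f p.1.1) p.1.2) (s.valL (f p.1.1) z') (ampl p.1.2 (Y p.1.1))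
      (ampl z' (Y p.1.1))) ?_
  have hv' := hv.comp (PT.fst (PT.id
    (α := {p : α × List ℕ // p.2 ∈ ((s.μ (f p.1)).map digits).support} × List ℕ)))
  have hd := s.dims_pt' (hf.comp (PT.fst hv'))
  have hx : ∀ p : {p : α × List ℕ // p.2 ∈ ((s.μ (f p.1)).map digits).support} × List ℕ,
      ∃ x : Basis (s.d (f p.1.1.1)), digits x = p.1.1.2 := by
    rintro ⟨⟨⟨a, xs⟩, h⟩, z⟩
    obtain ⟨x, _, hx⟩ := (PMF.mem_support_map_iff _ _ _).1 h
    exact ⟨x, hx⟩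
  have hz : PT fun p : {p : α × List ℕ // p.2 ∈ ((s.μ (f p.1)).map digits).support} × List ℕ =>
      if isLabel (List.ofFn (s.d (f p.1.1.1))) p.2 = true then p.2 else p.1.1.2 := by
    fun_prop
  have h1 := s.valL_pt (hf.comp (PT.fst hv')) (PT.snd hv') hx
  have h2 := s.valL_pt (hf.comp (PT.fst hv')) hz (by
    intro p
    split_ifs with h
    · exact (isLabel_iff _).1 h
    · exact hx p)
  exact PT.score (hM.comp (PT.fst hv')) h1 h2 (PT.ampl (PT.snd hv') (hY.comp (PT.fst hv')))
    (PT.ampl hz (hY.comp (PT.fst hv')))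

theorem estimate_rpt {f : α → J} {M N : α → List β} {Y : α → List Entry} (hf : PT f)
    (hM : PT M) (hN : PT N) (hY : PT Y) :
    RPT fun a => s.estimate (f a) (M a) (N a) (Y a) :=
  (RPT.mapP (f := fun a _ => s.sample (f a) (M a) (Y a))
    (s.sample_rpt' (by fun_prop) (by fun_prop) (by fun_prop)) hN).map
    (g := fun a l => 2 * l.sum - (N a).length * 2 ^ (M a).length) (by fun_prop)

theorem nodeEstimate_rpt {f : α → J} {M N : α → List β} {Y : α → List Entry} (hf : PT f)
    (hM : PT M) (hN : PT N) (hY : PT Y) :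
    RPT fun a => s.nodeEstimate (f a) (M a) (N a) (Y a) := by
  have := s.dims_pt' hf
  exact (s.estimate_rpt hf hM hN (by fun_prop)).map (g := fun a c => (Y a, c)) (by fun_prop)

theorem level_rpt {f : α → J} {M N L : α → List β} {thr : α → ℕ} {p : α → Factor}
    {nodes : α → List (List Entry × ℕ)} (hf : PT f) (hM : PT M) (hN : PT N) (hL : PT L)
    (ht : PT thr) (hp : PT p) (hn : PT nodes) :
    RPT fun a => s.level (f a) (M a) (N a) (L a) (thr a) (p a) (nodes a) :=
  (RPT.mapP (f := fun a Y => s.nodeEstimate (f a) (M a) (N a) Y)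
    (s.nodeEstimate_rpt (by fun_prop) (by fun_prop) (by fun_prop) (by fun_prop))
    (PT.candidates hp hn)).map
    (g := fun a l => prune (M a) (N a) (L a) (thr a) l) (by fun_prop)

end Source

end SparseSim

end

/-! ### Bounds on the data of the search and its polynomial running time -/

noncomputable section

namespace SparseSim

open Enc

theorem gsq_add_le (z w : ℤ × ℤ) : gsq (z + w) ≤ 2 * (gsq z + gsq w) := by
  zify
  rw [gsq_cast, gsq_cast, gsq_cast]
  simp only [Prod.fst_add, Prod.snd_add]
  nlinarith [mul_self_nonneg (z.1 - w.1), mul_self_nonneg (z.2 - w.2)]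

theorem score_le {μ : Type*} (M : List μ) (α β u v : ℤ × ℤ) :
    score M α β u v ≤ 2 ^ M.length := by
  unfold score
  refine Nat.div_le_of_le_mul ?_
  rw [mul_comm (2 * _)]
  exact Nat.mul_le_mul_left _ (gsq_add_le _ _)

namespace Source

variable {J : Type*} [Enc J] (s : Source J) {μ : Type*}

theorem sample_le {j : J} {M : List μ} {Y : List Entry} {c : ℕ}
    (h : c ∈ (s.sample j M Y).support) : c ≤ 2 ^ M.length := by
  simp only [sample, PMF.mem_support_bind_iff, PMF.mem_support_map_iff] at h
  obtain ⟨x, _, z, _, rfl⟩ := h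
  exact score_le _ _ _ _ _

theorem estimate_le {j : J} {M N : List μ} {Y : List Entry} {c : ℕ}
    (h : c ∈ (s.estimate j M N Y).support) : c ≤ N.length * 2 ^ M.length := by
  simp only [estimate, PMF.mem_support_map_iff, mem_support_mapP] at h
  obtain ⟨l, hl, rfl⟩ := h
  have h1 : l.sum ≤ N.length * 2 ^ M.length := by
    induction hl with
    | nil => simp
    | cons h _ ih =>
      have := s.sample_le h
      rw [List.sum_cons, List.length_cons, add_mul]
      omega
  omega

theorem mem_level {j : J} {M N L : List μ} {thr : ℕ} {p : Factor}
    {nodes nodes' : List (List Entry × ℕ)}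
    (h : nodes' ∈ (s.level j M N L thr p nodes).support) :
    ∃ r, nodes' = prune M N L thr r ∧ r.map Prod.fst = candidates p nodes ∧
      ∀ nd ∈ r, nd.2 ≤ N.length * 2 ^ M.length := by
  simp only [level, PMF.mem_support_map_iff, mem_support_mapP] at h
  obtain ⟨r, hr, rfl⟩ := h
  refine ⟨r, rfl, ?_, ?_⟩
  · generalize candidates p nodes = l at hr
    induction hr with
    | nil => rfl
    | cons h _ ih =>
      simp only [nodeEstimate, PMF.mem_support_map_iff] at h
      obtain ⟨c, _, rfl⟩ := h
      simp [ih]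
  · generalize candidates p nodes = l at hr
    induction hr with
    | nil => simp
    | cons h _ ih =>
      simp only [nodeEstimate, PMF.mem_support_map_iff] at h
      obtain ⟨c, hc, rfl⟩ := h
      intro nd hnd
      rcases List.mem_cons.1 hnd with rfl | hnd
      · exact s.estimate_le hc
      · exact ih nd hnd

theorem mem_prune {M N L : List μ} {thr : ℕ} {l : List (List Entry × ℕ)}
    {nd : List Entry × ℕ} (h : nd ∈ prune M N L thr l) :
    nd ∈ l ∧ N.length * 2 ^ M.length ≤ nd.2 * thr := by
  rw [prune, cut_eq_take] at h
  have := List.mem_of_mem_take h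
  simpa using this

theorem length_prune_le {M N L : List μ} {thr : ℕ} {l : List (List Entry × ℕ)} :
    (prune M N L thr l).length ≤ L.length := by
  rw [prune, cut_eq_take]
  simp

theorem esize_options {p : Factor} {e : Entry} (h : e ∈ options p) :
    esize e ≤ 2 * esize p + 10 := by
  unfold options at h
  have h1 : esize p = esize p.1 + (esize p.2.1 + (esize p.2.2.1 + esize p.2.2.2 + 1) + 1) + 1 := rfl
  split_ifs at h with h0
  · rw [List.mem_map] at h
    obtain ⟨⟨r, i⟩, hq, rfl⟩ := h
    have h2 := List.mem_zipIdx' hq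
    have h3 : esize r ≤ esize p.2.2.1 := by rw [h2.2]; exact esize_mem_le (List.getElem_mem _)
    have h4 := length_lt_esize p.2.2.1
    have h5 : Nat.size i ≤ i := Nat.size_le.2 Nat.lt_two_pow_self
    have h6 : esize true = 2 := by simp [esize, enc, Data.bool, Data.size]
    simp only [esize_pair, esize_nat, h6]
    have := h2.1
    omega
  · simp only [List.mem_singleton] at h
    subst h
    simp [esize, enc, Data.bool, Data.size, Data.list]

variable {α β : Type*} [Enc α] [Enc β]

/-- Pruning bounds the number of nodes on each level, each level appends one entry to a prefix, and
an estimate never exceeds the number of samples times the maximal score. Together they give the size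
invariant for `RPT.pfold`. -/
theorem search_rpt {f : α → J} {M N L : α → List β} {thr : α → ℕ} {l : α → List Factor}
    (hf : PT f) (hM : PT M) (hN : PT N) (hL : PT L) (ht : PT thr) (hl : PT l) :
    RPT fun a => s.search (f a) (M a) (N a) (L a) (thr a) (l a) := by
  have hc : PT fun a => (N a).length * 2 ^ (M a).length := by fun_prop
  let b : α → ℕ := fun a => (1 + esize (l a) * (2 * esize (l a) + 11)) +
    esize ((N a).length * 2 ^ (M a).length) + 2
  have hb : PB b := (((PB.const 1).add (hl.esize_le.mul (((PB.const 2).mul hl.esize_le).add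
    (PB.const 11)))).add hc.esize_le).add (PB.const 2)
  refine RPT.pfold (F := fun a p nodes => s.level (f a) (M a) (N a) (L a) (thr a) p nodes)
    (s.level_rpt (by fun_prop) (by fun_prop) (by fun_prop) (by fun_prop) (by fun_prop)
      (by fun_prop) (by fun_prop)) hl (by fun_prop)
    (B := fun a => (esize (L a) + 1) * (b a + 1) + 1)
    (((hL.esize_le.add (PB.const 1)).mul (hb.add (PB.const 1))).add (PB.const 1))
    -- The additional 1 accounts for the root, since L may be empty here.
    (fun a i nodes => nodes.length ≤ (L a).length + 1 ∧ ∀ nd ∈ nodes,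
      esize nd.1 ≤ 1 + i * (2 * esize (l a) + 11) ∧ nd.2 ≤ (N a).length * 2 ^ (M a).length) ?_ ?_ ?_
  · intro a
    simp
  · rintro a i nodes hi ⟨h1, h2⟩ nodes' hn
    obtain ⟨r, rfl, hr, hle⟩ := s.mem_level hn
    refine ⟨length_prune_le.trans (Nat.le_succ _), fun nd hnd => ?_⟩
    have h3 := (mem_prune hnd).1
    refine ⟨?_, hle nd h3⟩
    have h4 : nd.1 ∈ candidates (l a)[i] nodes := by
      rw [← hr]; exact List.mem_map_of_mem h3
    simp only [candidates, List.mem_flatMap, List.mem_map] at h4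
    obtain ⟨nd', h5, e, h6, h7⟩ := h4
    rw [← h7]
    have h8 := esize_append nd'.1 [e]
    have h9 := esize_options h6
    have h10 := esize_mem_le (List.getElem_mem hi)
    have h11 := (h2 nd' h5).1
    rw [esize_cons, esize_nil] at h8
    rw [add_mul]
    omega
  · rintro a i nodes hi ⟨h1, h2⟩
    refine (esize_list_le (B := b a) fun nd hnd => ?_).trans ?_
    · obtain ⟨h3, h4⟩ := h2 nd hnd
      have h5 : esize nd = esize nd.1 + esize nd.2 + 1 := rfl
      have h6 : esize nd.2 ≤ esize ((N a).length * 2 ^ (M a).length) := by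
        simp only [esize_nat]
        exact Nat.succ_le_succ (Nat.size_le_size h4)
      have h7 : i * (2 * esize (l a) + 11) ≤ esize (l a) * (2 * esize (l a) + 11) := by
        gcongr
        exact hi.trans (length_lt_esize _).le
      simp only [b]
      omega
    · have := length_lt_esize (L a)
      gcongr
      omega

theorem simulate_rpt {f : α → J} {M N L : α → List β} {thr : α → ℕ} {l : α → List Factor}
    (hf : PT f) (hM : PT M) (hN : PT N) (hL : PT L) (ht : PT thr) (hl : PT l) :
    RPT fun a => s.simulate (f a) (M a) (N a) (L a) (thr a) (l a) :=
  (s.search_rpt hf hM hN hL ht hl).map (g := fun a nodes => report (M a) (l a) nodes)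
    (by fun_prop)

end Source

end SparseSim

end

noncomputable section

namespace SparseSim

open Enc

/-! ### Distributions of random numbers and random choices -/

theorem foldl_bits (l : List Bool) (c : ℕ) :
    l.foldl (fun c b => 2 * c + b.toNat) c = c * 2 ^ l.length + ofBits l := by
  induction l generalizing c with
  | nil => simp [ofBits]
  | cons b l ih =>
    have h1 : ofBits (b :: l) = b.toNat * 2 ^ l.length + ofBits l := by
      have := ih (2 * 0 + b.toNat)
      simpa [ofBits] using this
    rw [List.foldl_cons, ih, h1, List.length_cons]
    ring

theorem rand_apply {β : Type*} (l : List β) (r : ℕ) :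
    rand l r = if r < 2 ^ l.length then ((2 : ENNReal) ^ l.length)⁻¹ else 0 := by
  induction l generalizing r with
  | nil =>
    simp [rand, coins, mapP, PMF.pure_map, ofBits, PMF.pure_apply]
  | cons a l ih =>
    have h1 : rand (a :: l) = (PMF.uniformOfFintype Bool).bind fun b =>
        (rand l).map fun r => b.toNat * 2 ^ l.length + r := by
      simp only [rand, coins, mapP, PMF.map_bind, PMF.map_comp]
      congr 1
      funext b
      refine pmf_map_congr _ fun r hr => ?_
      have hl : r.length = l.length := (mem_support_mapP.1 hr).length_eq.symm
      simp only [Function.comp, ofBits, List.foldl_cons]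
      rw [foldl_bits, hl]
      simp [ofBits]
    have h2 : ∀ b : Bool, ((rand l).map fun r => b.toNat * 2 ^ l.length + r) r =
        if b.toNat * 2 ^ l.length ≤ r then rand l (r - b.toNat * 2 ^ l.length) else 0 := by
      intro b
      rw [PMF.map_apply]
      split_ifs with h
      · rw [tsum_eq_single (r - b.toNat * 2 ^ l.length)]
        · rw [if_pos (by omega)]
        · intro r' hr'
          rw [if_neg (by omega)]
      · rw [ENNReal.tsum_eq_zero]
        intro r'
        rw [if_neg (by omega)]
    rw [h1, PMF.bind_apply, tsum_fintype, Fintype.sum_bool]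
    simp only [PMF.uniformOfFintype_apply, Fintype.card_bool, h2, ih, List.length_cons]
    have h3 : ((2 : ENNReal) ^ (l.length + 1))⁻¹ = (2 : ENNReal)⁻¹ * (2 ^ l.length)⁻¹ := by
      rw [pow_succ', ENNReal.mul_inv (by simp) (by simp)]
    rw [h3]
    have h4 : 2 ^ (l.length + 1) = 2 * 2 ^ l.length := by ring
    simp only [Bool.toNat_true, Bool.toNat_false, one_mul, zero_mul, Nat.zero_le, if_true,
      Nat.sub_zero, Nat.cast_ofNat]
    by_cases h5 : r < 2 ^ l.length
    · rw [if_neg (by omega), if_pos h5, if_pos (by omega)]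
      simp
    · by_cases h6 : r < 2 ^ (l.length + 1)
      · rw [if_pos (by omega), if_pos (by omega), if_neg h5, if_pos h6]
        simp
      · rw [if_pos (by omega), if_neg (by omega), if_neg h5, if_neg h6]
        simp

open Classical in
theorem rand_map_apply {β γ : Type*} (l : List β) (f : ℕ → γ) (c : γ) :
    ((rand l).map f c).toReal =
      (∑ r ∈ Finset.range (2 ^ l.length), if f r = c then 1 else 0) / 2 ^ l.length := by
  rw [PMF.map_apply, tsum_eq_sum (s := Finset.range (2 ^ l.length)), ENNReal.toReal_sum,
    Finset.sum_div]
  · refine Finset.sum_congr rfl fun r hr => ?_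
    rw [rand_apply, if_pos (Finset.mem_range.1 hr)]
    by_cases h : f r = c
    · rw [if_pos h, if_pos h.symm]
      simp
    · rw [if_neg h, if_neg (Ne.symm h)]
      simp
  · intro r _
    split_ifs
    · exact PMF.apply_ne_top _ _
    · simp
  · intro r hr
    have h0 : ¬ r < 2 ^ l.length := by simpa using hr
    rw [rand_apply, if_neg h0, ite_self]

theorem pick_map {β γ : Type*} (g : β → γ) (d : β) (l : List (β × ℕ)) (r : ℕ) :
    pick (g d) (l.map fun p => (g p.1, p.2)) r = g (pick d l r) := by
  induction l generalizing r with
  | nil => rfl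
  | cons b l ih =>
    simp only [List.map_cons, pick, ih]
    split_ifs <;> rfl

/-- Only default values depend on the default value. -/
theorem pick_dflt {β : Type*} (d d' : β) (l : List (β × ℕ)) (r : ℕ)
    (h : r < (l.map Prod.snd).sum) : pick d l r = pick d' l r := by
  induction l generalizing r with
  | nil => simp at h
  | cons b l ih =>
    simp only [pick]
    split_ifs with h1
    · rfl
    · simp only [List.map_cons, List.sum_cons] at h
      exact ih _ (by omega)

-- The numbers below the total weight split into consecutive blocks, one for every member and as
-- long as its weight; `pick` returns the member whose block is hit.
open Classical in
theorem sum_pick {β : Type*} (d : β) (l : List (β × ℕ)) (c : β) :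
    (∑ r ∈ Finset.range (l.map Prod.snd).sum, if pick d l r = c then (1 : ℝ) else 0) =
      (l.map fun p => if p.1 = c then (p.2 : ℝ) else 0).sum := by
  induction l with
  | nil => simp
  | cons b l ih =>
    obtain ⟨b, w⟩ := b
    simp only [List.map_cons, List.sum_cons]
    rw [Finset.sum_range_add]
    congr 1
    · rw [Finset.sum_congr rfl (g := fun _ => if b = c then (1 : ℝ) else 0)]
      · simp
      · intro r hr
        rw [pick, if_pos (Finset.mem_range.1 hr)]
    · rw [← ih]
      refine Finset.sum_congr rfl fun r _ => ?_
      have h1 : pick d ((b, w) :: l) (w + r) = pick d l r := by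
        rw [pick, if_neg (by omega), Nat.add_sub_cancel_left]
      rw [h1]

open Classical in
theorem rand_pick_apply {β μ : Type*} (M : List μ) (d : β) (l : List (β × ℕ)) (c : β)
    (h : (l.map Prod.snd).sum = 2 ^ M.length) :
    ((rand M).map (pick d l) c).toReal =
      (l.map fun p => if p.1 = c then (p.2 : ℝ) else 0).sum / 2 ^ M.length := by
  rw [rand_map_apply, ← h, sum_pick]

/-- Weights rescaled such that they sum up to `2 ^ M`. -/
def dyw {m : ℕ} (M : ℕ) (w : Fin m → ℕ) (i : Fin m) : ℕ :=
  2 ^ M * w i / (∑ i, w i) +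
    if (i : ℕ) = 0 then 2 ^ M - ∑ i, 2 ^ M * w i / (∑ i, w i) else 0

theorem dyadic_ofFn {β μ : Type*} {m : ℕ} (M : List μ) (k : Fin m → β) (w : Fin m → ℕ) :
    dyadic M (List.ofFn fun i => (k i, w i)) = List.ofFn fun i => (k i, dyw M.length w i) := by
  refine List.ext_getElem (by simp [dyadic]) ?_
  intro i h1 h2
  simp only [List.length_ofFn] at h2
  simp only [dyadic, List.map_ofFn, Function.comp_def, List.sum_ofFn, List.getElem_map,
    List.getElem_zipIdx, List.getElem_ofFn, zero_add, dyw]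
  split_ifs <;> rfl

theorem sum_div_le {m : ℕ} (N : ℕ) (w : Fin m → ℕ) :
    ∑ i, N * w i / (∑ i, w i) ≤ N := by
  rcases Nat.eq_zero_or_pos (∑ i, w i) with h | h
  · simp [h]
  · have h1 : (∑ i, N * w i / (∑ i, w i)) * (∑ i, w i) ≤ N * ∑ i, w i := by
      rw [Finset.sum_mul, Finset.mul_sum]
      exact Finset.sum_le_sum fun i _ => Nat.div_mul_le_self _ _
    exact Nat.le_of_mul_le_mul_right h1 h

theorem sum_dyw {m : ℕ} (hm : 0 < m) (M : ℕ) (w : Fin m → ℕ) : ∑ i, dyw M w i = 2 ^ M := by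
  obtain ⟨m, rfl⟩ : ∃ k, m = k + 1 := ⟨m - 1, by omega⟩
  have h := sum_div_le (2 ^ M) w
  simp only [dyw, Finset.sum_add_distrib]
  have h1 : ∀ c : ℕ, (∑ i : Fin (m + 1), if (i : ℕ) = 0 then c else 0) = c := by
    intro c
    rw [Fin.sum_univ_succ]; simp
  rw [h1]
  omega

/-- Rounding down changes each of the m weights by at most 1, so the remainder given to the first
one is at most m. In units of 2 ^ (-M) the total change is at most 2m. -/
theorem sum_abs_dyw_le {m : ℕ} (M : ℕ) (w : Fin m → ℕ) (hw : 0 < ∑ i, w i) :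
    ∑ i, |(dyw M w i : ℝ) / 2 ^ M - w i / (∑ i, w i : ℕ)| ≤ 2 * m / 2 ^ M := by
  rcases Nat.eq_zero_or_pos m with rfl | hm
  · simp
  obtain ⟨m, rfl⟩ : ∃ k, m = k + 1 := ⟨m - 1, by omega⟩
  set W := ∑ i, w i with hW
  have hW0 : (0 : ℝ) < (W : ℝ) := by exact_mod_cast hw
  have hM : (0 : ℝ) < (2 : ℝ) ^ M := by positivity
  set R := 2 ^ M - ∑ i, 2 ^ M * w i / W with hR
  have hfl : ∀ i, ((2 ^ M * w i / W : ℕ) : ℝ) ≤ 2 ^ M * w i / W ∧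
      (2 ^ M * w i / W : ℝ) - 1 ≤ ((2 ^ M * w i / W : ℕ) : ℝ) := by
    intro i
    constructor
    · have := @Nat.cast_div_le ℝ _ _ _ (2 ^ M * w i) W
      push_cast at this
      exact this
    · have h1 := Nat.lt_div_mul_add (a := 2 ^ M * w i) hw
      have h2 : ((2 ^ M * w i : ℕ) : ℝ) < ((2 ^ M * w i / W : ℕ) : ℝ) * W + W := by
        exact_mod_cast h1
      rw [sub_le_iff_le_add, div_le_iff₀ hW0]
      push_cast at h2
      nlinarith
  have hsum : ∑ i, (2 ^ M * w i / W : ℝ) = 2 ^ M := by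
    rw [← Finset.sum_div, ← Finset.mul_sum]
    rw [← Nat.cast_sum, ← hW]
    field_simp
  have hRle : (R : ℝ) ≤ (m + 1 : ℕ) := by
    have h1 : ((∑ i, 2 ^ M * w i / W : ℕ) : ℝ) ≥ 2 ^ M - (m + 1 : ℕ) := by
      push_cast [Nat.cast_sum]
      have h2 : ∑ i, ((2 ^ M * w i / W : ℝ) - 1) ≤ ∑ i, ((2 ^ M * w i / W : ℕ) : ℝ) :=
        Finset.sum_le_sum fun i _ => (hfl i).2
      rw [Finset.sum_sub_distrib, hsum] at h2
      simpa using h2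
    have h2 := sum_div_le (2 ^ M) w
    rw [hR, Nat.cast_sub h2]
    push_cast at h1 ⊢
    linarith
  have hterm : ∀ i : Fin (m + 1), |(dyw M w i : ℝ) / 2 ^ M - w i / W| ≤
      (1 + if (i : ℕ) = 0 then (R : ℝ) else 0) / 2 ^ M := by
    intro i
    have h1 : (dyw M w i : ℝ) / 2 ^ M - w i / W =
        ((2 ^ M * w i / W : ℕ) - (2 ^ M * w i / W : ℝ) +
          if (i : ℕ) = 0 then (R : ℝ) else 0) / 2 ^ M := by
      unfold dyw
      rw [← hW, ← hR]
      push_cast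
      field_simp
      ring
    rw [h1, abs_div, abs_of_pos hM]
    gcongr
    have h2 := hfl i
    have hR0 : (0 : ℝ) ≤ (R : ℝ) := Nat.cast_nonneg _
    rw [abs_le]
    split_ifs <;> constructor <;> linarith
  refine (Finset.sum_le_sum fun i _ => hterm i).trans ?_
  rw [← Finset.sum_div, Finset.sum_add_distrib]
  gcongr
  have h1 : (∑ i : Fin (m + 1), if (i : ℕ) = 0 then (R : ℝ) else 0) = R := by
    rw [Fin.sum_univ_succ]; simp
  rw [h1]
  simp only [Finset.sum_const, Finset.card_univ, Fintype.card_fin, nsmul_eq_mul, mul_one]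
  linarith

/-- The random choice of an index, as an element of a finite type. -/
def drawFin {μ : Type*} (M : List μ) {m : ℕ} (hm : 0 < m) (r : Fin m → ℤ × ℤ) : PMF (Fin m) :=
  (rand M).map (pick ⟨0, hm⟩ (List.ofFn fun i => (i, dyw M.length (fun i => gsq (r i)) i)))

theorem draw_ofFn {μ : Type*} (M : List μ) {m : ℕ} (hm : 0 < m) (r : Fin m → ℤ × ℤ) :
    draw M (List.ofFn r) = (drawFin M hm r).map Fin.val := by
  rw [draw, drawFin, PMF.map_comp]
  congr 1
  funext n
  simp only [Function.comp]
  have h1 : ((List.ofFn r).zipIdx.map fun p => (p.2, gsq p.1)) =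
      List.ofFn fun i : Fin m => ((i : ℕ), gsq (r i)) := by
    refine List.ext_getElem (by simp) ?_
    intro i h1 h2
    simp
  have h2 := pick_map Fin.val (⟨0, hm⟩ : Fin m)
    (List.ofFn fun i => (i, dyw M.length (fun i => gsq (r i)) i)) n
  rw [h1, dyadic_ofFn, ← h2, List.map_ofFn]
  rfl

theorem drawFin_apply {μ : Type*} (M : List μ) {m : ℕ} (hm : 0 < m) (r : Fin m → ℤ × ℤ)
    (i : Fin m) : (drawFin M hm r i).toReal =
      (dyw M.length (fun i => gsq (r i)) i : ℝ) / 2 ^ M.length := by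
  classical
  rw [drawFin, rand_pick_apply]
  · congr 1
    rw [List.map_ofFn, List.sum_ofFn]
    simp only [Function.comp]
    rw [Finset.sum_eq_single i]
    · simp
    · intro j _ hj
      simp [hj]
    · simp
  · rw [List.map_ofFn, List.sum_ofFn]
    exact sum_dyw hm _ _

/-! ### Product distributions -/

/-- The product of finitely many distributions. -/
def piPMF {n : ℕ} {d : Fin n → ℕ} (ν : ∀ k, PMF (Fin (d k))) : PMF (Basis d) :=
  PMF.ofFintype (fun x => ∏ k, ν k (x k)) (by
    rw [← Fintype.piFinset_univ, ← Finset.prod_univ_sum]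
    refine Finset.prod_eq_one fun k _ => ?_
    rw [← tsum_fintype (L := SummationFilter.unconditional _)]
    exact PMF.tsum_coe (ν k))

theorem piPMF_apply {n : ℕ} {d : Fin n → ℕ} (ν : ∀ k, PMF (Fin (d k))) (x : Basis d) :
    piPMF ν x = ∏ k, ν k (x k) := rfl

theorem mapP_ofFn_apply {α : Type*} {n : ℕ} (f : α → PMF ℕ) (a : Fin n → α) (b : Fin n → ℕ) :
    mapP f (List.ofFn a) (List.ofFn b) = ∏ k, f (a k) (b k) := by
  induction n with
  | zero => simp [mapP]
  | succ n ih =>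
    rw [List.ofFn_succ, List.ofFn_succ, Fin.prod_univ_succ, ← ih, mapP, PMF.bind_apply]
    rw [tsum_eq_single (b 0)]
    · congr 1
      rw [PMF.map_apply, tsum_eq_single (List.ofFn fun i : Fin n => b i.succ)]
      · simp
      · intro l hl
        rw [if_neg]
        intro h
        exact hl (by simpa using (List.cons_eq_cons.1 h).2.symm)
    · intro c hc
      rw [PMF.map_apply, ENNReal.tsum_eq_zero.2, mul_zero]
      intro l
      rw [if_neg]
      intro h
      exact hc (List.cons_eq_cons.1 h).1.symm

/-- On lists of digits of labels both sides are the same product; every other list is impossible,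
because each drawn digit is below its dimension. -/
theorem mapP_eq_piPMF {α : Type*} {n : ℕ} {d : Fin n → ℕ} (f : α → PMF ℕ) (a : Fin n → α)
    (ν : ∀ k, PMF (Fin (d k))) (h : ∀ k, f (a k) = (ν k).map Fin.val) :
    mapP f (List.ofFn a) = (piPMF ν).map digits := by
  have hval : ∀ k (i : Fin (d k)), f (a k) i = ν k i := by
    intro k i
    rw [h, PMF.map_apply, tsum_eq_single i]
    · simp
    · intro j hj
      rw [if_neg (fun h => hj (Fin.ext h.symm))]
  ext l
  by_cases hl : ∃ x : Basis d, digits x = l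
  · obtain ⟨x, rfl⟩ := hl
    rw [PMF.map_apply, tsum_eq_single x, if_pos rfl, digits, mapP_ofFn_apply, piPMF_apply]
    · exact Finset.prod_congr rfl fun k _ => hval k _
    · intro y hy
      rw [if_neg (fun h => hy (digits_injective h.symm))]
  · have h1 : ((piPMF ν).map digits) l = 0 := by
      rw [PMF.apply_eq_zero_iff, PMF.mem_support_map_iff]
      rintro ⟨x, _, hx⟩
      exact hl ⟨x, hx⟩
    rw [h1, PMF.apply_eq_zero_iff, mem_support_mapP]
    intro h2
    refine hl ((isLabel_iff l).1 ?_)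
    have hlen := h2.length_eq
    simp only [List.length_ofFn] at hlen
    simp only [isLabel, List.length_ofFn, Bool.and_eq_true, decide_eq_true_eq, List.all_eq_true]
    refine ⟨hlen.symm, fun p hp => ?_⟩
    obtain ⟨i, hi, rfl⟩ := List.mem_iff_getElem.1 hp
    simp only [List.length_zip, List.length_ofFn] at hi
    have h3 := (List.forall₂_iff_get.1 h2).2 i (by simp; omega) (by omega)
    simp only [List.get_eq_getElem, List.getElem_ofFn] at h3
    rw [h, PMF.mem_support_map_iff] at h3
    obtain ⟨j, _, hj⟩ := h3
    simp only [List.getElem_zip, List.getElem_ofFn]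
    rw [← hj]
    exact j.2

end SparseSim

end

noncomputable section

namespace SparseSim

open Enc ComplexConjugate

/-! ### The score of a pair of amplitudes -/

/-- The score of a pair of complex numbers. -/
def cscore (G H : ℂ) : ℝ := ‖G + H‖ ^ 2 / (2 * (‖G‖ ^ 2 + ‖H‖ ^ 2))

theorem cscore_comm (G H : ℂ) : cscore G H = cscore H G := by
  unfold cscore
  rw [add_comm G H, add_comm (‖G‖ ^ 2)]

theorem norm_add_sq_le (G H : ℂ) : ‖G + H‖ ^ 2 ≤ 2 * (‖G‖ ^ 2 + ‖H‖ ^ 2) := by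
  have h1 := norm_add_le G H
  have h2 := norm_nonneg (G + H)
  nlinarith [sq_nonneg (‖G‖ - ‖H‖)]

theorem cscore_nonneg (G H : ℂ) : 0 ≤ cscore G H := by unfold cscore; positivity

theorem cscore_le_one (G H : ℂ) : cscore G H ≤ 1 :=
  div_le_one_of_le₀ (norm_add_sq_le G H) (by positivity)

/-- The form of the definition in which the score is used: it also holds for vanishing amplitudes,
so no later argument divides by small numbers. -/
theorem cscore_mul (G H : ℂ) : cscore G H * (‖G‖ ^ 2 + ‖H‖ ^ 2) = ‖G + H‖ ^ 2 / 2 := by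
  unfold cscore
  by_cases h : ‖G‖ ^ 2 + ‖H‖ ^ 2 = 0
  · have h1 := norm_add_sq_le G H
    rw [h] at h1 ⊢
    have := sq_nonneg ‖G + H‖
    simp only [mul_zero] at *
    linarith
  · field_simp

theorem abs_sq_sub_sq_le {a b e : ℝ} (ha : 0 ≤ a) (hb : 0 ≤ b) (h : |b - a| ≤ e) :
    |a ^ 2 - b ^ 2| ≤ e * (2 * a + e) := by
  have h0 := abs_nonneg (b - a)
  have h1 := abs_le.1 h
  have : a ^ 2 - b ^ 2 = -((b - a) * (b + a)) := by ring
  rw [this, abs_neg, abs_mul, abs_of_nonneg (by linarith : 0 ≤ b + a)]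
  refine mul_le_mul h (by linarith) (by linarith) (by linarith)

/-- The score is stable under small perturbations of large amplitudes. -/
theorem cscore_perturb {G H G' H' : ℂ} {e : ℝ} (hG : ‖G‖ ≤ 1) (hH : ‖H‖ ≤ 1)
    (hG' : ‖G' - G‖ ≤ e) (hH' : ‖H' - H‖ ≤ e) (he : e ≤ 1) :
    ‖G‖ ^ 2 * |cscore G' H' - cscore G H| ≤ 12 * e := by
  have he0 : 0 ≤ e := (norm_nonneg _).trans hG'
  have h1 : |‖G‖ ^ 2 - ‖G'‖ ^ 2| ≤ 3 * e := by
    refine (abs_sq_sub_sq_le (norm_nonneg _) (norm_nonneg _)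
      ((abs_norm_sub_norm_le _ _).trans hG')).trans ?_
    nlinarith
  have h2 : |‖H‖ ^ 2 - ‖H'‖ ^ 2| ≤ 3 * e := by
    refine (abs_sq_sub_sq_le (norm_nonneg _) (norm_nonneg _)
      ((abs_norm_sub_norm_le _ _).trans hH')).trans ?_
    nlinarith
  have h3 : |‖G + H‖ ^ 2 - ‖G' + H'‖ ^ 2| ≤ 12 * e := by
    have h4 : |‖G' + H'‖ - ‖G + H‖| ≤ 2 * e := by
      refine (abs_norm_sub_norm_le _ _).trans ?_
      rw [show G' + H' - (G + H) = (G' - G) + (H' - H) by ring]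
      refine (norm_add_le _ _).trans ?_
      linarith
    have h5 : ‖G + H‖ ≤ 2 := (norm_add_le _ _).trans (by linarith)
    refine (abs_sq_sub_sq_le (norm_nonneg _) (norm_nonneg _) h4).trans ?_
    nlinarith
  have e1 := cscore_mul G H
  have e2 := cscore_mul G' H'
  have hx0 := cscore_nonneg G' H'
  have hx1 := cscore_le_one G' H'
  -- Multiplying by the exact denominator leaves only differences of squares. With the score bounded
  -- by 1, the first summand contributes 3e + 3e and the second 12e / 2.
  have key : (‖G‖ ^ 2 + ‖H‖ ^ 2) * (cscore G' H' - cscore G H) =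
      cscore G' H' * ((‖G‖ ^ 2 - ‖G'‖ ^ 2) + (‖H‖ ^ 2 - ‖H'‖ ^ 2)) +
        (‖G' + H'‖ ^ 2 - ‖G + H‖ ^ 2) / 2 := by
    linear_combination e2 - e1
  calc ‖G‖ ^ 2 * |cscore G' H' - cscore G H|
      ≤ (‖G‖ ^ 2 + ‖H‖ ^ 2) * |cscore G' H' - cscore G H| := by
        gcongr
        linarith [sq_nonneg ‖H‖]
    _ = |(‖G‖ ^ 2 + ‖H‖ ^ 2) * (cscore G' H' - cscore G H)| := by
        rw [abs_mul, abs_of_nonneg (by positivity : 0 ≤ ‖G‖ ^ 2 + ‖H‖ ^ 2)]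
    _ ≤ 12 * e := by
        rw [key]
        have h6 : |cscore G' H' * ((‖G‖ ^ 2 - ‖G'‖ ^ 2) + (‖H‖ ^ 2 - ‖H'‖ ^ 2))| ≤ 6 * e := by
          rw [abs_mul, abs_of_nonneg hx0]
          have h7 := (abs_add_le (‖G‖ ^ 2 - ‖G'‖ ^ 2) (‖H‖ ^ 2 - ‖H'‖ ^ 2)).trans
            (add_le_add h1 h2)
          have h8 := abs_nonneg ((‖G‖ ^ 2 - ‖G'‖ ^ 2) + (‖H‖ ^ 2 - ‖H'‖ ^ 2))
          nlinarith
        have h9 : |(‖G' + H'‖ ^ 2 - ‖G + H‖ ^ 2) / 2| ≤ 6 * e := by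
          rw [abs_div, abs_sub_comm, abs_of_pos (by norm_num : (0 : ℝ) < 2)]
          linarith
        exact (abs_add_le _ _).trans (by linarith)

/-- One factor is replaced at a time; the perturbed factors have norm at most 1 + e ≤ 2. The
exponential constant is affordable because precision costs only its logarithm. -/
theorem norm_prod_sub_prod_le {ι E : Type*} [NormedField E] (s : Finset ι) (a b : ι → E) {e : ℝ}
    (he : 0 ≤ e) (he1 : e ≤ 1) (ha : ∀ i ∈ s, ‖a i‖ ≤ 1) (hab : ∀ i ∈ s, ‖b i - a i‖ ≤ e) :
    ‖∏ i ∈ s, b i - ∏ i ∈ s, a i‖ ≤ (2 ^ s.card - 1) * e := by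
  classical
  induction s using Finset.induction_on with
  | empty => simp
  | insert i s hi ih =>
    rw [Finset.prod_insert hi, Finset.prod_insert hi, Finset.card_insert_of_notMem hi]
    have h1 := ih (fun j hj => ha j (by simp [hj])) (fun j hj => hab j (by simp [hj]))
    have h2 := ha i (by simp)
    have h3 := hab i (by simp)
    have h4 : ‖∏ j ∈ s, a j‖ ≤ 1 := by
      rw [norm_prod]
      exact Finset.prod_le_one (fun j _ => norm_nonneg _) (fun j hj => ha j (by simp [hj]))
    have h5 : ‖b i‖ ≤ 1 + e := by
      have := norm_add_le (b i - a i) (a i)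
      rw [sub_add_cancel] at this
      linarith
    have h6 : (1 : ℝ) ≤ 2 ^ s.card := one_le_pow₀ (by norm_num)
    calc ‖b i * ∏ j ∈ s, b j - a i * ∏ j ∈ s, a j‖
        = ‖b i * (∏ j ∈ s, b j - ∏ j ∈ s, a j) + (b i - a i) * ∏ j ∈ s, a j‖ := by
          congr 1; ring
      _ ≤ ‖b i‖ * ‖∏ j ∈ s, b j - ∏ j ∈ s, a j‖ + ‖b i - a i‖ * ‖∏ j ∈ s, a j‖ := by
          refine (norm_add_le _ _).trans ?_
          rw [norm_mul, norm_mul]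
      _ ≤ (1 + e) * ((2 ^ s.card - 1) * e) + e * 1 := by gcongr
      _ ≤ (2 ^ (s.card + 1) - 1) * e := by
          rw [pow_succ]
          nlinarith [mul_nonneg he he, mul_nonneg (sub_nonneg.2 h6) he,
            mul_nonneg (mul_nonneg (sub_nonneg.2 h6) he) (sub_nonneg.2 he1)]

/-! ### The probabilities of prefixes -/

section Prefix

variable {n : ℕ} {d : Fin n → ℕ}

/-- A basis label has the prescribed digits. -/
def Fits (Y : ∀ k, Option (Fin (d k))) (c : Basis d) : Prop := ∀ k, ∀ y ∈ Y k, c k = y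

open Classical in
/-- The probability that a measurement gives the prescribed digits. -/
def prefixProb (ψ : Basis d → ℂ) (Y : ∀ k, Option (Fin (d k))) : ℝ :=
  ∑ c, if Fits Y c then ‖ψ c‖ ^ 2 else 0

/-- The amplitude of a digit with respect to the prescribed row. -/
def rowAmp (u : ∀ k, Matrix (Fin (d k)) (Fin (d k)) ℂ) (Y : ∀ k, Option (Fin (d k))) (k : Fin n)
    (b : Fin (d k)) : ℂ := (Y k).elim 1 fun y => u k y b

/-- The probability of the digit `b`, where `a` was the digit before. -/
def digitProb (u : ∀ k, Matrix (Fin (d k)) (Fin (d k)) ℂ) (Y : ∀ k, Option (Fin (d k)))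
    (k : Fin n) (a b : Fin (d k)) : ℝ :=
  (Y k).elim (if b = a then 1 else 0) fun y => ‖u k y b‖ ^ 2

/-- The amplitude of a pair of basis labels. -/
def pairAmp (u : ∀ k, Matrix (Fin (d k)) (Fin (d k)) ℂ) (φ : Basis d → ℂ)
    (Y : ∀ k, Option (Fin (d k))) (x z : Basis d) : ℂ :=
  φ x * conj (∏ k, rowAmp u Y k (z k))

/-- The exact distribution of pairs of basis labels. -/
def pairProb (u : ∀ k, Matrix (Fin (d k)) (Fin (d k)) ℂ) (φ : Basis d → ℂ)
    (Y : ∀ k, Option (Fin (d k))) (x z : Basis d) : ℝ :=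
  ‖φ x‖ ^ 2 * ∏ k, digitProb u Y k (x k) (z k)

variable (u : ∀ k, Matrix.unitaryGroup (Fin (d k)) ℂ) (φ : Basis d → ℂ)
  (Y : ∀ k, Option (Fin (d k)))

theorem unitary_row_sum {m : ℕ} (v : Matrix.unitaryGroup (Fin m) ℂ) (y : Fin m) :
    ∑ b, ‖v.1 y b‖ ^ 2 = 1 := by
  have h := congrFun (congrFun (Matrix.mem_unitaryGroup_iff.1 v.2) y) y
  rw [Matrix.mul_apply, Matrix.one_apply_eq] at h
  simp only [Matrix.star_apply, Complex.star_def, Complex.mul_conj, Complex.normSq_eq_norm_sq] at h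
  exact_mod_cast h

theorem unitary_col_orth {m : ℕ} (v : Matrix.unitaryGroup (Fin m) ℂ) (a b : Fin m) :
    ∑ c, v.1 c a * conj (v.1 c b) = if a = b then 1 else 0 := by
  have h := congrFun (congrFun (Matrix.mem_unitaryGroup_iff'.1 v.2) b) a
  rw [Matrix.mul_apply, Matrix.one_apply] at h
  simp only [Matrix.star_apply, Complex.star_def] at h
  rw [show (if a = b then (1 : ℂ) else 0) = if b = a then 1 else 0 by simp [eq_comm], ← h]
  exact Finset.sum_congr rfl fun c _ => mul_comm _ _

theorem digitProb_nonneg (w : ∀ k, Matrix (Fin (d k)) (Fin (d k)) ℂ) (k : Fin n)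
    (a b : Fin (d k)) : 0 ≤ digitProb w Y k a b := by
  unfold digitProb
  cases Y k with
  | none => simp only [Option.elim]; split_ifs <;> norm_num
  | some y => simp only [Option.elim]; positivity

theorem pairProb_nonneg (x z : Basis d) : 0 ≤ pairProb (fun k => (u k).1) φ Y x z :=
  mul_nonneg (sq_nonneg _) (Finset.prod_nonneg fun k _ => digitProb_nonneg Y _ k _ _)

theorem digitProb_sum (k : Fin n) (a : Fin (d k)) :
    ∑ b, digitProb (fun k => (u k).1) Y k a b = 1 := by
  unfold digitProb
  cases Y k with
  | none => simp
  | some y => simpa using unitary_row_sum (u k) y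

theorem digitProb_le_one (k : Fin n) (a b : Fin (d k)) :
    digitProb (fun k => (u k).1) Y k a b ≤ 1 := by
  rw [← digitProb_sum u Y k a]
  exact Finset.single_le_sum (fun b _ => digitProb_nonneg Y _ k a b) (Finset.mem_univ b)

theorem sum_prod_digitProb (x : Basis d) :
    ∑ z : Basis d, ∏ k, digitProb (fun k => (u k).1) Y k (x k) (z k) = 1 := by
  have := Finset.prod_univ_sum (fun k => (Finset.univ : Finset (Fin (d k))))
    (fun k b => digitProb (fun k => (u k).1) Y k (x k) b)
  rw [Fintype.piFinset_univ] at this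
  rw [← this]
  exact Finset.prod_eq_one fun k _ => digitProb_sum u Y k (x k)

/-- The amplitudes that vanish where the digits that are not prescribed do not coincide. -/
def kernelAmp (w : ∀ k, Matrix (Fin (d k)) (Fin (d k)) ℂ) (x z : Basis d) : ℂ :=
  φ x * ∏ k, (Y k).elim (if x k = z k then 1 else 0) fun y => conj (w k y (z k))

theorem norm_kernelAmp_sq (w : ∀ k, Matrix (Fin (d k)) (Fin (d k)) ℂ) (x z : Basis d) :
    ‖kernelAmp φ Y w x z‖ ^ 2 = pairProb w φ Y x z := by
  rw [kernelAmp, pairProb, norm_mul, mul_pow, norm_prod, ← Finset.prod_pow]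
  congr 1
  refine Finset.prod_congr rfl fun k _ => ?_
  unfold digitProb
  cases Y k with
  | none => by_cases h : x k = z k <;> simp [h, eq_comm]
  | some y => simp

/-- The program computes `pairAmp`, which lacks the Kronecker deltas of `kernelAmp`. They differ
only where a free digit of x and z differs, and such pairs are never drawn. -/
theorem pairProb_mul_cscore (w : ∀ k, Matrix (Fin (d k)) (Fin (d k)) ℂ) (x z : Basis d) :
    pairProb w φ Y x z * cscore (pairAmp w φ Y x z) (pairAmp w φ Y z x) =
      ‖kernelAmp φ Y w x z‖ ^ 2 * cscore (kernelAmp φ Y w x z) (kernelAmp φ Y w z x) := by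
  rw [norm_kernelAmp_sq]
  by_cases h : ∀ k, Y k = none → x k = z k
  · have h1 : ∀ x z : Basis d, (∀ k, Y k = none → x k = z k) →
        kernelAmp φ Y w x z = pairAmp w φ Y x z := by
      intro x z h
      rw [kernelAmp, pairAmp, map_prod]
      congr 1
      refine Finset.prod_congr rfl fun k _ => ?_
      unfold rowAmp
      cases hk : Y k with
      | none => simp [h k hk]
      | some y => simp
    rw [h1 x z h, h1 z x fun k hk => (h k hk).symm]
  · push Not at h
    obtain ⟨k, hk, hxz⟩ := h
    have : pairProb w φ Y x z = 0 := by
      rw [pairProb, Finset.prod_eq_zero (Finset.mem_univ k), mul_zero]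
      simp [digitProb, hk, Ne.symm hxz]
    rw [this, zero_mul, zero_mul]

-- The quadratic form of the measurement, expanded in pairs of labels. At a free position the sum
-- over the measured digit collapses to a Kronecker delta, since the columns of u_k are orthonormal;
-- at a prescribed one only a single row survives.
open Classical in
theorem sum_kernelAmp_mul_conj : ∑ x, ∑ z, kernelAmp φ Y (fun k => (u k).1) x z *
    conj (kernelAmp φ Y (fun k => (u k).1) z x) =
      (prefixProb (tensor (fun k => (u k).1) *ᵥ φ) Y : ℂ) := by
  -- The identity for one qudit: the admissible measured digits c are summed over.
  have h1 : ∀ (k : Fin n) (a b : Fin (d k)),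
      ((Y k).elim (if a = b then 1 else 0) fun y => conj ((u k).1 y b)) *
        conj ((Y k).elim (if b = a then 1 else 0) fun y => conj ((u k).1 y a)) =
      ∑ c, if ∀ y ∈ Y k, c = y then (u k).1 c a * conj ((u k).1 c b) else 0 := by
    intro k a b
    cases Y k with
    | none =>
      simp only [Option.elim, Option.not_mem_none, IsEmpty.forall_iff, implies_true, if_true]
      rw [unitary_col_orth]
      by_cases h : a = b
      · simp [h]
      · simp [h]
    | some y =>
      simp only [Option.elim, Option.mem_def, Option.some.injEq, forall_eq', Complex.conj_conj]
      rw [Finset.sum_ite_eq' Finset.univ y]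
      simp [mul_comm]
  -- The product over the qudits of sums over digits becomes a sum over labels; those that violate
  -- the prescription contain a vanishing factor.
  have h2 : ∀ x z : Basis d, kernelAmp φ Y (fun k => (u k).1) x z *
      conj (kernelAmp φ Y (fun k => (u k).1) z x) =
      ∑ c : Basis d, if Fits Y c then
        (tensor (fun k => (u k).1) c x * φ x) * conj (tensor (fun k => (u k).1) c z * φ z)
        else 0 := by
    intro x z
    rw [kernelAmp, kernelAmp, map_mul, mul_mul_mul_comm, map_prod, ← Finset.prod_mul_distrib]
    rw [Finset.prod_congr rfl fun k _ => h1 k (x k) (z k), Finset.prod_univ_sum,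
      Fintype.piFinset_univ, Finset.mul_sum]
    refine Finset.sum_congr rfl fun c _ => ?_
    by_cases hc : Fits Y c
    · rw [if_pos hc, Finset.prod_congr rfl fun k _ => if_pos (hc k)]
      simp only [tensor, Matrix.of_apply, map_mul, map_prod, Finset.prod_mul_distrib]
      ring
    · rw [if_neg hc]
      unfold Fits at hc
      push Not at hc
      obtain ⟨k, y, hy, hne⟩ := hc
      rw [Finset.prod_eq_zero (Finset.mem_univ k), mul_zero]
      rw [if_neg]
      intro h
      exact hne (h y hy)
  simp only [h2]
  rw [prefixProb]
  push_cast
  rw [Finset.sum_congr rfl fun x _ => Finset.sum_comm, Finset.sum_comm]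
  refine Finset.sum_congr rfl fun c _ => ?_
  by_cases hc : Fits Y c
  · simp only [if_pos hc]
    simp only [← Finset.mul_sum, ← Finset.sum_mul, ← map_sum]
    have h3 : ∑ x, tensor (fun k => (u k).1) c x * φ x =
      (tensor (fun k => (u k).1) *ᵥ φ) c := rfl
    rw [h3, Complex.mul_conj, Complex.normSq_eq_norm_sq]
  · simp [hc]

/-- The expectation of the score. -/
theorem sum_pairProb_mul_cscore (hφ : ∑ x, ‖φ x‖ ^ 2 = 1) :
    ∑ x, ∑ z, pairProb (fun k => (u k).1) φ Y x z *
      cscore (pairAmp (fun k => (u k).1) φ Y x z) (pairAmp (fun k => (u k).1) φ Y z x) =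
      (1 + prefixProb (tensor (fun k => (u k).1) *ᵥ φ) Y) / 2 := by
  set w : ∀ k, Matrix (Fin (d k)) (Fin (d k)) ℂ := fun k => (u k).1 with hw
  set K := kernelAmp φ Y w with hK
  simp only [pairProb_mul_cscore]
  have h1 : ∑ x, ∑ z, ‖K x z‖ ^ 2 = 1 := by
    simp only [hK, norm_kernelAmp_sq, pairProb, ← Finset.mul_sum]
    rw [Finset.sum_congr rfl fun x _ => by rw [hw, sum_prod_digitProb u Y x, mul_one], hφ]
  have h2 : ∑ x, ∑ z, (K x z * conj (K z x)).re = prefixProb (tensor w *ᵥ φ) Y := by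
    have := sum_kernelAmp_mul_conj u φ Y
    have h3 := congrArg Complex.re this
    simpa only [Complex.re_sum, Complex.ofReal_re] using h3
  -- Expanding |G+H|² isolates the real part of G · conj H, the term whose sum is the desired
  -- probability.
  have h4 : ∀ x z, (‖K x z‖ ^ 2 + ‖K z x‖ ^ 2) * cscore (K x z) (K z x) =
      (‖K x z‖ ^ 2 + ‖K z x‖ ^ 2) / 2 + (K x z * conj (K z x)).re := by
    intro x z
    rw [mul_comm, cscore_mul, ← Complex.normSq_eq_norm_sq, ← Complex.normSq_eq_norm_sq,
      ← Complex.normSq_eq_norm_sq, Complex.normSq_add]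
    ring
  -- By symmetry of the score, the weights |K(x,z)|² and |K(z,x)|² give the same mean, so the mean
  -- can be computed with their average, which cancels the denominator.
  have h5 : ∑ x, ∑ z, ‖K z x‖ ^ 2 * cscore (K x z) (K z x) =
      ∑ x, ∑ z, ‖K x z‖ ^ 2 * cscore (K x z) (K z x) := by
    rw [Finset.sum_comm]
    refine Finset.sum_congr rfl fun x _ => Finset.sum_congr rfl fun z _ => ?_
    rw [cscore_comm]
  have h6 : ∑ x, ∑ z, (‖K x z‖ ^ 2 + ‖K z x‖ ^ 2) * cscore (K x z) (K z x) =
      2 * ∑ x, ∑ z, ‖K x z‖ ^ 2 * cscore (K x z) (K z x) := by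
    simp only [add_mul, Finset.sum_add_distrib]
    rw [h5]
    ring
  have h7 : ∑ x, ∑ z, ‖K z x‖ ^ 2 = 1 := by rw [Finset.sum_comm]; exact h1
  simp only [h4, Finset.sum_add_distrib, add_div, ← Finset.sum_div, h1, h7, h2] at h6
  linarith

theorem abs_sum_mul_le {ι : Type*} (s : Finset ι) (f g : ι → ℝ) {c : ℝ} (hg : ∀ i ∈ s, |g i| ≤ c) :
    |∑ i ∈ s, f i * g i| ≤ (∑ i ∈ s, |f i|) * c := by
  refine (Finset.abs_sum_le_sum_abs _ _).trans ?_
  rw [Finset.sum_mul]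
  refine Finset.sum_le_sum fun i hi => ?_
  rw [abs_mul]
  exact mul_le_mul_of_nonneg_left (hg i hi) (abs_nonneg _)

/-- The expectation of an approximate score with respect to an approximate distribution. -/
theorem abs_mean_sub_le (hφ : ∑ x, ‖φ x‖ ^ 2 = 1) (μ : Basis d → ℝ)
    (ν : Basis d → ∀ k, Fin (d k) → ℝ) (sc : Basis d → Basis d → ℝ) {e₁ e₂ e₃ : ℝ}
    (hμ : ∑ x, |μ x - ‖φ x‖ ^ 2| ≤ e₁)
    (he₂ : 0 ≤ e₂) (he₂' : e₂ ≤ 1) (hν0 : ∀ x k b, 0 ≤ ν x k b) (hν1 : ∀ x k, ∑ b, ν x k b = 1)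
    (hν : ∀ x k b, |ν x k b - digitProb (fun k => (u k).1) Y k (x k) b| ≤ e₂)
    (hsc0 : ∀ x z, 0 ≤ sc x z) (hsc1 : ∀ x z, sc x z ≤ 1)
    (hsc : ∀ x z, pairProb (fun k => (u k).1) φ Y x z *
      |sc x z - cscore (pairAmp (fun k => (u k).1) φ Y x z)
        (pairAmp (fun k => (u k).1) φ Y z x)| ≤ e₃) :
    |∑ x, μ x * ∑ z : Basis d, (∏ k, ν x k (z k)) * sc x z -
      (1 + prefixProb (tensor (fun k => (u k).1) *ᵥ φ) Y) / 2| ≤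
      e₁ + Fintype.card (Basis d) * (2 ^ n * e₂) + Fintype.card (Basis d) ^ 2 * e₃ := by
  set w : ∀ k, Matrix (Fin (d k)) (Fin (d k)) ℂ := fun k => (u k).1 with hw
  set X : Basis d → Basis d → ℝ := fun x z =>
    cscore (pairAmp w φ Y x z) (pairAmp w φ Y z x) with hX
  set D : Basis d → Basis d → ℝ := fun x z => ∏ k, digitProb w Y k (x k) (z k) with hD
  have hνs : ∀ x, ∑ z : Basis d, ∏ k, ν x k (z k) = 1 := by
    intro x
    have := Finset.prod_univ_sum (fun k => (Finset.univ : Finset (Fin (d k)))) (fun k b => ν x k b)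
    rw [Fintype.piFinset_univ] at this
    rw [← this]
    exact Finset.prod_eq_one fun k _ => hν1 x k
  have hsca : ∀ x z, |sc x z| ≤ 1 := fun x z => by
    rw [abs_of_nonneg (hsc0 x z)]; exact hsc1 x z
  have h1 : ∀ x, |∑ z : Basis d, (∏ k, ν x k (z k)) * sc x z| ≤ 1 := by
    intro x
    refine (abs_sum_mul_le _ _ _ fun z _ => hsca x z).trans ?_
    rw [mul_one, Finset.sum_congr rfl fun z _ => abs_of_nonneg
      (Finset.prod_nonneg fun k _ => hν0 x k (z k)), hνs]
  have h2 : |∑ x, (μ x - ‖φ x‖ ^ 2) * ∑ z : Basis d, (∏ k, ν x k (z k)) * sc x z| ≤ e₁ :=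
    (abs_sum_mul_le _ _ _ fun x _ => h1 x).trans (by simpa using hμ)
  have h3 : ∀ x, |∑ z : Basis d, ((∏ k, ν x k (z k)) - D x z) * sc x z| ≤
      Fintype.card (Basis d) * (2 ^ n * e₂) := by
    intro x
    refine (abs_sum_mul_le _ _ _ fun z _ => hsca x z).trans ?_
    rw [mul_one]
    refine (Finset.sum_le_card_nsmul _ _ (2 ^ n * e₂) fun z _ => ?_).trans ?_
    · have := norm_prod_sub_prod_le (E := ℝ) Finset.univ
        (fun k => digitProb w Y k (x k) (z k)) (fun k => ν x k (z k)) he₂ he₂'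
        (fun k _ => by
          rw [Real.norm_eq_abs, abs_of_nonneg (digitProb_nonneg Y w k _ _)]
          exact digitProb_le_one u Y k _ _)
        (fun k _ => hν x k (z k))
      rw [Real.norm_eq_abs, Finset.card_univ, Fintype.card_fin] at this
      refine this.trans ?_
      nlinarith
    · simp [Finset.card_univ]
  have h4 : |∑ x, ‖φ x‖ ^ 2 * ∑ z : Basis d, ((∏ k, ν x k (z k)) - D x z) * sc x z| ≤
      Fintype.card (Basis d) * (2 ^ n * e₂) := by
    refine (abs_sum_mul_le _ _ _ fun x _ => h3 x).trans ?_
    simp [hφ]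
  have h5 : |∑ x, ∑ z, pairProb w φ Y x z * (sc x z - X x z)| ≤
      Fintype.card (Basis d) ^ 2 * e₃ := by
    refine (Finset.abs_sum_le_sum_abs _ _).trans ?_
    have : ∀ x : Basis d, |∑ z, pairProb w φ Y x z * (sc x z - X x z)| ≤
        Fintype.card (Basis d) * e₃ := by
      intro x
      refine (Finset.abs_sum_le_sum_abs _ _).trans ?_
      refine (Finset.sum_le_card_nsmul _ _ e₃ fun z _ => ?_).trans (by simp [Finset.card_univ])
      rw [abs_mul, abs_of_nonneg (pairProb_nonneg u φ Y x z)]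
      exact hsc x z
    refine (Finset.sum_le_card_nsmul _ _ _ fun x _ => this x).trans ?_
    simp only [Finset.card_univ, nsmul_eq_mul]
    rw [sq, mul_assoc]
  have h6 := sum_pairProb_mul_cscore u φ Y hφ
  rw [← hw] at h6
  -- Three successive replacements: the distribution of x, the distribution of the redrawn digits,
  -- and finally the score.
  have h7 : ∑ x, μ x * ∑ z : Basis d, (∏ k, ν x k (z k)) * sc x z -
      (1 + prefixProb (tensor w *ᵥ φ) Y) / 2 =
      ∑ x, (μ x - ‖φ x‖ ^ 2) * ∑ z : Basis d, (∏ k, ν x k (z k)) * sc x z +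
      ∑ x, ‖φ x‖ ^ 2 * ∑ z : Basis d, ((∏ k, ν x k (z k)) - D x z) * sc x z +
      ∑ x, ∑ z, pairProb w φ Y x z * (sc x z - X x z) := by
    rw [← h6, ← Finset.sum_sub_distrib, ← Finset.sum_add_distrib, ← Finset.sum_add_distrib]
    refine Finset.sum_congr rfl fun x _ => ?_
    simp only [sub_mul, mul_sub, Finset.sum_sub_distrib, pairProb, mul_assoc, ← Finset.mul_sum]
    simp only [hX, hD]
    ring
  rw [h7]
  exact (abs_add_three _ _ _).trans (by linarith)

end Prefix

end SparseSim

end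

noncomputable section

namespace SparseSim

open Enc

/-! ### Expectations and large deviations -/

/-- The expectation of a nonnegative function. -/
def expect {α : Type*} (p : PMF α) (f : α → ENNReal) : ENNReal := ∑' a, p a * f a

theorem expect_bind {α β : Type*} (p : PMF α) (q : α → PMF β) (f : β → ENNReal) :
    expect (p.bind q) f = expect p fun a => expect (q a) f := by
  simp only [expect, PMF.bind_apply, ← ENNReal.tsum_mul_right, ← ENNReal.tsum_mul_left]
  rw [ENNReal.tsum_comm]
  simp only [mul_assoc]

theorem expect_pure {α : Type*} (a : α) (f : α → ENNReal) : expect (PMF.pure a) f = f a := by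
  rw [expect, tsum_eq_single a]
  · simp
  · intro b hb
    simp [PMF.pure_apply, hb]

theorem expect_map {α β : Type*} (p : PMF α) (g : α → β) (f : β → ENNReal) :
    expect (p.map g) f = expect p fun a => f (g a) := by
  rw [PMF.map, expect_bind]
  simp only [Function.comp, expect_pure]

theorem expect_const_mul {α : Type*} (p : PMF α) (c : ENNReal) (f : α → ENNReal) :
    expect p (fun a => c * f a) = c * expect p f := by
  simp only [expect, ← ENNReal.tsum_mul_left]
  exact tsum_congr fun a => by ring

theorem expect_fintype {α : Type*} [Fintype α] (p : PMF α) (f : α → ENNReal)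
    (hf : ∀ a, f a ≠ ⊤) : (expect p f).toReal = ∑ a, (p a).toReal * (f a).toReal := by
  rw [expect, tsum_fintype, ENNReal.toReal_sum fun a _ =>
    ENNReal.mul_ne_top (p.apply_ne_top a) (hf a)]
  exact Finset.sum_congr rfl fun a _ => ENNReal.toReal_mul

/-- Independence: the expectation of the product of functions of the samples factorizes. -/
theorem expect_mapP {β γ : Type*} (p : PMF γ) (l : List β) (g : γ → ENNReal) :
    expect (mapP (fun _ => p) l) (fun r => (r.map g).prod) = expect p g ^ l.length := by
  induction l with
  | nil => simp [mapP, expect_pure]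
  | cons b l ih =>
    simp only [mapP, expect_bind, expect_map, List.map_cons, List.prod_cons, expect_const_mul, ih,
      List.length_cons, pow_succ]
    simp only [mul_comm (g _), expect_const_mul]

theorem toOuterMeasure_mul_le_expect {α : Type*} (p : PMF α) (s : Set α) (c : ENNReal)
    (f : α → ENNReal) (h : ∀ a ∈ p.support, a ∈ s → c ≤ f a) :
    c * p.toOuterMeasure s ≤ expect p f := by
  rw [PMF.toOuterMeasure_apply, ← ENNReal.tsum_mul_left]
  refine ENNReal.tsum_le_tsum fun a => ?_
  by_cases ha : p a = 0
  · by_cases hs : a ∈ s <;> simp [ha, hs]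
  · by_cases hs : a ∈ s
    · rw [Set.indicator_of_mem hs, mul_comm]
      gcongr
      exact h a ha hs
    · simp [hs]

section Deviation

variable {p : PMF ℕ} {Q : ℕ}

theorem expect_eq_ofReal_sum (hp : ∀ c ∈ p.support, c ≤ Q) (f : ℕ → ℝ) (hf : ∀ c, 0 ≤ f c) :
    expect p (fun c => ENNReal.ofReal (f c)) =
      ENNReal.ofReal (∑ c ∈ Finset.range (Q + 1), (p c).toReal * f c) := by
  rw [expect, tsum_eq_sum (s := Finset.range (Q + 1)), ENNReal.ofReal_sum_of_nonneg]
  · refine Finset.sum_congr rfl fun c _ => ?_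
    rw [ENNReal.ofReal_mul ENNReal.toReal_nonneg, ENNReal.ofReal_toReal (p.apply_ne_top c)]
  · exact fun c _ => mul_nonneg ENNReal.toReal_nonneg (hf c)
  · intro c hc
    have : p c = 0 := by
      by_contra h
      have := hp c h
      simp at hc
      omega
    simp [this]

theorem sum_range_eq_one (hp : ∀ c ∈ p.support, c ≤ Q) :
    ∑ c ∈ Finset.range (Q + 1), (p c).toReal = 1 := by
  have h := expect_eq_ofReal_sum hp (fun _ => 1) (fun _ => zero_le_one)
  have h1 : expect p (fun _ => ENNReal.ofReal 1) = 1 := by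
    simp [expect, p.tsum_coe]
  rw [h1] at h
  simp only [mul_one] at h
  have h2 : 0 ≤ ∑ c ∈ Finset.range (Q + 1), (p c).toReal :=
    Finset.sum_nonneg fun _ _ => ENNReal.toReal_nonneg
  have := congrArg ENNReal.toReal h
  rw [ENNReal.toReal_ofReal h2] at this
  simpa using this.symm

/-- The mean, as a fraction of the upper bound. -/
def meanFrac (p : PMF ℕ) (Q : ℕ) : ℝ := (expect p fun c => (c : ENNReal)).toReal / Q

theorem meanFrac_eq (hp : ∀ c ∈ p.support, c ≤ Q) :
    meanFrac p Q = ∑ c ∈ Finset.range (Q + 1), (p c).toReal * (c / Q) := by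
  have h := expect_eq_ofReal_sum hp (fun c => (c : ℝ)) (fun _ => Nat.cast_nonneg _)
  simp only [ENNReal.ofReal_natCast] at h
  rw [meanFrac, h, ENNReal.toReal_ofReal, Finset.sum_div]
  · exact Finset.sum_congr rfl fun c _ => by ring
  · exact Finset.sum_nonneg fun _ _ => mul_nonneg ENNReal.toReal_nonneg (Nat.cast_nonneg _)

theorem frac_mem {c : ℕ} (hc : c ≤ Q) : (0 : ℝ) ≤ c / Q ∧ (c / Q : ℝ) ≤ 1 :=
  ⟨by positivity, div_le_one_of_le₀ (by exact_mod_cast hc) (Nat.cast_nonneg _)⟩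

theorem meanFrac_mem (hp : ∀ c ∈ p.support, c ≤ Q) : 0 ≤ meanFrac p Q ∧ meanFrac p Q ≤ 1 := by
  rw [meanFrac_eq hp]
  refine ⟨Finset.sum_nonneg fun c _ => mul_nonneg ENNReal.toReal_nonneg (by positivity), ?_⟩
  rw [← sum_range_eq_one hp]
  refine Finset.sum_le_sum fun c hc => ?_
  have := frac_mem (Q := Q) (c := c) (by simp at hc; omega)
  nlinarith [ENNReal.toReal_nonneg (a := p c)]

/-- For |s| ≤ 1 one has exp s ≤ 1 + s + s². The linear term has mean zero, and 1 + t² ≤ exp (t²). -/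
theorem expect_exp_le (hp : ∀ c ∈ p.support, c ≤ Q) {t : ℝ} (ht : |t| ≤ 1) :
    expect p (fun c => ENNReal.ofReal (Real.exp (t * (c / Q - meanFrac p Q)))) ≤
      ENNReal.ofReal (Real.exp (t ^ 2)) := by
  rw [expect_eq_ofReal_sum hp _ fun c => (Real.exp_pos _).le]
  refine ENNReal.ofReal_le_ofReal ?_
  set m := meanFrac p Q with hm
  have hm' := meanFrac_mem hp
  have h1 : ∀ c ∈ Finset.range (Q + 1), (p c).toReal * Real.exp (t * (c / Q - m)) ≤
      (p c).toReal * (1 + t * (c / Q - m) + t ^ 2) := by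
    intro c hc
    refine mul_le_mul_of_nonneg_left ?_ ENNReal.toReal_nonneg
    have h2 := frac_mem (Q := Q) (c := c) (by simp at hc; omega)
    have h3 : |(c / Q - m : ℝ)| ≤ 1 := by rw [abs_le]; constructor <;> linarith
    have h4 : |t * (c / Q - m)| ≤ 1 := by
      rw [abs_mul]
      nlinarith [abs_nonneg t, abs_nonneg (c / Q - m : ℝ)]
    have h5 := Real.abs_exp_sub_one_sub_id_le h4
    have h6 := (abs_le.1 h5).2
    have h7 : (t * (c / Q - m)) ^ 2 ≤ t ^ 2 := by
      rw [mul_pow]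
      have : (c / Q - m : ℝ) ^ 2 ≤ 1 := by rw [sq_le_one_iff_abs_le_one]; exact h3
      nlinarith [sq_nonneg t]
    linarith
  refine (Finset.sum_le_sum h1).trans ?_
  have h2 : ∑ c ∈ Finset.range (Q + 1), (p c).toReal * (1 + t * (c / Q - m) + t ^ 2) =
      1 + t ^ 2 := by
    have e1 := sum_range_eq_one hp
    have e2 := meanFrac_eq hp
    calc _ = (∑ c ∈ Finset.range (Q + 1), (p c).toReal) * (1 + t ^ 2 - t * m) +
          t * ∑ c ∈ Finset.range (Q + 1), (p c).toReal * (c / Q) := by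
          rw [Finset.sum_mul, Finset.mul_sum, ← Finset.sum_add_distrib]
          exact Finset.sum_congr rfl fun c _ => by ring
      _ = _ := by rw [e1, ← e2, ← hm]; ring
  rw [h2]
  linarith [Real.add_one_le_exp (t ^ 2)]

/-- Markov's inequality for the exponential moment. The relation between t and η is invariant under
a change of both signs, so one statement covers the upper tail (t = η / 2) and the lower one. -/
theorem tail_le {β : Type*} (hp : ∀ c ∈ p.support, c ≤ Q) (N : List β) {η t : ℝ}
    (ht : |t| ≤ 1) (hη : t ^ 2 = t * η / 2) :
    (mapP (fun _ => p) N).toOuterMeasure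
      {l | t * (η * N.length) < t * (l.sum / Q - N.length * meanFrac p Q)} ≤
      ENNReal.ofReal (Real.exp (-(N.length * t ^ 2))) := by
  set m := meanFrac p Q
  have h1 := toOuterMeasure_mul_le_expect (mapP (fun _ => p) N)
    {l | t * (η * N.length) < t * (l.sum / Q - N.length * m)}
    (ENNReal.ofReal (Real.exp (t * (η * N.length))))
    (fun r => (r.map fun c : ℕ => ENNReal.ofReal (Real.exp (t * (c / Q - m)))).prod) (by
      intro l hl hs
      have hlen : l.length = N.length := (mem_support_mapP.1 hl).length_eq.symm
      have h2 : ∀ l : List ℕ, (l.map fun c : ℕ => ENNReal.ofReal (Real.exp (t * (c / Q - m)))).prod =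
          ENNReal.ofReal (Real.exp (t * (l.sum / Q - l.length * m))) := by
        intro l
        induction l with
        | nil => simp
        | cons c l ih =>
          rw [List.map_cons, List.prod_cons, ih, ← ENNReal.ofReal_mul (Real.exp_pos _).le,
            ← Real.exp_add]
          congr 2
          push_cast [List.sum_cons, List.length_cons]
          ring
      rw [h2, hlen]
      exact ENNReal.ofReal_le_ofReal (Real.exp_le_exp.2 (le_of_lt hs)))
  rw [expect_mapP] at h1
  have h2 := h1.trans (pow_le_pow_left' (expect_exp_le hp ht) _)
  rw [← ENNReal.ofReal_pow (Real.exp_pos _).le, ← Real.exp_nat_mul] at h2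
  have h3 : ENNReal.ofReal (Real.exp (-(N.length * t ^ 2))) =
      ENNReal.ofReal (Real.exp (-(t * (η * N.length)))) *
        ENNReal.ofReal (Real.exp (N.length * t ^ 2)) := by
    rw [← ENNReal.ofReal_mul (Real.exp_pos _).le, ← Real.exp_add]
    congr 2
    linear_combination (-2 * (N.length : ℝ)) * hη
  rw [h3]
  refine le_trans (le_of_eq ?_) (mul_le_mul_right h2 _)
  rw [← mul_assoc (ENNReal.ofReal _), ← ENNReal.ofReal_mul (Real.exp_pos _).le, ← Real.exp_add]
  simp

/-- The average of independent samples deviates from the mean with small probability. -/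
theorem deviation_le {β : Type*} (hp : ∀ c ∈ p.support, c ≤ Q) (N : List β) {η : ℝ}
    (h0 : 0 < η) (h1 : η ≤ 1) :
    (mapP (fun _ => p) N).toOuterMeasure
      {l | η * N.length < |l.sum / Q - N.length * meanFrac p Q|} ≤
      2 * ENNReal.ofReal (Real.exp (-(N.length * (η / 2) ^ 2))) := by
  have h2 := tail_le hp N (η := η) (t := η / 2) (by rw [abs_of_pos] <;> linarith) (by ring)
  have h3 := tail_le hp N (η := -η) (t := -(η / 2)) (by rw [abs_neg, abs_of_pos] <;> linarith)
    (by ring)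
  rw [neg_sq] at h3
  rw [two_mul]
  refine le_trans ?_ (add_le_add h2 h3)
  refine le_trans (MeasureTheory.measure_mono ?_) (MeasureTheory.measure_union_le _ _)
  intro l hl
  simp only [Set.mem_ofPred_eq, Set.mem_union, lt_abs] at hl ⊢
  rcases hl with h | h
  · left
    have : 0 < η / 2 := by linarith
    nlinarith
  · right
    have : 0 < η / 2 := by linarith
    nlinarith

end Deviation

/-! ### Failure probabilities -/

/-- The probability that the result does not satisfy `G` is at most `δ`. -/
def Fails {α : Type*} (p : PMF α) (G : α → Prop) (δ : ENNReal) : Prop :=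
  p.toOuterMeasure {a | ¬ G a} ≤ δ

theorem Fails.mono {α : Type*} {p : PMF α} {G G' : α → Prop} {δ δ' : ENNReal} (h : Fails p G δ)
    (hG : ∀ a ∈ p.support, G a → G' a) (hδ : δ ≤ δ') : Fails p G' δ' := by
  refine le_trans (p.toOuterMeasure_mono ?_) (le_trans h hδ)
  rintro a ⟨h1, h2⟩ h3
  exact h1 (hG a h2 h3)

theorem fails_map {α β : Type*} {p : PMF α} {f : α → β} {G : β → Prop} {δ : ENNReal} :
    Fails (p.map f) G δ ↔ Fails p (fun a => G (f a)) δ := by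
  unfold Fails
  rw [PMF.toOuterMeasure_map_apply]
  rfl

theorem fails_pure {α : Type*} {a : α} {G : α → Prop} (h : G a) : Fails (PMF.pure a) G 0 := by
  unfold Fails
  rw [PMF.toOuterMeasure_pure_apply]
  simp [h]

/-- The union bound for two stages: the second stage only has to succeed after a successful first
one. -/
theorem Fails.bind {α β : Type*} {p : PMF α} {q : α → PMF β} {G : α → Prop} {H : β → Prop}
    {δ₁ δ₂ : ENNReal} (hp : Fails p G δ₁) (hq : ∀ a ∈ p.support, G a → Fails (q a) H δ₂) :
    Fails (p.bind q) H (δ₁ + δ₂) := by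
  unfold Fails at *
  rw [PMF.toOuterMeasure_bind_apply]
  have h1 : ∀ a, p a * (q a).toOuterMeasure {b | ¬ H b} ≤
      {a | ¬ G a}.indicator p a + p a * δ₂ := by
    intro a
    by_cases ha : p a = 0
    · simp [ha]
    · by_cases hG : G a
      · refine le_trans ?_ le_add_self
        gcongr
        exact hq a ha hG
      · refine le_trans ?_ le_self_add
        rw [Set.indicator_of_mem (by exact hG)]
        refine mul_le_of_le_one_right' ?_
        calc (q a).toOuterMeasure _ ≤ (q a).toOuterMeasure Set.univ :=
              MeasureTheory.measure_mono (Set.subset_univ _)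
          _ = 1 := (PMF.toOuterMeasure_apply_eq_one_iff _ _).2 (Set.subset_univ _)
  refine (ENNReal.tsum_le_tsum h1).trans ?_
  rw [ENNReal.tsum_add, ENNReal.tsum_mul_right, p.tsum_coe, one_mul,
    ← PMF.toOuterMeasure_apply]
  gcongr

theorem fails_mapP {β γ : Type*} {f : β → PMF γ} {G : β → γ → Prop} {δ : ENNReal} (l : List β)
    (h : ∀ b ∈ l, Fails (f b) (G b) δ) :
    Fails (mapP f l) (fun r => List.Forall₂ G l r) (l.length * δ) := by
  induction l with
  | nil =>
    simp only [mapP, List.length_nil, Nat.cast_zero, zero_mul]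
    exact fails_pure List.Forall₂.nil
  | cons b l ih =>
    have h1 := (h b (by simp)).bind (q := fun c => (mapP f l).map fun r => c :: r)
      (H := fun r => List.Forall₂ G (b :: l) r) (δ₂ := l.length * δ) (by
        intro c _ hc
        rw [fails_map]
        exact (ih fun b hb => h b (by simp [hb])).mono (fun r _ hr => List.Forall₂.cons hc hr)
          le_rfl)
    refine h1.mono (fun _ _ h => h) ?_
    rw [List.length_cons]
    push_cast
    rw [add_mul, one_mul, add_comm]

theorem fails_pfold {β γ : Type*} {F : β → γ → PMF γ} (G : ℕ → γ → Prop) {δ : ENNReal}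
    (l : List β) (h : ∀ i c (hi : i < l.length), G i c → Fails (F l[i] c) (G (i + 1)) δ) (c : γ)
    (h0 : G 0 c) : Fails (pfold F l c) (G l.length) (l.length * δ) := by
  induction l generalizing c G with
  | nil => simpa [pfold] using fails_pure h0
  | cons b l ih =>
    have h1 := (h 0 c (by simp) h0).bind (q := pfold F l) (H := G (l.length + 1))
      (δ₂ := l.length * δ) (by
        intro c' _ hc'
        exact ih (fun i => G (i + 1)) (fun i c hi hc => h (i + 1) c (by simpa using hi) hc) c' hc')
    refine h1.mono (fun _ _ h => h) ?_
    rw [List.length_cons]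
    push_cast
    rw [add_mul, one_mul, add_comm]

theorem mem_support_pfold {β γ : Type*} {F : β → γ → PMF γ} (G : ℕ → γ → Prop)
    (l : List β) (h : ∀ i c (hi : i < l.length), G i c → ∀ c' ∈ (F l[i] c).support, G (i + 1) c')
    (c : γ) (h0 : G 0 c) : ∀ c' ∈ (pfold F l c).support, G l.length c' := by
  induction l generalizing c G with
  | nil =>
    intro c' hc'
    simp [pfold] at hc'
    subst hc'
    exact h0
  | cons b l ih =>
    intro c' hc'
    rw [pfold, PMF.mem_support_bind_iff] at hc'
    obtain ⟨c₁, h1, h2⟩ := hc'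
    exact ih (fun i => G (i + 1)) (fun i c hi hc => h (i + 1) c (by simpa using hi) hc) c₁
      (h 0 c (by simp) h0 c₁ h1) c' h2

end SparseSim

end

/-! ### The mean of the computed score -/

noncomputable section

namespace SparseSim

open Enc ComplexConjugate

/-- The complex number of a pair of integers. -/
def toC (z : ℤ × ℤ) : ℂ := (z.1 : ℂ) + (z.2 : ℂ) * Complex.I

theorem toC_gmul (z w : ℤ × ℤ) : toC (gmul z w) = toC z * toC w := by
  simp only [toC, gmul]
  push_cast
  linear_combination (-(z.2 : ℂ) * w.2) * Complex.I_mul_I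

theorem toC_gconj (z : ℤ × ℤ) : toC (gconj z) = conj (toC z) := by
  simp [toC, gconj]

theorem toC_add (z w : ℤ × ℤ) : toC (z + w) = toC z + toC w := by
  simp only [toC, Prod.fst_add, Prod.snd_add]
  push_cast
  ring

theorem norm_toC_sq (z : ℤ × ℤ) : ‖toC z‖ ^ 2 = (gsq z : ℝ) := by
  rw [← Complex.normSq_eq_norm_sq, Complex.normSq_apply]
  have h : ((gsq z : ℤ) : ℝ) = z.1 * z.1 + z.2 * z.2 := by rw [gsq_cast]; push_cast; ring
  rw [← Int.cast_natCast, h]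
  simp [toC]

theorem toC_gprod (l : List (ℤ × ℤ)) : toC (gprod l) = (l.map toC).prod := by
  have h : ∀ c, toC (l.foldl gmul c) = toC c * (l.map toC).prod := by
    induction l with
    | nil => simp
    | cons z l ih =>
      intro c
      rw [List.foldl_cons, ih, toC_gmul, List.map_cons, List.prod_cons, mul_assoc]
  rw [gprod, h]
  simp [toC]

theorem look_ofFn {m : ℕ} (r : Fin m → ℤ × ℤ) (i : Fin m) : look (List.ofFn r) i = r i := by
  have h1 : ((List.ofFn r).zipIdx.map fun p => if p.2 = (i : ℕ) then p.1 else (0, 0)) =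
      List.ofFn fun k : Fin m => if k = i then r k else 0 := by
    refine List.ext_getElem (by simp) ?_
    intro k h1 h2
    simp [Fin.ext_iff]
    rfl
  have h2 : ∀ l : List (ℤ × ℤ), gsum l = l.sum := fun l => (List.sum_eq_foldl).symm
  rw [look, h1, h2, List.sum_ofFn]
  simp

theorem abs_score_sub_le {μ : Type*} (M : List μ) (α β u v : ℤ × ℤ) :
    |(score M α β u v : ℝ) / 2 ^ M.length -
      cscore (toC α * conj (toC v)) (toC β * conj (toC u))| ≤ (2 ^ M.length)⁻¹ := by
  have hM : (0 : ℝ) < 2 ^ M.length := by positivity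
  have h1 : cscore (toC α * conj (toC v)) (toC β * conj (toC u)) =
      (gsq (gmul α (gconj v) + gmul β (gconj u)) : ℝ) /
        (2 * (gsq (gmul α (gconj v)) + gsq (gmul β (gconj u))) : ℕ) := by
    rw [cscore, ← toC_gconj, ← toC_gconj, ← toC_gmul, ← toC_gmul, ← toC_add]
    simp only [norm_toC_sq]
    push_cast
    ring
  rw [h1, score]
  set a := gsq (gmul α (gconj v) + gmul β (gconj u))
  set b := 2 * (gsq (gmul α (gconj v)) + gsq (gmul β (gconj u)))
  -- If the denominator vanishes, both the integer and the real quotient are 0 by convention.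
  rcases Nat.eq_zero_or_pos b with hb | hb
  · rw [hb]
    simp
  · have hb' : (0 : ℝ) < b := by exact_mod_cast hb
    have h2 := @Nat.cast_div_le ℝ _ _ _ (2 ^ M.length * a) b
    have h3 := Nat.lt_div_mul_add (a := 2 ^ M.length * a) hb
    have h4 : ((2 ^ M.length * a : ℕ) : ℝ) < ((2 ^ M.length * a / b : ℕ) : ℝ) * b + b := by
      exact_mod_cast h3
    push_cast at h2 h4
    have h5 : (2 ^ M.length * a : ℝ) / b ≤ ((2 ^ M.length * a / b : ℕ) : ℝ) + 1 := by
      rw [div_le_iff₀ hb']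
      linarith
    have h6 : ((2 ^ M.length * a / b : ℕ) : ℝ) / 2 ^ M.length - (a : ℝ) / b =
        (((2 ^ M.length * a / b : ℕ) : ℝ) - (2 ^ M.length * a : ℝ) / b) / 2 ^ M.length := by
      field_simp
    rw [h6, abs_div, abs_of_pos hM, div_le_iff₀ hM, inv_mul_cancel₀ hM.ne', abs_le]
    constructor <;> linarith

/-- Amplitudes and matrices are therefore needed only up to scale. Factors such as 2 ^ (-k), or the
irrational powers of √2 in Hadamard matrices, never enter a computation. -/
theorem cscore_smul {c : ℂ} (hc : c ≠ 0) (G H : ℂ) : cscore (c * G) (c * H) = cscore G H := by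
  have h1 : ‖c‖ ^ 2 ≠ 0 := by simpa using hc
  unfold cscore
  rw [← mul_add, norm_mul, norm_mul, norm_mul, mul_pow, mul_pow, mul_pow, ← mul_add,
    mul_left_comm, mul_div_mul_left _ _ h1]

section Sample

variable {n : ℕ} {d : Fin n → ℕ} {β : Type*}

/-- The entries for prescribed digits. -/
def entries (w : ∀ k, Fin (d k) → Fin (d k) → ℤ × ℤ) (Y : ∀ k, Option (Fin (d k))) :
    List Entry :=
  List.ofFn fun k => (Y k).elim (false, 0, []) fun y => (true, (y : ℕ), List.ofFn (w k y))

/-- The distribution of a redrawn digit. -/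
def digitPMF (M : List β) (w : ∀ k, Fin (d k) → Fin (d k) → ℤ × ℤ)
    (Y : ∀ k, Option (Fin (d k))) (x : Basis d) (k : Fin n) : PMF (Fin (d k)) :=
  (Y k).elim (PMF.pure (x k)) fun y => drawFin M y.pos (w k y)

theorem zip_ofFn {α γ : Type*} (f : Fin n → α) (g : Fin n → γ) :
    (List.ofFn f).zip (List.ofFn g) = List.ofFn fun k => (f k, g k) := by
  refine List.ext_getElem (by simp) ?_
  intro i h1 h2
  simp

theorem redraw_entries (M : List β) (w : ∀ k, Fin (d k) → Fin (d k) → ℤ × ℤ)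
    (Y : ∀ k, Option (Fin (d k))) (x : Basis d) :
    redraw M (digits x) (entries w Y) = (piPMF (digitPMF M w Y x)).map digits := by
  rw [redraw, digits, entries, zip_ofFn]
  refine mapP_eq_piPMF _ _ _ fun k => ?_
  unfold digitPMF drawDigit
  cases Y k with
  | none => simp [PMF.pure_map]
  | some y => simpa using draw_ofFn M y.pos (w k y)

/-- The product of the relevant matrix entries. -/
def amplF (w : ∀ k, Fin (d k) → Fin (d k) → ℤ × ℤ) (Y : ∀ k, Option (Fin (d k)))
    (x : Basis d) : ℤ × ℤ := gprod (List.ofFn fun k => (Y k).elim (1, 0) fun y => w k y (x k))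

theorem ampl_entries (w : ∀ k, Fin (d k) → Fin (d k) → ℤ × ℤ)
    (Y : ∀ k, Option (Fin (d k))) (x : Basis d) :
    ampl (digits x) (entries w Y) = amplF w Y x := by
  rw [ampl, digits, entries, zip_ofFn, List.map_ofFn, amplF]
  congr 2
  funext k
  simp only [Function.comp]
  cases Y k with
  | none => simp
  | some y => simp [look_ofFn]

theorem toC_amplF (w : ∀ k, Fin (d k) → Fin (d k) → ℤ × ℤ) (Y : ∀ k, Option (Fin (d k)))
    (x : Basis d) : toC (amplF w Y x) = ∏ k, (Y k).elim 1 fun y => toC (w k y (x k)) := by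
  rw [amplF, toC_gprod, List.map_ofFn, List.prod_ofFn]
  refine Finset.prod_congr rfl fun k _ => ?_
  simp only [Function.comp]
  cases Y k with
  | none => simp [toC]
  | some y => rfl

/-- Integer matrices that are multiples of approximations of unitary matrices. -/
structure Approximates (σ e : ℝ) (w : ∀ k, Fin (d k) → Fin (d k) → ℤ × ℤ)
    (u : ∀ k, Matrix.unitaryGroup (Fin (d k)) ℂ) : Prop where
  pos : 0 < σ
  le : ∀ k p q, ‖(σ : ℂ) * toC (w k p q) - (u k).1 p q‖ ≤ e

theorem norm_unitary_le_one {m : ℕ} (v : Matrix.unitaryGroup (Fin m) ℂ) (y b : Fin m) :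
    ‖v.1 y b‖ ≤ 1 := by
  have h := unitary_row_sum v y
  have h1 : ‖v.1 y b‖ ^ 2 ≤ 1 := by
    rw [← h]
    exact Finset.single_le_sum (f := fun b => ‖v.1 y b‖ ^ 2) (fun _ _ => sq_nonneg _)
      (Finset.mem_univ b)
  rwa [sq_le_one_iff₀ (norm_nonneg _)] at h1

/-- Three errors add up: rounding of the weights (2D / 2 ^ M), normalization of the rounded row
(3De), and rounding of the entry itself (3e ≤ 3De). -/
theorem drawFin_close {σ e : ℝ} {w : ∀ k, Fin (d k) → Fin (d k) → ℤ × ℤ}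
    {u : ∀ k, Matrix.unitaryGroup (Fin (d k)) ℂ} (hw : Approximates σ e w u) {D : ℕ}
    (hD : ∀ k, d k ≤ D) (hD1 : 1 ≤ D) (he : 6 * D * e < 1) (M : List β) (k : Fin n)
    (y b : Fin (d k)) :
    |(drawFin M y.pos (w k y) b).toReal - ‖(u k).1 y b‖ ^ 2| ≤
      2 * D / 2 ^ M.length + 6 * D * e := by
  have hσ := hw.pos
  have he0 : 0 ≤ e := (norm_nonneg _).trans (hw.le k y b)
  have hD1' : (1 : ℝ) ≤ D := by exact_mod_cast hD1
  have hdk : (d k : ℝ) ≤ D := by exact_mod_cast hD k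
  have he1 : e ≤ 1 := by nlinarith
  have h1 : ∀ b, |‖(u k).1 y b‖ ^ 2 - σ ^ 2 * gsq (w k y b)| ≤ 3 * e := by
    intro b
    have h2 : σ ^ 2 * gsq (w k y b) = ‖(σ : ℂ) * toC (w k y b)‖ ^ 2 := by
      rw [norm_mul, mul_pow, norm_toC_sq]
      simp
    rw [h2]
    have hu := norm_unitary_le_one (u k) y b
    refine (abs_sq_sub_sq_le (norm_nonneg _) (norm_nonneg _)
      ((abs_norm_sub_norm_le _ _).trans (hw.le k y b))).trans ?_
    nlinarith
  set W := ∑ b, gsq (w k y b) with hW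
  have h2 : |1 - σ ^ 2 * W| ≤ 3 * D * e := by
    rw [← unitary_row_sum (u k) y, hW]
    push_cast
    rw [Finset.mul_sum, ← Finset.sum_sub_distrib]
    refine (Finset.abs_sum_le_sum_abs _ _).trans ?_
    refine (Finset.sum_le_card_nsmul _ _ _ fun b _ => h1 b).trans ?_
    simp only [Finset.card_univ, Fintype.card_fin, nsmul_eq_mul]
    nlinarith
  -- A vanishing rounded row would be at distance 1 from a unit vector in the sense of `h2`, while
  -- 3De < 1/2.
  have hWpos : 0 < W := by
    rcases Nat.eq_zero_or_pos W with h | h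
    · rw [h] at h2
      simp at h2
      nlinarith
    · exact h
  have hWr : (0 : ℝ) < W := by exact_mod_cast hWpos
  have h3 := sum_abs_dyw_le M.length (fun i => gsq (w k y i)) hWpos
  have h4 := (Finset.single_le_sum (f := fun i => |(dyw M.length (fun i => gsq (w k y i)) i : ℝ) /
    2 ^ M.length - gsq (w k y i) / (∑ i, gsq (w k y i) : ℕ)|) (fun _ _ => abs_nonneg _)
    (Finset.mem_univ b)).trans h3
  rw [← hW] at h4
  have hfrac : (gsq (w k y b) : ℝ) / W ≤ 1 := by
    refine div_le_one_of_le₀ ?_ hWr.le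
    exact_mod_cast Finset.single_le_sum (f := fun b => gsq (w k y b)) (fun _ _ => Nat.zero_le _)
      (Finset.mem_univ b)
  have hfrac0 : 0 ≤ (gsq (w k y b) : ℝ) / W := by positivity
  have h5 : |(gsq (w k y b) : ℝ) / W - σ ^ 2 * gsq (w k y b)| ≤ 3 * D * e := by
    have : (gsq (w k y b) : ℝ) / W - σ ^ 2 * gsq (w k y b) =
        (gsq (w k y b) : ℝ) / W * (1 - σ ^ 2 * W) := by field_simp
    rw [this, abs_mul, abs_of_nonneg hfrac0]
    nlinarith [abs_nonneg (1 - σ ^ 2 * (W : ℝ))]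
  rw [drawFin_apply]
  have h6 : (2 : ℝ) * d k / 2 ^ M.length ≤ 2 * D / 2 ^ M.length := by gcongr
  have h7 := h1 b
  have h8 : 3 * e ≤ 3 * D * e := by nlinarith
  have := abs_le.1 h4
  have := abs_le.1 h5
  have := abs_le.1 h7
  rw [abs_le]
  constructor <;> linarith

end Sample

namespace Source

variable {J : Type*} [Enc J] (s : Source J) {β : Type*} (j : J)

theorem sample_entries (M : List β) (w : ∀ k, Fin (s.d j k) → Fin (s.d j k) → ℤ × ℤ)
    (Y : ∀ k, Option (Fin (s.d j k))) :
    s.sample j M (entries w Y) = (s.μ j).bind fun x => (piPMF (digitPMF M w Y x)).map fun z =>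
      score M (s.val j x) (s.val j z) (amplF w Y x) (amplF w Y z) := by
  unfold sample
  rw [PMF.bind_map]
  refine pmf_bind_congr _ fun x _ => ?_
  simp only [Function.comp_apply]
  rw [redraw_entries, PMF.map_comp]
  refine pmf_map_congr _ fun z _ => ?_
  simp only [Function.comp_apply]
  rw [if_pos ((isLabel_iff _).2 ⟨z, rfl⟩), valL_digits, valL_digits, ampl_entries, ampl_entries]

theorem meanFrac_sample (M : List β) (w : ∀ k, Fin (s.d j k) → Fin (s.d j k) → ℤ × ℤ)
    (Y : ∀ k, Option (Fin (s.d j k))) :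
    meanFrac (s.sample j M (entries w Y)) (2 ^ M.length) =
      ∑ x, (s.μ j x).toReal * ∑ z : Basis (s.d j), (∏ k, (digitPMF M w Y x k (z k)).toReal) *
        ((score M (s.val j x) (s.val j z) (amplF w Y x) (amplF w Y z) : ℝ) / 2 ^ M.length) := by
  have h0 : ∀ x : Basis (s.d j), expect (piPMF (digitPMF M w Y x)) (fun z =>
      (score M (s.val j x) (s.val j z) (amplF w Y x) (amplF w Y z) : ENNReal)) ≠ ⊤ := by
    intro x
    rw [expect, tsum_fintype]
    exact ENNReal.sum_ne_top.2 fun z _ => ENNReal.mul_ne_top (PMF.apply_ne_top _ _) (by simp)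
  rw [meanFrac, sample_entries, expect_bind]
  simp only [expect_map]
  rw [expect_fintype _ _ h0, Finset.sum_div]
  refine Finset.sum_congr rfl fun x _ => ?_
  rw [expect_fintype _ _ (by simp), mul_div_assoc, Finset.sum_div]
  congr 1
  refine Finset.sum_congr rfl fun z _ => ?_
  rw [piPMF_apply, ENNReal.toReal_prod]
  push_cast
  rw [mul_div_assoc]
  simp

variable {s j}

/-- The mean of the score is close to the exact value. -/
theorem mean_close {φ : Basis (s.d j) → ℂ} {u : ∀ k, Matrix.unitaryGroup (Fin (s.d j k)) ℂ}
    {w : ∀ k, Fin (s.d j k) → Fin (s.d j k) → ℤ × ℤ} {σ σ' e E : ℝ} {D : ℕ}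
    (hφ : ∑ x, ‖φ x‖ ^ 2 = 1) (hw : Approximates σ e w u) (hσ' : 0 < σ')
    (hval : ∀ x, ‖(σ' : ℂ) * toC (s.val j x) - φ x‖ ≤ e)
    (hμ : ∑ x, |(s.μ j x).toReal - ‖φ x‖ ^ 2| ≤ e)
    (hD : ∀ k, s.d j k ≤ D) (hD1 : 1 ≤ D) (M : List β) (hM : (2 ^ M.length)⁻¹ ≤ e)
    (hE : 46 * (D ^ (2 * s.n j + 1) * 2 ^ s.n j) * e ≤ E) (hE1 : E ≤ 1)
    (Y : ∀ k, Option (Fin (s.d j k))) :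
    |meanFrac (s.sample j M (entries w Y)) (2 ^ M.length) -
      (1 + prefixProb (tensor (fun k => (u k).1) *ᵥ φ) Y) / 2| ≤ E := by
  have hM0 : (0 : ℝ) < (2 ^ M.length)⁻¹ := by positivity
  have he : 0 < e := hM0.trans_le hM
  have hD1' : (1 : ℝ) ≤ D := by exact_mod_cast hD1
  set N := s.n j
  have hDn : (1 : ℝ) ≤ (D : ℝ) ^ (2 * N) := one_le_pow₀ hD1'
  have h2n : (1 : ℝ) ≤ 2 ^ N := one_le_pow₀ (by norm_num)
  have hbig : (D : ℝ) * 2 ^ N ≤ D ^ (2 * N + 1) * 2 ^ N := by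
    gcongr
    rw [pow_succ]
    nlinarith
  have hD2 : 46 * (D * 2 ^ N) * e ≤ 1 := by
    refine le_trans ?_ (hE.trans hE1)
    gcongr
  have hDe : (D : ℝ) * e ≤ D * 2 ^ N * e := by
    gcongr
    nlinarith
  have h2e : (2 : ℝ) ^ N * e ≤ D * 2 ^ N * e := by
    gcongr
    nlinarith
  have h6 : 6 * (D : ℝ) * e < 1 := by nlinarith
  have he1 : e ≤ 1 := by nlinarith
  -- The scale depends on the pattern only, not on x and z, so it is common to both amplitudes of a
  -- pair and the score ignores it.
  have hsplit : ∀ x z : Basis (s.d j), ‖(σ' : ℂ) * (∏ k, (Y k).elim (1 : ℂ) fun _ => (σ : ℂ)) *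
      (toC (s.val j x) * conj (toC (amplF w Y z))) -
      pairAmp (fun k => (u k).1) φ Y x z‖ ≤ 3 * 2 ^ N * e := by
    intro x z
    have h1 : ‖conj ((∏ k, (Y k).elim (1 : ℂ) fun _ => (σ : ℂ)) * toC (amplF w Y z)) -
        conj (∏ k, rowAmp (fun k => (u k).1) Y k (z k))‖ ≤ (2 ^ N - 1) * e := by
      rw [← map_sub, RCLike.norm_conj, toC_amplF, ← Finset.prod_mul_distrib]
      have := norm_prod_sub_prod_le (E := ℂ) Finset.univ
        (fun k => rowAmp (fun k => (u k).1) Y k (z k))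
        (fun k => ((Y k).elim (1 : ℂ) fun _ => (σ : ℂ)) *
          (Y k).elim 1 fun y => toC (w k y (z k))) he.le he1 (fun k _ => by
          unfold rowAmp
          cases Y k with
          | none => simp
          | some y => exact norm_unitary_le_one _ _ _) (fun k _ => by
          unfold rowAmp
          cases Y k with
          | none => simpa using he.le
          | some y => exact hw.le k y (z k))
      simpa using this
    have hconj : conj (∏ k, (Y k).elim (1 : ℂ) fun _ => (σ : ℂ)) =
        ∏ k, (Y k).elim (1 : ℂ) fun _ => (σ : ℂ) := by
      rw [map_prod]
      refine Finset.prod_congr rfl fun k _ => ?_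
      cases Y k <;> simp
    have h2 : ‖conj (∏ k, rowAmp (fun k => (u k).1) Y k (z k))‖ ≤ 1 := by
      rw [RCLike.norm_conj, norm_prod]
      refine Finset.prod_le_one (fun k _ => norm_nonneg _) fun k _ => ?_
      unfold rowAmp
      cases Y k with
      | none => simp
      | some y => exact norm_unitary_le_one _ _ _
    have h3 : ‖φ x‖ ≤ 1 := by
      rw [← sq_le_one_iff₀ (norm_nonneg _), ← hφ]
      exact Finset.single_le_sum (f := fun x => ‖φ x‖ ^ 2) (fun _ _ => sq_nonneg _)
        (Finset.mem_univ x)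
    set A := (∏ k, (Y k).elim (1 : ℂ) fun _ => (σ : ℂ)) with hA
    set P := conj (∏ k, rowAmp (fun k => (u k).1) Y k (z k)) with hP
    rw [map_mul, hconj] at h1
    set B := A * conj (toC (amplF w Y z)) with hB
    set a := (σ' : ℂ) * toC (s.val j x) with ha
    have h4 : (σ' : ℂ) * A * (toC (s.val j x) * conj (toC (amplF w Y z))) -
        pairAmp (fun k => (u k).1) φ Y x z = (a - φ x) * B + φ x * (B - P) := by
      rw [pairAmp, ← hP, hB, ha]
      ring
    have h5 : ‖B‖ ≤ 1 + (2 ^ N - 1) * e := by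
      have := norm_add_le (B - P) P
      rw [sub_add_cancel] at this
      linarith
    rw [h4]
    refine (norm_add_le _ _).trans ?_
    rw [norm_mul (a - φ x) B, norm_mul (φ x) (B - P)]
    have h7 : ‖a - φ x‖ * ‖B‖ ≤ e * (1 + (2 ^ N - 1) * e) := by
      gcongr
      exact hval x
    have h8 : ‖φ x‖ * ‖B - P‖ ≤ 1 * ((2 ^ N - 1) * e) := by gcongr
    have h9 : (2 ^ N - 1) * e ≤ 1 := by nlinarith
    nlinarith
  have hc : (σ' : ℂ) * (∏ k, (Y k).elim (1 : ℂ) fun _ => (σ : ℂ)) ≠ 0 := by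
    refine mul_ne_zero (by exact_mod_cast hσ'.ne') (Finset.prod_ne_zero_iff.2 fun k _ => ?_)
    cases Y k with
    | none => simp
    | some y => simpa using hw.pos.ne'
  have hpair : ∀ x z : Basis (s.d j), ‖pairAmp (fun k => (u k).1) φ Y x z‖ ≤ 1 := by
    intro x z
    rw [pairAmp, norm_mul, RCLike.norm_conj, norm_prod]
    have h3 : ‖φ x‖ ≤ 1 := by
      rw [← sq_le_one_iff₀ (norm_nonneg _), ← hφ]
      exact Finset.single_le_sum (f := fun x => ‖φ x‖ ^ 2) (fun _ _ => sq_nonneg _)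
        (Finset.mem_univ x)
    refine mul_le_one₀ h3 (Finset.prod_nonneg fun _ _ => norm_nonneg _) ?_
    refine Finset.prod_le_one (fun k _ => norm_nonneg _) fun k _ => ?_
    unfold rowAmp
    cases Y k with
    | none => simp
    | some y => exact norm_unitary_le_one _ _ _
  -- e₂ = 8De is 2De + 6De from `drawFin_close`. In e₃, one e comes from rounding the score and 12 ·
  -- 3 · 2 ^ N · e from `cscore_perturb`. The bounds 1 + 8 + 37 add up to the constant 46.
  have hmain := abs_mean_sub_le u φ Y hφ (fun x => (s.μ j x).toReal)
    (fun x k b => (digitPMF M w Y x k b).toReal)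
    (fun x z => (score M (s.val j x) (s.val j z) (amplF w Y x) (amplF w Y z) : ℝ) / 2 ^ M.length)
    (e₁ := e) (e₂ := 8 * D * e) (e₃ := 37 * 2 ^ N * e) hμ (by positivity) (by nlinarith)
    (fun _ _ _ => ENNReal.toReal_nonneg) ?_ ?_ (fun x z => by positivity) ?_ ?_
  · rw [meanFrac_sample]
    refine hmain.trans (le_trans ?_ hE)
    have hB : (Fintype.card (Basis (s.d j)) : ℝ) ≤ D ^ N := by
      have h1 : Fintype.card (Basis (s.d j)) ≤ D ^ N := by
        rw [Fintype.card_pi]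
        refine (Finset.prod_le_pow_card _ _ D fun k _ => by simpa using hD k).trans ?_
        simp [N]
      exact_mod_cast h1
    have hX : (Fintype.card (Basis (s.d j)) : ℝ) * (2 ^ N * (8 * D * e)) ≤
        8 * (D ^ (2 * N + 1) * 2 ^ N) * e := by
      calc _ ≤ (D : ℝ) ^ N * (2 ^ N * (8 * D * e)) := by gcongr
        _ = 8 * (D ^ (N + 1) * 2 ^ N) * e := by ring
        _ ≤ _ := by (gcongr; omega)
    have hY : (Fintype.card (Basis (s.d j)) : ℝ) ^ 2 * (37 * 2 ^ N * e) ≤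
        37 * (D ^ (2 * N + 1) * 2 ^ N) * e := by
      calc _ ≤ ((D : ℝ) ^ N) ^ 2 * (37 * 2 ^ N * e) := by gcongr
        _ = 37 * (D ^ (2 * N) * 2 ^ N) * e := by ring
        _ ≤ _ := by (gcongr; omega)
    have hZ : e ≤ 1 * (D ^ (2 * N + 1) * 2 ^ N) * e := by
      have : (1 : ℝ) ≤ D ^ (2 * N + 1) * 2 ^ N := by
        refine le_trans ?_ hbig
        nlinarith
      nlinarith
    linarith
  · intro x k
    rw [← ENNReal.toReal_sum fun _ _ => PMF.apply_ne_top _ _]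
    have := (digitPMF M w Y x k).tsum_coe
    rw [tsum_fintype] at this
    rw [this]
    rfl
  · intro x k b
    unfold digitPMF digitProb
    cases Y k with
    | none =>
      simp only [Option.elim, PMF.pure_apply]
      have : (0 : ℝ) ≤ 8 * D * e := by positivity
      by_cases h : b = x k <;> simp [h, this]
    | some y =>
      simp only [Option.elim]
      refine (drawFin_close hw hD hD1 h6 M k y b).trans ?_
      have : 2 * (D : ℝ) / 2 ^ M.length ≤ 2 * D * e := by
        rw [div_eq_mul_inv]
        gcongr
      linarith
  · intro x z
    refine div_le_one_of_le₀ ?_ (by positivity)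
    exact_mod_cast score_le M _ _ _ _
  · intro x z
    have h1 := abs_score_sub_le M (s.val j x) (s.val j z) (amplF w Y x) (amplF w Y z)
    rw [← cscore_smul hc] at h1
    have h2 := cscore_perturb (hpair x z) (hpair z x) (hsplit x z) (hsplit z x) (by nlinarith)
    have h3 := norm_kernelAmp_sq φ Y (fun k => (u k).1) x z
    have hq0 := pairProb_nonneg u φ Y x z
    -- This provides the weight that `cscore_perturb` needs: a pair with a tiny amplitude may have
    -- an unstable score, but it is drawn with tiny probability.
    have hq1 : pairProb (fun k => (u k).1) φ Y x z ≤ ‖pairAmp (fun k => (u k).1) φ Y x z‖ ^ 2 := by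
      rw [pairProb, pairAmp, norm_mul, RCLike.norm_conj, norm_prod, mul_pow, ← Finset.prod_pow]
      refine mul_le_mul_of_nonneg_left ?_ (sq_nonneg _)
      refine Finset.prod_le_prod (fun k _ => digitProb_nonneg Y _ k _ _) fun k _ => ?_
      unfold digitProb rowAmp
      cases Y k with
      | none => simp only [Option.elim]; split_ifs <;> simp
      | some y => simp
    have hq2 : pairProb (fun k => (u k).1) φ Y x z ≤ 1 := by
      refine hq1.trans ?_
      rw [sq_le_one_iff₀ (norm_nonneg _)]
      exact hpair x z
    set sc := (score M (s.val j x) (s.val j z) (amplF w Y x) (amplF w Y z) : ℝ) / 2 ^ M.length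
    set X := cscore (pairAmp (fun k => (u k).1) φ Y x z) (pairAmp (fun k => (u k).1) φ Y z x)
    set X' := cscore ((σ' : ℂ) * (∏ k, (Y k).elim (1 : ℂ) fun _ => (σ : ℂ)) *
      (toC (s.val j x) * conj (toC (amplF w Y z))))
      ((σ' : ℂ) * (∏ k, (Y k).elim (1 : ℂ) fun _ => (σ : ℂ)) *
      (toC (s.val j z) * conj (toC (amplF w Y x))))
    calc pairProb (fun k => (u k).1) φ Y x z * |sc - X|
        ≤ pairProb (fun k => (u k).1) φ Y x z * (|sc - X'| + |X' - X|) := by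
          gcongr
          exact abs_sub_le _ _ _
      _ ≤ 1 * e + ‖pairAmp (fun k => (u k).1) φ Y x z‖ ^ 2 * |X' - X| := by
          rw [mul_add]
          gcongr
          exact h1.trans hM
      _ ≤ 1 * e + 12 * (3 * 2 ^ N * e) := by gcongr
      _ ≤ 37 * 2 ^ N * e := by nlinarith

end Source

end SparseSim

end

noncomputable section

namespace SparseSim

open Enc

/-! ### The search tree -/

section Tree

variable {n : ℕ} {d : Fin n → ℕ}

/-- The prescription of some digits. -/
abbrev Pattern (d : Fin n → ℕ) : Type := ∀ k, Option (Fin (d k))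

/-- A factor of a tensor product operator as it is handed to a program. -/
def factor (S : Finset (Fin n)) (w : ∀ k, Fin (d k) → Fin (d k) → ℤ × ℤ) (k : Fin n) : Factor :=
  (d k, decide (k ∈ S), List.ofFn fun a => List.ofFn (w k a), ())

/-- The extensions of a pattern by the digit of one more qudit. -/
def extensions (S : Finset (Fin n)) (Y : Pattern d) (k : Fin n) : List (Pattern d) :=
  if k ∈ S then List.ofFn fun y : Fin (d k) => Function.update Y k (some y)
  else [Function.update Y k none]

/-- A node of the search tree as it is handled by the program. -/
def node (w : ∀ k, Fin (d k) → Fin (d k) → ℤ × ℤ) (i : ℕ) (q : Pattern d × ℕ) :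
    List Entry × ℕ := ((entries w q.1).take i, q.2)

theorem take_entries_update (w : ∀ k, Fin (d k) → Fin (d k) → ℤ × ℤ) (Y : Pattern d) (k : Fin n)
    (o : Option (Fin (d k))) : (entries w (Function.update Y k o)).take (k + 1) =
      (entries w Y).take k ++
        [o.elim (false, 0, []) fun y => (true, (y : ℕ), List.ofFn (w k y))] := by
  have hk : (k : ℕ) < (entries w (Function.update Y k o)).length := by simp [entries]
  rw [List.take_add_one, List.getElem?_eq_getElem hk]
  congr 1
  · refine List.ext_getElem (by simp [entries]) ?_
    intro i h1 h2
    have hi : (⟨i, by simp [entries] at h1; omega⟩ : Fin n) ≠ k := by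
      intro h
      simp [entries] at h1
      have := congrArg Fin.val h
      simp only at this
      omega
    simp only [List.getElem_take, entries, List.getElem_ofFn]
    rw [Function.update_of_ne hi]
  · simp [entries]

theorem options_factor (S : Finset (Fin n)) (w : ∀ k, Fin (d k) → Fin (d k) → ℤ × ℤ)
    (Y : Pattern d) (k : Fin n) :
    (options (factor S w k)).map (fun e => (entries w Y).take k ++ [e]) =
      (extensions S Y k).map fun Y' => (entries w Y').take (k + 1) := by
  unfold options extensions factor
  by_cases hk : k ∈ S
  · simp only [hk, decide_true, if_true]
    have h1 : (List.ofFn fun a => List.ofFn (w k a)).zipIdx.map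
        (fun q => ((true, q.2, q.1) : Entry)) =
        List.ofFn fun a : Fin (d k) => ((true, (a : ℕ), List.ofFn (w k a)) : Entry) := by
      refine List.ext_getElem (by simp) ?_
      intro i h1 h2
      simp
    rw [h1, List.map_ofFn, List.map_ofFn]
    congr 1
    funext y
    simp only [Function.comp_apply]
    rw [take_entries_update]
    rfl
  · simp only [hk, decide_false, if_false, List.map_cons, List.map_nil, Bool.false_eq_true]
    rw [take_entries_update]
    rfl

/-- Transports a fold on data to a fold on mathematical objects. The translation `g k` varies with
the level because the data represent prefixes of length k. -/
theorem pfold_ofFn {β γ γ' : Type*} {m : ℕ} {F : β → γ → PMF γ} {F' : Fin m → γ' → PMF γ'}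
    (b : Fin m → β) (g : ℕ → γ' → γ)
    (h : ∀ k T, F (b k) (g k T) = (F' k T).map (g (k + 1))) (T : γ') :
    pfold F (List.ofFn b) (g 0 T) = (pfold F' (List.ofFn id) T).map (g m) := by
  have key : ∀ (l : List (Fin m)) (i : ℕ) (_ : ∀ p (hp : p < l.length), ((l[p] : Fin m) : ℕ) = i + p)
      (T : γ'), pfold F (l.map b) (g i T) = (pfold F' l T).map (g (i + l.length)) := by
    intro l
    induction l with
    | nil => intro i _ T; simp [pfold, PMF.pure_map]
    | cons k l ih =>
      intro i hl T
      have h0 : (k : ℕ) = i := hl 0 (by simp)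
      simp only [List.map_cons, pfold]
      rw [← h0, h, PMF.bind_map, PMF.map_bind]
      refine pmf_bind_congr _ fun T' _ => ?_
      simp only [Function.comp_apply]
      rw [ih (k + 1) ?_ T', List.length_cons]
      · congr 2
        omega
      · intro p hp
        have := hl (p + 1) (by simpa using hp)
        simp only [List.getElem_cons_succ] at this
        omega
  have := key (List.ofFn id) 0 (fun p hp => by simp) T
  simpa [List.map_ofFn] using this

end Tree

namespace Source

variable {J : Type*} [Enc J] (s : Source J) {β : Type*} (j : J)

/-- Entries enter only through pairing with exactly n digits, so surplus entries have no effect. -/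
theorem sample_append (M : List β) (Y Z : List Entry) (hY : Y.length = s.n j) :
    s.sample j M (Y ++ Z) = s.sample j M Y := by
  have h1 : ∀ xs : List ℕ, xs.length = s.n j → xs.zip (Y ++ Z) = xs.zip Y := by
    intro xs hx
    have := List.zip_append (l₁ := xs) (r₁ := []) (l₂ := Y) (r₂ := Z) (by rw [hx, hY])
    simpa using this
  unfold sample
  refine pmf_bind_congr _ fun xs hxs => ?_
  obtain ⟨x, _, rfl⟩ := (PMF.mem_support_map_iff _ _ _).1 hxs
  have hx : (digits x).length = s.n j := by simp [digits]
  have h2 : redraw M (digits x) (Y ++ Z) = redraw M (digits x) Y := by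
    unfold redraw
    rw [h1 _ hx]
  rw [h2]
  refine pmf_map_congr _ fun z _ => ?_
  have hz : (if isLabel (List.ofFn (s.d j)) z = true then z else digits x).length = s.n j := by
    split_ifs with h
    · obtain ⟨y, rfl⟩ := (isLabel_iff _).1 h
      simp [digits]
    · exact hx
  simp only [ampl]
  rw [h1 _ hx, h1 _ hz]

/-- The estimated probability of a pattern of the first digits. -/
def patternEstimate (w : ∀ k, Fin (s.d j k) → Fin (s.d j k) → ℤ × ℤ) (M N : List β) (i : ℕ)
    (Y : Pattern (s.d j)) : PMF ℕ :=
  s.estimate j M N ((entries w Y).take i ++ (List.ofFn (s.d j)).map fun _ => (false, 0, []))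

/-- One level of the search tree, in terms of patterns. -/
def levelPattern (w : ∀ k, Fin (s.d j k) → Fin (s.d j k) → ℤ × ℤ) (S : Finset (Fin (s.n j)))
    (M N L : List β) (thr : ℕ) (k : Fin (s.n j)) (T : List (Pattern (s.d j) × ℕ)) :
    PMF (List (Pattern (s.d j) × ℕ)) :=
  (mapP (fun Y => (s.patternEstimate j w M N (k + 1) Y).map fun c => (Y, c))
    (T.flatMap fun q => extensions S q.1 k)).map fun r =>
      (r.filter fun q => decide (N.length * 2 ^ M.length ≤ q.2 * thr)).take L.length

/-- The search, in terms of patterns. -/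
def searchPattern (w : ∀ k, Fin (s.d j k) → Fin (s.d j k) → ℤ × ℤ) (S : Finset (Fin (s.n j)))
    (M N L : List β) (thr : ℕ) : PMF (List (Pattern (s.d j) × ℕ)) :=
  pfold (s.levelPattern j w S M N L thr) (List.ofFn id)
    [(fun _ => none, N.length * 2 ^ M.length)]

theorem mapP_map_map {α α' γ γ' : Type*} (f : α → PMF γ) (f' : α' → PMF γ') (g : α' → α)
    (g' : γ' → γ) (h : ∀ a, f (g a) = (f' a).map g') (l : List α') :
    mapP f (l.map g) = (mapP f' l).map (List.map g') := by
  induction l with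
  | nil => simp [mapP, PMF.pure_map]
  | cons a l ih =>
    simp only [List.map_cons, mapP]
    rw [h, ih, PMF.bind_map, PMF.map_bind]
    refine pmf_bind_congr _ fun c _ => ?_
    simp only [Function.comp_apply, PMF.map_comp]
    rfl

theorem level_map (w : ∀ k, Fin (s.d j k) → Fin (s.d j k) → ℤ × ℤ) (S : Finset (Fin (s.n j)))
    (M N L : List β) (thr : ℕ) (k : Fin (s.n j)) (T : List (Pattern (s.d j) × ℕ)) :
    s.level j M N L thr (factor S w k) (T.map (node w k)) =
      (s.levelPattern j w S M N L thr k T).map (List.map (node w (k + 1))) := by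
  have h1 : candidates (factor S w k) (T.map (node w k)) =
      (T.flatMap fun q => extensions S q.1 k).map fun Y => (entries w Y).take (k + 1) := by
    rw [candidates, List.flatMap_map, List.map_flatMap]
    refine List.flatMap_congr fun q _ => ?_
    exact options_factor S w q.1 k
  rw [level, h1, mapP_map_map (s.nodeEstimate j M N) (fun Y =>
    (s.patternEstimate j w M N (k + 1) Y).map fun c => (Y, c)) _ (node w (k + 1)),
    levelPattern, PMF.map_comp, PMF.map_comp]
  · refine pmf_map_congr _ fun r _ => ?_
    simp only [Function.comp_apply, prune, cut_eq_take, List.map_take, List.filter_map]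
    rfl
  · intro Y
    rw [nodeEstimate, patternEstimate, PMF.map_comp]
    rfl

theorem search_map (w : ∀ k, Fin (s.d j k) → Fin (s.d j k) → ℤ × ℤ) (S : Finset (Fin (s.n j)))
    (M N L : List β) (thr : ℕ) :
    s.search j M N L thr (List.ofFn (factor S w)) =
      (s.searchPattern j w S M N L thr).map (List.map (node w (s.n j))) := by
  rw [search, searchPattern]
  exact pfold_ofFn (F := s.level j M N L thr) (factor S w) (fun i => List.map (node w i))
    (s.level_map j w S M N L thr) [(fun _ => none, N.length * 2 ^ M.length)]

end Source

end SparseSim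

end

/-! ### Invariants and failure probability of the search -/

noncomputable section

namespace SparseSim

open Enc

section Tree

variable {n : ℕ} {d : Fin n → ℕ} {S : Finset (Fin n)}

/-- The pattern prescribes the measured ones among the first `i` digits. -/
def IsPrefix (S : Finset (Fin n)) (i : ℕ) (Y : Pattern d) : Prop :=
  ∀ k, (Y k).isSome = true ↔ k ∈ S ∧ (k : ℕ) < i

/-- Patterns of one level prescribe the same positions, so a label fits at most one of them. This is
the disjointness behind the bound on the number of nodes. -/
theorem IsPrefix.eq_of_fits {i : ℕ} {Y Y' : Pattern d} (hY : IsPrefix S i Y)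
    (hY' : IsPrefix S i Y') {c : Basis d} (h : Fits Y c) (h' : Fits Y' c) : Y = Y' := by
  funext k
  have h1 := h k
  have h2 := h' k
  have h3 := (hY k).trans (hY' k).symm
  cases hk : Y k with
  | none =>
    cases hk' : Y' k with
    | none => rfl
    | some y => simp [hk, hk'] at h3
  | some y =>
    cases hk' : Y' k with
    | none => simp [hk, hk'] at h3
    | some y' => rw [← h1 y hk, ← h2 y' hk']

theorem IsPrefix.eq_none {i : ℕ} {Y : Pattern d} (hY : IsPrefix S i Y) {k : Fin n}
    (hk : i ≤ k) : Y k = none := by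
  have := hY k
  cases h : Y k with
  | none => rfl
  | some y =>
    rw [h] at this
    simp at this
    omega

theorem IsPrefix.extend {Y Y' : Pattern d} {k : Fin n} (hY : IsPrefix S k Y)
    (h : Y' ∈ extensions S Y k) :
    IsPrefix S (k + 1) Y' ∧ Function.update Y' k none = Y := by
  have hk := hY.eq_none le_rfl
  have aux : ∀ o : Option (Fin (d k)), (o.isSome = true ↔ k ∈ S) →
      IsPrefix S (k + 1) (Function.update Y k o) ∧
        Function.update (Function.update Y k o) k none = Y := by
    intro o ho
    refine ⟨fun l => ?_, ?_⟩
    · by_cases hl : l = k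
      · subst hl
        simpa using ho
      · rw [Function.update_of_ne hl, hY l]
        have : (l : ℕ) ≠ k := fun h => hl (Fin.ext h)
        refine and_congr_right fun _ => ?_
        omega
    · rw [Function.update_idem, ← hk, Function.update_eq_self]
  unfold extensions at h
  split_ifs at h with hS
  · simp only [List.mem_ofFn] at h
    obtain ⟨y, rfl⟩ := h
    exact aux _ (by simpa using hS)
  · simp only [List.mem_singleton] at h
    subst h
    exact aux _ (by simpa using hS)

theorem IsPrefix.restrict {Y : Pattern d} {k : Fin n} (hY : IsPrefix S (k + 1) Y) :
    IsPrefix S k (Function.update Y k none) ∧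
      Y ∈ extensions S (Function.update Y k none) k := by
  refine ⟨fun l => ?_, ?_⟩
  · by_cases hl : l = k
    · subst hl
      simp
    · rw [Function.update_of_ne hl, hY l]
      have : (l : ℕ) ≠ k := fun h => hl (Fin.ext h)
      refine and_congr_right fun _ => ?_
      omega
  · unfold extensions
    have h1 := hY k
    split_ifs with hS
    · simp only [List.mem_ofFn]
      have : (Y k).isSome = true := by rw [h1]; exact ⟨hS, by omega⟩
      obtain ⟨y, hy⟩ := Option.isSome_iff_exists.1 this
      refine ⟨y, ?_⟩
      rw [Function.update_idem, ← hy, Function.update_eq_self]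
    · simp only [List.mem_singleton, Function.update_idem]
      have : Y k = none := by
        cases h : Y k with
        | none => rfl
        | some y => rw [h] at h1; simp [hS] at h1
      rw [← this, Function.update_eq_self]

theorem prefixProb_nonneg (ψ : Basis d → ℂ) (Y : Pattern d) : 0 ≤ prefixProb ψ Y := by
  unfold prefixProb
  exact Finset.sum_nonneg fun c _ => by split_ifs <;> positivity

theorem prefixProb_none (ψ : Basis d → ℂ) :
    prefixProb ψ (fun _ => none) = ∑ c, ‖ψ c‖ ^ 2 := by
  unfold prefixProb
  refine Finset.sum_congr rfl fun c _ => ?_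
  rw [if_pos]
  intro k y hy
  simp at hy

/-- Forgetting a digit enlarges the event. Hence all ancestors of a significant pattern are
significant, and the search cannot lose it on the way. -/
theorem prefixProb_le_update (ψ : Basis d → ℂ) (Y : Pattern d) (k : Fin n) :
    prefixProb ψ Y ≤ prefixProb ψ (Function.update Y k none) := by
  classical
  unfold prefixProb
  refine Finset.sum_le_sum fun c _ => ?_
  by_cases h : Fits Y c
  · rw [if_pos h, if_pos]
    intro l y hy
    by_cases hl : l = k
    · subst hl
      simp at hy
    · rw [Function.update_of_ne hl] at hy
      exact h l y hy
  · rw [if_neg h]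
    split_ifs <;> positivity

theorem sum_prefixProb_le {ψ : Basis d → ℂ} {i : ℕ} {U : List (Pattern d)} (hU : U.Nodup)
    (h : ∀ Y ∈ U, IsPrefix S i Y) : (U.map (prefixProb ψ)).sum ≤ ∑ c, ‖ψ c‖ ^ 2 := by
  classical
  have h1 : (U.map (prefixProb ψ)).sum = ∑ Y ∈ U.toFinset, prefixProb ψ Y :=
    (List.sum_toFinset _ hU).symm
  rw [h1]
  unfold prefixProb
  rw [Finset.sum_comm]
  refine Finset.sum_le_sum fun c _ => ?_
  by_cases hc : ∃ Y ∈ U.toFinset, Fits Y c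
  · obtain ⟨Y, hY, hYc⟩ := hc
    rw [Finset.sum_eq_single_of_mem Y hY]
    · simp [hYc]
    · intro Y' hY' hne
      rw [if_neg]
      intro hf
      exact hne ((h Y' (by simpa using hY')).eq_of_fits (h Y (by simpa using hY)) hf hYc)
  · refine (Finset.sum_nonpos fun Y hY => ?_).trans (sq_nonneg _)
    rw [if_neg fun hf => hc ⟨Y, hY, hf⟩]

/-- Disjoint events of probability at least x have total probability at most 1. -/
theorem length_mul_le_one {ψ : Basis d → ℂ} (hψ : ∑ c, ‖ψ c‖ ^ 2 = 1) {i : ℕ}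
    {U : List (Pattern d)} (hU : U.Nodup) (h : ∀ Y ∈ U, IsPrefix S i Y) {x : ℝ}
    (hx : ∀ Y ∈ U, x ≤ prefixProb ψ Y) : U.length * x ≤ 1 := by
  have h1 := List.card_nsmul_le_sum (U.map (prefixProb ψ)) x (by simpa using hx)
  have h2 := sum_prefixProb_le (ψ := ψ) hU h
  rw [List.length_map, nsmul_eq_mul] at h1
  linarith

/-- The invariant of the search: the nodes are different patterns with positive estimates. -/
structure Valid (S : Finset (Fin n)) (L i : ℕ) (T : List (Pattern d × ℕ)) : Prop where
  isPrefix : ∀ q ∈ T, IsPrefix S i q.1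
  pos : ∀ q ∈ T, 0 < q.2
  nodup : (T.map Prod.fst).Nodup
  length_le : T.length ≤ L

/-- The invariant of a successful search: the estimates are correct, and no pattern of
significant probability is missing. -/
structure Successful (S : Finset (Fin n)) (L i : ℕ) (ψ : Basis d → ℂ) (C : ℕ) (η h : ℝ)
    (T : List (Pattern d × ℕ)) : Prop extends Valid S L i T where
  close : ∀ q ∈ T, |(q.2 : ℝ) / C - prefixProb ψ q.1| ≤ η
  complete : ∀ Y, IsPrefix S i Y → h ≤ prefixProb ψ Y → Y ∈ T.map Prod.fst

/-- Forgetting the k-th digit recovers the parent, so different parents have no common extension. -/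
theorem nodup_extensions (k : Fin n) {U : List (Pattern d)} (hU : U.Nodup)
    (h : ∀ Y ∈ U, IsPrefix S k Y) : (U.flatMap fun Y => extensions S Y k).Nodup := by
  rw [List.nodup_flatMap]
  refine ⟨fun Y _ => ?_, ?_⟩
  · unfold extensions
    split_ifs
    · rw [List.nodup_ofFn]
      intro y y' hy
      have := congrFun hy k
      simpa using this
    · simp
  · refine List.Pairwise.imp_of_mem ?_ hU
    intro Y Y' hY hY' hne
    simp only [Function.onFun]
    rw [List.disjoint_iff_ne]
    rintro a ha _ hb rfl
    exact hne (((h Y hY).extend ha).2.symm.trans ((h Y' hY').extend hb).2)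

theorem length_extensions_le (k : Fin n) {D : ℕ} (hD : d k ≤ D) (hD1 : 1 ≤ D)
    (T : List (Pattern d × ℕ)) :
    (T.flatMap fun q => extensions S q.1 k).length ≤ T.length * D := by
  induction T with
  | nil => simp
  | cons q T ih =>
    rw [List.flatMap_cons, List.length_append, List.length_cons, add_mul]
    have : (extensions S q.1 k).length ≤ D := by
      unfold extensions
      split_ifs <;> simp [hD, hD1]
    omega

end Tree

namespace Source

variable {J : Type*} [Enc J] {s : Source J} {β : Type*} {j : J}
  {w : ∀ k, Fin (s.d j k) → Fin (s.d j k) → ℤ × ℤ} {S : Finset (Fin (s.n j))}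
  {M N L : List β} {thr : ℕ}

theorem mem_levelPattern {k : Fin (s.n j)} {T T' : List (Pattern (s.d j) × ℕ)}
    (h : T' ∈ (s.levelPattern j w S M N L thr k T).support) :
    ∃ r : List (Pattern (s.d j) × ℕ), r.map Prod.fst = T.flatMap (fun q => extensions S q.1 k) ∧
      T' = (r.filter fun q => decide (N.length * 2 ^ M.length ≤ q.2 * thr)).take L.length := by
  rw [levelPattern, PMF.mem_support_map_iff] at h
  obtain ⟨r, hr, rfl⟩ := h
  refine ⟨r, ?_, rfl⟩
  rw [mem_support_mapP] at hr
  generalize T.flatMap (fun q => extensions S q.1 k) = l at hr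
  induction hr with
  | nil => rfl
  | cons h _ ih =>
    obtain ⟨c, _, rfl⟩ := (PMF.mem_support_map_iff _ _ _).1 h
    simp [ih]

/-- `Valid` survives whatever the estimates are. It carries the guarantees without exception, namely
distinct outcomes, positive weights and bounded length. -/
theorem valid_take {k : Fin (s.n j)} (hN : 0 < N.length) {T r : List (Pattern (s.d j) × ℕ)}
    (hT : Valid S L.length k T)
    (hr : r.map Prod.fst = T.flatMap fun q => extensions S q.1 k) :
    Valid S L.length (k + 1)
      ((r.filter fun q => decide (N.length * 2 ^ M.length ≤ q.2 * thr)).take L.length) := by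
  have hC : T.flatMap (fun q => extensions S q.1 k) =
      (T.map Prod.fst).flatMap fun Y => extensions S Y k := by rw [List.flatMap_map]
  have hsub : ((r.filter fun q => decide (N.length * 2 ^ M.length ≤ q.2 * thr)).take
      L.length).Sublist r := (List.take_sublist _ _).trans List.filter_sublist
  refine ⟨fun q hq => ?_, fun q hq => ?_, ?_, by simp⟩
  · have h1 : q.1 ∈ r.map Prod.fst := List.mem_map_of_mem (hsub.subset hq)
    rw [hr, List.mem_flatMap] at h1
    obtain ⟨q', hq', h2⟩ := h1
    exact ((hT.isPrefix q' hq').extend h2).1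
  · have h1 := List.mem_of_mem_take hq
    simp only [List.mem_filter, decide_eq_true_eq] at h1
    rcases Nat.eq_zero_or_pos q.2 with h | h
    · have : 0 < N.length * 2 ^ M.length := by positivity
      rw [h] at h1
      omega
    · exact h
  · refine (hsub.map Prod.fst).nodup ?_
    rw [hr, hC]
    refine nodup_extensions k hT.nodup ?_
    intro Y hY
    obtain ⟨q, hq, rfl⟩ := List.mem_map.1 hY
    exact hT.isPrefix q hq

theorem valid_init (hN : 0 < N.length) (hL : 1 ≤ L.length) :
    Valid S L.length 0
      [((fun _ => none : Pattern (s.d j)), N.length * 2 ^ M.length)] := by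
  refine ⟨?_, ?_, by simp, by simpa using hL⟩
  · intro q hq k
    simp only [List.mem_singleton] at hq
    subst hq
    simp
  · intro q hq
    simp only [List.mem_singleton] at hq
    subst hq
    positivity

theorem valid_searchPattern (hN : 0 < N.length) (hL : 1 ≤ L.length)
    {T : List (Pattern (s.d j) × ℕ)} (h : T ∈ (s.searchPattern j w S M N L thr).support) :
    Valid S L.length (s.n j) T := by
  have := mem_support_pfold (F := s.levelPattern j w S M N L thr)
    (fun i T => Valid S L.length i T) (List.ofFn id) ?_ _ (valid_init hN hL) T h
  · simpa using this
  · intro i T hi hT T' hT'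
    simp only [List.getElem_ofFn, id] at hT'
    obtain ⟨r, hr, rfl⟩ := mem_levelPattern hT'
    exact valid_take (k := ⟨i, by simpa using hi⟩) hN hT hr

variable {ψ : Basis (s.d j) → ℂ} {η h : ℝ} {δ : ENNReal} {D : ℕ}

/-- If all estimates of the level are accurate, success is inherited. At most L · D estimates are
made, which gives the union bound. -/
theorem fails_level (hψ : ∑ c, ‖ψ c‖ ^ 2 = 1) (hN : 0 < N.length) (hthr : 0 < thr)
    (hest : ∀ i Y, IsPrefix S i Y → Fails (s.patternEstimate j w M N i Y)
      (fun c => |(c : ℝ) / (N.length * 2 ^ M.length : ℕ) - prefixProb ψ Y| ≤ η) δ)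
    (hh : (thr : ℝ)⁻¹ + η ≤ h) (hη : η < (thr : ℝ)⁻¹) (hL : 1 ≤ L.length * ((thr : ℝ)⁻¹ - η))
    (hD : ∀ k, s.d j k ≤ D) (hD1 : 1 ≤ D) {k : Fin (s.n j)}
    {T : List (Pattern (s.d j) × ℕ)}
    (hT : Successful S L.length k ψ (N.length * 2 ^ M.length) η h T) :
    Fails (s.levelPattern j w S M N L thr k T)
      (fun T' => Successful S L.length (k + 1) ψ (N.length * 2 ^ M.length) η h T')
      ((L.length * D : ℕ) * δ) := by
  set C := N.length * 2 ^ M.length with hC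
  have hC0 : (0 : ℝ) < C := by rw [hC]; positivity
  have ht0 : (0 : ℝ) < thr := by exact_mod_cast hthr
  rw [levelPattern, fails_map]
  refine (fails_mapP (G := fun Y p => p.1 = Y ∧ |(p.2 : ℝ) / C - prefixProb ψ Y| ≤ η)
    (δ := δ) _ fun Y hY => ?_).mono ?_ ?_
  · rw [fails_map]
    rw [List.mem_flatMap] at hY
    obtain ⟨q, hq, h2⟩ := hY
    refine (hest (k + 1) Y ((hT.isPrefix q hq).extend h2).1).mono (fun c _ hc => ?_) le_rfl
    exact ⟨rfl, hc⟩
  · intro r hr0 hr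
    clear hr0
    have hfst : r.map Prod.fst = T.flatMap fun q => extensions S q.1 k := by
      generalize T.flatMap (fun q => extensions S q.1 k) = l at hr
      induction hr with
      | nil => rfl
      | cons h _ ih => simp [ih, h.1]
    have hclose : ∀ q ∈ r, |(q.2 : ℝ) / C - prefixProb ψ q.1| ≤ η := by
      generalize T.flatMap (fun q => extensions S q.1 k) = l at hr
      clear hfst
      induction hr with
      | nil => simp
      | cons h _ ih =>
        intro q hq
        rcases List.mem_cons.1 hq with rfl | hq
        · rw [h.1]
          exact h.2
        · exact ih q hq
    have hv := valid_take (M := M) (N := N) (thr := thr) hN hT.toValid hfst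
    set F := r.filter fun q => decide (C ≤ q.2 * thr) with hF
    have hkeep : ∀ q : Pattern (s.d j) × ℕ, C ≤ q.2 * thr ↔ (thr : ℝ)⁻¹ ≤ (q.2 : ℝ) / C := by
      intro q
      rw [inv_le_iff_one_le_mul₀ ht0, div_mul_eq_mul_div, one_le_div hC0]
      exact_mod_cast Iff.rfl
    -- Every retained pattern truly has probability at least 1 / thr - η, so there are at most L of
    -- them and the cut removes nothing.
    have hlen : F.length ≤ L.length := by
      have h1 : (F.map Prod.fst).length * ((thr : ℝ)⁻¹ - η) ≤ 1 := by
        refine length_mul_le_one (S := S) (i := k + 1) hψ ?_ ?_ ?_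
        · refine (List.filter_sublist.map Prod.fst).nodup ?_
          rw [hfst]
          have := nodup_extensions k hT.nodup (S := S) (by
            intro Y hY
            obtain ⟨q, hq, rfl⟩ := List.mem_map.1 hY
            exact hT.isPrefix q hq)
          rwa [List.flatMap_map] at this
        · intro Y hY
          obtain ⟨q, hq, rfl⟩ := List.mem_map.1 hY
          have h1 : q.1 ∈ r.map Prod.fst := List.mem_map_of_mem (List.mem_filter.1 hq).1
          rw [hfst, List.mem_flatMap] at h1
          obtain ⟨q', hq', h2⟩ := h1
          exact ((hT.isPrefix q' hq').extend h2).1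
        · intro Y hY
          obtain ⟨q, hq, rfl⟩ := List.mem_map.1 hY
          rw [hF, List.mem_filter, decide_eq_true_eq, hkeep] at hq
          have := abs_le.1 (hclose q hq.1)
          linarith
      rw [List.length_map] at h1
      have h2 : (F.length : ℝ) * ((thr : ℝ)⁻¹ - η) ≤ L.length * ((thr : ℝ)⁻¹ - η) := h1.trans hL
      have h3 := le_of_mul_le_mul_right h2 (by linarith)
      exact_mod_cast h3
    have htake : F.take L.length = F := List.take_of_length_le hlen
    rw [htake] at hv ⊢
    refine ⟨hv, fun q hq => hclose q (List.mem_filter.1 hq).1, fun Y hY hYh => ?_⟩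
    -- Completeness: the parent of a significant pattern is significant and hence present; the
    -- pattern itself has estimate at least h - η ≥ 1 / thr and passes the filter.
    obtain ⟨h1, h2⟩ := hY.restrict
    have h3 := hT.complete _ h1 (hYh.trans (prefixProb_le_update ψ Y k))
    have h4 : Y ∈ r.map Prod.fst := by
      rw [hfst, List.mem_flatMap]
      obtain ⟨q, hq, h5⟩ := List.mem_map.1 h3
      exact ⟨q, hq, by rw [h5]; exact h2⟩
    obtain ⟨q, hq, rfl⟩ := List.mem_map.1 h4
    refine List.mem_map_of_mem (List.mem_filter.2 ⟨hq, ?_⟩)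
    rw [decide_eq_true_eq, hkeep]
    have := abs_le.1 (hclose q hq)
    linarith
  · gcongr
    refine (length_extensions_le k (hD k) hD1 T).trans ?_
    gcongr
    exact hT.length_le

theorem fails_search (hψ : ∑ c, ‖ψ c‖ ^ 2 = 1) (hN : 0 < N.length) (hthr : 0 < thr)
    (hest : ∀ i Y, IsPrefix S i Y → Fails (s.patternEstimate j w M N i Y)
      (fun c => |(c : ℝ) / (N.length * 2 ^ M.length : ℕ) - prefixProb ψ Y| ≤ η) δ)
    (hη0 : 0 ≤ η) (hh : (thr : ℝ)⁻¹ + η ≤ h) (hη : η < (thr : ℝ)⁻¹)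
    (hL : 1 ≤ L.length * ((thr : ℝ)⁻¹ - η))
    (hD : ∀ k, s.d j k ≤ D) (hD1 : 1 ≤ D) :
    Fails (s.searchPattern j w S M N L thr)
      (fun T => Successful S L.length (s.n j) ψ (N.length * 2 ^ M.length) η h T)
      (s.n j * ((L.length * D : ℕ) * δ)) := by
  have h1 := fails_pfold (F := s.levelPattern j w S M N L thr)
    (fun i T => Successful S L.length i ψ (N.length * 2 ^ M.length) η h T)
    (δ := (L.length * D : ℕ) * δ) (List.ofFn id) (fun i T hi hT => ?_)
    [(fun _ => none, N.length * 2 ^ M.length)] ?_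
  · simpa [searchPattern] using h1
  · simp only [List.getElem_ofFn, id]
    exact fails_level hψ hN hthr hest hh hη hL hD hD1 (k := ⟨i, by simpa using hi⟩) hT
  · have hL1 : 1 ≤ L.length := by
      rcases Nat.eq_zero_or_pos L.length with h0 | h0
      · rw [h0] at hL
        norm_num at hL
      · exact h0
    refine ⟨valid_init hN hL1, ?_, ?_⟩
    · intro q hq
      simp only [List.mem_singleton] at hq
      subst hq
      rw [prefixProb_none, hψ, div_self, sub_self, abs_zero]
      · exact hη0
      · have : 0 < N.length * 2 ^ M.length := by positivity
        exact_mod_cast this.ne'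
    · intro Y hY _
      have : Y = fun _ => none := by
        funext k
        exact hY.eq_none (Nat.zero_le _)
      simp [this]

end Source

end SparseSim

end

/-! ### Accuracy of one estimate, and of the normalized list -/

noncomputable section

namespace SparseSim

open Enc

namespace Source

variable {J : Type*} [Enc J] {s : Source J} {β : Type*} {j : J}
  {w : ∀ k, Fin (s.d j k) → Fin (s.d j k) → ℤ × ℤ} {S : Finset (Fin (s.n j))}
  {M N L : List β} {thr : ℕ} {ψ : Basis (s.d j) → ℂ} {η h : ℝ}

theorem entries_pad {i : ℕ} {Y : Pattern (s.d j)} (hY : IsPrefix S i Y) :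
    ∃ Z, (entries w Y).take i ++ (List.ofFn (s.d j)).map (fun _ => (false, 0, [])) =
      entries w Y ++ Z := by
  have h1 : (entries w Y).drop i = List.replicate (s.n j - i) (false, 0, []) := by
    refine List.ext_getElem (by simp [entries]) ?_
    intro k h1 h2
    simp only [entries, List.getElem_drop, List.getElem_ofFn, List.getElem_replicate]
    rw [hY.eq_none (k := ⟨i + k, _⟩) (by simp)]
    rfl
  have h2 : (List.ofFn (s.d j)).map (fun _ => ((false, 0, []) : Entry)) =
      (entries w Y).drop i ++ List.replicate (s.n j - (s.n j - i)) (false, 0, []) := by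
    rw [h1, ← List.replicate_add, List.map_const', List.length_ofFn]
    congr 1
    omega
  refine ⟨List.replicate (s.n j - (s.n j - i)) (false, 0, []), ?_⟩
  rw [h2, ← List.append_assoc, List.take_append_drop]

/-- The systematic error E of the mean and the statistical error η₁ of the average are both doubled
when (1 + P) / 2 is solved for P. -/
theorem fails_patternEstimate {E η₁ : ℝ}
    (hmean : ∀ Y, |meanFrac (s.sample j M (entries w Y)) (2 ^ M.length) -
      (1 + prefixProb ψ Y) / 2| ≤ E) (h0 : 0 < η₁) (h1 : η₁ ≤ 1) (hη : 2 * (E + η₁) ≤ η)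
    (hN : 0 < N.length) {i : ℕ} {Y : Pattern (s.d j)} (hY : IsPrefix S i Y) :
    Fails (s.patternEstimate j w M N i Y)
      (fun c => |(c : ℝ) / (N.length * 2 ^ M.length : ℕ) - prefixProb ψ Y| ≤ η)
      (2 * ENNReal.ofReal (Real.exp (-(N.length * (η₁ / 2) ^ 2)))) := by
  obtain ⟨Z, hZ⟩ := entries_pad (w := w) hY
  rw [patternEstimate, hZ, estimate, fails_map, s.sample_append _ _ _ _ (by simp [entries])]
  have hQ : (0 : ℝ) < (2 ^ M.length : ℕ) := by positivity
  have hN' : (0 : ℝ) < N.length := by exact_mod_cast hN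
  have hdev := deviation_le (p := s.sample j M (entries w Y)) (Q := 2 ^ M.length)
    (fun c hc => s.sample_le hc) N h0 h1
  unfold Fails
  refine le_trans (MeasureTheory.measure_mono ?_) hdev
  intro l hl
  simp only [Set.mem_ofPred_eq, not_le] at hl ⊢
  by_contra hcon
  push Not at hcon
  refine absurd hl (not_lt.2 ?_)
  have hm := hmean Y
  have hP := prefixProb_nonneg ψ Y
  clear hdev
  generalize l.sum = c at *
  generalize meanFrac (s.sample j M (entries w Y)) (2 ^ M.length) = m at *
  generalize 2 ^ M.length = Q at *
  have hdiv : |(c : ℝ) / Q / N.length - m| ≤ η₁ := by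
    have : (c : ℝ) / Q / N.length - m = ((c : ℝ) / Q - N.length * m) / N.length := by
      field_simp
    rw [this, abs_div, abs_of_pos hN', div_le_iff₀ hN']
    exact hcon
  have hA := abs_le.1 hdiv
  have hB := abs_le.1 hm
  have hx : (2 * c : ℝ) / (N.length * Q : ℕ) = 2 * ((c : ℝ) / Q / N.length) := by
    push_cast
    field_simp
  have hNQ : (0 : ℝ) < (N.length * Q : ℕ) := by push_cast; positivity
  rcases le_total (N.length * Q) (2 * c) with hle | hle
  · rw [Nat.cast_sub hle, sub_div, div_self hNQ.ne']
    push_cast at hx ⊢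
    rw [hx, abs_le]
    constructor <;> linarith
  -- The subtraction was truncated. The untruncated estimate is then at most 0 ≤ P, so 0 is at least
  -- as close to P.
  · rw [Nat.sub_eq_zero_of_le hle]
    have h2 : (2 * c : ℝ) / (N.length * Q : ℕ) ≤ 1 := by
      rw [div_le_one hNQ]
      exact_mod_cast hle
    rw [hx] at h2
    rw [Nat.cast_zero, zero_div, zero_sub, abs_neg, abs_of_nonneg hP]
    linarith

end Source

/-! ### Distances -/

/-- Outside U, the support of the sparse vector carries at most t · h ≤ ε plus its approximation
error, and the rest is within the sparsity error: 2ε in total. The errors on U add ε. So f is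
3ε-close to P, its total F satisfies |F - 1| ≤ 3ε, and dividing by F costs another 3ε. The bound ε ≤
1/6 keeps F away from 0. -/
theorem sum_abs_normalize_le {X : Type*} [Fintype X] [DecidableEq X] {P f : X → ℝ} {U : Finset X}
    {ε η h : ℝ} {t : ℕ} (hP : ∑ x, P x = 1) (hf0 : ∀ x, 0 ≤ f x)
    (hP0 : ∀ x, 0 ≤ P x) (hf : ∀ x, x ∉ U → f x = 0) (hη : ∀ x ∈ U, |f x - P x| ≤ η)
    (hh : ∀ x, x ∉ U → P x ≤ h) (hs : ApproxSparse ε t P) (hth : t * h ≤ ε) (hh0 : 0 ≤ h)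
    (hUη : U.card * η ≤ ε) (hε : ε ≤ 1 / 6) :
    0 < ∑ x, f x ∧ ∑ x, |f x / (∑ x, f x) - P x| ≤ 6 * ε := by
  obtain ⟨v, hv, hd⟩ := hs
  set V := (Set.toFinite (Function.support v)).toFinset with hV
  have hVc : V.card ≤ t := by
    rw [hV, ← Set.ncard_eq_toFinset_card]
    exact hv
  have h1 : ∑ x ∈ Uᶜ, P x ≤ 2 * ε := by
    have : ∀ x ∈ Uᶜ, P x ≤ ‖(P x : ℂ) - v x‖ + if x ∈ V then h else 0 := by
      intro x hx
      split_ifs with hxV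
      · have := hh x (by simpa using hx)
        have := norm_nonneg ((P x : ℂ) - v x)
        linarith
      · have hvx : v x = 0 := by simpa [hV] using hxV
        rw [hvx, sub_zero, add_zero, Complex.norm_real]
        exact Real.le_norm_self _
    refine (Finset.sum_le_sum this).trans ?_
    rw [Finset.sum_add_distrib]
    have h2 : ∑ x ∈ Uᶜ, ‖(P x : ℂ) - v x‖ ≤ ε :=
      (Finset.sum_le_univ_sum_of_nonneg fun x => norm_nonneg _).trans hd
    have h3 : ∑ x ∈ Uᶜ, (if x ∈ V then h else 0) ≤ ε := by
      refine (Finset.sum_le_univ_sum_of_nonneg fun x => by split_ifs <;> simp [hh0]).trans ?_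
      rw [Finset.sum_ite_mem, Finset.univ_inter, Finset.sum_const, nsmul_eq_mul]
      refine le_trans ?_ hth
      gcongr
    linarith
  have h2 : ∑ x, |f x - P x| ≤ 3 * ε := by
    rw [← Finset.sum_add_sum_compl U]
    have h3 : ∑ x ∈ U, |f x - P x| ≤ ε := by
      refine (Finset.sum_le_card_nsmul _ _ _ hη).trans ?_
      rwa [nsmul_eq_mul]
    have h4 : ∑ x ∈ Uᶜ, |f x - P x| = ∑ x ∈ Uᶜ, P x := by
      refine Finset.sum_congr rfl fun x hx => ?_
      rw [hf x (by simpa using hx), zero_sub, abs_neg, abs_of_nonneg (hP0 x)]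
    linarith
  have h3 : |∑ x, f x - 1| ≤ 3 * ε := by
    rw [← hP, ← Finset.sum_sub_distrib]
    exact (Finset.abs_sum_le_sum_abs _ _).trans h2
  have hF : 0 < ∑ x, f x := by
    have := (abs_le.1 h3).1
    linarith
  refine ⟨hF, ?_⟩
  set F := ∑ x, f x with hFdef
  have h4 : ∑ x, |f x / F - f x| = |F - 1| := by
    have : ∀ x, |f x / F - f x| = f x * (|F - 1| / F) := by
      intro x
      have : f x / F - f x = -(f x * ((F - 1) / F)) := by field_simp; ring
      rw [this, abs_neg, abs_mul, abs_of_nonneg (hf0 x), abs_div, abs_of_pos hF]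
    simp only [this]
    rw [← Finset.sum_mul, ← hFdef]
    field_simp
  calc ∑ x, |f x / F - P x| ≤ ∑ x, (|f x / F - f x| + |f x - P x|) :=
        Finset.sum_le_sum fun x _ => abs_sub_le _ _ _
    _ ≤ 6 * ε := by
        rw [Finset.sum_add_distrib, h4]
        linarith

/-! ### The final list -/

section Report

variable {n : ℕ} {d : Fin n → ℕ} {S : Finset (Fin n)}

/-- Outcomes as lists of digits. -/
def outcomeDigits (y : Outcome d S) : List ℕ :=
  (List.finRange n).filterMap fun j => if h : j ∈ S then some (y ⟨j, h⟩ : ℕ) else none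

theorem encOutcome_eq (y : Outcome d S) : encOutcome y = enc (outcomeDigits y) := by
  have : enc (outcomeDigits y) = Data.list ((outcomeDigits y).map Data.nat) := rfl
  rw [this, outcomeDigits, List.map_filterMap, encOutcome]
  congr 1
  refine List.filterMap_congr fun j _ => ?_
  split_ifs <;> rfl

/-- The pattern of an outcome. -/
def patternOf (y : Outcome d S) : Pattern d := fun k => if h : k ∈ S then some (y ⟨k, h⟩) else none

/-- The outcome of a pattern. -/
def outcomeFrom (y₀ : Outcome d S) (Y : Pattern d) : Outcome d S :=
  fun k => (Y k).getD (y₀ k)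

theorem isPrefix_patternOf (y : Outcome d S) : IsPrefix S n (patternOf y) := by
  intro k
  unfold patternOf
  split_ifs with h <;> simp [h]

/-- A pattern of the last level prescribes all of S, so the default outcome is never consulted. -/
theorem patternOf_outcomeFrom (y₀ : Outcome d S) {Y : Pattern d} (hY : IsPrefix S n Y) :
    patternOf (outcomeFrom y₀ Y) = Y := by
  funext k
  have := hY k
  unfold patternOf outcomeFrom
  split_ifs with h
  · cases hk : Y k with
    | none => simp [hk, h] at this
    | some y => rfl
  · cases hk : Y k with
    | none => rfl
    | some y => simp [hk, h] at this

theorem patternOf_injective : Function.Injective (patternOf : Outcome d S → Pattern d) := by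
  intro y y' h
  funext k
  have := congrFun h k
  simpa [patternOf, k.2] using this

theorem prefixProb_patternOf (ψ : Basis d → ℂ) (y : Outcome d S) :
    prefixProb ψ (patternOf y) = outcomeProb S ψ y := by
  classical
  unfold prefixProb outcomeProb
  refine Finset.sum_congr rfl fun c _ => ?_
  have : Fits (patternOf y) c ↔ (fun j : S => c j) = y := by
    constructor
    · intro h
      funext k
      exact h k (y k) (by simp [patternOf])
    · rintro rfl k z hz
      unfold patternOf at hz
      split_ifs at hz with h
      · simpa using hz
      · simp at hz
  by_cases h : (fun j : S => c j) = y
  · rw [if_pos (this.2 h), if_pos h]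
  · rw [if_neg (fun h' => h (this.1 h')), if_neg h]

theorem outcomeOf_entries (w : ∀ k, Fin (d k) → Fin (d k) → ℤ × ℤ) (y : Outcome d S) :
    outcomeOf (entries w (patternOf y)) = outcomeDigits y := by
  have h1 : ∀ l : List Entry, outcomeOf l = l.filterMap fun e => if e.1 = true then some e.2.1
      else none := by
    intro l
    unfold outcomeOf
    induction l with
    | nil => rfl
    | cons e l ih =>
      rw [List.filterMap_cons, List.filter_cons]
      split_ifs <;> simp_all
  rw [h1, entries, outcomeDigits, List.ofFn_eq_map, List.filterMap_map]
  refine List.filterMap_congr fun k _ => ?_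
  simp only [Function.comp_apply, patternOf]
  split_ifs <;> simp_all

theorem zeroOutcome_factor (w : ∀ k, Fin (d k) → Fin (d k) → ℤ × ℤ) (h : ∀ k, 0 < d k) :
    zeroOutcome (List.ofFn (factor S w)) = outcomeDigits (fun k : S => (⟨0, h k⟩ : Fin (d k))) := by
  have h1 : ∀ l : List Factor, zeroOutcome l = l.filterMap fun p => if p.2.1 = true then some 0
      else none := by
    intro l
    unfold zeroOutcome
    induction l with
    | nil => rfl
    | cons e l ih =>
      rw [List.filterMap_cons, List.filter_cons]
      split_ifs <;> simp_all
  rw [h1, outcomeDigits, List.ofFn_eq_map, List.filterMap_map]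
  refine List.filterMap_congr fun k _ => ?_
  simp only [Function.comp_apply, factor]
  split_ifs <;> simp_all

theorem dyadic_map {β γ μ : Type*} (M : List μ) (g : β → γ) (l : List (β × ℕ)) :
    dyadic M (l.map fun p => (g p.1, p.2)) = (dyadic M l).map fun p => (g p.1, p.2) := by
  have h1 : l = List.ofFn fun i : Fin l.length => (l[i].1, l[i].2) := by
    refine List.ext_getElem (by simp) fun i h1 h2 => by simp
  have h2 : dyadic M l = List.ofFn fun i : Fin l.length =>
      (l[i].1, dyw M.length (fun i : Fin l.length => l[i].2) i) := by
    conv_lhs => rw [h1]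
    exact dyadic_ofFn M _ _
  have h3 : (l.map fun p => (g p.1, p.2)) =
      List.ofFn fun i : Fin l.length => (g l[i].1, l[i].2) := by
    conv_lhs => rw [h1]
    rw [List.map_ofFn]
    rfl
  rw [h2, h3, List.map_ofFn, dyadic_ofFn]
  rfl

/-- The dyadic weights different from zero. -/
def roundWeights {β μ : Type*} (M : List μ) (ws : List (β × ℕ)) : List (β × ℕ) :=
  (dyadic M ws).filter fun q => decide (¬ q.2 = 0)

theorem roundWeights_map {β γ μ : Type*} (M : List μ) (g : β → γ) (l : List (β × ℕ)) :
    roundWeights M (l.map fun p => (g p.1, p.2)) =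
      (roundWeights M l).map fun p => (g p.1, p.2) := by
  rw [roundWeights, dyadic_map, List.filter_map, roundWeights]
  rfl

theorem sum_filter_ne_zero {β : Type*} (l : List (β × ℕ)) (f : β × ℕ → ℝ)
    (hf : ∀ p, p.2 = 0 → f p = 0) :
    ((l.filter fun q => decide (¬ q.2 = 0)).map f).sum = (l.map f).sum := by
  induction l with
  | nil => rfl
  | cons p l ih =>
    rw [List.filter_cons]
    simp only [decide_not] at ih ⊢
    by_cases hp : p.2 = 0
    · simp [hp, ih, hf p hp]
    · simp [hp, ih]

/-- The rounded weights exhaust the range of a random number with `M.length` bits exactly, so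
sampling from them has no error. -/
theorem sum_roundWeights {β μ : Type*} (M : List μ) {ws : List (β × ℕ)} (h : ws ≠ []) :
    ((roundWeights M ws).map Prod.snd).sum = 2 ^ M.length := by
  have h1 := sum_filter_ne_zero (dyadic M ws) (fun p => (p.2 : ℝ)) (by simp)
  have h2 : ws = List.ofFn fun i : Fin ws.length => (ws[i].1, ws[i].2) := by
    refine List.ext_getElem (by simp) fun i h1 h2 => by simp
  have h3 : ((dyadic M ws).map fun p => (p.2 : ℝ)).sum = 2 ^ M.length := by
    rw [h2, dyadic_ofFn, List.map_ofFn, List.sum_ofFn]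
    simp only [Function.comp_apply]
    rw [← Nat.cast_sum, sum_dyw (List.length_pos_iff.2 h)]
    norm_num
  rw [h3] at h1
  have h4 : (((roundWeights M ws).map Prod.snd).sum : ℝ) =
      ((roundWeights M ws).map fun p => (p.2 : ℝ)).sum := by
    rw [Nat.cast_list_sum, List.map_map]
    rfl
  exact_mod_cast h4.trans h1

theorem keys_roundWeights_sublist {β μ : Type*} (M : List μ) (ws : List (β × ℕ)) :
    ((roundWeights M ws).map Prod.fst).Sublist (ws.map Prod.fst) := by
  have h2 : (dyadic M ws).map Prod.fst = ws.map Prod.fst := by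
    refine List.ext_getElem (by simp [dyadic]) ?_
    intro i h1 h2
    simp only [dyadic, List.getElem_map, List.getElem_zipIdx]
    split_ifs <;> rfl
  rw [← h2]
  exact List.filter_sublist.map _

/-- The distribution given by a list of weights. -/
def weightPMF {β μ : Type*} (M : List μ) (b : β) (l : List (β × ℕ)) : PMF β :=
  (rand M).map (pick b l)

theorem weightPMF_apply {β μ : Type*} (M : List μ) (b : β) {ws : List (β × ℕ)} (h : ws ≠ [])
    (c : β) [DecidableEq β] : (weightPMF M b (roundWeights M ws) c).toReal =
      ((roundWeights M ws).map fun p => if p.1 = c then (p.2 : ℝ) else 0).sum / 2 ^ M.length := by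
  rw [weightPMF, rand_pick_apply M b _ c (sum_roundWeights M h)]
  congr 3
  funext p
  split_ifs <;> rfl

/-- Pushing weights forward along the keys does not increase the ℓ¹ distance; this reduces the claim
to `sum_abs_dyw_le`. -/
theorem weightPMF_close {X μ : Type*} [Fintype X] [DecidableEq X] (M : List μ) (b : X)
    {ws : List (X × ℕ)} (h : 0 < (ws.map Prod.snd).sum) :
    ∑ x, |(weightPMF M b (roundWeights M ws) x).toReal -
      (ws.map fun p => if p.1 = x then (p.2 : ℝ) else 0).sum / (ws.map Prod.snd).sum| ≤
      2 * ws.length / 2 ^ M.length := by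
  have hne : ws ≠ [] := by
    rintro rfl
    simp at h
  have h2 : ws = List.ofFn fun i : Fin ws.length => (ws[i].1, ws[i].2) := by
    refine List.ext_getElem (by simp) fun i h1 h2 => by simp
  set k : Fin ws.length → X := fun i => ws[i].1
  set v : Fin ws.length → ℕ := fun i => ws[i].2
  have hW : (ws.map Prod.snd).sum = ∑ i, v i := by
    conv_lhs => rw [h2]
    rw [List.map_ofFn, List.sum_ofFn]
    rfl
  have h3 : ∀ x, (weightPMF M b (roundWeights M ws) x).toReal =
      ∑ i, if k i = x then (dyw M.length v i : ℝ) / 2 ^ M.length else 0 := by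
    intro x
    rw [weightPMF_apply M b hne, roundWeights, sum_filter_ne_zero _ _ (by
      intro p hp
      simp [hp])]
    have : dyadic M ws = List.ofFn fun i => (k i, dyw M.length v i) := by
      conv_lhs => rw [h2]
      exact dyadic_ofFn M k v
    rw [this, List.map_ofFn, List.sum_ofFn, Finset.sum_div]
    refine Finset.sum_congr rfl fun i _ => ?_
    simp only [Function.comp_apply]
    split_ifs <;> simp
  have h4 : ∀ x, (ws.map fun p => if p.1 = x then (p.2 : ℝ) else 0).sum / (ws.map Prod.snd).sum =
      ∑ i, if k i = x then (v i : ℝ) / (∑ i, v i : ℕ) else 0 := by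
    intro x
    rw [hW]
    have : (ws.map fun p => if p.1 = x then (p.2 : ℝ) else 0).sum =
        ∑ i, if k i = x then (v i : ℝ) else 0 := by
      conv_lhs => rw [h2]
      rw [List.map_ofFn, List.sum_ofFn]
      rfl
    rw [this, Finset.sum_div]
    refine Finset.sum_congr rfl fun i _ => ?_
    split_ifs <;> simp
  refine le_trans ?_ (sum_abs_dyw_le M.length v (by rwa [← hW]))
  calc _ ≤ ∑ x, ∑ i, if k i = x then
        |(dyw M.length v i : ℝ) / 2 ^ M.length - (v i : ℝ) / (∑ i, v i : ℕ)| else 0 := by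
        refine Finset.sum_le_sum fun x _ => ?_
        rw [h3, h4, ← Finset.sum_sub_distrib]
        refine (Finset.abs_sum_le_sum_abs _ _).trans (Finset.sum_le_sum fun i _ => ?_)
        split_ifs <;> simp
    _ = _ := by
        rw [Finset.sum_comm]
        refine Finset.sum_congr rfl fun i _ => ?_
        simp

end Report

end SparseSim

end

/-! ### The output list as a probability distribution -/

noncomputable section

namespace SparseSim

open Enc

section Report

variable {n : ℕ} {d : Fin n → ℕ} {S : Finset (Fin n)}

/-- The final weights of outcomes, before rounding. -/
def weights (y₀ : Outcome d S) (T : List (Pattern d × ℕ)) : List (Outcome d S × ℕ) :=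
  if T.isEmpty = true then [(y₀, 1)] else T.map fun q => (outcomeFrom y₀ q.1, q.2)

/-- Translates the program's final step into weights on outcomes. Rounding looks at the weights
only, so it commutes with replacing outcomes by their digits. -/
theorem report_node {μ : Type*} (M : List μ) (w : ∀ k, Fin (d k) → Fin (d k) → ℤ × ℤ)
    (hd : ∀ k, 0 < d k) {T : List (Pattern d × ℕ)} (hT : ∀ q ∈ T, IsPrefix S n q.1) :
    report M (List.ofFn (factor S w)) (T.map (node w n)) =
      (roundWeights M (weights (fun k : S => (⟨0, hd k⟩ : Fin (d k))) T)).map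
        fun q => (outcomeDigits q.1, q.2, 2 ^ M.length) := by
  set y₀ : Outcome d S := fun k : S => (⟨0, hd k⟩ : Fin (d k)) with hy₀
  have h1 : (if (T.map (node w n)).isEmpty = true then [(zeroOutcome (List.ofFn (factor S w)), 1)]
      else (T.map (node w n)).map fun nd => (outcomeOf nd.1, nd.2)) =
      (weights y₀ T).map fun q => (outcomeDigits q.1, q.2) := by
    rw [List.isEmpty_map, weights]
    split_ifs
    · rw [zeroOutcome_factor w hd]
      rfl
    · rw [List.map_map, List.map_map]
      refine List.map_congr_left fun q hq => ?_
      simp only [Function.comp_apply, node]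
      rw [List.take_of_length_le (by simp [entries])]
      conv_lhs => rw [← patternOf_outcomeFrom y₀ (hT q hq), outcomeOf_entries]
  have h2 : report M (List.ofFn (factor S w)) (T.map (node w n)) =
      (roundWeights M ((weights y₀ T).map fun q => (outcomeDigits q.1, q.2))).map
        fun q => (q.1, q.2, 2 ^ M.length) := by
    rw [← h1]
    rfl
  rw [h2, roundWeights_map, List.map_map]
  rfl

theorem weights_ne_nil (y₀ : Outcome d S) (T : List (Pattern d × ℕ)) : weights y₀ T ≠ [] := by
  unfold weights
  split_ifs with h
  · simp
  · simpa using h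

theorem sum_weights_pos (y₀ : Outcome d S) {T : List (Pattern d × ℕ)} (h : ∀ q ∈ T, 0 < q.2) :
    0 < ((weights y₀ T).map Prod.snd).sum := by
  have h1 := weights_ne_nil y₀ T
  obtain ⟨p, l, hp⟩ := List.exists_cons_of_ne_nil h1
  have h2 : p ∈ weights y₀ T := by rw [hp]; simp
  have h3 : 0 < p.2 := by
    unfold weights at h2
    split_ifs at h2
    · simp only [List.mem_singleton] at h2
      subst h2
      exact one_pos
    · obtain ⟨q, hq, rfl⟩ := List.mem_map.1 h2
      exact h q hq
  rw [hp, List.map_cons, List.sum_cons]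
  omega

theorem nodup_weights (y₀ : Outcome d S) {T : List (Pattern d × ℕ)} {L : ℕ}
    (h : Valid S L n T) : ((weights y₀ T).map Prod.fst).Nodup := by
  unfold weights
  split_ifs
  · simp
  · have h1 : T.map Prod.fst = ((T.map fun q => (outcomeFrom y₀ q.1, q.2)).map Prod.fst).map
        patternOf := by
      rw [List.map_map, List.map_map]
      refine List.map_congr_left fun q hq => ?_
      exact (patternOf_outcomeFrom y₀ (h.isPrefix q hq)).symm
    have h2 := h.nodup
    rw [h1] at h2
    exact h2.of_map _

theorem length_weights_le (y₀ : Outcome d S) {T : List (Pattern d × ℕ)} {L : ℕ} (hL : 1 ≤ L)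
    (h : T.length ≤ L) : (weights y₀ T).length ≤ L := by
  unfold weights
  split_ifs
  · simpa using hL
  · simpa using h

theorem sum_ite_key {X : Type*} [DecidableEq X] {l : List (X × ℕ)} (hl : (l.map Prod.fst).Nodup)
    {q : X × ℕ} (hq : q ∈ l) :
    (l.map fun p => if p.1 = q.1 then (p.2 : ℝ) else 0).sum = q.2 := by
  induction l with
  | nil => simp at hq
  | cons p l ih =>
    rw [List.map_cons, List.nodup_cons] at hl
    rw [List.map_cons, List.sum_cons]
    rcases List.mem_cons.1 hq with rfl | hq
    · have : (l.map fun p => if p.1 = q.1 then (p.2 : ℝ) else 0).sum = 0 := by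
        refine List.sum_eq_zero fun x hx => ?_
        obtain ⟨p', hp', rfl⟩ := List.mem_map.1 hx
        rw [if_neg]
        intro he
        exact hl.1 (he ▸ List.mem_map_of_mem hp')
      simp [this]
    · rw [ih hl.2 hq, if_neg, zero_add]
      intro he
      exact hl.1 (he ▸ List.mem_map_of_mem hq)

theorem lists_roundWeights {μ : Type*} (M : List μ) (y₀ : Outcome d S)
    {ws : List (Outcome d S × ℕ)} (h : ws ≠ []) (hn : (ws.map Prod.fst).Nodup) :
    Lists (enc ((roundWeights M ws).map fun q => (outcomeDigits q.1, q.2, 2 ^ M.length)))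
      (weightPMF M y₀ (roundWeights M ws)) := by
  classical
  have hnd := (keys_roundWeights_sublist M ws).nodup hn
  refine ⟨(roundWeights M ws).map fun q => (q.1, q.2, 2 ^ M.length), ?_, ?_, ?_, ?_⟩
  · simp only [enc, List.map_map]
    congr 1
    refine List.map_congr_left fun q _ => ?_
    simp only [Function.comp_apply, encOutcome_eq]
    rfl
  · rw [List.map_map]
    exact hnd
  · intro y
    rw [List.map_map]
    have h1 : (weightPMF M y₀ (roundWeights M ws) y ≠ 0) ↔
        (weightPMF M y₀ (roundWeights M ws) y).toReal ≠ 0 := by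
      rw [ENNReal.toReal_ne_zero]
      exact ⟨fun h => ⟨h, PMF.apply_ne_top _ _⟩, fun h => h.1⟩
    rw [h1, weightPMF_apply M y₀ h]
    have h2 : (2 : ℝ) ^ M.length ≠ 0 := by positivity
    constructor
    · intro hy
      obtain ⟨q, hq, rfl⟩ := List.mem_map.1 hy
      simp only [Function.comp_apply]
      rw [sum_ite_key hnd hq]
      have : q.2 ≠ 0 := by simpa using (List.mem_filter.1 hq).2
      positivity
    · intro hy
      by_contra hcon
      refine hy ?_
      rw [List.sum_eq_zero, zero_div]
      intro x hx
      obtain ⟨p, hp, rfl⟩ := List.mem_map.1 hx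
      rw [if_neg]
      rintro rfl
      exact hcon (List.mem_map_of_mem (f := Prod.fst ∘ fun q : Outcome d S × ℕ =>
        (q.1, q.2, 2 ^ M.length)) hp)
  · intro q hq
    obtain ⟨p, hp, rfl⟩ := List.mem_map.1 hq
    refine ⟨by positivity, ?_⟩
    simp only
    rw [weightPMF_apply M y₀ h, sum_ite_key hnd hp]
    norm_num

theorem ncard_support_weightPMF_le {μ : Type*} (M : List μ) (y₀ : Outcome d S)
    {ws : List (Outcome d S × ℕ)} (h : ws ≠ []) (hn : (ws.map Prod.fst).Nodup) :
    (weightPMF M y₀ (roundWeights M ws)).support.ncard ≤ ws.length := by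
  classical
  obtain ⟨l, h1, h2, h3, h4⟩ := lists_roundWeights M y₀ h hn
  have h5 : (weightPMF M y₀ (roundWeights M ws)).support = ((l.map Prod.fst).toFinset : Set _) := by
    ext y
    rw [PMF.mem_support_iff, ← h3]
    simp
  rw [h5, Set.ncard_coe_finset, List.toFinset_card_of_nodup h2, List.length_map]
  have h6 : ((roundWeights M ws).map fun q => (outcomeDigits q.1, q.2, 2 ^ M.length)).length ≤
      ws.length := by
    have := (keys_roundWeights_sublist M ws).length_le
    simpa using this
  -- `Lists` provides its list only through the encoding; injectivity of `Data.list` transfers the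
  -- length.
  have h7 : ∀ l l' : List Data, Data.list l = Data.list l' → l = l' := by
    intro l
    induction l with
    | nil => intro l' h; cases l' <;> simp_all [Data.list]
    | cons a l ih =>
      intro l' h
      cases l' with
      | nil => simp [Data.list] at h
      | cons b l' =>
        simp only [Data.list, Data.pair.injEq] at h
        rw [h.1, ih _ h.2]
  have h8 := congrArg List.length (h7 _ _ h1)
  simp only [List.length_map] at h8 h6
  omega

theorem rand_congr {β γ : Type*} (l : List β) (l' : List γ) (h : l.length = l'.length) :
    rand l = rand l' := by
  ext r
  rw [rand_apply, rand_apply, h]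

/-- The denominator reveals `M.length`, and every random number below 2 ^ `M.length` hits a block.
So the default value of the sampler does not matter. -/
theorem resample_roundWeights {μ : Type*} (M : List μ) (y₀ : Outcome d S)
    {ws : List (Outcome d S × ℕ)} (h : ws ≠ []) :
    resample ((roundWeights M ws).map fun q => (outcomeDigits q.1, q.2, 2 ^ M.length)) =
      (weightPMF M y₀ (roundWeights M ws)).map outcomeDigits := by
  have hs := sum_roundWeights M h
  set l := roundWeights M ws
  have hne : l ≠ [] := by
    intro h
    rw [h] at hs
    have : 0 < 2 ^ M.length := by positivity
    simp at hs
    omega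
  obtain ⟨p, l', hp⟩ := List.exists_cons_of_ne_nil hne
  have h1 : (List.replicate (Nat.size ((l.map fun q => (outcomeDigits q.1, q.2,
      2 ^ M.length)).headD ([], 0, 0)).2.2) ()).tail.length = M.length := by
    rw [hp]
    simp [Nat.size_pow]
  rw [resample, rand_congr _ M h1, weightPMF, PMF.map_comp]
  refine pmf_map_congr _ fun r hr => ?_
  have hr' : r < 2 ^ M.length := by
    rw [PMF.mem_support_iff, rand_apply] at hr
    by_contra hcon
    simp [hcon] at hr
  simp only [Function.comp_apply]
  refine Eq.trans ?_ (pick_map outcomeDigits y₀ l r)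
  rw [List.map_map]
  refine pick_dflt _ _ _ _ ?_
  rw [List.map_map]
  have : (Prod.snd ∘ (fun q : List ℕ × ℕ × ℕ => (q.1, q.2.1)) ∘
      fun q : Outcome d S × ℕ => (outcomeDigits q.1, q.2, 2 ^ M.length)) = Prod.snd := rfl
  rw [this, hs]
  exact hr'

end Report

theorem sum_outcomeProb {n : ℕ} {d : Fin n → ℕ} {S : Finset (Fin n)} (ψ : Basis d → ℂ) :
    ∑ y, outcomeProb S ψ y = ∑ c, ‖ψ c‖ ^ 2 := by
  unfold outcomeProb
  rw [Finset.sum_comm]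
  refine Finset.sum_congr rfl fun c _ => ?_
  simp

theorem Successful.close_outcomeProb {n : ℕ} {d : Fin n → ℕ} {S : Finset (Fin n)} {L C t : ℕ}
    {ψ : Basis d → ℂ} (hψ : ∑ c, ‖ψ c‖ ^ 2 = 1) {ε η h : ℝ} {T : List (Pattern d × ℕ)}
    (hT : Successful S L n ψ C η h T) (hC : 0 < C) {μ : Type*} (M : List μ) (y₀ : Outcome d S)
    (hs : ApproxSparse ε t (outcomeProb S ψ)) (hth : t * h ≤ ε) (hh0 : 0 ≤ h) (hη0 : 0 ≤ η)
    (hLη : L * η ≤ ε) (hε : ε ≤ 1 / 6) (hM : 2 * L / 2 ^ M.length ≤ ε) :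
    ∑ y, |(weightPMF M y₀ (roundWeights M (weights y₀ T)) y).toReal - outcomeProb S ψ y| ≤
      7 * ε := by
  classical
  have hC' : (0 : ℝ) < C := by exact_mod_cast hC
  have hclose := weightPMF_close M y₀ (sum_weights_pos y₀ hT.pos)
  set U : List (Outcome d S × ℕ) := T.map fun q => (outcomeFrom y₀ q.1, q.2) with hU
  set f : Outcome d S → ℝ := fun y => (U.map fun p => if p.1 = y then (p.2 : ℝ) else 0).sum / C
    with hf
  have hkeys : T.map Prod.fst = (U.map Prod.fst).map patternOf := by
    rw [hU, List.map_map, List.map_map]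
    refine List.map_congr_left fun q hq => ?_
    exact (patternOf_outcomeFrom y₀ (hT.isPrefix q hq)).symm
  have hnd : (U.map Prod.fst).Nodup := by
    have := hT.nodup
    rw [hkeys] at this
    exact this.of_map _
  have hoff : ∀ y, y ∉ (U.map Prod.fst).toFinset → f y = 0 := by
    intro y hy
    simp only [hf]
    rw [List.sum_eq_zero, zero_div]
    intro x hx
    obtain ⟨p, hp, rfl⟩ := List.mem_map.1 hx
    rw [if_neg]
    rintro rfl
    exact hy (by simpa using ⟨p.2, hp⟩)
  have hon : ∀ y ∈ (U.map Prod.fst).toFinset, |f y - outcomeProb S ψ y| ≤ η := by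
    intro y hy
    rw [List.mem_toFinset] at hy
    obtain ⟨p, hp, rfl⟩ := List.mem_map.1 hy
    obtain ⟨q, hq, rfl⟩ := List.mem_map.1 hp
    have h1 := hT.close q hq
    simp only [hf]
    rw [sum_ite_key hnd hp, ← prefixProb_patternOf]
    simp only
    rw [patternOf_outcomeFrom y₀ (hT.isPrefix q hq)]
    exact h1
  have hsmall : ∀ y, y ∉ (U.map Prod.fst).toFinset → outcomeProb S ψ y ≤ h := by
    intro y hy
    by_contra hcon
    push Not at hcon
    rw [← prefixProb_patternOf] at hcon
    have := hT.complete _ (isPrefix_patternOf y) hcon.le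
    rw [hkeys, List.mem_map] at this
    obtain ⟨y', hy', he⟩ := this
    rw [← patternOf_injective he] at hy
    exact hy (by simpa using hy')
  have hcard : ((U.map Prod.fst).toFinset.card : ℝ) * η ≤ ε := by
    refine le_trans ?_ hLη
    gcongr
    refine (List.toFinset_card_le _).trans ?_
    rw [List.length_map, hU, List.length_map]
    exact hT.length_le
  have hP0 : ∀ y, 0 ≤ outcomeProb S ψ y := by
    intro y
    rw [← prefixProb_patternOf]
    exact prefixProb_nonneg _ _
  have hf0 : ∀ y, 0 ≤ f y := by
    intro y
    refine div_nonneg (List.sum_nonneg fun x hx => ?_) hC'.le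
    obtain ⟨p, _, rfl⟩ := List.mem_map.1 hx
    split_ifs <;> positivity
  obtain ⟨hpos, hmain⟩ := sum_abs_normalize_le (by rw [sum_outcomeProb, hψ]) hf0 hP0 hoff hon
    hsmall hs hth hh0 hcard hε
  have hsumf : ∑ y, f y = ((U.map Prod.snd).sum : ℕ) / C := by
    simp only [hf]
    rw [← Finset.sum_div]
    congr 1
    generalize U = l
    induction l with
    | nil => simp
    | cons p l ih =>
      simp only [List.map_cons, List.sum_cons, Finset.sum_add_distrib, ih]
      simp
  -- The positive total from `sum_abs_normalize_le` rules out an empty list, so the fallback outcome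
  -- is not used in a successful run.
  have hTne : T ≠ [] := by
    rintro rfl
    rw [hsumf, hU] at hpos
    simp at hpos
  have hw : weights y₀ T = U := by
    unfold weights
    rw [if_neg (by simpa using hTne)]
  rw [hw] at hclose ⊢
  have hfU : ∀ y, f y / ∑ y, f y =
      (U.map fun p => if p.1 = y then (p.2 : ℝ) else 0).sum / (U.map Prod.snd).sum := by
    intro y
    rw [hsumf]
    simp only [hf]
    rw [div_div_div_cancel_right₀ hC'.ne']
  calc _ ≤ ∑ y, (|(weightPMF M y₀ (roundWeights M U) y).toReal - f y / ∑ y, f y| +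
        |f y / ∑ y, f y - outcomeProb S ψ y|) := Finset.sum_le_sum fun y _ => abs_sub_le _ _ _
    _ ≤ 2 * U.length / 2 ^ M.length + 6 * ε := by
        rw [Finset.sum_add_distrib]
        simp only [hfU] at hmain ⊢
        exact add_le_add hclose hmain
    _ ≤ 2 * L / 2 ^ M.length + 6 * ε := by
        gcongr
        rw [hU, List.length_map]
        exact hT.length_le
    _ ≤ 7 * ε := by linarith

end SparseSim

end

/-! ### Choice of the parameters -/

noncomputable section

namespace SparseSim

open Enc ComplexConjugate

theorem tensor_mul {n : ℕ} {d : Fin n → ℕ} (u v : ∀ j, Matrix (Fin (d j)) (Fin (d j)) ℂ) :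
    tensor u * tensor v = tensor fun j => u j * v j := by
  ext x y
  simp only [tensor, Matrix.mul_apply, Matrix.of_apply]
  rw [Finset.prod_univ_sum, Fintype.piFinset_univ]
  refine Finset.sum_congr rfl fun z _ => ?_
  rw [Finset.prod_mul_distrib]

theorem tensor_one {n : ℕ} {d : Fin n → ℕ} :
    tensor (fun j => (1 : Matrix (Fin (d j)) (Fin (d j)) ℂ)) = 1 := by
  ext x y
  simp only [tensor, Matrix.of_apply, Matrix.one_apply]
  by_cases h : x = y
  · simp [h]
  · rw [if_neg h]
    obtain ⟨k, hk⟩ := Function.ne_iff.1 h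
    exact Finset.prod_eq_zero (Finset.mem_univ k) (if_neg hk)

theorem tensor_conjTranspose {n : ℕ} {d : Fin n → ℕ}
    (u : ∀ j, Matrix (Fin (d j)) (Fin (d j)) ℂ) :
    (tensor u)ᴴ = tensor fun j => (u j)ᴴ := by
  ext x y
  simp [tensor, Matrix.conjTranspose_apply]

theorem sum_norm_sq_mulVec {X : Type*} [Fintype X] [DecidableEq X] {U : Matrix X X ℂ}
    (hU : Uᴴ * U = 1) (φ : X → ℂ) : ∑ x, ‖(U *ᵥ φ) x‖ ^ 2 = ∑ x, ‖φ x‖ ^ 2 := by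
  have h1 : ∀ ψ : X → ℂ, ((∑ x, ‖ψ x‖ ^ 2 : ℝ) : ℂ) = star ψ ⬝ᵥ ψ := by
    intro ψ
    push_cast
    refine Finset.sum_congr rfl fun x _ => ?_
    rw [Pi.star_apply, RCLike.star_def, Complex.conj_mul']
  have h2 : star (U *ᵥ φ) ⬝ᵥ (U *ᵥ φ) = star φ ⬝ᵥ φ := by
    rw [Matrix.star_mulVec, ← Matrix.dotProduct_mulVec, Matrix.mulVec_mulVec, hU,
      Matrix.one_mulVec]
  rw [← h1, ← h1] at h2
  exact_mod_cast h2

theorem sum_norm_sq_tensor_mulVec {n : ℕ} {d : Fin n → ℕ}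
    (u : ∀ k, Matrix.unitaryGroup (Fin (d k)) ℂ) (φ : Basis d → ℂ) :
    ∑ x, ‖(tensor (fun k => (u k).1) *ᵥ φ) x‖ ^ 2 = ∑ x, ‖φ x‖ ^ 2 := by
  refine sum_norm_sq_mulVec ?_ φ
  rw [tensor_conjTranspose, tensor_mul]
  have : (fun j => ((u j).1)ᴴ * (u j).1) = fun j => (1 : Matrix (Fin (d j)) (Fin (d j)) ℂ) := by
    funext j
    exact (u j).2.1
  rw [this, tensor_one]

theorem Fails.le_toOuterMeasure {α : Type*} {p : PMF α} {G : α → Prop} {δ : ℝ} (hδ : 0 ≤ δ)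
    (h : Fails p G (ENNReal.ofReal δ)) :
    ENNReal.ofReal (1 - δ) ≤ p.toOuterMeasure {a | G a} := by
  rw [ENNReal.ofReal_sub _ hδ, ENNReal.ofReal_one, tsub_le_iff_right]
  have h1 : p.toOuterMeasure Set.univ = 1 :=
    (PMF.toOuterMeasure_apply_eq_one_iff _ _).2 (Set.subset_univ _)
  have h2 : (Set.univ : Set α) = {a | G a} ∪ {a | ¬ G a} := by
    ext a
    simp [em]
  rw [← h1, h2]
  exact (MeasureTheory.measure_union_le _ _).trans (by gcongr; exact h)

/-- The zero vector has distance 1 from a probability distribution. Thus t ≥ 1, as the parameters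
require. -/
theorem ApproxSparse.pos {X : Type*} [Fintype X] {ε : ℝ} {t : ℕ} {p : X → ℝ}
    (h : ApproxSparse ε t p) (hp : ∑ x, p x = 1) (hε : ε < 1) : 0 < t := by
  rcases Nat.eq_zero_or_pos t with rfl | ht
  · obtain ⟨v, hv, hd⟩ := h
    have h0 : v = 0 := by
      rw [← Function.support_eq_empty_iff]
      exact (Set.ncard_eq_zero (Set.toFinite _)).1 (Nat.le_zero.1 hv)
    subst h0
    have h1 : ∑ x, p x ≤ ∑ x, ‖(p x : ℂ) - (0 : X → ℂ) x‖ := by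
      refine Finset.sum_le_sum fun x _ => ?_
      simp only [Pi.zero_apply, sub_zero, Complex.norm_real]
      exact Real.le_norm_self _
    linarith
  · exact ht

/-- The logarithm of the precision, as a multiple of the size of the instance. -/
def precisionFactor (D : ℕ) : ℕ := 2 * D + 13

/-- 1472 = 46 · 32 combines the constant of `mean_close` with the target accuracy 1 / (32tA²); it is
below 2 ^ 11. -/
theorem precision_le {D n t A : ℕ} (hD : 1 ≤ D) (hA : 1 ≤ A) :
    1472 * (t * A ^ 2) * (D ^ (2 * n + 1) * 2 ^ n) ≤ 2 ^ (precisionFactor D * (n + t + A)) := by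
  have h1 : t ≤ 2 ^ t := Nat.lt_two_pow_self.le
  have h2 : A ≤ 2 ^ A := Nat.lt_two_pow_self.le
  have h3 : D ≤ 2 ^ D := Nat.lt_two_pow_self.le
  calc 1472 * (t * A ^ 2) * (D ^ (2 * n + 1) * 2 ^ n)
      ≤ 2 ^ 11 * (2 ^ t * (2 ^ A) ^ 2) * ((2 ^ D) ^ (2 * n + 1) * 2 ^ n) := by
        gcongr
        norm_num
    _ = 2 ^ (11 + (t + A * 2) + (D * (2 * n + 1) + n)) := by
        rw [← pow_mul, ← pow_mul, ← pow_add, ← pow_add, ← pow_add, ← pow_add]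
    _ ≤ _ := by
        refine Nat.pow_le_pow_right (by norm_num) ?_
        unfold precisionFactor
        nlinarith

/-- n levels with at most 4tA · D estimates, each failing with probability at most 2 exp(-...). The
exponent absorbs every factor through m ≤ 2 ^ m, and the summand 3 absorbs 4 · 2. -/
theorem failure_le {D n t A c : ℕ} :
    (n * (4 * t * A * D) * 2 : ℝ) * Real.exp (-(c + n + t + A + D + 3 : ℕ)) ≤ (2 ^ c)⁻¹ := by
  have h1 : (t : ℝ) ≤ 2 ^ t := by exact_mod_cast Nat.lt_two_pow_self.le
  have h2 : (A : ℝ) ≤ 2 ^ A := by exact_mod_cast Nat.lt_two_pow_self.le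
  have h3 : (D : ℝ) ≤ 2 ^ D := by exact_mod_cast Nat.lt_two_pow_self.le
  have h4 : (n : ℝ) ≤ 2 ^ n := by exact_mod_cast Nat.lt_two_pow_self.le
  have h5 : Real.exp (-(c + n + t + A + D + 3 : ℕ)) ≤ (2 ^ (c + n + t + A + D + 3))⁻¹ := by
    rw [Real.exp_neg]
    refine inv_anti₀ (by positivity) ?_
    have := Real.exp_one_gt_two
    rw [← Real.exp_one_pow]
    gcongr
  calc _ ≤ (2 ^ n * (4 * 2 ^ t * 2 ^ A * 2 ^ D) * 2 : ℝ) * (2 ^ (c + n + t + A + D + 3))⁻¹ := by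
        gcongr
    _ = (2 ^ c)⁻¹ := by
        rw [pow_add, pow_add, pow_add, pow_add, pow_add]
        field_simp
        norm_num

theorem confidence_spec {δ : ℝ} (h0 : 0 < δ) : ((2 : ℝ) ^ confidence δ)⁻¹ ≤ δ := by
  have h1 : Real.logb 2 (1 / δ) ≤ confidence δ := Nat.le_ceil _
  rw [Real.logb_le_iff_le_rpow (by norm_num) (by positivity), Real.rpow_natCast] at h1
  rw [inv_le_comm₀ (by positivity) h0, ← one_div]
  exact h1

/-- A = ⌊1/ε⌋ + 1 is the integer substitute for 1/ε: its inverse is a safe accuracy, and ε ≤ 1/6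
makes the additional 1 cost at most a factor 7/6. -/
theorem accuracy_spec {ε : ℝ} (h0 : 0 < ε) (h1 : ε ≤ 1 / 6) :
    1 / (accuracy ε + 1 : ℝ) ≤ ε ∧ (accuracy ε + 1 : ℝ) ≤ 7 / 6 / ε := by
  unfold accuracy
  constructor
  · rw [div_le_comm₀ (by positivity) h0]
    exact (Nat.lt_floor_add_one _).le
  · have h2 : ((⌊1 / ε⌋₊ : ℕ) : ℝ) ≤ 1 / ε := Nat.floor_le (by positivity)
    have h3 : (1 : ℝ) ≤ 1 / 6 / ε := by
      rw [le_div_iff₀ h0]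
      linarith
    have h4 : (7 : ℝ) / 6 / ε = 1 / ε + 1 / 6 / ε := by ring
    linarith

namespace Source

variable {J : Type*} [Enc J] {s : Source J} {β : Type*} {j : J}
  {w : ∀ k, Fin (s.d j k) → Fin (s.d j k) → ℤ × ℤ} {S : Finset (Fin (s.n j))}
  {M N L : List β} {φ : Basis (s.d j) → ℂ} {u : ∀ k, Matrix.unitaryGroup (Fin (s.d j k)) ℂ}

theorem simulate_support {ε : ℝ} {t thr : ℕ} (hd : ∀ k, 0 < s.d j k) (hN : 0 < N.length)
    (hL : 1 ≤ L.length) (hLt : (L.length : ℝ) ≤ 5 * (t / ε)) :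
    ∀ v ∈ (s.simulate j M N L thr (List.ofFn (factor S w))).support,
      ∃ P' : PMF (Outcome (s.d j) S), Lists (enc v) P' ∧ (P'.support.ncard : ℝ) ≤ 5 * (t / ε) ∧
        resample v = P'.map outcomeDigits := by
  intro v hv
  rw [simulate, search_map, PMF.map_comp, PMF.mem_support_map_iff] at hv
  obtain ⟨T, hT, rfl⟩ := hv
  have hval := valid_searchPattern hN hL hT
  simp only [Function.comp_apply]
  rw [report_node M w hd hval.isPrefix]
  set y₀ : Outcome (s.d j) S := fun k : S => (⟨0, hd k⟩ : Fin (s.d j k))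
  refine ⟨weightPMF M y₀ (roundWeights M (weights y₀ T)),
    lists_roundWeights M y₀ (weights_ne_nil y₀ T) (nodup_weights y₀ hval), ?_,
    resample_roundWeights M y₀ (weights_ne_nil y₀ T)⟩
  refine le_trans ?_ hLt
  exact_mod_cast (ncard_support_weightPMF_le M y₀ (weights_ne_nil y₀ T)
    (nodup_weights y₀ hval)).trans (length_weights_le y₀ hL hval.length_le)

/-- The threshold is 1 / (2tA), patterns above h = 1 / (tA) must be found, and L = 4tA nodes are
kept. The estimates are accurate to η = 4e₀ = 1 / (8tA²). Hence t · h = 1 / A ≤ ε, and L · η = 1 /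
(2A) ≤ ε; the square of A serves the latter. -/
theorem simulate_fails {σ σ' ε δ : ℝ} {D t : ℕ} (hφ : ∑ x, ‖φ x‖ ^ 2 = 1)
    (hw : Approximates σ (2 ^ M.length)⁻¹ w u) (hσ' : 0 < σ')
    (hval : ∀ x, ‖(σ' : ℂ) * toC (s.val j x) - φ x‖ ≤ (2 ^ M.length)⁻¹)
    (hμ : ∑ x, |(s.μ j x).toReal - ‖φ x‖ ^ 2| ≤ (2 ^ M.length)⁻¹)
    (hd : ∀ k, 0 < s.d j k) (hD : ∀ k, s.d j k ≤ D) (hD1 : 1 ≤ D) (hε : 0 < ε) (hε6 : ε ≤ 1 / 6)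
    (hδ : 0 < δ) (ht : 0 < t)
    (hs : ApproxSparse ε t (outcomeProb S (tensor (fun k => (u k).1) *ᵥ φ)))
    (hM : M.length = precisionFactor D * (s.n j + t + accuracy ε + 1))
    (hN : N.length = 4096 * t ^ 2 * (accuracy ε + 1) ^ 4 *
      (confidence δ + s.n j + t + (accuracy ε + 1) + D + 3))
    (hL : L.length = 4 * t * (accuracy ε + 1)) :
    Fails (s.simulate j M N L (2 * t * (accuracy ε + 1)) (List.ofFn (factor S w)))
      (fun v => ∃ P' : PMF (Outcome (s.d j) S), Lists (enc v) P' ∧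
        ∑ y, |(P' y).toReal - outcomeProb S (tensor (fun k => (u k).1) *ᵥ φ) y| ≤ 7 * ε)
      (ENNReal.ofReal δ) := by
  set ψ := tensor (fun k => (u k).1) *ᵥ φ with hψdef
  have hψ : ∑ x, ‖ψ x‖ ^ 2 = 1 := by rw [hψdef, sum_norm_sq_tensor_mulVec, hφ]
  obtain ⟨hA1, hA2⟩ := accuracy_spec hε hε6
  set A := accuracy ε + 1 with hA
  have hAr : (A : ℝ) = accuracy ε + 1 := by rw [hA]; push_cast; rfl
  rw [← hAr] at hA1 hA2
  have hA0 : (1 : ℝ) ≤ A := by rw [hAr]; linarith [Nat.cast_nonneg (α := ℝ) (accuracy ε)]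
  have ht0 : (1 : ℝ) ≤ t := by exact_mod_cast ht
  have htA : (0 : ℝ) < t * A := by positivity
  have htA2 : (1 : ℝ) ≤ t * A ^ 2 := one_le_mul_of_one_le_of_one_le ht0 (one_le_pow₀ hA0)
  have hNpos : 0 < N.length := by
    rw [hN]
    have : 0 < A := Nat.succ_pos _
    positivity
  have hprec : (1472 * (t * A ^ 2) * (D ^ (2 * s.n j + 1) * 2 ^ s.n j) : ℝ) ≤ 2 ^ M.length := by
    rw [hM, show s.n j + t + accuracy ε + 1 = s.n j + t + A by rw [hA]; ring]
    exact_mod_cast precision_le hD1 (Nat.succ_pos _)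
  have hDn : (1 : ℝ) ≤ D ^ (2 * s.n j + 1) * 2 ^ s.n j := by
    refine one_le_mul_of_one_le_of_one_le (one_le_pow₀ ?_) (one_le_pow₀ (by norm_num))
    exact_mod_cast hD1
  have hQ : (0 : ℝ) < 2 ^ M.length := by positivity
  -- Used both as the systematic and as the statistical error of the mean; doubling their sum gives
  -- η = 4e₀.
  set e₀ : ℝ := 1 / (32 * (t * A ^ 2)) with he₀
  have he₀1 : e₀ ≤ 1 := by
    rw [he₀, div_le_one (by positivity)]
    linarith
  have hE : 46 * ((D : ℝ) ^ (2 * s.n j + 1) * 2 ^ s.n j) * (2 ^ M.length)⁻¹ ≤ e₀ := by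
    rw [he₀, le_div_iff₀ (by positivity), mul_right_comm, mul_inv_le_iff₀ hQ]
    linarith
  have hmean := fun Y => mean_close hφ hw hσ' hval hμ hD hD1 M le_rfl hE he₀1 Y
  rw [simulate, search_map, PMF.map_comp, fails_map]
  have hthr : ((2 * t * A : ℕ) : ℝ)⁻¹ = 1 / (2 * (t * A)) := by push_cast; rw [mul_assoc, one_div]
  have hη4 : 4 * e₀ ≤ 1 / (8 * (t * A)) := by
    rw [he₀, show 4 * (1 / (32 * ((t : ℝ) * A ^ 2))) = 1 / (8 * (t * A ^ 2)) by field_simp; norm_num]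
    gcongr
    nlinarith
  have h8 : (1 : ℝ) / (2 * (t * A)) = 4 * (1 / (8 * (t * A))) := by field_simp; norm_num
  have h9 : (1 : ℝ) / (t * A) = 8 * (1 / (8 * (t * A))) := by field_simp
  have h10 : 0 < 1 / (8 * ((t : ℝ) * A)) := by positivity
  have hfail := fails_search (w := w) (M := M) (N := N) (L := L) (thr := 2 * t * A) (S := S)
    (η := 4 * e₀) (h := 1 / (t * A)) (D := D) hψ hNpos (by positivity)
    (fun i Y hY => fails_patternEstimate hmean (η₁ := e₀) (by positivity) he₀1 (by linarith) hNpos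
      hY) (by positivity) (by rw [hthr]; linarith) (by rw [hthr]; linarith) (by
      rw [hthr, hL]
      push_cast
      have : (4 * t * A : ℝ) * (1 / (8 * (t * A))) = 1 / 2 := by field_simp; norm_num
      nlinarith) hD hD1
  refine hfail.mono (fun T _ hT => ?_) ?_
  · simp only [Function.comp_apply]
    rw [report_node M w hd hT.isPrefix]
    set y₀ : Outcome (s.d j) S := fun k : S => (⟨0, hd k⟩ : Fin (s.d j k))
    refine ⟨weightPMF M y₀ (roundWeights M (weights y₀ T)),
      lists_roundWeights M y₀ (weights_ne_nil y₀ T) (nodup_weights y₀ hT.toValid), ?_⟩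
    refine hT.close_outcomeProb hψ (by positivity) M y₀ hs ?_ (by positivity) (by positivity) ?_
      hε6 ?_
    · rw [show (t : ℝ) * (1 / (t * A)) = 1 / A by field_simp]
      exact hA1
    · rw [hL, he₀]
      push_cast
      refine le_trans ?_ hA1
      rw [show (4 * t * A : ℝ) * (4 * (1 / (32 * (t * A ^ 2)))) = 1 / 2 * (1 / A) by
        field_simp; norm_num]
      have : (0 : ℝ) < 1 / A := by positivity
      linarith
    · rw [hL]
      push_cast
      refine le_trans ?_ hA1
      rw [div_le_div_iff₀ hQ (by positivity), one_mul]
      refine le_trans ?_ hprec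
      nlinarith
  · rw [← ENNReal.ofReal_natCast, ← ENNReal.ofReal_natCast, ← ENNReal.ofReal_ofNat,
      ← ENNReal.ofReal_mul (by norm_num), ← ENNReal.ofReal_mul (by positivity),
      ← ENNReal.ofReal_mul (by positivity)]
    refine ENNReal.ofReal_le_ofReal ?_
    refine le_trans ?_ ((failure_le (D := D) (n := s.n j) (t := t) (A := A)
      (c := confidence δ)).trans (confidence_spec hδ))
    -- 4096t²A⁴ is (2 / e₀)², so the exponent of `deviation_le` is exactly the remaining factor of
    -- N.
    have h11 : (N.length : ℝ) * (e₀ / 2) ^ 2 =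
        (confidence δ + s.n j + t + A + D + 3 : ℕ) := by
      rw [hN, he₀]
      push_cast
      field_simp
      norm_num
    rw [h11, hL]
    push_cast
    exact le_of_eq (by ring)

end Source

end SparseSim

end

noncomputable section

namespace SparseSim

open Enc

/-! ### Running times that are polynomial in a parameter -/

section Budget

/-- Polynomially bounded in a parameter. -/
def PolyIn {α : Type*} (v g : α → ℕ) : Prop := ∃ C c : ℕ, ∀ a, g a ≤ C * (v a + 1) ^ c

variable {α β γ : Type*} {v g h : α → ℕ}

theorem PolyIn.mono (hh : PolyIn v h) (H : ∀ a, g a ≤ h a) : PolyIn v g := by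
  obtain ⟨C, c, hC⟩ := hh
  exact ⟨C, c, fun a => (H a).trans (hC a)⟩

theorem PolyIn.const (k : ℕ) : PolyIn v (fun _ => k) := ⟨k, 0, fun a => by simp⟩

theorem PolyIn.of_le (H : ∀ a, g a ≤ v a) : PolyIn v g :=
  ⟨1, 1, fun a => by have := H a; rw [one_mul, pow_one]; omega⟩

theorem PolyIn.add (hg : PolyIn v g) (hh : PolyIn v h) : PolyIn v (fun a => g a + h a) := by
  obtain ⟨C, c, hC⟩ := hg
  obtain ⟨D, d, hD⟩ := hh
  refine ⟨C + D, c + d, fun a => ?_⟩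
  have h1 : (v a + 1) ^ c ≤ (v a + 1) ^ (c + d) := Nat.pow_le_pow_right (by omega) (by omega)
  have h2 : (v a + 1) ^ d ≤ (v a + 1) ^ (c + d) := Nat.pow_le_pow_right (by omega) (by omega)
  have := hC a
  have := hD a
  nlinarith

theorem PolyIn.mul (hg : PolyIn v g) (hh : PolyIn v h) : PolyIn v (fun a => g a * h a) := by
  obtain ⟨C, c, hC⟩ := hg
  obtain ⟨D, d, hD⟩ := hh
  refine ⟨C * D, c + d, fun a => ?_⟩
  calc g a * h a ≤ (C * (v a + 1) ^ c) * (D * (v a + 1) ^ d) := Nat.mul_le_mul (hC a) (hD a)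
    _ = _ := by ring

theorem PolyIn.pow (hg : PolyIn v g) (k : ℕ) : PolyIn v (fun a => g a ^ k) := by
  induction k with
  | zero => simpa using PolyIn.const 1
  | succ k ih => simpa [pow_succ] using ih.mul hg

theorem PolyIn.bound (hg : PolyIn v g) (C c : ℕ) : PolyIn v (fun a => C * (g a + 1) ^ c) :=
  (PolyIn.const C).mul ((hg.add (PolyIn.const 1)).pow c)

theorem PB.polyIn {β : Type*} [Enc β] {T : β → ℕ} (hT : PB T) {f : α → β} (hf : PolyIn v fun a => SparseSim.esize (f a)) :
    PolyIn v fun a => T (f a) := by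
  obtain ⟨C, c, hC⟩ := hT
  exact ((PolyIn.const C).mul (hf.pow c)).mono fun a => hC _

variable [Enc α] [Enc β] [Enc γ]

/-- A randomized function that is computed in a time polynomial in a parameter. -/
def RTime (v : α → ℕ) (f : α → PMF β) : Prop :=
  ∃ (A : Code) (T : α → ℕ), PolyIn v T ∧ ∀ a, Run A (enc a) (T a) ((f a).map enc)

/-- A function that is computed in a time polynomial in a parameter. -/
def Time (v : α → ℕ) (f : α → β) : Prop :=
  ∃ (A : Code) (T : α → ℕ), PolyIn v T ∧ ∀ a, Run A (enc a) (T a) (PMF.pure (enc (f a)))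

theorem PT.time {f : α → β} (hf : PT f) (hv : PolyIn v fun a => esize a) : Time v f := by
  obtain ⟨A, T, hT, hA⟩ := hf
  exact ⟨A, T, hT.polyIn (f := fun a => a) hv, hA⟩

theorem Time.polyIn_esize {f : α → β} (hf : Time v f) (hv : PolyIn v fun a => esize a) :
    PolyIn v fun a => esize (f a) := by
  obtain ⟨A, T, hT, hA⟩ := hf
  exact (hv.add ((PolyIn.const 2).mul hT)).mono fun a => (hA a).size_le (by simp)

theorem Time.prodMk {f : α → β} {f' : α → γ} (hf : Time v f) (hf' : Time v f')
    (hv : PolyIn v fun a => esize a) : Time v fun a => (f a, f' a) := by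
  obtain ⟨A, T, hT, hA⟩ := hf
  obtain ⟨A', T', hT', hA'⟩ := hf'
  exact ⟨.both A A', fun a => T a + (T' a + esize a), hT.add (hT'.add hv),
    fun a => (hA a).both_pure (hA' a)⟩

theorem RPT.comp_time {f : β → PMF γ} (hf : RPT f) {p : α → β} (hp : Time v p)
    (hv : PolyIn v fun a => esize a) : RTime v fun a => f (p a) := by
  have h1 := hp.polyIn_esize hv
  obtain ⟨A, T, hT, hA⟩ := hf
  obtain ⟨B, U, hU, hB⟩ := hp
  exact ⟨.seq B A, fun a => U a + T (p a), hU.add (hT.polyIn h1),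
    fun a => (hB a).seq_pure (hA (p a))⟩

theorem esize_replicate_unit (j : ℕ) : esize (List.replicate j ()) = 2 * j + 1 := by
  induction j with
  | zero => simp
  | succ j ih =>
    rw [List.replicate_succ, esize_cons, ih]
    simp [esize, enc, Data.size]; omega

/-- Numbers can be written in unary. -/
theorem time_replicate : Time (fun n : ℕ => n) fun n => List.replicate n () := by
  have hbody : PT (fun p : ℕ × List Unit => (p.1 - 1, () :: p.2)) := by fun_prop
  obtain ⟨A, g, ⟨C, k, hC⟩, hA⟩ := hbody
  have key : ∀ s n j : ℕ, n + j ≤ s → LoopRun A (enc (n, List.replicate j ()))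
      ((n + 1) * ((3 * s + 9) + C * (3 * s + 9) ^ k))
      (PMF.pure (enc ((0 : ℕ), List.replicate (n + j) ()))) := by
    intro s n
    induction n with
    | zero =>
      intro j hn
      have h5 : esize ((0 : ℕ), List.replicate j ()) ≤ 3 * s + 9 := by
        rw [esize_pair, esize_nat, esize_replicate_unit, Nat.size_zero]; omega
      have := (loopRun_stop (f := A) (v := enc ((0 : ℕ), List.replicate j ())) rfl).mono
        (T' := (0 + 1) * ((3 * s + 9) + C * (3 * s + 9) ^ k)) (by
          rw [zero_add, one_mul]
          exact h5.trans (Nat.le_add_right _ _))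
      simpa using this
    | succ n ih =>
      intro j hn
      have h5 : esize (n + 1, List.replicate j ()) ≤ 3 * s + 9 := by
        rw [esize_pair, esize_nat, esize_replicate_unit]
        have : Nat.size (n + 1) ≤ n + 1 := Nat.size_le.2 Nat.lt_two_pow_self
        omega
      have h1 := ih (j + 1) (by omega)
      have h3 : (enc (n + 1, List.replicate j ())).fst.isZero = false := by
        simp [enc, Data.fst, Data.isZero]
      have h4 := LoopRun.step h3 (hA (n + 1, List.replicate j ())) (κ := fun _ =>
        PMF.pure (enc ((0 : ℕ), List.replicate (n + 1 + j) ()))) (by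
          intro w hw
          simp only [PMF.mem_support_pure_iff] at hw
          subst hw
          rw [show n + 1 + j = n + (j + 1) by omega]
          exact h1)
      rw [PMF.pure_bind] at h4
      refine h4.mono ?_
      have h6 : g (n + 1, List.replicate j ()) ≤ C * (3 * s + 9) ^ k := (hC _).trans (by gcongr)
      calc _ ≤ (3 * s + 9) + (C * (3 * s + 9) ^ k +
            (n + 1) * ((3 * s + 9) + C * (3 * s + 9) ^ k)) :=
            Nat.add_le_add h5 (Nat.add_le_add h6 le_rfl)
        _ = _ := by ring
  obtain ⟨A₀, p, hp, hA₀⟩ := (PT.id (α := ℕ)).prodMk (PT.const (α := ℕ) ([] : List Unit))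
  obtain ⟨B, q, hq, hB⟩ := PT.snd (PT.id (α := ℕ × List Unit))
  have hself : PolyIn (fun n : ℕ => n) fun n => n := PolyIn.of_le fun _ => le_rfl
  have hs : PolyIn (fun n : ℕ => n) fun n => esize n := by
    refine (hself.add (PolyIn.const 1)).mono fun n => ?_
    rw [esize_nat]
    exact Nat.succ_le_succ (Nat.size_le.2 Nat.lt_two_pow_self)
  have h9 : PolyIn (fun n : ℕ => n) fun n => 3 * n + 9 :=
    ((PolyIn.const 3).mul hself).add (PolyIn.const 9)
  refine ⟨.seq A₀ (.seq (.loop A) B), fun n => p n + ((n + 1) * ((3 * n + 9) +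
    C * (3 * n + 9) ^ k) + q (0, List.replicate n ())), ?_, fun n => ?_⟩
  · refine (hp.polyIn (f := fun a => a) hs).add (((hself.add (PolyIn.const 1)).mul
      (h9.add ((PolyIn.const C).mul (h9.pow k)))).add (hq.polyIn ?_))
    refine (((PolyIn.const 2).mul hself).add (PolyIn.const 3)).mono fun n => ?_
    rw [esize_pair, esize_replicate_unit, esize_nat, Nat.size_zero]
    omega
  · exact (hA₀ n).seq_pure ((key n n 0 le_rfl).run.seq_pure (hB (0, List.replicate n ())))

theorem PT.time_unary {p : α → ℕ} (hp : PT p) (hv : PolyIn v fun a => esize a)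
    (hpv : PolyIn v p) : Time v fun a => List.replicate (p a) () := by
  obtain ⟨A, T, hT, hA⟩ := hp
  obtain ⟨B, U, ⟨C, c, hU⟩, hB⟩ := time_replicate
  exact ⟨.seq A B, fun a => T a + C * (p a + 1) ^ c,
    (hT.polyIn (f := fun a => a) hv).add (hpv.bound C c),
    fun a => (hA a).seq_pure ((hB (p a)).mono (hU _))⟩

end Budget

/-- The number of entries and their denominators depend on L and M, not on the number of samples. So
the time of the sampler will not depend on δ. -/
theorem esize_roundWeights {n D : ℕ} {d : Fin n → ℕ} (hd : ∀ k, d k ≤ D) {S : Finset (Fin n)}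
    {μ : Type*} (M : List μ) {ws : List (Outcome d S × ℕ)} (h : ws ≠ []) {L : ℕ}
    (hL : ws.length ≤ L) :
    esize ((roundWeights M ws).map fun q => (outcomeDigits q.1, q.2, 2 ^ M.length)) ≤
      L * ((n * (D + 2) + 1) + 2 * (M.length + 2) + 3) + 1 := by
  have h1 : ((roundWeights M ws).map fun q => (outcomeDigits q.1, q.2, 2 ^ M.length)).length ≤
      L := by
    have := (keys_roundWeights_sublist M ws).length_le
    rw [List.length_map] at this ⊢
    simp only [List.length_map] at this
    omega
  refine (esize_list_le (B := (n * (D + 2) + 1) + 2 * (M.length + 2) + 2) ?_).trans ?_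
  · intro a ha
    obtain ⟨q, hq, rfl⟩ := List.mem_map.1 ha
    have h2 : q.2 ≤ 2 ^ M.length := by
      rw [← sum_roundWeights M h]
      exact List.single_le_sum (by simp) _ (List.mem_map_of_mem hq)
    have h3 : esize (outcomeDigits q.1) ≤ n * (D + 2) + 1 := by
      refine (esize_list_le (B := D + 1) ?_).trans ?_
      · intro a ha
        obtain ⟨k, _, hk⟩ := List.mem_filterMap.1 ha
        split_ifs at hk with hkS
        · simp only [Option.some.injEq] at hk
          rw [← hk, esize_nat]
          have h5 := (q.1 ⟨k, hkS⟩).2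
          have h6 : Nat.size (q.1 ⟨k, hkS⟩ : ℕ) ≤ (q.1 ⟨k, hkS⟩ : ℕ) :=
            Nat.size_le.2 Nat.lt_two_pow_self
          have h7 := hd k
          simp only at h5
          omega
      · gcongr
        refine (List.length_filterMap_le _ _).trans ?_
        simp
    have h4 : Nat.size q.2 ≤ M.length + 1 := (Nat.size_le_size h2).trans (by simp [Nat.size_pow])
    have h5 : Nat.size (2 ^ M.length) = M.length + 1 := by simp [Nat.size_pow]
    rw [esize_pair, esize_pair, esize_nat, esize_nat]
    omega
  · gcongr

namespace Source

variable {J : Type*} [Enc J] {s : Source J} {β : Type*} {j : J}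
  {w : ∀ k, Fin (s.d j k) → Fin (s.d j k) → ℤ × ℤ} {S : Finset (Fin (s.n j))}
  {M N L : List β} {φ : Basis (s.d j) → ℂ} {u : ∀ k, Matrix.unitaryGroup (Fin (s.d j k)) ℂ}

theorem esize_simulate_le {D thr : ℕ} (hd : ∀ k, 0 < s.d j k) (hD : ∀ k, s.d j k ≤ D)
    (hN : 0 < N.length) (hL : 1 ≤ L.length) :
    ∀ v ∈ (s.simulate j M N L thr (List.ofFn (factor S w))).support,
      esize v ≤ L.length * ((s.n j * (D + 2) + 1) + 2 * (M.length + 2) + 3) + 1 := by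
  intro v hv
  rw [simulate, search_map, PMF.map_comp, PMF.mem_support_map_iff] at hv
  obtain ⟨T, hT, rfl⟩ := hv
  have hval := valid_searchPattern hN hL hT
  simp only [Function.comp_apply]
  rw [report_node M w hd hval.isPrefix]
  exact esize_roundWeights hD M (weights_ne_nil _ T) (length_weights_le _ hL hval.length_le)

/-- The number of random bits of the simulation. -/
def bits (D n t A : ℕ) : ℕ := precisionFactor D * (n + t + A + 1)

/-- The number of samples of the simulation. -/
def samples (D n t A c : ℕ) : ℕ := 4096 * t ^ 2 * (A + 1) ^ 4 * (c + n + t + (A + 1) + D + 3)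

/-- The number of outcomes that are kept by the simulation. -/
def width (t A : ℕ) : ℕ := 4 * t * (A + 1)

theorem simulatesSparse {A B : Code} {input : Data} {T T' D t : ℕ} {σ σ' ε δ : ℝ}
    (hM : M.length = bits D (s.n j) t (accuracy ε))
    (hN : N.length = samples D (s.n j) t (accuracy ε) (confidence δ))
    (hL : L.length = width t (accuracy ε))
    (hA : Run A input T ((s.simulate j M N L (2 * t * (accuracy ε + 1))
      (List.ofFn (factor S w))).map enc))
    (hB : ∀ v : List (List ℕ × ℕ × ℕ),
      esize v ≤ width t (accuracy ε) * ((s.n j * (D + 2) + 1) +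
        2 * (bits D (s.n j) t (accuracy ε) + 2) + 3) + 1 →
      Run B (enc v) T' ((resample v).map enc))
    (hφ : ∑ x, ‖φ x‖ ^ 2 = 1) (hw : Approximates σ (2 ^ M.length)⁻¹ w u) (hσ' : 0 < σ')
    (hval : ∀ x, ‖(σ' : ℂ) * toC (s.val j x) - φ x‖ ≤ (2 ^ M.length)⁻¹)
    (hμ : ∑ x, |(s.μ j x).toReal - ‖φ x‖ ^ 2| ≤ (2 ^ M.length)⁻¹)
    (hD : ∀ k, s.d j k ≤ D) (hD1 : 1 ≤ D) (hε : 0 < ε) (hε6 : ε ≤ 1 / 6) (hδ : 0 < δ)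
    (hs : ApproxSparse ε t (outcomeProb S (tensor (fun k => (u k).1) *ᵥ φ))) :
    SimulatesSparse A B input T T' (7 * (t / ε)) (7 * ε) δ
      (outcomeProb S (tensor (fun k => (u k).1) *ᵥ φ)) := by
  have ht : 0 < t := hs.pos (by rw [sum_outcomeProb, sum_norm_sq_tensor_mulVec, hφ]) (by linarith)
  -- A normalized state needs a nonempty basis.
  have hd : ∀ k, 0 < s.d j k := by
    intro k
    have : Nonempty (Basis (s.d j)) := by
      by_contra hne
      rw [not_nonempty_iff] at hne
      simp at hφ
    obtain ⟨x⟩ := this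
    exact (x k).pos
  have hN0 : 0 < N.length := by
    rw [hN, samples]
    positivity
  have hL0 : 1 ≤ L.length := by
    rw [hL, width]
    exact Nat.one_le_iff_ne_zero.2 (by positivity)
  have htε : (0 : ℝ) ≤ t / ε := by positivity
  have hLt : (L.length : ℝ) ≤ 5 * (t / ε) := by
    rw [hL, width]
    push_cast
    have := (accuracy_spec hε hε6).2
    calc (4 * t * (accuracy ε + 1) : ℝ) ≤ 4 * t * (7 / 6 / ε) := by gcongr
      _ = 14 / 3 * (t / ε) := by ring
      _ ≤ _ := by linarith
  refine ⟨_, hA.outputs, ?_, ?_⟩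
  · intro v hv
    obtain ⟨v, hv', rfl⟩ := (PMF.mem_support_map_iff _ _ _).1 hv
    obtain ⟨P', h1, h2, h3⟩ := simulate_support hd hN0 hL0 hLt v hv'
    refine ⟨P', h1, h2.trans (by linarith), ?_⟩
    have h4 := hB v (by
      have := esize_simulate_le hd hD hN0 hL0 v hv'
      rwa [hL, hM] at this)
    rw [h3, PMF.map_comp] at h4
    have h5 : (enc ∘ outcomeDigits : Outcome (s.d j) S → Data) = encOutcome := by
      funext y
      exact (encOutcome_eq y).symm
    rw [h5] at h4
    exact h4.outputs
  · refine Fails.le_toOuterMeasure hδ.le ?_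
    rw [fails_map]
    exact simulate_fails hφ hw hσ' hval hμ hd hD hD1 hε hε6 hδ ht hs hM hN hL

end Source

end SparseSim

end

/-! ### Assembling the programs; sources from tractable families -/

noncomputable section

namespace SparseSim

open Enc

theorem PolyIn.bits {α : Type*} {v : α → ℕ} (D : ℕ) {n t A : α → ℕ} (hn : PolyIn v n) (ht : PolyIn v t)
    (hA : PolyIn v A) : PolyIn v fun a => Source.bits D (n a) (t a) (A a) :=
  (PolyIn.const _).mul (((hn.add ht).add hA).add (PolyIn.const 1))

theorem PolyIn.samples {α : Type*} {v : α → ℕ} (D : ℕ) {n t A c : α → ℕ} (hn : PolyIn v n)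
    (ht : PolyIn v t) (hA : PolyIn v A) (hc : PolyIn v c) :
    PolyIn v fun a => Source.samples D (n a) (t a) (A a) (c a) :=
  (((PolyIn.const _).mul (ht.pow 2)).mul ((hA.add (PolyIn.const 1)).pow 4)).mul
    (((((hc.add hn).add ht).add (hA.add (PolyIn.const 1))).add (PolyIn.const D)).add
      (PolyIn.const 3))

theorem PolyIn.width {α : Type*} {v : α → ℕ} {t A : α → ℕ} (ht : PolyIn v t) (hA : PolyIn v A) :
    PolyIn v fun a => Source.width (t a) (A a) :=
  ((PolyIn.const 4).mul ht).mul (hA.add (PolyIn.const 1))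

section Glue

variable {α β : Type*} [Enc α] [Enc β]

theorem PT.subtype_mk {P : β → Prop} {f : α → β} (hf : PT f) (h : ∀ a, P (f a)) :
    PT (fun a => (⟨f a, h a⟩ : {b // P b})) := by
  obtain ⟨A, g, hg, hA⟩ := hf
  exact ⟨A, g, hg, hA⟩

@[fun_prop] theorem PT.bits (D : ℕ) {n t A : α → ℕ} (hn : PT n) (ht : PT t) (hA : PT A) :
    PT fun a => Source.bits D (n a) (t a) (A a) := by
  unfold Source.bits
  fun_prop

@[fun_prop] theorem PT.samples (D : ℕ) {n t A c : α → ℕ} (hn : PT n) (ht : PT t) (hA : PT A)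
    (hc : PT c) : PT fun a => Source.samples D (n a) (t a) (A a) (c a) := by
  simp only [Source.samples, pow_succ, pow_zero]
  fun_prop

@[fun_prop] theorem PT.width {t A : α → ℕ} (ht : PT t) (hA : PT A) :
    PT fun a => Source.width (t a) (A a) := by
  unfold Source.width
  fun_prop

/-- The parameters M, N, L are written in unary, which takes time polynomial in their values;
relative to these lists the simulation is polynomial in the input size. The source also receives the
unary M, because it has to work with that precision. -/
theorem Source.simulate_rtime {J : Type*} [Enc J] (s : Source J) {f : α × List Unit → J}
    (hf : PT f) {F : α → List Factor} (hF : PT F) {M N L thr : α → ℕ} (hM : PT M) (hN : PT N)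
    (hL : PT L) (ht : PT thr) {v : α → ℕ} (hv : PolyIn v fun a => esize a) (hvM : PolyIn v M)
    (hvN : PolyIn v N) (hvL : PolyIn v L) :
    RTime v fun a => s.simulate (f (a, List.replicate (M a) ())) (List.replicate (M a) ())
      (List.replicate (N a) ()) (List.replicate (L a) ()) (thr a) (F a) := by
  have h1 : RPT fun p : α × List Unit × List Unit × List Unit =>
      s.simulate (f (p.1, p.2.1)) p.2.1 p.2.2.1 p.2.2.2 (thr p.1) (F p.1) :=
    s.simulate_rpt (by fun_prop) (by fun_prop) (by fun_prop) (by fun_prop) (by fun_prop)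
      (by fun_prop)
  have h2 := h1.comp_time ((PT.id.time hv).prodMk ((hM.time_unary hv hvM).prodMk
    ((hN.time_unary hv hvN).prodMk (hL.time_unary hv hvL) hv) hv) hv) hv
  dsimp only at h2
  exact h2

/-- Sampling from the output takes polynomial time. -/
theorem exists_sampler (D : ℕ) : ∃ (B : Code) (C c : ℕ), ∀ (n t A : ℕ)
    (v : List (List ℕ × ℕ × ℕ)),
    esize v ≤ Source.width t A * ((n * (D + 2) + 1) + 2 * (Source.bits D n t A + 2) + 3) + 1 →
      Run B (enc v) (C * (n + t + A + 1) ^ c) ((resample v).map enc) := by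
  obtain ⟨B, g, ⟨C, c, hg⟩, hB⟩ := RPT.resample
  have hP : PolyIn (fun q : ℕ × ℕ × ℕ => q.1 + q.2.1 + q.2.2) fun q => C *
      (Source.width q.2.1 q.2.2 * ((q.1 * (D + 2) + 1) +
        2 * (Source.bits D q.1 q.2.1 q.2.2 + 2) + 3) + 1) ^ c := by
    have h1 : PolyIn (fun q : ℕ × ℕ × ℕ => q.1 + q.2.1 + q.2.2) fun q => q.1 :=
      PolyIn.of_le fun q => by omega
    have h2 : PolyIn (fun q : ℕ × ℕ × ℕ => q.1 + q.2.1 + q.2.2) fun q => q.2.1 :=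
      PolyIn.of_le fun q => by omega
    have h3 : PolyIn (fun q : ℕ × ℕ × ℕ => q.1 + q.2.1 + q.2.2) fun q => q.2.2 :=
      PolyIn.of_le fun q => by omega
    exact (PolyIn.const C).mul ((((h2.width h3).mul ((((h1.mul (PolyIn.const _)).add
      (PolyIn.const 1)).add ((PolyIn.const 2).mul ((h1.bits D h2 h3).add (PolyIn.const 2)))).add
      (PolyIn.const 3))).add (PolyIn.const 1)).pow c)
  obtain ⟨C', c', hP⟩ := hP
  refine ⟨B, C', c', fun n t A v hv => ?_⟩
  have h1 := hP (n, t, A)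
  dsimp only at h1
  refine (hB v).mono ((hg v).trans (le_trans ?_ h1))
  gcongr

theorem Approx.norm_sub_le {k : ℕ} {z : ℂ} {w : ℤ × ℤ} (h : Approx k z w) :
    ‖(((2 ^ k)⁻¹ : ℝ) : ℂ) * toC w - z‖ ≤ (2 ^ k)⁻¹ := by
  rw [norm_sub_rev]
  refine le_trans (le_of_eq ?_) h
  congr 2
  rw [toC, div_eq_inv_mul]
  push_cast
  rfl

/-- A k-bit description of a number in the unit disc has O(k) bits. So the rounded entries do not
spoil the bound on the input size. -/
theorem Approx.esize_le {k : ℕ} {z : ℂ} {w : ℤ × ℤ} (h : Approx k z w) (hz : ‖z‖ ≤ 1) :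
    esize w ≤ 4 * k + 15 := by
  have h1 := h.norm_sub_le
  have h2 : (0 : ℝ) < 2 ^ k := by positivity
  have h3 : ‖toC w‖ ≤ 2 ^ (k + 1) := by
    have h4 : ‖(((2 ^ k)⁻¹ : ℝ) : ℂ) * toC w‖ ≤ (2 ^ k)⁻¹ + 1 := by
      have := norm_le_norm_add_norm_sub' ((((2 ^ k)⁻¹ : ℝ) : ℂ) * toC w) z
      linarith
    rw [norm_mul, Complex.norm_real, Real.norm_of_nonneg (by positivity),
      inv_mul_le_iff₀ h2, mul_add, mul_inv_cancel₀ h2.ne'] at h4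
    have : (1 : ℝ) ≤ 2 ^ k := one_le_pow₀ (by norm_num)
    rw [pow_succ]
    linarith
  have h5 : gsq w ≤ 2 ^ (2 * k + 2) := by
    have h6 : (gsq w : ℝ) ≤ (2 ^ (k + 1)) ^ 2 := by
      rw [← norm_toC_sq]
      gcongr
    rw [← pow_mul] at h6
    have h7 : (gsq w : ℝ) ≤ ((2 ^ (2 * k + 2) : ℕ) : ℝ) := by
      push_cast
      rwa [show 2 * k + 2 = (k + 1) * 2 by ring]
    exact_mod_cast h7
  have h8 := esize_gauss_le w
  have h9 := Nat.size_le_size h5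
  rw [Nat.size_pow] at h9
  omega

end Glue

/-! ### Tensor product operations on tractable states -/

section Tractable

variable {ι : Type*} [Enc ι] {n : ι → ℕ} {d : ∀ i, Fin (n i) → ℕ} {φ : ∀ i, Basis (d i) → ℂ}

/-- An instance together with the dimensions and with a precision. -/
abbrev PreciseInstance (d : ∀ i, Fin (n i) → ℕ) : Type _ :=
  {q : ι × List ℕ × List Unit // q.2.1 = List.ofFn (d q.1)}

/-- A computationally tractable family, with all precisions. -/
def tractableSource (h : IsCT enc d φ) : Source (PreciseInstance d) where
  n q := n q.1.1
  d q := d q.1.1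
  μ q := (h.1.choose_spec.choose_spec.choose_spec q.1.1 q.1.2.2.length).choose
  val q x := (h.2.choose_spec.choose_spec.choose_spec q.1.1 x q.1.2.2.length).choose
  dims_pt := by
    have h1 : PT fun q : PreciseInstance d => q.1.2.1 := by
      have := PT.subtype_val (P := fun q : ι × List ℕ × List Unit => q.2.1 = List.ofFn (d q.1))
      fun_prop
    refine (congrArg PT (funext fun q => ?_)).mp h1
    exact q.2
  sample_rpt := by
    set A := h.1.choose
    set C := h.1.choose_spec.choose
    set c := h.1.choose_spec.choose_spec.choose
    have hA := h.1.choose_spec.choose_spec.choose_spec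
    have h1 : PT fun q : PreciseInstance d => (q.1.1, q.1.2.2.length) := by
      have := PT.subtype_val (P := fun q : ι × List ℕ × List Unit => q.2.1 = List.ofFn (d q.1))
      fun_prop
    obtain ⟨B, g, hg, hB⟩ := h1
    refine ⟨.seq B A, fun q => g q + C * (2 * esize q + 1) ^ c, hg.add ((PB.const C).mul
      ((((PB.const 2).mul PB.esize).add (PB.const 1)).pow c)), fun q => ?_⟩
    have h2 := run_of_outputs (hA q.1.1 q.1.2.2.length).choose_spec.1
    rw [PMF.map_comp]
    have h3 : (enc ∘ digits : Basis (d q.1.1) → Data) = encBasis := by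
      funext x
      exact (encBasis_eq x).symm
    rw [h3]
    refine (hB q).seq_pure (h2.mono ?_)
    have h4 := length_lt_esize q.1.2.1
    have h5 := length_lt_esize q.1.2.2
    have h6 : esize q = esize q.1.1 + (esize q.1.2.1 + esize q.1.2.2 + 1) + 1 := rfl
    -- The list of dimensions is part of the index partly for this reason: it makes n, and with it
    -- the time bound of the family, polynomial in the encoding.
    have h7 : n q.1.1 = q.1.2.1.length := by rw [q.2, List.length_ofFn]
    gcongr
    omega
  val_pt := by
    set A := h.2.choose
    set C := h.2.choose_spec.choose
    set c := h.2.choose_spec.choose_spec.choose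
    have hA := h.2.choose_spec.choose_spec.choose_spec
    have h1 : PT fun p : (Σ q : PreciseInstance d, Basis (d q.1.1)) =>
        (p.1.1.1, digits p.2, p.1.1.2.2.length) := by
      have h0 : PT fun p : (Σ q : PreciseInstance d, Basis (d q.1.1)) => (p.1.1, digits p.2) :=
        PT.of_enc_eq fun _ => rfl
      have h2 : PT fun r : (ι × List ℕ × List Unit) × List ℕ => (r.1.1, r.2, r.1.2.2.length) := by
        fun_prop
      exact h2.comp h0
    obtain ⟨B, g, hg, hB⟩ := h1
    refine ⟨.seq B A, fun q => g q + C * (2 * esize q + 1) ^ c, hg.add ((PB.const C).mul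
      ((((PB.const 2).mul PB.esize).add (PB.const 1)).pow c)), fun p => ?_⟩
    have h2 := run_of_outputs (hA p.1.1.1 p.2 p.1.1.2.2.length).choose_spec.1
    refine (hB p).seq_pure (h2.congr (by rw [encBasis_eq]; rfl) ?_ rfl)
    have h4 := length_lt_esize p.1.1.2.1
    have h5 := length_lt_esize p.1.1.2.2
    have h6 : esize p = esize p.1.1.1 + (esize p.1.1.2.1 + esize p.1.1.2.2 + 1) + 1 +
      esize (digits p.2) + 1 := rfl
    have h7 : n p.1.1.1 = p.1.1.2.1.length := by rw [p.1.2, List.length_ofFn]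
    gcongr
    omega

theorem tractableSource_dist (h : IsCT enc d φ) (q : PreciseInstance d) :
    ∑ x, |((tractableSource h).μ q x).toReal - ‖φ q.1.1 x‖ ^ 2| ≤ (2 ^ q.1.2.2.length)⁻¹ :=
  (h.1.choose_spec.choose_spec.choose_spec q.1.1 q.1.2.2.length).choose_spec.2

theorem tractableSource_val (h : IsCT enc d φ) (q : PreciseInstance d) (x : Basis (d q.1.1)) :
    Approx q.1.2.2.length (φ q.1.1 x) ((tractableSource h).val q x) :=
  (h.2.choose_spec.choose_spec.choose_spec q.1.1 x q.1.2.2.length).choose_spec.2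

/-- The input of the simulation of a tensor product operation. -/
structure ProductInput (d : ∀ i, Fin (n i) → ℕ) (a : ℕ) where
  /-- the instance -/
  i : ι
  /-- the measured qudits -/
  S : Finset (Fin (n i))
  /-- the matrices -/
  w : ∀ k, Fin (d i k) → Fin (d i k) → ℤ × ℤ
  /-- the sparsity -/
  t : ℕ
  /-- the accuracy -/
  A : ℕ
  /-- the confidence -/
  c : ℕ
  esize_w : ∀ k p q, esize (w k p q) ≤ 4 * (a * (n i + t + A + 1)) + 15

instance (a : ℕ) : Enc (ProductInput d a) :=
  ⟨fun p => .list [enc p.i, encProduct p.S p.w, .list [.nat p.t, .nat p.A, .nat p.c]]⟩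

theorem encProduct_eq {n : ℕ} {d : Fin n → ℕ} (S : Finset (Fin n))
    (w : ∀ j, Fin (d j) → Fin (d j) → ℤ × ℤ) :
    encProduct S w = enc (List.ofFn (factor S w)) := by
  simp only [encProduct, enc, List.map_ofFn]
  congr 2
  funext k
  simp only [Function.comp_def, factor, List.map_ofFn]
  rfl

theorem pt_productInput {a : ℕ} : PT fun p : ProductInput d a =>
    (p.i, List.ofFn (factor p.S p.w), (p.t, p.A, p.c, ()), ()) := by
  refine PT.of_enc_eq fun p => ?_
  have : enc p = .list [enc p.i, encProduct p.S p.w, .list [.nat p.t, .nat p.A, .nat p.c]] := rfl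
  rw [this, encProduct_eq]
  rfl

theorem esize_factor_le {n D B : ℕ} {d : Fin n → ℕ} (hd : ∀ k, d k ≤ D) (S : Finset (Fin n))
    {w : ∀ j, Fin (d j) → Fin (d j) → ℤ × ℤ} (hw : ∀ k p q, esize (w k p q) ≤ B) :
    esize (List.ofFn (factor S w)) ≤ n * (D + (D * (D * (B + 1) + 2) + 10)) + 1 := by
  refine (esize_list_le (B := D + (D * (D * (B + 1) + 2) + 9)) fun p hp => ?_).trans
    (by rw [List.length_ofFn]; exact le_of_eq (by ring))
  obtain ⟨k, rfl⟩ := List.mem_ofFn.1 hp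
  have h1 : esize (List.ofFn fun a => List.ofFn (w k a)) ≤ D * (D * (B + 1) + 2) + 1 := by
    refine (esize_list_le (B := D * (B + 1) + 1) fun r hr => ?_).trans ?_
    · obtain ⟨b, rfl⟩ := List.mem_ofFn.1 hr
      refine (esize_list_le (B := B) fun z hz => ?_).trans ?_
      · obtain ⟨b', rfl⟩ := List.mem_ofFn.1 hz
        exact hw k b b'
      · rw [List.length_ofFn]
        gcongr
        exact hd k
    · rw [List.length_ofFn]
      gcongr
      exact hd k
  have h2 : esize (decide (k ∈ S)) ≤ 2 := by
    simp only [esize, enc, Data.bool, Data.size]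
    cases decide (k ∈ S) <;> simp
  have h3 : Nat.size (d k) ≤ d k := Nat.size_le.2 Nat.lt_two_pow_self
  have h4 := hd k
  have h5 : esize (factor S w k) = esize (d k) + (esize (decide (k ∈ S)) +
    (esize (List.ofFn fun a => List.ofFn (w k a)) + 1 + 1) + 1) + 1 := rfl
  rw [h5, esize_nat]
  omega

theorem polyIn_productInput {a D : ℕ} (hd : ∀ i k, d i k ≤ D) (h : IsCT enc d φ) :
    PolyIn (fun p : ProductInput d a => n p.i + p.t + p.A + p.c) fun p => esize p := by
  obtain ⟨A, C, c, hA⟩ := h.1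
  have h1 : PolyIn (fun p : ProductInput d a => n p.i + p.t + p.A + p.c) fun p => n p.i :=
    PolyIn.of_le fun p => by omega
  have h2 : PolyIn (fun p : ProductInput d a => n p.i + p.t + p.A + p.c) fun p => p.t :=
    PolyIn.of_le fun p => by omega
  have h3 : PolyIn (fun p : ProductInput d a => n p.i + p.t + p.A + p.c) fun p => p.A :=
    PolyIn.of_le fun p => by omega
  have h4 : PolyIn (fun p : ProductInput d a => n p.i + p.t + p.A + p.c) fun p => p.c :=
    PolyIn.of_le fun p => by omega
  have h5 : PolyIn (fun p : ProductInput d a => n p.i + p.t + p.A + p.c) fun p =>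
      4 * (a * (n p.i + p.t + p.A + 1)) + 15 :=
    ((PolyIn.const 4).mul ((PolyIn.const a).mul (((h1.add h2).add h3).add
      (PolyIn.const 1)))).add (PolyIn.const 15)
  refine (((h1.bound C c).add ((h1.mul ((PolyIn.const D).add (((PolyIn.const D).mul
    (((PolyIn.const D).mul (h5.add (PolyIn.const 1))).add (PolyIn.const 2))).add
    (PolyIn.const 10)))).add (PolyIn.const 1))).add
    (((h2.add h3).add h4).add (PolyIn.const 20))).mono fun p => ?_
  -- No bound on the names of instances is assumed. The sampler of the family must read the name,
  -- even for precision 0, within its time bound.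
  have h6 : (enc p.i).size ≤ C * (n p.i + 1) ^ c := by
    obtain ⟨μ, hμ, _⟩ := hA p.i 0
    have := (run_of_outputs hμ).input_le
    simp only [Data.size] at this
    have h7 : C * (n p.i + 0 + 1) ^ c = C * (n p.i + 1) ^ c := rfl
    omega
  have h7 := esize_factor_le (hd p.i) p.S p.esize_w
  have h8 : esize p = (enc p.i).size + ((encProduct p.S p.w).size + ((Nat.size p.t + 1) +
    ((Nat.size p.A + 1) + ((Nat.size p.c + 1) + (Nat.size 0 + 1) + 1) + 1) + 1 +
    (Nat.size 0 + 1) + 1) + 1) + 1 := rfl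
  rw [h8, encProduct_eq]
  have h9 : (enc (List.ofFn (factor p.S p.w))).size = esize (List.ofFn (factor p.S p.w)) := rfl
  have h10 : ∀ m, Nat.size m ≤ m := fun m => Nat.size_le.2 Nat.lt_two_pow_self
  have := h10 p.t
  have := h10 p.A
  have := h10 p.c
  rw [h9, Nat.size_zero]
  omega

theorem exists_simulation_tensor {D : ℕ} (hd : ∀ i k, d i k ≤ D)
    (hφ : ∀ i, ∑ x, ‖φ i x‖ ^ 2 = 1) (h : IsCT enc d φ) :
    ∃ (A B : Code) (a C c : ℕ), ∀ (i : ι) (u : ∀ j, Matrix.unitaryGroup (Fin (d i j)) ℂ)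
      (S : Finset (Fin (n i))) (t : ℕ) (ε δ : ℝ) (w : ∀ j, Fin (d i j) → Fin (d i j) → ℤ × ℤ),
      0 < ε → ε ≤ 1 / 6 → 0 < δ → δ < 1 →
      ApproxSparse ε t (outcomeProb S (tensor (fun j => (u j).1) *ᵥ φ i)) →
      (∀ j p q, Approx (a * (n i + t + accuracy ε + 1)) ((u j).1 p q) (w j p q)) →
      SimulatesSparse A B (.list [enc i, encProduct S w, encParams t ε δ])
        (C * (n i + t + accuracy ε + confidence δ + 1) ^ c)
        (C * (n i + t + accuracy ε + 1) ^ c)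
        (7 * (t / ε)) (7 * ε) δ (outcomeProb S (tensor (fun j => (u j).1) *ᵥ φ i)) := by
  set a := precisionFactor (D + 1) with ha
  set s := tractableSource h with hs
  have htup := pt_productInput (d := d) (a := a)
  have hF : PT fun p : ProductInput d a => List.ofFn (factor p.S p.w) := htup.snd.fst
  have hdims : PT fun p : ProductInput d a => List.ofFn (d p.i) := by
    have h1 : PT fun p : ProductInput d a => (List.ofFn (factor p.S p.w)).map fun q => q.1 := by
      fun_prop
    refine (congrArg PT (funext fun p => ?_)).mp h1
    rw [List.map_ofFn]
    rfl
  have hn : PT fun p : ProductInput d a => n p.i := by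
    have h1 : PT fun p : ProductInput d a => (List.ofFn (d p.i)).length := by fun_prop
    simpa only [List.length_ofFn] using h1
  have hf : PT fun p : ProductInput d a × List Unit =>
      (⟨(p.1.i, List.ofFn (d p.1.i), p.2), rfl⟩ : PreciseInstance d) := by
    have h1 : PT fun p : ProductInput d a => p.i := htup.fst
    exact PT.subtype_mk ((h1.comp (PT.fst PT.id)).prodMk ((hdims.comp (PT.fst PT.id)).prodMk
      (PT.snd PT.id))) _
  have hv := polyIn_productInput (a := a) hd h
  have ht : PT fun p : ProductInput d a => p.t := htup.snd.snd.fst.fst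
  have hacc : PT fun p : ProductInput d a => p.A := htup.snd.snd.fst.snd.fst
  have hc : PT fun p : ProductInput d a => p.c := htup.snd.snd.fst.snd.snd.fst
  have hvn : PolyIn (fun p : ProductInput d a => n p.i + p.t + p.A + p.c) fun p => n p.i :=
    PolyIn.of_le fun p => by omega
  have hvt : PolyIn (fun p : ProductInput d a => n p.i + p.t + p.A + p.c) fun p => p.t :=
    PolyIn.of_le fun p => by omega
  have hvA : PolyIn (fun p : ProductInput d a => n p.i + p.t + p.A + p.c) fun p => p.A :=
    PolyIn.of_le fun p => by omega
  have hvc : PolyIn (fun p : ProductInput d a => n p.i + p.t + p.A + p.c) fun p => p.c :=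
    PolyIn.of_le fun p => by omega
  -- D + 1 instead of D, since the estimates need a dimension bound that is at least 1 and D may be
  -- 0.
  obtain ⟨A, T, ⟨C₁, c₁, hT⟩, hA⟩ := s.simulate_rtime hf hF (PT.bits (D + 1) hn ht hacc)
    (PT.samples (D + 1) hn ht hacc hc) (PT.width ht hacc)
    (thr := fun p => 2 * p.t * (p.A + 1)) (by fun_prop) hv (hvn.bits (D + 1) hvt hvA)
    (hvn.samples (D + 1) hvt hvA hvc) (hvt.width hvA)
  obtain ⟨B, C₂, c₂, hB⟩ := exists_sampler (D + 1)
  -- One pair of constants serves for the simulator and for the sampler.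
  have hpow : ∀ {C C' c c' : ℕ} (m : ℕ), C * (m + 1) ^ c ≤ (C + C') * (m + 1) ^ (c + c') := by
    intro C C' c c' m
    exact Nat.mul_le_mul (by omega) (Nat.pow_le_pow_right (by omega) (by omega))
  refine ⟨A, B, a, C₁ + C₂, c₁ + c₂, fun i u S t ε δ w hε hε6 hδ _ hsp hw => ?_⟩
  have hu : ∀ k p q, ‖(u k).1 p q‖ ≤ 1 := fun k p q => norm_unitary_le_one (u k) p q
  let p : ProductInput d a := ⟨i, S, w, t, accuracy ε, confidence δ,
    fun k p q => (hw k p q).esize_le (hu k p q)⟩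
  have hrun := hA p
  refine Source.simulatesSparse (s := s) (D := D + 1)
    (j := (⟨(i, List.ofFn (d i), List.replicate (Source.bits (D + 1) (n i) t (accuracy ε)) ()),
      rfl⟩ : PreciseInstance d)) (β := Unit) (σ := (2 ^ (a * (n i + t + accuracy ε + 1)))⁻¹)
    (σ' := (2 ^ (a * (n i + t + accuracy ε + 1)))⁻¹)
    (M := List.replicate (Source.bits (D + 1) (n i) t (accuracy ε)) ())
    (N := List.replicate (Source.samples (D + 1) (n i) t (accuracy ε) (confidence δ)) ())
    (L := List.replicate (Source.width t (accuracy ε)) ())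
    (List.length_replicate ..) (List.length_replicate ..) (List.length_replicate ..)
    (hrun.mono ((hT p).trans (hpow _))) ?_ (hφ i) ⟨by positivity, ?_⟩ (by positivity) ?_ ?_
    (fun k => (hd i k).trans (Nat.le_succ _)) (by omega) hε hε6 hδ hsp
  · intro v hv
    refine (hB _ _ _ v hv).mono ?_
    rw [add_comm C₁, add_comm c₁]
    exact hpow _
  · intro k p q
    rw [List.length_replicate]
    exact (hw k p q).norm_sub_le
  · intro x
    have := (tractableSource_val h ⟨(i, List.ofFn (d i), List.replicate
      (Source.bits (D + 1) (n i) t (accuracy ε)) ()), rfl⟩ x).norm_sub_le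
    rw [List.length_replicate] at this ⊢
    exact this
  · exact tractableSource_dist h _

end Tractable

end SparseSim

end

noncomputable section

namespace SparseSim

open Enc ComplexConjugate

/-! ### The structure of IQP circuits -/

/-- The Hadamard matrix. -/
def hadamard : Matrix (Fin 2) (Fin 2) ℂ :=
  Matrix.of fun a b => (((√2)⁻¹ : ℝ) : ℂ) * (-1) ^ ((a : ℕ) * b)

theorem sqrt_two_inv_sq : (((√2)⁻¹ : ℝ) : ℂ) * (((√2)⁻¹ : ℝ) : ℂ) = 1 / 2 := by
  rw [← Complex.ofReal_mul, ← mul_inv, Real.mul_self_sqrt (by norm_num)]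
  norm_num

theorem hadamard_mul_self : hadamard * hadamard = 1 := by
  have h := sqrt_two_inv_sq
  push_cast at h
  ext a b
  rw [Matrix.mul_apply, Fin.sum_univ_two]
  fin_cases a <;> fin_cases b <;> simp [hadamard] <;> linear_combination 2 * h

theorem hadamard_conjTranspose : hadamardᴴ = hadamard := by
  ext a b
  simp [hadamard, Matrix.conjTranspose_apply, mul_comm]

theorem hadamard_mem : hadamard ∈ Matrix.unitaryGroup (Fin 2) ℂ := by
  rw [Matrix.mem_unitaryGroup_iff, Matrix.star_eq_conjTranspose, hadamard_conjTranspose,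
    hadamard_mul_self]

theorem hadamard_conj_pauli (b : Bool) :
    hadamard * Matrix.diagonal (fun z : Fin 2 => (if b then (-1 : ℂ) ^ (z : ℕ) else 1)) *
      hadamard = if b then !![0, 1; 1, 0] else 1 := by
  cases b
  · simp [hadamard_mul_self]
  · have h := sqrt_two_inv_sq
    push_cast at h
    ext a b
    rw [Matrix.mul_apply, Fin.sum_univ_two]
    simp only [Matrix.mul_diagonal]
    fin_cases a <;> fin_cases b <;> simp [hadamard] <;> linear_combination 2 * h

section IQP

variable {n r : ℕ}

/-- The Hadamard transformation of all qubits. -/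
def hadamardAll (n : ℕ) : Matrix (Basis (qubits n)) (Basis (qubits n)) ℂ :=
  tensor (d := qubits n) fun _ => hadamard

theorem hadamardAll_mul_self : hadamardAll n * hadamardAll n = 1 := by
  rw [hadamardAll, tensor_mul]
  simp only [hadamard_mul_self]
  exact tensor_one

/-- The parity that determines an eigenvalue of a product of Pauli operators. -/
def parity (m : Fin n → Bool) (z : Basis (qubits n)) : ℕ := ∑ j, if m j then (z j : ℕ) else 0

theorem tensor_diagonal {d : Fin n → ℕ} (v : ∀ j, Fin (d j) → ℂ) :
    tensor (fun j => Matrix.diagonal (v j)) = Matrix.diagonal fun z => ∏ j, v j (z j) := by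
  ext x y
  simp only [tensor, Matrix.of_apply, Matrix.diagonal_apply]
  by_cases h : x = y
  · simp [h]
  · rw [if_neg h]
    obtain ⟨k, hk⟩ := Function.ne_iff.1 h
    exact Finset.prod_eq_zero (Finset.mem_univ k) (if_neg hk)

theorem pauliX_eq (m : Fin n → Bool) : pauliX m =
    hadamardAll n * Matrix.diagonal (fun z => (-1 : ℂ) ^ parity m z) * hadamardAll n := by
  have h1 : Matrix.diagonal (fun z : Basis (qubits n) => (-1 : ℂ) ^ parity m z) =
      tensor (d := qubits n) fun j =>
        Matrix.diagonal fun z : Fin 2 => (if m j then (-1 : ℂ) ^ (z : ℕ) else 1) := by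
    rw [tensor_diagonal]
    congr 1
    funext z
    rw [parity, ← Finset.prod_pow_eq_pow_sum]
    refine Finset.prod_congr rfl fun j _ => ?_
    split_ifs <;> simp
  rw [h1, hadamardAll, tensor_mul, tensor_mul, pauliX]
  congr 1
  funext j
  exact (hadamard_conj_pauli (m j)).symm

theorem exp_pauliX (θ : ℂ) (m : Fin n → Bool) : NormedSpace.exp (θ • pauliX m) =
    hadamardAll n * Matrix.diagonal (fun z => Complex.exp (θ * (-1) ^ parity m z)) *
      hadamardAll n := by
  have hW := hadamardAll_mul_self (n := n)
  have hinv : (hadamardAll n)⁻¹ = hadamardAll n := Matrix.inv_eq_right_inv hW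
  have hunit : IsUnit (hadamardAll n) := ⟨⟨_, _, hW, hW⟩, rfl⟩
  have h1 : θ • pauliX m = hadamardAll n *
      Matrix.diagonal (fun z => θ * (-1 : ℂ) ^ parity m z) * (hadamardAll n)⁻¹ := by
    rw [pauliX_eq, hinv, ← Matrix.smul_mul, ← Matrix.mul_smul, ← Matrix.diagonal_smul]
    rfl
  rw [h1, Matrix.exp_conj _ _ hunit, Matrix.exp_diagonal, hinv]
  congr 3
  funext z
  rw [Pi.coe_exp, Complex.exp_eq_exp_ℂ]

/-- The phase of a basis state. -/
def phase (θ : Fin r → ℝ) (m : Fin r → Fin n → Bool) (z : Basis (qubits n)) : ℂ :=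
  ∏ g, Complex.exp (Complex.I * θ g * (-1) ^ parity (m g) z)

/-- Every gate is diagonal after conjugation with the Hadamard transformation, and the inner
Hadamard transformations of consecutive gates cancel. -/
theorem iqp_eq (θ : Fin r → ℝ) (m : Fin r → Fin n → Bool) : iqp θ m =
    hadamardAll n * Matrix.diagonal (phase θ m) * hadamardAll n := by
  have hW := hadamardAll_mul_self (n := n)
  have key : ∀ l : List (Fin r), (l.map fun g => NormedSpace.exp ((Complex.I * (θ g : ℂ)) •
      pauliX (m g))).prod = hadamardAll n * Matrix.diagonal (fun z => (l.map fun g =>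
        Complex.exp (Complex.I * θ g * (-1) ^ parity (m g) z)).prod) * hadamardAll n := by
    intro l
    induction l with
    | nil =>
      simp [hW]
    | cons g l ih =>
      rw [List.map_cons, List.prod_cons, ih, exp_pauliX]
      simp only [List.map_cons, List.prod_cons]
      rw [show (fun z : Basis (qubits n) => Complex.exp (Complex.I * θ g * (-1) ^ parity (m g) z) *
        (l.map fun g => Complex.exp (Complex.I * θ g * (-1) ^ parity (m g) z)).prod) = fun z =>
        (fun z => Complex.exp (Complex.I * θ g * (-1) ^ parity (m g) z)) z *
        (fun z => (l.map fun g => Complex.exp (Complex.I * θ g * (-1) ^ parity (m g) z)).prod) z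
        from rfl, ← Matrix.diagonal_mul_diagonal]
      simp only [Matrix.mul_assoc]
      rw [← Matrix.mul_assoc (hadamardAll n) (hadamardAll n), hW, Matrix.one_mul]
  rw [iqp, List.ofFn_eq_map, key]
  congr 3

/-- The state before the final Hadamard transformation. -/
def phaseState (x : Basis (qubits n)) (θ : Fin r → ℝ) (m : Fin r → Fin n → Bool)
    (z : Basis (qubits n)) : ℂ := phase θ m z * hadamardAll n z x

/-- The final Hadamard transformation plays the role of the tensor product operation, and
`phaseState` that of the tractable state. -/
theorem iqp_mulVec_ket (x : Basis (qubits n)) (θ : Fin r → ℝ) (m : Fin r → Fin n → Bool) :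
    iqp θ m *ᵥ ket x = tensor (d := qubits n) (fun _ => hadamard) *ᵥ phaseState x θ m := by
  rw [iqp_eq, ket, ← Matrix.mulVec_mulVec, ← Matrix.mulVec_mulVec]
  congr 1
  funext z
  rw [Matrix.mulVec_diagonal, Matrix.mulVec_single_one]
  rfl

/-- The scalar product of labels. -/
def dotLabel (x z : Basis (qubits n)) : ℕ := ∑ j, (z j : ℕ) * x j

theorem hadamardAll_apply (z x : Basis (qubits n)) :
    hadamardAll n z x = (((√2)⁻¹ ^ n : ℝ) : ℂ) * (-1) ^ dotLabel x z := by
  simp only [hadamardAll, tensor, hadamard, Matrix.of_apply, Finset.prod_mul_distrib,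
    Finset.prod_const, Finset.card_univ, Fintype.card_fin, Finset.prod_pow_eq_pow_sum, dotLabel]
  push_cast
  rfl

theorem norm_exp_phase (θ : ℝ) (k : ℕ) : ‖Complex.exp (Complex.I * θ * (-1) ^ k)‖ = 1 := by
  rw [Complex.norm_exp]
  rcases neg_one_pow_eq_or ℂ k with h | h <;> simp [h]

theorem norm_phaseState_sq (x : Basis (qubits n)) (θ : Fin r → ℝ) (m : Fin r → Fin n → Bool)
    (z : Basis (qubits n)) : ‖phaseState x θ m z‖ ^ 2 = (2 ^ n)⁻¹ := by
  rw [phaseState, hadamardAll_apply, phase, norm_mul, norm_prod]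
  simp only [norm_exp_phase, Finset.prod_const_one, one_mul, norm_mul, norm_pow, norm_neg,
    norm_one, one_pow, mul_one, Complex.norm_real]
  rw [Real.norm_of_nonneg (by positivity), ← pow_mul, mul_comm, pow_mul, inv_pow,
    Real.sq_sqrt (by norm_num), inv_pow]

theorem sum_norm_phaseState_sq (x : Basis (qubits n)) (θ : Fin r → ℝ)
    (m : Fin r → Fin n → Bool) : ∑ z, ‖phaseState x θ m z‖ ^ 2 = 1 := by
  simp only [norm_phaseState_sq, Finset.sum_const, Finset.card_univ, Fintype.card_pi,
    Fintype.card_fin, Finset.prod_const, nsmul_eq_mul]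
  push_cast
  exact mul_inv_cancel₀ (by positivity)

end IQP

end SparseSim

end

noncomputable section

namespace SparseSim

open Enc ComplexConjugate

/-! ### The simulation of IQP circuits -/

/-- The input of the simulation of an IQP circuit. -/
structure IQPInput (a : ℕ) where
  /-- the number of qubits -/
  n : ℕ
  /-- the number of gates -/
  r : ℕ
  /-- the basis state -/
  x : Basis (qubits n)
  /-- the Pauli operators -/
  m : Fin r → Fin n → Bool
  /-- the phases -/
  w : Fin r → ℤ × ℤ
  /-- the measured qubits -/
  S : Finset (Fin n)
  /-- the sparsity -/
  t : ℕ
  /-- the accuracy -/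
  A : ℕ
  /-- the confidence -/
  c : ℕ
  esize_w : ∀ g, esize (w g) ≤ 4 * (a * (n + r + t + A + 1)) + 15

instance (a : ℕ) : Enc (IQPInput a) :=
  ⟨fun p => .list [encIQP p.x p.m p.w p.S, .list [.nat p.t, .nat p.A, .nat p.c]]⟩

namespace IQPInput

variable {a : ℕ}

/-- The gates as a list. -/
def gates (p : IQPInput a) : List ((ℤ × ℤ) × List Bool) :=
  List.ofFn fun g => (p.w g, List.ofFn (p.m g))

/-- The measured qubits as a list. -/
def flags (p : IQPInput a) : List Bool := List.ofFn fun j => decide (j ∈ p.S)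

theorem pt_tuple : PT fun p : IQPInput a =>
    ((digits p.x, p.gates, p.flags, ()), (p.t, p.A, p.c, ()), ()) := by
  refine PT.of_enc_eq fun p => ?_
  have h1 : enc p = .list [encIQP p.x p.m p.w p.S, .list [.nat p.t, .nat p.A, .nat p.c]] := rfl
  have h2 : encIQP p.x p.m p.w p.S = enc (digits p.x, p.gates, p.flags, ()) := by
    rw [encIQP, encBasis_eq]
    simp only [enc, gates, flags, List.map_ofFn, Function.comp_def]
    rfl
  rw [h1, h2]
  rfl

@[fun_prop] theorem pt_x : PT fun p : IQPInput a => digits p.x := pt_tuple.fst.fst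
@[fun_prop] theorem pt_gates : PT fun p : IQPInput a => p.gates := pt_tuple.fst.snd.fst
@[fun_prop] theorem pt_flags : PT fun p : IQPInput a => p.flags := pt_tuple.fst.snd.snd.fst
@[fun_prop] theorem pt_t : PT fun p : IQPInput a => p.t := pt_tuple.snd.fst.fst
@[fun_prop] theorem pt_A : PT fun p : IQPInput a => p.A := pt_tuple.snd.fst.snd.fst
@[fun_prop] theorem pt_c : PT fun p : IQPInput a => p.c := pt_tuple.snd.fst.snd.snd.fst

@[fun_prop] theorem pt_n : PT fun p : IQPInput a => p.n := by
  have h1 : PT fun p : IQPInput a => (digits p.x).length := by fun_prop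
  refine (congrArg PT (funext fun p => ?_)).mp h1
  simp [digits]

end IQPInput

/-- The parity that determines an eigenvalue, for lists. -/
def parityL (l : List Bool) (zs : List ℕ) : ℕ :=
  ((l.zip zs).map fun p => if p.1 = true then p.2 else 0).sum

/-- The scalar product of lists. -/
def dotL (xs zs : List ℕ) : ℕ := ((zs.zip xs).map fun p => p.1 * p.2).sum

/-- The rounded amplitude before the final Hadamard transformation. -/
def phaseL (xs : List ℕ) (gates : List ((ℤ × ℤ) × List Bool)) (zs : List ℕ) : ℤ × ℤ :=
  gmul (if 2 * (dotL xs zs / 2) = dotL xs zs then (1, 0) else (-1, 0))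
    (gprod (gates.map fun g =>
      if 2 * (parityL g.2 zs / 2) = parityL g.2 zs then g.1 else gconj g.1))

section PT

variable {α : Type*} [Enc α]

@[fun_prop] theorem PT.parityL {l : α → List Bool} {zs : α → List ℕ} (hl : PT l) (hz : PT zs) :
    PT fun a => parityL (l a) (zs a) := by
  unfold SparseSim.parityL
  fun_prop

@[fun_prop] theorem PT.dotL {xs zs : α → List ℕ} (hx : PT xs) (hz : PT zs) :
    PT fun a => dotL (xs a) (zs a) := by
  unfold SparseSim.dotL
  fun_prop

@[fun_prop] theorem PT.phaseL {xs zs : α → List ℕ} {g : α → List ((ℤ × ℤ) × List Bool)}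
    (hx : PT xs) (hg : PT g) (hz : PT zs) : PT fun a => phaseL (xs a) (g a) (zs a) := by
  unfold SparseSim.phaseL
  fun_prop

end PT

theorem parityL_ofFn {n : ℕ} (m : Fin n → Bool) (z : Basis (qubits n)) :
    parityL (List.ofFn m) (digits z) = parity m z := by
  rw [parityL, digits, zip_ofFn, List.map_ofFn, List.sum_ofFn]
  rfl

theorem dotL_digits {n : ℕ} (x z : Basis (qubits n)) :
    dotL (digits x) (digits z) = dotLabel x z := by
  rw [dotL, digits, digits, zip_ofFn, List.map_ofFn, List.sum_ofFn]
  rfl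

theorem two_mul_half_iff (k : ℕ) : 2 * (k / 2) = k ↔ Even k := by
  rw [Nat.even_iff]
  omega

/-- A fair digit. -/
def fairDigit : PMF (Fin 2) := (PMF.uniformOfFintype Bool).map fun b => if b = true then 1 else 0

theorem fairDigit_apply (i : Fin 2) : fairDigit i = 2⁻¹ := by
  rw [fairDigit, PMF.map_apply, tsum_fintype, Fintype.sum_bool]
  fin_cases i <;> simp

theorem pt_iqpSource_val {a : ℕ} : PT fun p : (Σ p : IQPInput a, Basis (qubits p.n)) =>
    phaseL (digits p.1.x) p.1.gates (digits p.2) := by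
  have h1 : PT fun p : (Σ p : IQPInput a, Basis (qubits p.n)) => (p.1, digits p.2) :=
    PT.of_enc_eq fun _ => rfl
  have h2 : PT fun q : IQPInput a × List ℕ => digits q.1.x :=
    IQPInput.pt_x.comp (PT.fst (PT.id (α := IQPInput a × List ℕ)))
  have h3 : PT fun q : IQPInput a × List ℕ => q.1.gates :=
    IQPInput.pt_gates.comp (PT.fst (PT.id (α := IQPInput a × List ℕ)))
  have h4 := (PT.phaseL h2 h3 (PT.snd PT.id)).comp h1
  dsimp only at h4
  exact h4

/-- The uniform distribution and the amplitudes before the final Hadamard transformation. -/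
def iqpSource (a : ℕ) : Source (IQPInput a) where
  n p := p.n
  d p := qubits p.n
  μ p := piPMF fun _ => fairDigit
  val p z := phaseL (digits p.x) p.gates (digits z)
  dims_pt := by
    have h1 : PT fun p : IQPInput a => (digits p.x).map fun _ => 2 := by fun_prop
    refine (congrArg PT (funext fun p => ?_)).mp h1
    rw [digits, List.map_ofFn]
    rfl
  sample_rpt := by
    have h1 : RPT fun p : IQPInput a => mapP (fun _ => (PMF.uniformOfFintype Bool).map
        fun b => if b = true then 1 else 0) (digits p.x) := by
      refine RPT.mapP (f := fun _ _ => (PMF.uniformOfFintype Bool).map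
        fun b => if b = true then 1 else 0) ?_ IQPInput.pt_x
      exact RPT.map RPT.coin (g := fun _ b => if b = true then 1 else 0) (by fun_prop)
    refine (congrArg RPT (funext fun p => ?_)).mp h1
    rw [digits]
    refine mapP_eq_piPMF _ _ _ fun k => ?_
    rw [fairDigit, PMF.map_comp]
    refine pmf_map_congr _ fun b _ => ?_
    cases b <;> rfl
  val_pt := by
    exact pt_iqpSource_val

/-- All amplitudes have modulus 2 ^ (-n/2), so fair coins sample the labels without error. -/
theorem iqpSource_dist {a : ℕ} (p : IQPInput a) (θ : Fin p.r → ℝ) :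
    ∑ z, |((iqpSource a).μ p z).toReal - ‖phaseState p.x θ p.m z‖ ^ 2| = 0 := by
  have h (z : Basis (qubits p.n)) :
      |((iqpSource a).μ p z).toReal - ‖phaseState p.x θ p.m z‖ ^ 2| = 0 := by
    have h1 : (iqpSource a).μ p z = ∏ _k : Fin p.n, (2 : ENNReal)⁻¹ := by
      have h2 : (iqpSource a).μ p z = ∏ k : Fin p.n, fairDigit (z k) := rfl
      rw [h2]
      exact Finset.prod_congr rfl fun k _ => fairDigit_apply _
    rw [h1, norm_phaseState_sq]
    simp
  exact Finset.sum_eq_zero fun z _ => h z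

theorem exp_phase (θ : ℝ) (k : ℕ) : Complex.exp (Complex.I * θ * (-1) ^ k) =
    if Even k then Complex.exp (Complex.I * θ) else conj (Complex.exp (Complex.I * θ)) := by
  split_ifs with h
  · rw [h.neg_one_pow, mul_one]
  · rw [(Nat.not_even_iff_odd.1 h).neg_one_pow, ← Complex.exp_conj]
    simp

/-- The eigenvalue of a gate at z is its phase or the conjugate, according to a parity. Only the
product of r rounded phases is inexact; the scale (√2)⁻¹ ^ n · (2 ^ (-k)) ^ r is left out of the
computation. -/
theorem iqpSource_val {a k : ℕ} (p : IQPInput a) (θ : Fin p.r → ℝ)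
    (hw : ∀ g, Approx k (Complex.exp (Complex.I * (θ g : ℂ))) (p.w g)) (z : Basis (qubits p.n)) :
    ‖(((√2)⁻¹ ^ p.n * ((2 ^ k)⁻¹) ^ p.r : ℝ) : ℂ) * toC ((iqpSource a).val p z) -
      phaseState p.x θ p.m z‖ ≤ (2 ^ p.r - 1) * (2 ^ k)⁻¹ := by
  have h1 : toC ((iqpSource a).val p z) = (-1) ^ dotLabel p.x z *
      ∏ g, if Even (parity (p.m g) z) then toC (p.w g) else conj (toC (p.w g)) := by
    have h2 : (iqpSource a).val p z = phaseL (digits p.x) p.gates (digits z) := rfl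
    rw [h2, phaseL, toC_gmul, toC_gprod, dotL_digits, IQPInput.gates, List.map_ofFn,
      List.map_ofFn, List.prod_ofFn]
    congr 1
    · simp only [two_mul_half_iff]
      split_ifs with h
      · simp [h.neg_one_pow, toC]
      · simp [(Nat.not_even_iff_odd.1 h).neg_one_pow, toC]
    · refine Finset.prod_congr rfl fun g _ => ?_
      simp only [Function.comp_apply, parityL_ofFn, two_mul_half_iff]
      split_ifs
      · rfl
      · exact toC_gconj _
  have h3 := norm_prod_sub_prod_le (E := ℂ) Finset.univ
    (fun g => Complex.exp (Complex.I * θ g * (-1) ^ parity (p.m g) z))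
    (fun g => (((2 ^ k)⁻¹ : ℝ) : ℂ) *
      if Even (parity (p.m g) z) then toC (p.w g) else conj (toC (p.w g)))
    (e := (2 ^ k)⁻¹) (by positivity) (inv_le_one_of_one_le₀ (one_le_pow₀ (by norm_num)))
    (fun g _ => (norm_exp_phase _ _).le) (fun g _ => by
      rw [exp_phase]
      split_ifs
      · exact (hw g).norm_sub_le
      · rw [← Complex.conj_ofReal, ← map_mul, ← map_sub, RCLike.norm_conj]
        exact (hw g).norm_sub_le)
  rw [Finset.card_univ, Fintype.card_fin, Finset.prod_mul_distrib, Finset.prod_const,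
    Finset.card_univ, Fintype.card_fin] at h3
  have h4 : (((√2)⁻¹ ^ p.n * ((2 ^ k)⁻¹) ^ p.r : ℝ) : ℂ) * toC ((iqpSource a).val p z) -
      phaseState p.x θ p.m z = ((((√2)⁻¹ ^ p.n : ℝ) : ℂ) * (-1) ^ dotLabel p.x z) *
      ((((2 ^ k)⁻¹ : ℝ) : ℂ) ^ p.r * (∏ g, if Even (parity (p.m g) z) then toC (p.w g)
        else conj (toC (p.w g))) -
        ∏ g, Complex.exp (Complex.I * θ g * (-1) ^ parity (p.m g) z)) := by
    rw [h1, phaseState, hadamardAll_apply, phase, Complex.ofReal_mul,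
      Complex.ofReal_pow ((2 ^ k)⁻¹) p.r]
    ring
  have h5 : ‖(((√2)⁻¹ ^ p.n : ℝ) : ℂ) * (-1) ^ dotLabel p.x z‖ ≤ 1 := by
    rw [norm_mul, norm_pow, norm_neg, norm_one, one_pow, mul_one, Complex.norm_real,
      Real.norm_of_nonneg (by positivity)]
    refine pow_le_one₀ (by positivity) (inv_le_one_of_one_le₀ ?_)
    exact Real.one_le_sqrt.2 (by norm_num)
  rw [h4, norm_mul]
  exact (mul_le_of_le_one_left (norm_nonneg _) h5).trans h3

/-- The integer matrix of the Hadamard transformation. -/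
def hadamardInt (p q : Fin 2) : ℤ × ℤ := if (p : ℕ) * q = 1 then (-1, 0) else (1, 0)

theorem toC_hadamardInt (p q : Fin 2) :
    (((√2)⁻¹ : ℝ) : ℂ) * toC (hadamardInt p q) = hadamard p q := by
  fin_cases p <;> fin_cases q <;> simp [hadamardInt, hadamard, toC]

theorem polyIn_iqpInput (a : ℕ) :
    PolyIn (fun p : IQPInput a => p.n + p.r + p.t + p.A + p.c) fun p => esize p := by
  have h1 : PolyIn (fun p : IQPInput a => p.n + p.r + p.t + p.A + p.c) fun p => p.n :=
    PolyIn.of_le fun p => by omega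
  have h2 : PolyIn (fun p : IQPInput a => p.n + p.r + p.t + p.A + p.c) fun p => p.r :=
    PolyIn.of_le fun p => by omega
  have h3 : PolyIn (fun p : IQPInput a => p.n + p.r + p.t + p.A + p.c) fun p =>
      p.t + p.A + p.c := PolyIn.of_le fun p => by omega
  have h4 : PolyIn (fun p : IQPInput a => p.n + p.r + p.t + p.A + p.c) fun p =>
      4 * (a * (p.n + p.r + p.t + p.A + 1)) + 15 := by
    refine (((PolyIn.const 4).mul ((PolyIn.const a).mul (((h1.add h2).add h3).add
      (PolyIn.const 1)))).add (PolyIn.const 15)).mono fun p => ?_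
    exact Nat.add_le_add_right (Nat.mul_le_mul_left _ (Nat.mul_le_mul_left _ (by omega))) _
  refine (((h1.mul (PolyIn.const 3)).add ((h2.mul ((h4.add (h1.mul (PolyIn.const 3))).add
    (PolyIn.const 3))).add (h1.mul (PolyIn.const 3)))).add
    (h3.add (PolyIn.const 30))).mono fun p => ?_
  have hbool : ∀ b : Bool, esize b ≤ 2 := by
    intro b
    simp only [esize, enc, Data.bool, Data.size]
    cases b <;> simp
  have hb : ∀ l : List Bool, esize l ≤ l.length * 3 + 1 := fun l =>
    esize_list_le fun b _ => hbool b
  have h5 : esize (digits p.x) ≤ p.n * 3 + 1 := by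
    refine (esize_list_le (B := 2) fun z hz => ?_).trans (by simp [digits])
    obtain ⟨k, rfl⟩ := List.mem_ofFn.1 hz
    have h6 : ((p.x k : Fin 2) : ℕ) ≤ 1 := Nat.lt_succ_iff.1 (p.x k).2
    rw [esize_nat]
    exact Nat.succ_le_succ ((Nat.size_le_size h6).trans (by simp))
  have h6 : esize p.gates ≤ p.r * (4 * (a * (p.n + p.r + p.t + p.A + 1)) + 15 + p.n * 3 + 3) +
      1 := by
    refine (esize_list_le (B := 4 * (a * (p.n + p.r + p.t + p.A + 1)) + 15 + p.n * 3 + 2)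
      fun z hz => ?_).trans (by simp [IQPInput.gates])
    obtain ⟨g, rfl⟩ := List.mem_ofFn.1 hz
    have h7 := p.esize_w g
    have h8 := hb (List.ofFn (p.m g))
    rw [List.length_ofFn] at h8
    rw [esize_pair]
    omega
  have h7 := hb p.flags
  rw [show p.flags.length = p.n by simp [IQPInput.flags]] at h7
  have h8 : esize p = esize ((digits p.x, p.gates, p.flags, ()), (p.t, p.A, p.c, ()), ()) := by
    have h9 : enc p = .list [encIQP p.x p.m p.w p.S, .list [.nat p.t, .nat p.A, .nat p.c]] := rfl
    have h10 : encIQP p.x p.m p.w p.S = enc (digits p.x, p.gates, p.flags, ()) := by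
      rw [encIQP, encBasis_eq]
      simp only [enc, IQPInput.gates, IQPInput.flags, List.map_ofFn, Function.comp_def]
      rfl
    rw [esize, h9, h10]
    rfl
  have h9 : ∀ m, Nat.size m ≤ m := fun m => Nat.size_le.2 Nat.lt_two_pow_self
  have h10 := h9 p.t
  have h11 := h9 p.A
  have h12 := h9 p.c
  have h13 : esize () = 1 := by simp [esize, enc, Data.size]
  rw [h8]
  simp only [esize_pair, esize_nat, h13]
  omega

theorem exists_simulation_iqp :
    ∃ (A B : Code) (a C c : ℕ),
      ∀ (n r : ℕ) (x : Basis (qubits n)) (θ : Fin r → ℝ) (m : Fin r → Fin n → Bool)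
        (S : Finset (Fin n)) (t : ℕ) (ε δ : ℝ) (w : Fin r → ℤ × ℤ),
        0 < ε → ε ≤ 1 / 6 → 0 < δ → δ < 1 →
        ApproxSparse ε t (outcomeProb S (iqp θ m *ᵥ ket x)) →
        (∀ g, Approx (a * (n + r + t + accuracy ε + 1))
          (Complex.exp (Complex.I * (θ g : ℂ))) (w g)) →
        SimulatesSparse A B (.list [encIQP x m w S, encParams t ε δ])
          (C * (n + r + t + accuracy ε + confidence δ + 1) ^ c)
          (C * (n + t + accuracy ε + 1) ^ c)
          (7 * (t / ε)) (7 * ε) δ (outcomeProb S (iqp θ m *ᵥ ket x)) := by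
  set a := precisionFactor 2 with ha
  have hF : PT fun p : IQPInput a =>
      List.ofFn (factor (d := qubits p.n) p.S fun _ => hadamardInt) := by
    have h1 : PT fun p : IQPInput a => p.flags.map fun b => ((2, b, List.ofFn fun a =>
        List.ofFn (hadamardInt a), ()) : Factor) := by fun_prop
    refine (congrArg PT (funext fun p => ?_)).mp h1
    rw [IQPInput.flags, List.map_ofFn]
    rfl
  have hvn : PolyIn (fun p : IQPInput a => p.n + p.r + p.t + p.A + p.c) fun p => p.n :=
    PolyIn.of_le fun p => by omega
  have hvt : PolyIn (fun p : IQPInput a => p.n + p.r + p.t + p.A + p.c) fun p => p.t :=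
    PolyIn.of_le fun p => by omega
  have hvA : PolyIn (fun p : IQPInput a => p.n + p.r + p.t + p.A + p.c) fun p => p.A :=
    PolyIn.of_le fun p => by omega
  have hvc : PolyIn (fun p : IQPInput a => p.n + p.r + p.t + p.A + p.c) fun p => p.c :=
    PolyIn.of_le fun p => by omega
  obtain ⟨A, T, ⟨C₁, c₁, hT⟩, hA⟩ := (iqpSource a).simulate_rtime
    (f := fun p : IQPInput a × List Unit => p.1) (by fun_prop) hF
    (PT.bits 2 IQPInput.pt_n IQPInput.pt_t IQPInput.pt_A)
    (PT.samples 2 IQPInput.pt_n IQPInput.pt_t IQPInput.pt_A IQPInput.pt_c)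
    (PT.width IQPInput.pt_t IQPInput.pt_A) (thr := fun p => 2 * p.t * (p.A + 1)) (by fun_prop)
    (polyIn_iqpInput a) (hvn.bits 2 hvt hvA) (hvn.samples 2 hvt hvA hvc) (hvt.width hvA)
  obtain ⟨B, C₂, c₂, hB⟩ := exists_sampler 2
  have hpow : ∀ {C C' c c' : ℕ} (m : ℕ), C * (m + 1) ^ c ≤ (C + C') * (m + 1) ^ (c + c') := by
    intro C C' c c' m
    exact Nat.mul_le_mul (by omega) (Nat.pow_le_pow_right (by omega) (by omega))
  refine ⟨A, B, a, C₁ + C₂, c₁ + c₂, fun n r x θ m S t ε δ w hε hε6 hδ _ hsp hw => ?_⟩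
  have hexp : ∀ g, ‖Complex.exp (Complex.I * (θ g : ℂ))‖ ≤ 1 := fun g => by
    have := norm_exp_phase (θ g) 0
    rw [pow_zero, mul_one] at this
    exact this.le
  let p : IQPInput a := ⟨n, r, x, m, w, S, t, accuracy ε, confidence δ,
    fun g => (hw g).esize_le (hexp g)⟩
  have hrun := hA p
  rw [iqp_mulVec_ket] at hsp ⊢
  -- The product of r rounded phases loses a factor of about 2 ^ r. This is why the required
  -- precision grows with the number of gates.
  have hbits : (2 ^ Source.bits 2 n t (accuracy ε) * 2 ^ r : ℝ) ≤
      2 ^ (a * (n + r + t + accuracy ε + 1)) := by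
    rw [← pow_add]
    refine pow_le_pow_right₀ (by norm_num) ?_
    have : 1 ≤ a := by rw [ha, precisionFactor]; omega
    unfold Source.bits
    nlinarith
  refine Source.simulatesSparse (s := iqpSource a) (D := 2) (j := p) (β := Unit)
    (φ := phaseState x θ m) (u := fun _ => ⟨hadamard, hadamard_mem⟩) (S := S)
    (w := fun _ => hadamardInt) (σ := (√2)⁻¹)
    (σ' := (√2)⁻¹ ^ n * ((2 ^ (a * (n + r + t + accuracy ε + 1)))⁻¹) ^ r)
    (M := List.replicate (Source.bits 2 n t (accuracy ε)) ())
    (N := List.replicate (Source.samples 2 n t (accuracy ε) (confidence δ)) ())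
    (L := List.replicate (Source.width t (accuracy ε)) ())
    (List.length_replicate ..) (List.length_replicate ..) (List.length_replicate ..)
    (hrun.mono ((hT p).trans (hpow _))) ?_ (sum_norm_phaseState_sq x θ m)
    ⟨by positivity, ?_⟩ (by positivity) ?_ ?_
    (fun _ => le_rfl) (by omega) hε hε6 hδ hsp
  · intro v hv
    refine (hB _ _ _ v hv).mono ?_
    rw [add_comm C₁, add_comm c₁]
    exact hpow _
  -- The sign matrix times (√2)⁻¹ is the Hadamard matrix exactly, so the approximation error is 0.
  · intro k y z
    have h1 := toC_hadamardInt y z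
    refine (norm_le_zero_iff.2 (sub_eq_zero.2 h1)).trans ?_
    positivity
  · intro z
    refine (iqpSource_val p θ hw z).trans ?_
    rw [List.length_replicate, ← div_eq_mul_inv, div_le_iff₀ (by positivity),
      inv_mul_eq_div, le_div_iff₀ (by positivity)]
    have h1 : ((2 : ℝ) ^ p.r - 1) * 2 ^ Source.bits 2 n t (accuracy ε) ≤
        2 ^ r * 2 ^ Source.bits 2 n t (accuracy ε) := by
      gcongr
      have : p.r = r := rfl
      rw [this]
      linarith
    linarith
  · refine (iqpSource_dist p θ).le.trans ?_
    positivity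

end SparseSim

end

/-! ### The theorem -/

theorem mainTheorem2 :
    ∃ K : ℝ,
      -- tensor product operations on systems of qudits of bounded dimensions
      (∀ (ι : Type*) (enc : ι → Data) (D : ℕ) (n : ι → ℕ) (d : ∀ i, Fin (n i) → ℕ)
        (ψin : ∀ i, Basis (d i) → ℂ) (U₁ : ∀ i, Matrix.unitaryGroup (Basis (d i)) ℂ),
        (∀ i j, d i j ≤ D) →
        (∀ i, ∑ x, ‖ψin i x‖ ^ 2 = 1) →
        IsCT enc d (fun i => (U₁ i).1 *ᵥ ψin i) →
        ∃ (A B : Code) (a C c : ℕ),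
          ∀ (i : ι) (u : ∀ j, Matrix.unitaryGroup (Fin (d i j)) ℂ) (S : Finset (Fin (n i)))
            (t : ℕ) (ε δ : ℝ) (w : ∀ j, Fin (d i j) → Fin (d i j) → ℤ × ℤ),
            0 < ε → ε ≤ 1 / 6 → 0 < δ → δ < 1 →
            ApproxSparse ε t
              (outcomeProb S (tensor (fun j => (u j).1) *ᵥ ((U₁ i).1 *ᵥ ψin i))) →
            (∀ j p q, Approx (a * (n i + t + accuracy ε + 1)) ((u j).1 p q) (w j p q)) →
            SimulatesSparse A B (.list [enc i, encProduct S w, encParams t ε δ])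
              (C * (n i + t + accuracy ε + confidence δ + 1) ^ c)
              (C * (n i + t + accuracy ε + 1) ^ c)
              (K * (t / ε)) (K * ε) δ
              (outcomeProb S (tensor (fun j => (u j).1) *ᵥ ((U₁ i).1 *ᵥ ψin i)))) ∧
      -- IQP circuits
      (∃ (A B : Code) (a C c : ℕ),
        ∀ (n r : ℕ) (x : Basis (qubits n)) (θ : Fin r → ℝ) (m : Fin r → Fin n → Bool)
          (S : Finset (Fin n)) (t : ℕ) (ε δ : ℝ) (w : Fin r → ℤ × ℤ),
          0 < ε → ε ≤ 1 / 6 → 0 < δ → δ < 1 →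
          ApproxSparse ε t (outcomeProb S (iqp θ m *ᵥ ket x)) →
          (∀ g, Approx (a * (n + r + t + accuracy ε + 1))
            (Complex.exp (Complex.I * (θ g : ℂ))) (w g)) →
          SimulatesSparse A B (.list [encIQP x m w S, encParams t ε δ])
            (C * (n + r + t + accuracy ε + confidence δ + 1) ^ c)
            (C * (n + t + accuracy ε + 1) ^ c)
            (K * (t / ε)) (K * ε) δ (outcomeProb S (iqp θ m *ᵥ ket x))) := by
  -- As an ℓ¹ constant, 7 = 6 + 1: the normalized estimates cost 6ε and the dyadic rounding ε. As a
  -- sparsity constant it exceeds 14/3, from 4t(⌊1/ε⌋ + 1) ≤ (14/3) t / ε.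
  refine ⟨7, ?_, exists_simulation_iqp⟩
  intro ι encι D n d ψin U₁ hd hψ hCT
  let : Enc ι := ⟨encι⟩
  exact exists_simulation_tensor (φ := fun i => (U₁ i).1 *ᵥ ψin i) hd
    (fun i => (sum_norm_sq_mulVec (U₁ i).2.1 (ψin i)).trans (hψ i)) hCT
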